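/- Let $\mathcal F=(\mathrm{KeyGen},\mathrm{Mac},\mathrm{Ver})$ be a keyed classical primitive (a MAC scheme, deterministic or randomised): for security parameter $n$, keys $k$ are drawn by $\mathrm{KeyGen}(1^n)$, messages are the strings in $\mathcal M_n=\{0,1\}^{a(n)}$, tags are strings in $\{0,1\}^{b(n)}$ with $a,b$ polynomially bounded, and tags are $\mathrm{Mac}_k(m;r)$ with randomness $r$ drawn afresh by the oracle for each query. The oracle of a function $g$ is the unitary $|m,y\rangle\mapsto|m,y\oplus g(m)\rangle$. A function of $n$ is negligible if for every $c$ it is at most $n^{-c}$ for all large $n$. Adversaries are uniform quantum polynomial-time (QPT) oracle algorithms, which may measure and choose their queries adaptively; their input is $1^n$ together with the public lengths $a(n),b(n)$, and their time bound holds for every oracle of the right format. **1-qGEU.** In the game, $k\leftarrow\mathrm{KeyGen}(1^n)$; the adversary $\mathcal A$ queries the oracle of $\mathrm{Mac}_k$, then chooses a message $m\in\mathcal M_n$, may query again, and outputs a tag $t$. It wins if $\mathrm{Ver}_k(m,t)$ accepts and if $|m\rangle$ is $1$-distinguishable from the message register of every query made in this run, that is, $F(|m\rangle\langle m|,\rho^{in}_i)\le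 1-1=0$ for all $i$, where $F$ is the Uhlmann fidelity and $\rho^{in}_i$ is the reduced state of the message register at the $i$-th query, given the key, the oracle randomness and the measurement outcomes of the run up to then. $\mathcal F$ is 1-qGEU if every QPT adversary wins with negligible probability. **BU (blind unforgeability).** In the experiment, $k\leftarrow\mathrm{KeyGen}(1^n)$ and a random set $B\subseteq\mathcal M_n$ is formed by placing each message into $B$ independently with probability $\varepsilon(n)$; the adversary $\mathcal A$ gets the oracle of the blinded function that equals $\perp$ on $B$ and $\mathrm{Mac}_k$ outside $B$ (elements of $\{0,1\}^{b(n)}\cup\{\perp\}$ being encoded by $b(n)+1$ bits, the last of which flags $\perp$), and outputs $(m,t)$. It wins if $\mathrm{Ver}_k(m,t)$ accepts and $m\in B$. $\mathcal F$ is BU if for every QPT adversary $\mathcal A$ and every efficiently computable $\varepsilon:\mathbb N\to[0,1]$ the winning probability is negligible. **Theorem.** For every such $\mathcal F$, $\mathcal F$ is 1-qGEU if and only if $\mathcal F$ is BU. -/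

import Mathlib

open scoped NNReal ENNReal MatrixOrder

noncomputable section

namespace QUnf

/-! ## Negligible functions -/

/-- A function of the security parameter is negligible if, for every `c`, it is eventually at most
`1 / n ^ c`. -/
def Negligible (f : ℕ → ℝ) : Prop :=
  ∀ c : ℕ, ∀ᶠ n in Filter.atTop, f n ≤ 1 / (n : ℝ) ^ c

/-! ## Pure states of a quantum memory

The memory consists of qubits `(r, i)`: the `i`-th qubit of register number `r`.  Register `0` is
the message register, register `1` is the answer (ancillary) register, and all others are
workspace.  A computational basis state assigns a bit to every qubit; a pure state is a finite
superposition of basis states.  State vectors are not renormalised after a measurement: every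
definition below divides by the squared norm, so only the ray spanned by the vector matters. -/

abbrev Bits (d : ℕ) : Type := Fin d → Bool

abbrev Qubit : Type := ℕ × ℕ

abbrev Basis : Type := Qubit → Bool

abbrev QState : Type := Basis →₀ ℂ

/-- The register holding the message part of a query. -/
abbrev regX : ℕ := 0

/-- The register holding the ancillary part of a query, which receives the answer. -/
abbrev regY : ℕ := 1

/-- The all-zero basis state. -/
def QState.zeroKet : QState := Finsupp.single (fun _ => false) 1

def QState.normSq (ψ : QState) : ℝ≥0 := ψ.sum fun _ c => ‖c‖₊ ^ 2

/-- The content of the first `d` qubits of register `r`. -/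
def readReg (r d : ℕ) (b : Basis) : Bits d := fun i => b (r, i)

/-- Replace the content of the first `d` qubits of register `r` by `u`. -/
def writeReg (r d : ℕ) (u : Bits d) (b : Basis) : Basis :=
  fun q => if h : q.1 = r ∧ q.2 < d then u ⟨q.2, h.2⟩ else b q

/-- The unitary `|x, y⟩ ↦ |x, y ⊕ g x⟩` on the first `a` qubits of the message register and the
first `d` qubits of the answer register (the standard oracle of `g`). -/
def standardOracle {a d : ℕ} (g : Bits a → Bits d) (ψ : QState) : QState :=
  ψ.mapDomain fun b =>
    writeReg regY d (fun i => xor (b (regY, i)) (g (readReg regX a b) i)) b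

/-- The one-qubit gates. -/
inductive Gate1
  | X
  | H
  | T

/-- The matrix entry `⟨v| U |w⟩` of a one-qubit gate. -/
def Gate1.entry : Gate1 → Bool → Bool → ℂ
  | .X, v, w => if v = w then 0 else 1
  | .H, v, w => (if v && w then -1 else 1) / (Real.sqrt 2 : ℂ)
  | .T, v, w => if v = w then (if v then Complex.exp (Complex.I * (Real.pi / 4)) else 1) else 0

def applyGate1 (g : Gate1) (q : Qubit) (ψ : QState) : QState :=
  ψ.sum fun b c => ∑ v : Bool, Finsupp.single (Function.update b q v) (g.entry v (b q) * c)

/-- Controlled not; nothing happens if the control is the target. -/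
def applyCNOT (q t : Qubit) (ψ : QState) : QState :=
  if q = t then ψ else ψ.mapDomain fun b => Function.update b t (xor (b t) (b q))

/-- Toffoli gate; nothing happens if a control is the target. -/
def applyToffoli (q q' t : Qubit) (ψ : QState) : QState :=
  if q = t ∨ q' = t then ψ
  else ψ.mapDomain fun b => Function.update b t (xor (b t) (b q && b q'))

/-- The projection of `ψ` onto the basis states in which qubit `q` has value `v`. -/
def project (q : Qubit) (v : Bool) (ψ : QState) : QState := ψ.filter fun b => b q = v

/-- A coin that shows `true` with probability `p`. -/
def coin (p : ℝ≥0) (hp : p ≤ 1) : PMF Bool :=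
  PMF.ofFintype (fun v => if v then (p : ℝ≥0∞) else 1 - p) (by simp [hp])

/-- Measurement of one qubit in the computational basis: the outcome, distributed by the Born
rule, and the post-measurement state. -/
def measureQubit (q : Qubit) (ψ : QState) : PMF (Bool × QState) :=
  (coin
    ((project q true ψ).normSq / ((project q true ψ).normSq + (project q false ψ).normSq))
    (div_le_one_of_le₀ le_self_add (zero_le))).map fun v => (v, project q v ψ)

/-! ## Density operators and fidelity -/

/-- The density operator of the first `a` qubits of the message register when the whole memory is
in state `ψ`: the partial trace of `|ψ⟩⟨ψ|` over all other qubits. -/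
def messageDensity (a : ℕ) (ψ : QState) : Matrix (Bits a) (Bits a) ℂ :=
  Matrix.of fun u v =>
    (ψ.sum fun b c => if readReg regX a b = u then
      c * (starRingEnd ℂ) (ψ (writeReg regX a v b)) else 0) / ((ψ.normSq : ℝ) : ℂ)

/-- The density operator `|m⟩⟨m|` of a computational basis state. -/
def ketbra {a : ℕ} (m : Bits a) : Matrix (Bits a) (Bits a) ℂ := Matrix.single m m 1

/-- Uhlmann fidelity `(Tr √(√ρ σ √ρ))²`. -/
def fidelity {ι : Type} [Fintype ι] [DecidableEq ι] (ρ σ : Matrix ι ι ℂ) : ℝ :=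
  (CFC.sqrt (CFC.sqrt ρ * σ * CFC.sqrt ρ)).trace.re ^ 2

/-- Two density operators are `μ`-distinguishable if their fidelity is at most `1 - μ`. -/
def Distinguishable {ι : Type} [Fintype ι] [DecidableEq ι] (μ : ℝ) (ρ σ : Matrix ι ι ℂ) : Prop :=
  fidelity ρ σ ≤ 1 - μ

/-! ## Quantum oracle programs

A program has natural-number variables (classical memory) and the quantum memory above.  Qubits are
addressed by a register number written in the program and an index held in a variable.  All
control is classical and may depend on measurement outcomes.  Loops have a bound that is read when
the loop is entered, so that every run terminates; a polynomial time bound can itself be computed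
by such loops, so this is no restriction for polynomial-time algorithms.  One program serves all
security parameters (uniformity). -/

structure QRef where
  reg : ℕ
  idx : ℕ

inductive Cmd
  | skip
  | seq (p q : Cmd)
  /-- `x := k` -/
  | const (x k : ℕ)
  /-- `x := y + z` -/
  | add (x y z : ℕ)
  /-- `x := y - z`, truncated at zero -/
  | sub (x y z : ℕ)
  /-- run `p` if `x` is non-zero, else `q` -/
  | cond (x : ℕ) (p q : Cmd)
  /-- run `p` as often as the value that `x` has on entry -/
  | loop (x : ℕ) (p : Cmd)
  | gate (g : Gate1) (q : QRef)
  | cnot (q t : QRef)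
  | toffoli (q q' t : QRef)
  /-- measure a qubit and store the outcome in `x` -/
  | measure (q : QRef) (x : ℕ)
  /-- query the oracle on the message and answer registers -/
  | query

/-- The state of a run.  The number of elementary steps and the list of the global states at the
moments of the oracle queries are records of the game; programs cannot read them. -/
structure State where
  vars : ℕ → ℕ
  psi : QState
  queries : List QState
  steps : ℕ

/-- An oracle with `a`-bit inputs and `d`-bit outputs: for each query a fresh function is drawn from
the distribution and its standard oracle is applied.  (A deterministic oracle is a point mass.) -/
abbrev Oracle (a d : ℕ) : Type := PMF (Bits a → Bits d)

namespace State

/-- Start of a run: variables `0, 1, 2, …` have the listed values, all other variables are zero and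
all qubits are in state `|0⟩`. -/
def init (input : List ℕ) : State :=
  { vars := fun i => input.getD i 0, psi := QState.zeroKet, queries := [], steps := 0 }

def tick (s : State) : State := { s with steps := s.steps + 1 }

def setVar (x k : ℕ) (s : State) : State := { s with vars := Function.update s.vars x k }

def qubit (s : State) (q : QRef) : Qubit := (q.reg, s.vars q.idx)

end State

/-- Run a probabilistic step `k` times. -/
def iterate (f : State → PMF State) : ℕ → State → PMF State
  | 0, s => PMF.pure s
  | k + 1, s => (f s).bind (iterate f k)

/-- The distribution of the final state of a program run.  Each elementary command, each test and
each loop iteration costs one step. -/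
def Cmd.run {a d : ℕ} (O : Oracle a d) : Cmd → State → PMF State
  | .skip, s => PMF.pure s.tick
  | .seq p q, s => (p.run O s).bind (q.run O)
  | .const x k, s => PMF.pure (s.tick.setVar x k)
  | .add x y z, s => PMF.pure (s.tick.setVar x (s.vars y + s.vars z))
  | .sub x y z, s => PMF.pure (s.tick.setVar x (s.vars y - s.vars z))
  | .cond x p q, s => if s.vars x ≠ 0 then p.run O s.tick else q.run O s.tick
  | .loop x p, s => iterate (fun s' => p.run O s'.tick) (s.vars x) s.tick
  | .gate g q, s => PMF.pure { s.tick with psi := applyGate1 g (s.qubit q) s.psi }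
  | .cnot q t, s => PMF.pure { s.tick with psi := applyCNOT (s.qubit q) (s.qubit t) s.psi }
  | .toffoli q q' t, s =>
      PMF.pure { s.tick with psi := applyToffoli (s.qubit q) (s.qubit q') (s.qubit t) s.psi }
  | .measure q x, s =>
      (measureQubit (s.qubit q) s.psi).map fun o =>
        { s.tick.setVar x (if o.1 then 1 else 0) with psi := o.2 }
  | .query, s =>
      O.map fun g =>
        { s.tick with psi := standardOracle g s.psi, queries := s.queries ++ [s.psi] }

/-- Programs without quantum commands. -/
def Cmd.IsClassical : Cmd → Prop
  | .skip | .const _ _ | .add _ _ _ | .sub _ _ _ => True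
  | .seq p q | .cond _ p q => p.IsClassical ∧ q.IsClassical
  | .loop _ p => p.IsClassical
  | .gate _ _ | .cnot _ _ | .toffoli _ _ _ | .measure _ _ | .query => False

/-- Measure the first `d` qubits of register `r`, qubit by qubit. -/
def measureReg (r : ℕ) : (d : ℕ) → QState → PMF (Bits d × QState)
  | 0, ψ => PMF.pure (fun i => i.elim0, ψ)
  | d + 1, ψ =>
      (measureReg r d ψ).bind fun o =>
        (measureQubit (r, d) o.2).map fun o' => (Fin.snoc o.1 o'.1, o'.2)

/-- A real function is efficiently computable if some classical program computes, from `n` and `k`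
and in time polynomial in `n + k`, a natural number `z` with `|ε n - z / 2 ^ k| ≤ 1 / 2 ^ k`. -/
def EfficientlyComputable (ε : ℕ → ℝ) : Prop :=
  ∃ p : Cmd, p.IsClassical ∧ ∃ B : Polynomial ℕ, ∀ n k : ℕ,
    ∀ s ∈ (p.run (PMF.pure id : Oracle 0 0) (State.init [n, k])).support,
      s.steps ≤ B.eval (n + k) ∧ |ε n - (s.vars 0 : ℝ) / 2 ^ k| ≤ 1 / 2 ^ k

/-! ## Classical primitives (message authentication schemes) -/

/-- A keyed classical primitive: key generation (setup), a deterministic or randomised evaluation,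
and a (possibly randomised) verification.  Messages and tags for security parameter `n` are bit
strings whose lengths are polynomially bounded. -/
structure MACScheme where
  msgLen : ℕ → ℕ
  tagLen : ℕ → ℕ
  msgLen_le : ∃ B : Polynomial ℕ, ∀ n, msgLen n ≤ B.eval n
  tagLen_le : ∃ B : Polynomial ℕ, ∀ n, tagLen n ≤ B.eval n
  Key : ℕ → Type
  Rand : ℕ → Type
  keyGen : ∀ n, PMF (Key n)
  coins : ∀ n, PMF (Rand n)
  mac : ∀ n, Key n → Bits (msgLen n) → Rand n → Bits (tagLen n)
  ver : ∀ n, Key n → Bits (msgLen n) → Bits (tagLen n) → PMF Bool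

namespace MACScheme

variable (F : MACScheme)

/-- The evaluation oracle: fresh randomness `r` for each query, `|m, y⟩ ↦ |m, y ⊕ mac k m r⟩`. -/
def evalOracle (n : ℕ) (k : F.Key n) : Oracle (F.msgLen n) (F.tagLen n) :=
  (F.coins n).map fun r m => F.mac n k m r

/-- The public input of an adversary: the security parameter and the lengths of messages and tags. -/
def publicInput (n : ℕ) : List ℕ := [n, F.msgLen n, F.tagLen n]

/-! ### The game defining `μ`-qGEU -/

/-- The adversary's part of the game: first learning phase, choice of the challenge message (by
measuring the message register), second learning phase, output of the tag (by measuring the answer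
register).  The result consists of the message, the tag and the final state. -/
def qExRun (A₁ A₂ : Cmd) (n : ℕ) (O : Oracle (F.msgLen n) (F.tagLen n)) :
    PMF (Bits (F.msgLen n) × Bits (F.tagLen n) × State) :=
  (A₁.run O (State.init (F.publicInput n))).bind fun s₁ =>
  (measureReg regX (F.msgLen n) s₁.psi).bind fun om =>
  (A₂.run O { s₁ with psi := om.2 }).bind fun s₂ =>
  (measureReg regY (F.tagLen n) s₂.psi).map fun ot =>
    (om.1, ot.1, { s₂ with psi := ot.2 })

/-- The adversary runs in polynomial time, whatever the oracle. -/
def QExPolyTime (A₁ A₂ : Cmd) : Prop :=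
  ∃ B : Polynomial ℕ, ∀ (n : ℕ) (O : Oracle (F.msgLen n) (F.tagLen n)),
    ∀ o ∈ (F.qExRun A₁ A₂ n O).support, o.2.2.steps ≤ B.eval n

open Classical in
/-- The existential game: the adversary wins if in this run the state `|m⟩` is `μ`-distinguishable
from the message part of every query and the pair `(m, t)` is accepted. -/
def qExGame (μ : ℝ) (A₁ A₂ : Cmd) (n : ℕ) : PMF Bool :=
  (F.keyGen n).bind fun k =>
  (F.qExRun A₁ A₂ n (F.evalOracle n k)).bind fun o =>
  (F.ver n k o.1 o.2.1).map fun acc =>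
    acc && decide (∀ ψ ∈ o.2.2.queries,
      Distinguishable μ (ketbra o.1) (messageDensity (F.msgLen n) ψ))

/-- `μ`-qGEU: quantum generalised existential unforgeability of degree `μ`. -/
def QGEU (μ : ℝ) : Prop :=
  ∀ A₁ A₂ : Cmd, F.QExPolyTime A₁ A₂ →
    Negligible fun n => (F.qExGame μ A₁ A₂ n true).toReal

end MACScheme

/-! ### Blind unforgeability -/

/-- The blinded function: `⊥` on `B`, and `f` elsewhere. -/
def blind {a b : ℕ} (B : Finset (Bits a)) (f : Bits a → Bits b) (x : Bits a) : Option (Bits b) :=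
  if x ∈ B then none else some (f x)

/-- Encoding of `{0,1}^b ∪ {⊥}` in `b + 1` bits; the last bit flags `⊥`. -/
def encodeBot {b : ℕ} : Option (Bits b) → Bits (b + 1)
  | none => Fin.snoc (α := fun _ => Bool) (fun _ => false) true
  | some y => Fin.snoc (α := fun _ => Bool) y false

/-- The random blinding set: each element is put into it independently with probability `ε`. -/
def blindingSet (a : ℕ) (ε : unitInterval) : PMF (Finset (Bits a)) :=
  PMF.ofFintype
    (fun B => ((∏ x : Bits a, if x ∈ B then Real.toNNReal ε else Real.toNNReal (1 - ε) : ℝ≥0)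
      : ℝ≥0∞))
    (by
      have hε : Real.toNNReal (ε : ℝ) + Real.toNNReal (1 - (ε : ℝ)) = 1 := by
        rw [← Real.toNNReal_add ε.2.1 (sub_nonneg.2 ε.2.2)]
        simp
      have key := Finset.prod_add (fun _ : Bits a => Real.toNNReal (ε : ℝ))
        (fun _ => Real.toNNReal (1 - (ε : ℝ))) Finset.univ
      simp only [hε, Finset.prod_const_one, Finset.powerset_univ] at key
      rw [← ENNReal.ofNNReal_finsetSum, ← ENNReal.coe_one, ENNReal.coe_inj, key]
      refine Finset.sum_congr rfl fun B _ => ?_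
      rw [Finset.prod_ite]
      congr 2 <;> ext x <;> simp)

namespace MACScheme

variable (F : MACScheme)

/-- The blinded evaluation oracle. -/
def blindedOracle (n : ℕ) (k : F.Key n) (B : Finset (Bits (F.msgLen n))) :
    Oracle (F.msgLen n) (F.tagLen n + 1) :=
  (F.coins n).map fun r m => encodeBot (blind B (fun m' => F.mac n k m' r) m)

/-- The adversary's part of the blind forgery experiment; the forgery is read off by measuring the
message and answer registers. -/
def blindRun (A : Cmd) (n : ℕ) (O : Oracle (F.msgLen n) (F.tagLen n + 1)) :
    PMF (Bits (F.msgLen n) × Bits (F.tagLen n) × State) :=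
  (A.run O (State.init (F.publicInput n))).bind fun s =>
  (measureReg regX (F.msgLen n) s.psi).bind fun om =>
  (measureReg regY (F.tagLen n) om.2).map fun ot => (om.1, ot.1, { s with psi := ot.2 })

/-- The adversary runs in polynomial time, whatever the oracle. -/
def BlindPolyTime (A : Cmd) : Prop :=
  ∃ B : Polynomial ℕ, ∀ (n : ℕ) (O : Oracle (F.msgLen n) (F.tagLen n + 1)),
    ∀ o ∈ (F.blindRun A n O).support, o.2.2.steps ≤ B.eval n

/-- The blind forgery experiment. -/
def blindForge (A : Cmd) (ε : ℕ → unitInterval) (n : ℕ) : PMF Bool :=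
  (F.keyGen n).bind fun k =>
  (blindingSet (F.msgLen n) (ε n)).bind fun B =>
  (F.blindRun A n (F.blindedOracle n k B)).bind fun o =>
  (F.ver n k o.1 o.2.1).map fun acc => acc && decide (o.1 ∈ B)

/-- Blind unforgeability. -/
def BU : Prop :=
  ∀ (A : Cmd) (ε : ℕ → unitInterval), F.BlindPolyTime A →
    EfficientlyComputable (fun n => (ε n : ℝ)) →
    Negligible fun n => (F.blindForge A ε n true).toReal

end MACScheme

end QUnf

end

set_option linter.unusedSimpArgs false

open scoped NNReal ENNReal MatrixOrder

noncomputable section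

namespace QUnf

/-! ## Expectations under a `PMF` -/

/-! The fidelity of a basis state |m⟩ with a density operator ρ is ⟨m|ρ|m⟩, so distinguishability of
degree one says that the forged message has amplitude exactly zero in every query of the run
(`distinguishable_one_iff`). Both games are rewritten as sums over unnormalised measurement branches
(`nE_mul_wp_runMem`). In this form a run is linear in its final payoff, and runs with different
oracles can be compared branch by branch under the same measurement outcomes and oracle coins
(`famMem`).

BU implies 1-qGEU. The existential forger is run with the blinded oracle, where the flag of ⊥ is
hidden from it and ⊥ becomes the zero answer. Let φ_B be the state under blinding set B, so that φ_∅
is the honest one. Requiring the output m to lie in B costs a factor ε and leaves the rest of B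
independent (`sum_bern_mem_mul`), so φ_∅ has to be compared with φ_{B∪{m}}. On average over B, ‖φ_B
− φ_∅‖² is of order ε, up to a polynomial in the number of queries. The step from φ_B to φ_{B∪{m}}
is driven by the weight of φ_B on m at the queries. Since φ_∅ has no weight there, this is the
weight of φ_B − φ_∅ on m, and the sum of these weights over all m is ‖φ_B − φ_∅‖² again, without a
factor for the number of messages (`diffE_query`). A potential collects both errors (`pot_query`),
and for T queries `honest_le_blinded` gives honest value ≤ (3/ε) · blinded value + 48 ε (T+1)^5. The
probability ε is an inverse polynomial chosen after the polynomial that the advantage has to beat.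

1-qGEU implies BU. The existential forger samples a blinding set B itself and simulates the blinded
oracle without ever querying a message of B. A reversible circuit computes whether the message lies
in B. If so, the true oracle is given a fixed spare message outside B, together with an answer
register in uniform superposition, which the answer does not change, and ⊥ is written by hand. Then
every forgery in B satisfies the condition on the queries (`log_query`). The spare message is the
first of r random messages that falls outside B. If there is none, all answers are ⊥. This is
harmless, because the average of dens(B)^r [x ∉ B] is at most 1/(r+1) for each x
(`sum_bern_dens_pow_le`), so replacing the oracle by ⊥ everywhere changes little
(`sum_bern_valOn_le`).

A fully random B has no short description. However, amplitudes after T queries are polynomials of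
degree at most T in the membership bits of B, so the value of the simulated run, including the
search for the spare message, has degree at most k = 2T + 1 + r (`sum_valMix_eq_zero`), and any
k-wise independent B serves as well. Such a set is made from affine forms over 𝔽₂ alone: buckets,
each an intersection of random affine conditions, almost surely separate small sets by parity
(`sum_not_good_le`), hence the bucket vectors of any k messages are linearly independent and random
linear combinations of them are independent uniform words (`sum_prod_word`). A message belongs to B
if its word lies below a threshold approximating ε.

Every embedded program has its loops capped by a polynomial, so that the new adversary is
polynomial-time for every oracle. The cap does not affect runs that respect their own time bound
(`expect_run`). -/

def expect {α : Type} (p : PMF α) (f : α → ℝ≥0∞) : ℝ≥0∞ := ∑' x, p x * f x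

theorem expect_pure {α : Type} (a : α) (f : α → ℝ≥0∞) : expect (PMF.pure a) f = f a := by
  unfold expect
  rw [tsum_eq_single a]
  · simp
  · intro b hb
    simp [PMF.pure_apply, hb]

theorem expect_bind {α β : Type} (p : PMF α) (q : α → PMF β) (f : β → ℝ≥0∞) :
    expect (p.bind q) f = expect p fun x => expect (q x) f := by
  unfold expect
  simp only [PMF.bind_apply, ← ENNReal.tsum_mul_right, ← ENNReal.tsum_mul_left]
  rw [ENNReal.tsum_comm]
  simp only [mul_assoc]

theorem expect_map {α β : Type} (p : PMF α) (g : α → β) (f : β → ℝ≥0∞) :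
    expect (p.map g) f = expect p fun x => f (g x) := by
  rw [← PMF.bind_pure_comp, expect_bind]
  simp [expect_pure]

theorem expect_mono {α : Type} (p : PMF α) {f g : α → ℝ≥0∞} (h : ∀ x, f x ≤ g x) :
    expect p f ≤ expect p g :=
  ENNReal.tsum_le_tsum fun x => by gcongr; exact h x

theorem expect_congr {α : Type} {p : PMF α} {f g : α → ℝ≥0∞} (h : ∀ x ∈ p.support, f x = g x) :
    expect p f = expect p g := by
  refine tsum_congr fun x => ?_
  by_cases hx : x ∈ p.support
  · rw [h x hx]
  · rw [PMF.mem_support_iff, not_not] at hx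
    simp [hx]

theorem expect_const_mul {α : Type} (p : PMF α) (c : ℝ≥0∞) (f : α → ℝ≥0∞) :
    expect p (fun x => c * f x) = c * expect p f := by
  unfold expect
  rw [← ENNReal.tsum_mul_left]
  exact tsum_congr fun x => by ring

theorem expect_add {α : Type} (p : PMF α) (f g : α → ℝ≥0∞) :
    expect p (fun x => f x + g x) = expect p f + expect p g := by
  unfold expect
  rw [← ENNReal.tsum_add]
  exact tsum_congr fun x => by ring

theorem expect_const {α : Type} (p : PMF α) (c : ℝ≥0∞) : expect p (fun _ => c) = c := by
  unfold expect
  rw [ENNReal.tsum_mul_right, p.tsum_coe, one_mul]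

theorem bind_apply_eq_expect {α β : Type} (p : PMF α) (q : α → PMF β) (b : β) :
    (p.bind q) b = expect p fun x => q x b := PMF.bind_apply _ _ _

/-! ## Amplitudes of states after elementary operations -/

theorem applyGate1_add (g : Gate1) (q : Qubit) (ψ φ : QState) :
    applyGate1 g q (ψ + φ) = applyGate1 g q ψ + applyGate1 g q φ := by
  unfold applyGate1
  rw [Finsupp.sum_add_index']
  · intro b; simp
  · intro b c c'
    simp [mul_add, Finset.sum_add_distrib, Finsupp.single_add]

/-- Both sides are linear in the state, so basis states suffice. This pull-back form replaces the
push-forward of the definition, and norms, products and degrees are all computed from it pointwise.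
-/
theorem applyGate1_apply (g : Gate1) (q : Qubit) (ψ : QState) (b : Basis) :
    applyGate1 g q ψ b = ∑ v : Bool, g.entry (b q) v * ψ (Function.update b q v) := by
  classical
  induction ψ using Finsupp.induction_linear with
  | zero => simp [applyGate1]
  | add ψ φ h1 h2 =>
    rw [applyGate1_add, Finsupp.add_apply, h1, h2, ← Finset.sum_add_distrib]
    simp [mul_add]
  | single b' c =>
    have hs : applyGate1 g q (Finsupp.single b' c)
        = ∑ v : Bool, Finsupp.single (Function.update b' q v) (g.entry v (b' q) * c) := by
      unfold applyGate1
      rw [Finsupp.sum_single_index]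
      simp
    rw [hs]
    by_cases hb : ∀ q', q' ≠ q → b' q' = b q'
    · have e1 : ∀ v, Function.update b' q v = b ↔ v = b q := by
        intro v
        constructor
        · intro h; rw [← h]; simp
        · rintro rfl; funext q'
          by_cases h : q' = q
          · subst h; simp
          · simp [h, hb q' h]
      have e2 : ∀ v, b' = Function.update b q v ↔ v = b' q := by
        intro v
        constructor
        · intro h; rw [h]; simp
        · rintro rfl; funext q'
          by_cases h : q' = q
          · subst h; simp
          · simp [h, hb q' h]
      rw [Finsupp.finsetSum_apply, Fintype.sum_bool, Fintype.sum_bool]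
      repeat rw [Finsupp.single_apply]
      simp only [e1, e2]
      cases b q <;> cases b' q <;> simp
    · have e1 : ∀ v, Function.update b' q v ≠ b := by
        intro v h
        apply hb
        intro q' h'
        rw [← h]; simp [h']
      have e2 : ∀ v, b' ≠ Function.update b q v := by
        intro v h
        apply hb
        intro q' h'
        rw [h]; simp [h']
      rw [Finsupp.finsetSum_apply, Fintype.sum_bool, Fintype.sum_bool]
      repeat rw [Finsupp.single_apply]
      simp only [e1, e2]
      simp

/-- All permutations of basis states that occur (the gates X, CNOT and Toffoli, the oracles, swaps
and copies) are their own inverses, so a pull-back needs no separate inverse map. -/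
theorem mapDomain_involutive_apply {f : Basis → Basis} (hf : Function.Involutive f) (ψ : QState)
    (b : Basis) : ψ.mapDomain f b = ψ (f b) := by
  conv_lhs => rw [← hf b]
  exact Finsupp.mapDomain_apply hf.injective ψ (f b)

def cnotMap (q t : Qubit) (b : Basis) : Basis :=
  if q = t then b else Function.update b t (xor (b t) (b q))

def toffoliMap (q q' t : Qubit) (b : Basis) : Basis :=
  if q = t ∨ q' = t then b else Function.update b t (xor (b t) (b q && b q'))

def notMap (q : Qubit) (b : Basis) : Basis := Function.update b q (!b q)

def oracleMap {a d : ℕ} (g : Bits a → Bits d) (b : Basis) : Basis :=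
  writeReg regY d (fun i => xor (b (regY, i)) (g (readReg regX a b) i)) b

theorem cnotMap_involutive (q t : Qubit) : Function.Involutive (cnotMap q t) := by
  intro b
  unfold cnotMap
  split_ifs with h
  · rfl
  · simp [h]

theorem toffoliMap_involutive (q q' t : Qubit) : Function.Involutive (toffoliMap q q' t) := by
  intro b
  unfold toffoliMap
  split_ifs with h
  · rfl
  · push Not at h
    simp [h.1, h.2]

theorem notMap_involutive (q : Qubit) : Function.Involutive (notMap q) := by
  intro b
  simp [notMap]

theorem oracleMap_apply {a d : ℕ} (g : Bits a → Bits d) (b : Basis) (q : Qubit) :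
    oracleMap g b q = if h : q.1 = regY ∧ q.2 < d then
      xor (b q) (g (readReg regX a b) ⟨q.2, h.2⟩) else b q := by
  unfold oracleMap writeReg
  split_ifs with h
  · obtain ⟨r, i⟩ := q
    obtain ⟨h1, h2⟩ := h
    simp only at h1
    subst h1
    rfl
  · rfl

theorem readReg_oracleMap {a a' d : ℕ} (g : Bits a → Bits d) (b : Basis) :
    readReg regX a' (oracleMap g b) = readReg regX a' b := by
  funext i
  simp [readReg, oracleMap_apply]

theorem oracleMap_involutive {a d : ℕ} (g : Bits a → Bits d) :
    Function.Involutive (oracleMap g) := by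
  intro b
  funext q
  rw [oracleMap_apply, readReg_oracleMap, oracleMap_apply]
  split_ifs <;> simp

theorem applyCNOT_eq (q t : Qubit) (ψ : QState) : applyCNOT q t ψ = ψ.mapDomain (cnotMap q t) := by
  unfold applyCNOT cnotMap
  split_ifs with h
  · exact (Finsupp.mapDomain_id).symm
  · rfl

theorem applyToffoli_eq (q q' t : Qubit) (ψ : QState) :
    applyToffoli q q' t ψ = ψ.mapDomain (toffoliMap q q' t) := by
  unfold applyToffoli toffoliMap
  split_ifs with h
  · exact (Finsupp.mapDomain_id).symm
  · rfl

theorem standardOracle_eq {a d : ℕ} (g : Bits a → Bits d) (ψ : QState) :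
    standardOracle g ψ = ψ.mapDomain (oracleMap g) := rfl

theorem applyX_eq (q : Qubit) (ψ : QState) : applyGate1 .X q ψ = ψ.mapDomain (notMap q) := by
  ext b
  rw [applyGate1_apply, mapDomain_involutive_apply (notMap_involutive q), notMap]
  cases h : b q <;> simp [Gate1.entry]

theorem project_apply (q : Qubit) (v : Bool) (ψ : QState) (b : Basis) :
    project q v ψ b = if b q = v then ψ b else 0 := by
  unfold project
  rw [Finsupp.filter_apply]

/-! ## The squared norm -/

/-- With values in `ℝ≥0∞` the squared norm can be multiplied with expectations and summed over
branches without side conditions on summability. -/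
def nE (ψ : QState) : ℝ≥0∞ := ∑' b, ‖ψ b‖ₑ ^ 2

theorem coe_normSq (ψ : QState) : (ψ.normSq : ℝ≥0∞) = nE ψ := by
  unfold QState.normSq nE Finsupp.sum
  rw [tsum_eq_sum (s := ψ.support)]
  · push_cast
    rfl
  · intro b hb
    rw [Finsupp.notMem_support_iff] at hb
    simp [hb]

theorem nE_ne_top (ψ : QState) : nE ψ ≠ ⊤ := by
  rw [← coe_normSq]; exact ENNReal.coe_ne_top

theorem nE_zeroKet : nE QState.zeroKet = 1 := by
  unfold nE QState.zeroKet
  rw [tsum_eq_single (fun _ => false)]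
  · simp
  · intro b hb
    rw [Finsupp.single_eq_of_ne hb]; simp

theorem nE_mapDomain {f : Basis → Basis} (hf : Function.Involutive f) (ψ : QState) :
    nE (ψ.mapDomain f) = nE ψ := by
  unfold nE
  simp only [mapDomain_involutive_apply hf]
  exact (hf.toPerm f).tsum_eq fun b => ‖ψ b‖ₑ ^ 2

theorem nE_project_add (q : Qubit) (ψ : QState) :
    nE (project q true ψ) + nE (project q false ψ) = nE ψ := by
  unfold nE
  rw [← ENNReal.tsum_add]
  refine tsum_congr fun b => ?_
  rw [project_apply, project_apply]
  cases b q <;> simp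

theorem gate_isometry (g : Gate1) (x : Bool → ℂ) :
    ∑ v : Bool, ‖∑ w : Bool, g.entry v w * x w‖ ^ 2 = ∑ v : Bool, ‖x v‖ ^ 2 := by
  cases g with
  | X => simp [Gate1.entry, add_comm]
  | H =>
    simp only [Gate1.entry, Fintype.sum_bool]
    have h2 : (1 / (Real.sqrt 2 : ℂ)) = ((1 / Real.sqrt 2 : ℝ) : ℂ) := by push_cast; rfl
    have h3 : ((-1 : ℂ) / (Real.sqrt 2 : ℂ)) = ((-(1 / Real.sqrt 2) : ℝ) : ℂ) := by
      push_cast; ring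
    have hs : (Real.sqrt 2) * Real.sqrt 2 = 2 := Real.mul_self_sqrt (by norm_num)
    simp only [Bool.and_self, Bool.and_true, Bool.true_and, Bool.false_and, Bool.and_false,
      if_true, Bool.false_eq_true, if_false, h2, h3]
    rw [← Complex.normSq_eq_norm_sq, ← Complex.normSq_eq_norm_sq, ← Complex.normSq_eq_norm_sq,
      ← Complex.normSq_eq_norm_sq]
    simp only [Complex.normSq_apply, Complex.add_re, Complex.add_im, Complex.mul_re,
      Complex.mul_im, Complex.ofReal_re, Complex.ofReal_im]
    have hi : (1 / Real.sqrt 2) * (1 / Real.sqrt 2) = 1 / 2 := by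
      rw [div_mul_div_comm, hs]; norm_num
    generalize 1 / Real.sqrt 2 = c at hi
    -- With c = 1/√2 both sides are multiples of the squared norm of `x`, with coefficients 2c² and
    -- 1, so only c² = 1/2 enters.
    linear_combination (2 * ((x true).re * (x true).re + (x true).im * (x true).im
      + (x false).re * (x false).re + (x false).im * (x false).im)) * hi
  | T =>
    simp only [Gate1.entry, Fintype.sum_bool]
    have : ‖Complex.exp (Complex.I * (Real.pi / 4))‖ = 1 := by
      have h : Complex.I * (Real.pi / 4) = ((Real.pi / 4 : ℝ) : ℂ) * Complex.I := by
        push_cast; ring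
      rw [h, Complex.norm_exp_ofReal_mul_I]
    simp [this]

theorem nE_gate (g : Gate1) (q : Qubit) (ψ : QState) : nE (applyGate1 g q ψ) = nE ψ := by
  unfold nE
  -- The basis states are grouped by the values of all qubits other than `q`; on each group the gate
  -- is a unitary 2 × 2 matrix.
  have key : ∀ f : Basis → ℝ≥0∞, ∑' b, f b
      = ∑' c : ({j : Qubit // j ≠ q} → Bool), ∑ v : Bool,
        f ((Equiv.funSplitAt q Bool).symm (v, c)) := by
    intro f
    rw [← (Equiv.funSplitAt q Bool).symm.tsum_eq f, ENNReal.tsum_prod', ENNReal.tsum_comm]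
    refine tsum_congr fun c => ?_
    rw [tsum_fintype]
  rw [key, key]
  refine tsum_congr fun c => ?_
  have hq : ∀ v : Bool, (Equiv.funSplitAt q Bool).symm (v, c) q = v := by
    intro v; simp [Equiv.funSplitAt]
  have hu : ∀ v w : Bool, Function.update ((Equiv.funSplitAt q Bool).symm (v, c)) q w
      = (Equiv.funSplitAt q Bool).symm (w, c) := by
    intro v w; funext j
    by_cases h : j = q
    · subst h; simp [Equiv.funSplitAt]
    · simp [Equiv.funSplitAt, h]
  simp only [applyGate1_apply, hq, hu]
  have := gate_isometry g fun v => ψ ((Equiv.funSplitAt q Bool).symm (v, c))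
  have h2 := congrArg ENNReal.ofReal this
  rw [ENNReal.ofReal_sum_of_nonneg (fun _ _ => by positivity),
    ENNReal.ofReal_sum_of_nonneg (fun _ _ => by positivity)] at h2
  simpa only [ENNReal.ofReal_pow (norm_nonneg _), ofReal_norm] using h2

theorem nE_cnot (q t : Qubit) (ψ : QState) : nE (applyCNOT q t ψ) = nE ψ := by
  rw [applyCNOT_eq, nE_mapDomain (cnotMap_involutive q t)]

theorem nE_toffoli (q q' t : Qubit) (ψ : QState) : nE (applyToffoli q q' t ψ) = nE ψ := by
  rw [applyToffoli_eq, nE_mapDomain (toffoliMap_involutive q q' t)]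

theorem nE_standardOracle {a d : ℕ} (g : Bits a → Bits d) (ψ : QState) :
    nE (standardOracle g ψ) = nE ψ := by
  rw [standardOracle_eq, nE_mapDomain (oracleMap_involutive g)]

/-! ## Reading registers -/

/-- The part of `ψ` in which the first `d` qubits of register `r` show `u`. -/
def projReg (r d : ℕ) (u : Bits d) (ψ : QState) : QState :=
  ψ.filter fun b => readReg r d b = u

theorem projReg_apply (r d : ℕ) (u : Bits d) (ψ : QState) (b : Basis) :
    projReg r d u ψ b = if readReg r d b = u then ψ b else 0 := by
  classical
  unfold projReg
  rw [Finsupp.filter_apply]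

theorem sum_nE_projReg (r d : ℕ) (ψ : QState) : ∑ u, nE (projReg r d u ψ) = nE ψ := by
  unfold nE
  rw [← tsum_fintype (L := SummationFilter.unconditional _), ENNReal.tsum_comm]
  refine tsum_congr fun b => ?_
  rw [tsum_eq_single (readReg r d b)]
  · rw [projReg_apply, if_pos rfl]
  · intro u hu
    rw [projReg_apply, if_neg (Ne.symm hu)]; simp

/-- Multiplication by the squared norm cancels the denominators of the Born rule. The zero vector,
for which the Born rule divides by zero, contributes zero on both sides. -/
theorem expect_measureQubit (q : Qubit) (ψ : QState) (F : Bool → QState → ℝ≥0∞) :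
    nE ψ * expect (measureQubit q ψ) (fun o => F o.1 o.2)
      = nE (project q true ψ) * F true (project q true ψ)
        + nE (project q false ψ) * F false (project q false ψ) := by
  unfold measureQubit
  rw [expect_map]
  unfold expect coin
  rw [tsum_fintype, Fintype.sum_bool]
  simp only [PMF.ofFintype_apply, if_true, Bool.false_eq_true, if_false]
  have hs := nE_project_add q ψ
  rw [← coe_normSq, ← coe_normSq] at hs
  set A := (project q true ψ).normSq
  set B := (project q false ψ).normSq
  rw [← coe_normSq (project q true ψ), ← coe_normSq (project q false ψ), ← hs]
  by_cases h : A + B = 0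
  · obtain ⟨hA, hB⟩ := add_eq_zero.1 h
    have hA' : (project q true ψ).normSq = 0 := hA
    have hB' : (project q false ψ).normSq = 0 := hB
    simp [hA, hB, hA', hB']
  · have e1 : ((A : ℝ≥0∞) + B) * ((A / (A + B) : ℝ≥0) : ℝ≥0∞) = A := by
      rw [← ENNReal.coe_add, ← ENNReal.coe_mul, mul_div_cancel₀ _ h]
    have e2 : ((A : ℝ≥0∞) + B) * (1 - ((A / (A + B) : ℝ≥0) : ℝ≥0∞)) = B := by
      rw [ENNReal.mul_sub (by simp), e1, mul_one, ENNReal.add_sub_cancel_left ENNReal.coe_ne_top]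
    rw [mul_add, ← mul_assoc, ← mul_assoc, e1, e2]

theorem project_projReg (r d : ℕ) (u : Bits d) (v : Bool) (ψ : QState) :
    project (r, d) v (projReg r d u ψ)
      = projReg r (d + 1) (Fin.snoc (α := fun _ => Bool) u v) ψ := by
  ext b
  rw [project_apply, projReg_apply, projReg_apply]
  have : readReg r (d + 1) b = Fin.snoc (α := fun _ => Bool) u v ↔
      b (r, d) = v ∧ readReg r d b = u := by
    constructor
    · intro h
      refine ⟨?_, ?_⟩
      · have := congrFun h (Fin.last d)
        simpa [readReg] using this
      · funext i
        have := congrFun h i.castSucc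
        simpa [readReg] using this
    · rintro ⟨h1, h2⟩
      funext i
      refine Fin.lastCases ?_ (fun i => ?_) i
      · simpa [readReg] using h1
      · simpa [readReg] using congrFun h2 i
  by_cases h1 : b (r, d) = v <;> by_cases h2 : readReg r d b = u <;> simp [this, h1, h2]

theorem sum_bits_succ {M : Type} [AddCommMonoid M] {d : ℕ} (f : Bits (d + 1) → M) :
    ∑ u, f u = ∑ u : Bits d, (f (Fin.snoc (α := fun _ => Bool) u true)
      + f (Fin.snoc (α := fun _ => Bool) u false)) := by
  rw [← (Fin.snocEquiv (fun _ : Fin (d + 1) => Bool)).sum_comp, Fintype.sum_prod_type,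
      Finset.sum_comm]
  refine Finset.sum_congr rfl fun u _ => ?_
  rw [Fintype.sum_bool]
  rfl

/-- Projecting one more qubit refines the projection by the last bit of the string, so the
single-qubit formula can be iterated; the norm of each intermediate branch cancels against the next
denominator. -/
theorem expect_measureReg (r d : ℕ) (ψ : QState) (F : Bits d → QState → ℝ≥0∞) :
    nE ψ * expect (measureReg r d ψ) (fun o => F o.1 o.2)
      = ∑ u, nE (projReg r d u ψ) * F u (projReg r d u ψ) := by
  induction d with
  | zero =>
    simp only [measureReg, expect_pure, Finset.univ_unique, Finset.sum_singleton]
    have e2 : ∀ u : Bits 0, nE ψ * F u ψ = nE (projReg r 0 u ψ) * F u (projReg r 0 u ψ) := by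
      intro u
      have : projReg r 0 u ψ = ψ := by
        ext b
        rw [projReg_apply, if_pos (Subsingleton.elim _ _)]
      rw [this]
    convert e2 _
  | succ d ih =>
    simp only [measureReg, expect_bind, expect_map]
    rw [ih fun u φ => expect (measureQubit (r, d) φ) fun o' => F (Fin.snoc u o'.1) o'.2]
    rw [sum_bits_succ]
    refine Finset.sum_congr rfl fun u _ => ?_
    rw [expect_measureQubit (r, d) (projReg r d u ψ)
      fun v φ => F (Fin.snoc (α := fun _ => Bool) u v) φ, project_projReg, project_projReg]

/-! ## Generic semantics of programs -/

abbrev Vars : Type := ℕ → ℕ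

/-- The operations that a program performs on a memory `M`, with results in `R`. -/
structure Mem (M R : Type) where
  tick : M → M
  gate : Gate1 → Qubit → M → M
  cnot : Qubit → Qubit → M → M
  toffoli : Qubit → Qubit → Qubit → M → M
  meas : Qubit → (Bool → M → R) → M → R
  query : (M → R) → M → R

/-- Weakest-precondition semantics; a loop whose variable has value `k` is run `cnt k` times. -/
def wp {M R : Type} (E : Mem M R) (cnt : ℕ → ℕ) : Cmd → (Vars → M → R) → Vars → M → R
  | .skip, f => fun v m => f v (E.tick m)
  | .seq p q, f => wp E cnt p (wp E cnt q f)
  | .const x k, f => fun v m => f (Function.update v x k) (E.tick m)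
  | .add x y z, f => fun v m => f (Function.update v x (v y + v z)) (E.tick m)
  | .sub x y z, f => fun v m => f (Function.update v x (v y - v z)) (E.tick m)
  | .cond x p q, f => fun v m =>
      if v x ≠ 0 then wp E cnt p f v (E.tick m) else wp E cnt q f v (E.tick m)
  | .loop x p, f => fun v m =>
      ((fun g v m => wp E cnt p g v (E.tick m))^[cnt (v x)] f) v (E.tick m)
  | .gate g q, f => fun v m => f v (E.gate g (q.reg, v q.idx) (E.tick m))
  | .cnot q t, f => fun v m => f v (E.cnot (q.reg, v q.idx) (t.reg, v t.idx) (E.tick m))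
  | .toffoli q q' t, f => fun v m =>
      f v (E.toffoli (q.reg, v q.idx) (q'.reg, v q'.idx) (t.reg, v t.idx) (E.tick m))
  | .measure q x, f => fun v m =>
      E.meas (q.reg, v q.idx) (fun o => f (Function.update v x (if o then 1 else 0))) (E.tick m)
  | .query, f => fun v m => E.query (f v) (E.tick m)

/-- A relation between memories and between results that all operations respect. -/
structure MemRel {M R M' R' : Type} (E : Mem M R) (E' : Mem M' R') (S : M → M' → Prop)
    (r : M → M' → R → R' → Prop) : Prop where
  tick : ∀ m m', S m m' → S (E.tick m) (E'.tick m') ∧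
    ∀ a a', r (E.tick m) (E'.tick m') a a' → r m m' a a'
  gate : ∀ g q m m', S m m' → S (E.gate g q m) (E'.gate g q m') ∧
    ∀ a a', r (E.gate g q m) (E'.gate g q m') a a' → r m m' a a'
  cnot : ∀ q t m m', S m m' → S (E.cnot q t m) (E'.cnot q t m') ∧
    ∀ a a', r (E.cnot q t m) (E'.cnot q t m') a a' → r m m' a a'
  toffoli : ∀ q q' t m m', S m m' → S (E.toffoli q q' t m) (E'.toffoli q q' t m') ∧
    ∀ a a', r (E.toffoli q q' t m) (E'.toffoli q q' t m') a a' → r m m' a a'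
  meas : ∀ q m m' k k', S m m' → (∀ o n n', S n n' → r n n' (k o n) (k' o n')) →
    r m m' (E.meas q k m) (E'.meas q k' m')
  query : ∀ m m' k k', S m m' → (∀ n n', S n n' → r n n' (k n) (k' n')) →
    r m m' (E.query k m) (E'.query k' m')

/-- This is the shared induction over programs behind many comparisons of semantics: renormalised
and unnormalised states, members of a family, linearity, monotonicity, potentials and degree bounds.
The relation between results may depend on the current memories and is carried backwards through
each operation, as in a precondition calculus. -/
theorem wp_rel {M R M' R' : Type} {E : Mem M R} {E' : Mem M' R'} {S : M → M' → Prop}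
    {r : M → M' → R → R' → Prop} (h : MemRel E E' S r) (cnt : ℕ → ℕ) (p : Cmd) :
    ∀ (f : Vars → M → R) (f' : Vars → M' → R'),
      (∀ v m m', S m m' → r m m' (f v m) (f' v m')) →
      ∀ v m m', S m m' → r m m' (wp E cnt p f v m) (wp E' cnt p f' v m') := by
  induction p with
  | seq p q ihp ihq => intro f f' hf; exact ihp _ _ (ihq _ _ hf)
  | cond x p q ihp ihq =>
    intro f f' hf v m m' hm
    simp only [wp]
    have ht := h.tick m m' hm
    split_ifs
    · exact ht.2 _ _ (ihp _ _ hf _ _ _ ht.1)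
    · exact ht.2 _ _ (ihq _ _ hf _ _ _ ht.1)
  | loop x p ih =>
    intro f f' hf v m m' hm
    simp only [wp]
    have ht := h.tick m m' hm
    refine ht.2 _ _ ?_
    have key : ∀ k : ℕ, ∀ v m m', S m m' → r m m'
        (((fun g v m => wp E cnt p g v (E.tick m))^[k] f) v m)
        (((fun g v m => wp E' cnt p g v (E'.tick m))^[k] f') v m') := by
      intro k
      induction k with
      | zero => exact hf
      | succ k ihk =>
        intro v m m' hm
        rw [Function.iterate_succ_apply', Function.iterate_succ_apply']
        have ht := h.tick m m' hm
        exact ht.2 _ _ (ih _ _ ihk _ _ _ ht.1)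
    exact key _ _ _ _ ht.1
  | gate g q =>
    intro f f' hf v m m' hm
    have ht := h.tick m m' hm
    have hg := h.gate g (q.reg, v q.idx) _ _ ht.1
    exact ht.2 _ _ (hg.2 _ _ (hf _ _ _ hg.1))
  | cnot q t =>
    intro f f' hf v m m' hm
    have ht := h.tick m m' hm
    have hg := h.cnot (q.reg, v q.idx) (t.reg, v t.idx) _ _ ht.1
    exact ht.2 _ _ (hg.2 _ _ (hf _ _ _ hg.1))
  | toffoli q q' t =>
    intro f f' hf v m m' hm
    have ht := h.tick m m' hm
    have hg := h.toffoli (q.reg, v q.idx) (q'.reg, v q'.idx) (t.reg, v t.idx) _ _ ht.1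
    exact ht.2 _ _ (hg.2 _ _ (hf _ _ _ hg.1))
  | measure q x =>
    intro f f' hf v m m' hm
    have ht := h.tick m m' hm
    exact ht.2 _ _ (h.meas _ _ _ _ _ ht.1 fun o n n' hn => hf _ _ _ hn)
  | query =>
    intro f f' hf v m m' hm
    have ht := h.tick m m' hm
    exact ht.2 _ _ (h.query _ _ _ _ ht.1 fun n n' hn => hf _ _ _ hn)
  | _ =>
    intro f f' hf v m m' hm
    have ht := h.tick m m' hm
    exact ht.2 _ _ (hf _ _ _ ht.1)

/-! ## Runs as expectations -/

def State.toMem (s : State) : QState × List QState × ℕ := (s.psi, s.queries, s.steps)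

/-- The semantics given by `Cmd.run`. -/
def runMem {a d : ℕ} (O : Oracle a d) : Mem (QState × List QState × ℕ) ℝ≥0∞ where
  tick m := (m.1, m.2.1, m.2.2 + 1)
  gate g q m := (applyGate1 g q m.1, m.2)
  cnot q t m := (applyCNOT q t m.1, m.2)
  toffoli q q' t m := (applyToffoli q q' t m.1, m.2)
  meas q k m := expect (measureQubit q m.1) fun o => k o.1 (o.2, m.2)
  query f m := expect O fun g => f (standardOracle g m.1, m.2.1 ++ [m.1], m.2.2)

theorem iterate_steps {f : State → PMF State}
    (hf : ∀ s, ∀ s' ∈ (f s).support, s.steps + 1 ≤ s'.steps ∧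
      s'.queries.length + s.steps + 1 ≤ s.queries.length + s'.steps) (k : ℕ) :
    ∀ s, ∀ s' ∈ (iterate f k s).support, s.steps + k ≤ s'.steps ∧
      s'.queries.length + s.steps ≤ s.queries.length + s'.steps := by
  induction k with
  | zero =>
    intro s s' h
    rw [iterate, PMF.mem_support_pure_iff] at h
    subst h; simp
  | succ k ih =>
    intro s s' h
    rw [iterate, PMF.mem_support_bind_iff] at h
    obtain ⟨s₁, h1, h2⟩ := h
    have := hf _ _ h1
    have := ih _ _ h2
    omega

/-- Every query costs a step, so the log of queries never grows faster than the clock; a time bound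
is therefore also a bound on the number of queries. -/
theorem run_steps {a d : ℕ} (O : Oracle a d) (p : Cmd) : ∀ s, ∀ s' ∈ (p.run O s).support,
    s.steps ≤ s'.steps ∧ s'.queries.length + s.steps ≤ s.queries.length + s'.steps := by
  induction p with
  | seq p q ihp ihq =>
    intro s s' h
    rw [Cmd.run, PMF.mem_support_bind_iff] at h
    obtain ⟨s₁, h1, h2⟩ := h
    have := ihp _ _ h1
    have := ihq _ _ h2
    omega
  | cond x p q ihp ihq =>
    intro s s' h
    rw [Cmd.run] at h
    split_ifs at h
    · have := ihp _ _ h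
      simp only [State.tick] at this
      omega
    · have := ihq _ _ h
      simp only [State.tick] at this
      omega
  | loop x p ih =>
    intro s s' h
    rw [Cmd.run] at h
    have := iterate_steps (f := fun s' => p.run O s'.tick) (fun s s' h => by
      have := ih _ _ h
      simp only [State.tick] at this
      omega) _ _ _ h
    simp only [State.tick] at this
    omega
  | measure q x =>
    intro s s' h
    rw [Cmd.run, PMF.mem_support_map_iff] at h
    obtain ⟨o, -, rfl⟩ := h
    simp only [State.tick, State.setVar]
    omega
  | query =>
    intro s s' h
    rw [Cmd.run, PMF.mem_support_map_iff] at h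
    obtain ⟨o, -, rfl⟩ := h
    simp only [State.tick, State.setVar, List.length_append, List.length_singleton]
    omega
  | _ =>
    intro s s' h
    rw [Cmd.run, PMF.mem_support_pure_iff] at h
    subst h
    simp only [State.tick, State.setVar]
    omega

theorem run_iterate_steps {a d : ℕ} (O : Oracle a d) (p : Cmd) (k : ℕ) (s s' : State)
    (h : s' ∈ (iterate (fun s' => p.run O s'.tick) k s).support) : s.steps + k ≤ s'.steps :=
  (iterate_steps (fun s s' h => by
    have := run_steps O p _ _ h
    simp only [State.tick] at this
    omega) k s s' h).1

/-- Bounding the loops by a bound on the number of steps changes nothing. -/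
theorem expect_run {a d : ℕ} (O : Oracle a d) {cnt : ℕ → ℕ} {β : ℕ} (hcnt : ∀ k ≤ β, cnt k = k)
    (p : Cmd) : ∀ (s : State) (F : Vars → QState × List QState × ℕ → ℝ≥0∞),
    (∀ s' ∈ (p.run O s).support, s'.steps ≤ β) →
    expect (p.run O s) (fun s' => F s'.vars s'.toMem) = wp (runMem O) cnt p F s.vars s.toMem := by
  induction p with
  | seq p q ihp ihq =>
    intro s F hs
    simp only [Cmd.run, PMF.mem_support_bind_iff] at hs
    rw [Cmd.run, expect_bind, wp, ← ihp]
    · refine expect_congr fun s₁ h1 => ihq _ _ fun s' h2 => hs s' ⟨s₁, h1, h2⟩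
    · intro s₁ h1
      obtain ⟨s₂, h2⟩ := (q.run O s₁).support_nonempty
      exact (run_steps O q _ _ h2).1.trans (hs s₂ ⟨s₁, h1, h2⟩)
  | cond x p q ihp ihq =>
    intro s F hs
    rw [Cmd.run] at hs ⊢
    rw [wp]
    beta_reduce
    split_ifs at hs ⊢
    · exact ihp s.tick F hs
    · exact ihq s.tick F hs
  | loop x p ih =>
    intro s F hs
    rw [Cmd.run] at hs ⊢
    rw [wp]
    -- An iteration costs at least one step, so the loop count is at most the final step count,
    -- hence at most `β`, where `cnt` is the identity.
    have hk : s.vars x ≤ β := by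
      obtain ⟨s₂, h2⟩ := (iterate (fun s' => p.run O s'.tick) (s.vars x) s.tick).support_nonempty
      have := run_iterate_steps O p _ _ _ h2
      have := hs _ h2
      simp only [State.tick] at *
      omega
    beta_reduce
    rw [hcnt _ hk]
    have key : ∀ k : ℕ, ∀ s : State,
        (∀ s' ∈ (iterate (fun s' => p.run O s'.tick) k s).support, s'.steps ≤ β) →
        expect (iterate (fun s' => p.run O s'.tick) k s) (fun s' => F s'.vars s'.toMem)
          = ((fun g v m => wp (runMem O) cnt p g v ((runMem O).tick m))^[k] F) s.vars s.toMem := by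
      intro k
      induction k with
      | zero => intro s hs; rw [iterate, expect_pure]; rfl
      | succ k ihk =>
        intro s hs
        simp only [iterate, PMF.mem_support_bind_iff] at hs
        rw [iterate, expect_bind, Function.iterate_succ_apply']
        refine Eq.trans ?_ (ih s.tick _ ?_)
        · exact expect_congr fun s₁ h1 => ihk _ fun s' h2 => hs s' ⟨s₁, h1, h2⟩
        · intro s₁ h1
          obtain ⟨s₂, h2⟩ := (iterate (fun s' => p.run O s'.tick) k s₁).support_nonempty
          have := run_iterate_steps O p _ _ _ h2
          have := hs s₂ ⟨s₁, h1, h2⟩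
          omega
    exact key _ s.tick hs
  | measure q x => intro s F hs; rw [Cmd.run, expect_map]; rfl
  | query => intro s F hs; rw [Cmd.run, expect_map]; rfl
  | _ => intro s F hs; rw [Cmd.run, expect_pure]; rfl

/-- The semantics with states that are not renormalised after a measurement; both outcomes of a
measurement are summed. -/
def pureMem {a d : ℕ} (O : Oracle a d) : Mem (QState × List QState) ℝ≥0∞ where
  tick m := m
  gate g q m := (applyGate1 g q m.1, m.2)
  cnot q t m := (applyCNOT q t m.1, m.2)
  toffoli q q' t m := (applyToffoli q q' t m.1, m.2)
  meas q k m := k true (project q true m.1, m.2) + k false (project q false m.1, m.2)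
  query f m := expect O fun g => f (standardOracle g m.1, m.2 ++ [m.1])

/-- Gates and oracles preserve the norm, and at a measurement the norm turns the Born average into
the plain sum of both branches. Results in the two semantics therefore differ exactly by the squared
norm of the current state. -/
theorem memRel_runMem_pureMem {a d : ℕ} (O : Oracle a d) :
    MemRel (runMem O) (pureMem O) (fun m m' => m' = (m.1, m.2.1))
      (fun m _ a a' => nE m.1 * a = a') := by
  constructor
  · rintro m _ rfl
    exact ⟨rfl, fun a a' h => h⟩
  · rintro g q m _ rfl
    exact ⟨rfl, fun a a' h => by rw [← h]; simp [runMem, nE_gate]⟩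
  · rintro q t m _ rfl
    exact ⟨rfl, fun a a' h => by rw [← h]; simp [runMem, nE_cnot]⟩
  · rintro q q' t m _ rfl
    exact ⟨rfl, fun a a' h => by rw [← h]; simp [runMem, nE_toffoli]⟩
  · rintro q m _ k k' rfl hk
    simp only [runMem, pureMem]
    rw [expect_measureQubit q m.1 fun v φ => k v (φ, m.2)]
    rw [← hk true (project q true m.1, m.2) _ rfl, ← hk false (project q false m.1, m.2) _ rfl]
  · rintro m _ k k' rfl hk
    simp only [runMem, pureMem]
    rw [← expect_const_mul]
    refine expect_congr fun g _ => ?_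
    rw [← hk (standardOracle g m.1, m.2.1 ++ [m.1], m.2.2) _ rfl, nE_standardOracle]

theorem nE_mul_wp_runMem {a d : ℕ} (O : Oracle a d) (cnt : ℕ → ℕ) (p : Cmd)
    (F : Vars → QState × List QState → ℝ≥0∞) (v : Vars) (ψ : QState) (l : List QState) (n : ℕ) :
    nE ψ * wp (runMem O) cnt p (fun v m => F v (m.1, m.2.1)) v (ψ, l, n)
      = wp (pureMem O) cnt p (fun v m => nE m.1 * F v m) v (ψ, l) := by
  exact wp_rel (memRel_runMem_pureMem O) cnt p (fun v m => F v (m.1, m.2.1)) (fun v m => nE m.1 * F v m)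
    (fun v m m' hm => by subst hm; rfl) v (ψ, l, n) (ψ, l) rfl

/-! ## The values of the games -/

def inputVars (l : List ℕ) : Vars := fun i => l.getD i 0

namespace MACScheme

variable (F : MACScheme)

theorem queries_length_le_of_mem_qExRun {A₁ A₂ : Cmd} {n : ℕ}
    {O : Oracle (F.msgLen n) (F.tagLen n)} {o}
    (h : o ∈ (F.qExRun A₁ A₂ n O).support) : o.2.2.queries.length ≤ o.2.2.steps := by
  simp only [qExRun, PMF.mem_support_bind_iff, PMF.mem_support_map_iff] at h
  obtain ⟨s₁, h1, om, h2, s₂, h3, ot, h4, rfl⟩ := h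
  have := run_steps O A₁ _ _ h1
  have := run_steps O A₂ _ _ h3
  simp [State.init] at *
  omega

theorem queries_length_le_of_mem_blindRun {A : Cmd} {n : ℕ}
    {O : Oracle (F.msgLen n) (F.tagLen n + 1)} {o}
    (h : o ∈ (F.blindRun A n O).support) : o.2.2.queries.length ≤ o.2.2.steps := by
  simp only [blindRun, PMF.mem_support_bind_iff, PMF.mem_support_map_iff] at h
  obtain ⟨s₁, h1, om, h2, ot, h4, rfl⟩ := h
  have := run_steps O A _ _ h1
  simp [State.init] at *
  omega

/-- The step counter is used only to justify the arbitrary loop count `cnt`; afterwards the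
experiment is a sum of squared norms of branches. The initial state has norm one, so no factor
remains. -/
theorem expect_blindRun (A : Cmd) (n : ℕ) (O : Oracle (F.msgLen n) (F.tagLen n + 1))
    {cnt : ℕ → ℕ} {β : ℕ} (hcnt : ∀ k ≤ β, cnt k = k)
    (hβ : ∀ o ∈ (F.blindRun A n O).support, o.2.2.steps ≤ β)
    (G : Bits (F.msgLen n) → Bits (F.tagLen n) → List QState → ℝ≥0∞) :
    expect (F.blindRun A n O) (fun o => G o.1 o.2.1 o.2.2.queries)
      = wp (pureMem O) cnt A (fun _ m => ∑ x, ∑ t,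
          nE (projReg regY (F.tagLen n) t (projReg regX (F.msgLen n) x m.1)) * G x t m.2)
        (inputVars (F.publicInput n)) (QState.zeroKet, []) := by
  simp only [blindRun, expect_bind, expect_map]
  have hs : ∀ s' ∈ (A.run O (State.init (F.publicInput n))).support, s'.steps ≤ β := by
    intro s' h
    obtain ⟨om, h2⟩ := (measureReg regX (F.msgLen n) s'.psi).support_nonempty
    obtain ⟨ot, h3⟩ := (measureReg regY (F.tagLen n) om.2).support_nonempty
    refine hβ (om.1, ot.1, { s' with psi := ot.2 }) ?_
    simp only [blindRun, PMF.mem_support_bind_iff, PMF.mem_support_map_iff]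
    exact ⟨s', h, om, h2, ot, h3, rfl⟩
  have h1 := expect_run O hcnt A (State.init (F.publicInput n)) (fun _ m =>
    expect (measureReg regX (F.msgLen n) m.1) fun om =>
      expect (measureReg regY (F.tagLen n) om.2) fun ot => G om.1 ot.1 m.2.1) hs
  refine h1.trans ?_
  have h2 := nE_mul_wp_runMem O cnt A (fun _ m => expect (measureReg regX (F.msgLen n) m.1)
    fun om => expect (measureReg regY (F.tagLen n) om.2) fun ot => G om.1 ot.1 m.2)
    (State.init (F.publicInput n)).vars QState.zeroKet [] 0
  rw [nE_zeroKet, one_mul] at h2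
  refine h2.trans ?_
  congr 1
  funext v m
  rw [expect_measureReg regX _ m.1 fun x φ => expect (measureReg regY (F.tagLen n) φ)
    fun ot => G x ot.1 m.2]
  refine Finset.sum_congr rfl fun x _ => ?_
  rw [expect_measureReg regY _ _ fun t _ => G x t m.2]

/-- Unnormalised states make the measurement between the phases a sum of projections, inserted as
the payoff of the first phase. The time bound for the whole run bounds the first phase too, because
the clock never goes back. -/
theorem expect_qExRun (A₁ A₂ : Cmd) (n : ℕ) (O : Oracle (F.msgLen n) (F.tagLen n))
    {cnt : ℕ → ℕ} {β : ℕ} (hcnt : ∀ k ≤ β, cnt k = k)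
    (hβ : ∀ o ∈ (F.qExRun A₁ A₂ n O).support, o.2.2.steps ≤ β)
    (G : Bits (F.msgLen n) → Bits (F.tagLen n) → List QState → ℝ≥0∞) :
    expect (F.qExRun A₁ A₂ n O) (fun o => G o.1 o.2.1 o.2.2.queries)
      = wp (pureMem O) cnt A₁ (fun v m => ∑ x, wp (pureMem O) cnt A₂
          (fun _ m' => ∑ t, nE (projReg regY (F.tagLen n) t m'.1) * G x t m'.2)
          v (projReg regX (F.msgLen n) x m.1, m.2))
        (inputVars (F.publicInput n)) (QState.zeroKet, []) := by
  simp only [qExRun, expect_bind, expect_map]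
  have hs : ∀ s₁ ∈ (A₁.run O (State.init (F.publicInput n))).support,
      ∀ om ∈ (measureReg regX (F.msgLen n) s₁.psi).support,
      ∀ s₂ ∈ (A₂.run O { s₁ with psi := om.2 }).support, s₂.steps ≤ β := by
    intro s₁ h1 om h2 s₂ h3
    obtain ⟨ot, h4⟩ := (measureReg regY (F.tagLen n) s₂.psi).support_nonempty
    refine hβ (om.1, ot.1, { s₂ with psi := ot.2 }) ?_
    simp only [qExRun, PMF.mem_support_bind_iff, PMF.mem_support_map_iff]
    exact ⟨s₁, h1, om, h2, s₂, h3, ot, h4, rfl⟩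
  have hs1 : ∀ s₁ ∈ (A₁.run O (State.init (F.publicInput n))).support, s₁.steps ≤ β := by
    intro s₁ h1
    obtain ⟨om, h2⟩ := (measureReg regX (F.msgLen n) s₁.psi).support_nonempty
    obtain ⟨s₂, h3⟩ := (A₂.run O { s₁ with psi := om.2 }).support_nonempty
    exact (run_steps O A₂ _ _ h3).1.trans (hs s₁ h1 om h2 s₂ h3)
  have h0 : expect (A₁.run O (State.init (F.publicInput n))) (fun s₁ =>
      expect (measureReg regX (F.msgLen n) s₁.psi) fun om =>
        expect (A₂.run O { s₁ with psi := om.2 }) fun s₂ =>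
          expect (measureReg regY (F.tagLen n) s₂.psi) fun ot => G om.1 ot.1 s₂.queries)
      = expect (A₁.run O (State.init (F.publicInput n))) (fun s₁ =>
      expect (measureReg regX (F.msgLen n) s₁.psi) fun om =>
        wp (runMem O) cnt A₂ (fun _ m => expect (measureReg regY (F.tagLen n) m.1)
          fun ot => G om.1 ot.1 m.2.1) s₁.vars (om.2, s₁.queries, s₁.steps)) := by
    refine expect_congr fun s₁ h1 => expect_congr fun om h2 => ?_
    exact expect_run O hcnt A₂ { s₁ with psi := om.2 } (fun _ m =>
      expect (measureReg regY (F.tagLen n) m.1) fun ot => G om.1 ot.1 m.2.1) (hs s₁ h1 om h2)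
  refine h0.trans ?_
  have h1 := expect_run O hcnt A₁ (State.init (F.publicInput n)) (fun v m =>
    expect (measureReg regX (F.msgLen n) m.1) fun om =>
      wp (runMem O) cnt A₂ (fun _ m => expect (measureReg regY (F.tagLen n) m.1)
          fun ot => G om.1 ot.1 m.2.1) v (om.2, m.2.1, m.2.2)) hs1
  refine h1.trans ?_
  have hstep : ∀ (x : Bits (F.msgLen n)) (v : Vars) (φ : QState) (l : List QState) (k : ℕ),
      nE φ * wp (runMem O) cnt A₂ (fun _ m => expect (measureReg regY (F.tagLen n) m.1)
          fun ot => G x ot.1 m.2.1) v (φ, l, k)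
      = wp (pureMem O) cnt A₂
          (fun _ m' => ∑ t, nE (projReg regY (F.tagLen n) t m'.1) * G x t m'.2) v (φ, l) := by
    intro x v φ l k
    rw [nE_mul_wp_runMem O cnt A₂ (fun _ m => expect (measureReg regY (F.tagLen n) m.1)
          fun ot => G x ot.1 m.2)]
    congr 1
    funext v m
    rw [expect_measureReg regY _ _ fun t _ => G x t m.2]
  have h2 := wp_rel (memRel_runMem_pureMem O) cnt A₁ (fun v m =>
    expect (measureReg regX (F.msgLen n) m.1) fun om =>
      wp (runMem O) cnt A₂ (fun _ m => expect (measureReg regY (F.tagLen n) m.1)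
          fun ot => G om.1 ot.1 m.2.1) v (om.2, m.2.1, m.2.2))
    (fun v m => ∑ x, wp (pureMem O) cnt A₂
          (fun _ m' => ∑ t, nE (projReg regY (F.tagLen n) t m'.1) * G x t m'.2)
          v (projReg regX (F.msgLen n) x m.1, m.2))
    (by
      rintro v m _ rfl
      rw [expect_measureReg regX _ m.1 fun x φ => wp (runMem O) cnt A₂
        (fun _ m => expect (measureReg regY (F.tagLen n) m.1)
          fun ot => G x ot.1 m.2.1) v (φ, m.2.1, m.2.2)]
      exact Finset.sum_congr rfl fun x _ => hstep _ _ _ _ _)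
    (State.init (F.publicInput n)).vars (QState.zeroKet, [], 0) _ rfl
  rw [nE_zeroKet, one_mul] at h2
  exact h2

end MACScheme

/-! ## Distinguishability from a basis state -/

theorem messageDensity_diag (a : ℕ) (ψ : QState) (m : Bits a) :
    messageDensity a ψ m m
      = (((projReg regX a m ψ).normSq : ℝ) / ((ψ.normSq : ℝ)) : ℝ) := by
  classical
  unfold messageDensity
  rw [Matrix.of_apply, Complex.ofReal_div]
  congr 1
  unfold QState.normSq projReg Finsupp.sum
  rw [Finsupp.support_filter, Finset.sum_filter]
  push_cast
  refine Finset.sum_congr rfl fun b hb => ?_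
  have hw : readReg regX a b = m → writeReg regX a m b = b := by
    rintro rfl
    funext q
    unfold writeReg readReg
    split_ifs with h
    · obtain ⟨r, i⟩ := q
      obtain ⟨h1, h2⟩ := h
      simp only at h1
      subst h1; rfl
    · rfl
  split_ifs with h
  · rw [hw h, Finsupp.filter_apply, if_pos h, Complex.mul_conj, Complex.normSq_eq_norm_sq]
    push_cast
    rfl
  · rfl

-- |m⟩⟨m| is a projection, so its multiple by √c is a positive square root of its multiple by c, and
-- positive square roots are unique.
open ComplexOrder in
theorem sqrt_smul_ketbra {a : ℕ} (m : Bits a) (c : ℝ) (hc : 0 ≤ c) :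
    CFC.sqrt (((c : ℝ) : ℂ) • ketbra m) = ((Real.sqrt c : ℝ) : ℂ) • ketbra m := by
  have hk : ketbra m * ketbra m = ketbra m := by simp [ketbra]
  have hn : ∀ c : ℝ, 0 ≤ c → 0 ≤ ((c : ℝ) : ℂ) • ketbra m := by
    intro c hc
    rw [Matrix.nonneg_iff_posSemidef]
    have h1 : ((c : ℝ) : ℂ) • ketbra m = Matrix.diagonal (Pi.single m ((c : ℝ) : ℂ)) := by
      rw [Matrix.diagonal_single]
      simp [ketbra]
    rw [h1, Matrix.posSemidef_diagonal_iff]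
    intro i
    by_cases h : i = m
    · subst h; simpa using hc
    · simp [h]
  refine CFC.sqrt_unique ?_ (hn _ (Real.sqrt_nonneg c))
  rw [smul_mul_smul_comm, hk, ← Complex.ofReal_mul, Real.mul_self_sqrt hc]

/-- Sandwiching ρ between the projection |m⟩⟨m| leaves ⟨m|ρ|m⟩ |m⟩⟨m|, whose root has an explicit
trace. The fidelity is thus the probability of reading m, and a nonnegative number is at most 1 − 1
only if it vanishes. -/
theorem distinguishable_one_iff (a : ℕ) (ψ : QState) (m : Bits a) :
    Distinguishable 1 (ketbra m) (messageDensity a ψ) ↔ projReg regX a m ψ = 0 := by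
  set c : ℝ := ((projReg regX a m ψ).normSq : ℝ) / (ψ.normSq : ℝ) with hc
  have hc0 : 0 ≤ c := by positivity
  have h1 : CFC.sqrt (ketbra m) = ketbra m := by
    have := sqrt_smul_ketbra m 1 zero_le_one
    simpa using this
  have h2 : ketbra m * messageDensity a ψ * ketbra m = ((c : ℝ) : ℂ) • ketbra m := by
    rw [hc, ← messageDensity_diag]
    ext i j
    simp only [ketbra, Matrix.smul_apply, Matrix.single_mul_mul_single, one_mul, mul_one,
      smul_eq_mul]
    simp [Matrix.single_apply]
  have h3 : fidelity (ketbra m) (messageDensity a ψ) = c := by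
    unfold fidelity
    rw [h1, h2, sqrt_smul_ketbra m c hc0, Matrix.trace_smul]
    simp [ketbra, Real.sq_sqrt hc0]
  unfold Distinguishable
  rw [h3, sub_self]
  constructor
  · intro h
    have h0 : c = 0 := le_antisymm h hc0
    have hle : (projReg regX a m ψ).normSq ≤ ψ.normSq := by
      have := sum_nE_projReg regX a ψ
      rw [← ENNReal.coe_le_coe, coe_normSq, coe_normSq, ← this]
      exact Finset.single_le_sum (f := fun u => nE (projReg regX a u ψ))
        (fun _ _ => zero_le) (Finset.mem_univ m)
    have hz : (projReg regX a m ψ).normSq = 0 := by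
      -- For the zero state the quotient is zero by convention, but then the projection vanishes as
      -- well, being no longer than the state.
      rcases div_eq_zero_iff.1 h0 with h | h
      · exact_mod_cast h
      · rw [NNReal.coe_eq_zero] at h
        rw [h] at hle
        exact le_antisymm hle (zero_le)
    have hE : nE (projReg regX a m ψ) = 0 := by rw [← coe_normSq, hz]; rfl
    ext b
    have := ENNReal.tsum_eq_zero.1 hE b
    simpa using this
  · intro h
    rw [hc, h]
    simp [QState.normSq]

/-! ## Product states -/

/-- The part of a basis state that lies in the registers `ρ r`. -/
def hi (ρ : ℕ → ℕ) (b : Basis) : Basis := fun q => b (ρ q.1, q.2)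

/-- `χ` does not depend on the registers `ρ r`. -/
def Indep (ρ : ℕ → ℕ) (χ : Basis → ℂ) : Prop :=
  ∀ b b' : Basis, (∀ q : Qubit, q.1 ∉ Set.range ρ → b q = b' q) → χ b = χ b'

/-- `ψ'` is the product of `ψ`, moved to the registers `ρ r`, and `χ`. -/
def IsProd (ρ : ℕ → ℕ) (ψ' ψ : QState) (χ : Basis → ℂ) : Prop :=
  ∀ b, ψ' b = ψ (hi ρ b) * χ b

/-- The image of a qubit. -/
abbrev mvq (ρ : ℕ → ℕ) (q : Qubit) : Qubit := (ρ q.1, q.2)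

section Prod

variable {ρ : ℕ → ℕ} {χ : Basis → ℂ} {ψ' ψ : QState}

theorem hi_update (hρ : Function.Injective ρ) (b : Basis) (q : Qubit) (v : Bool) :
    hi ρ (Function.update b (mvq ρ q) v) = Function.update (hi ρ b) q v := by
  funext q'
  by_cases h : q' = q
  · subst h; simp [hi]
  · have : (ρ q'.1, q'.2) ≠ mvq ρ q := by
      intro h'
      apply h
      rw [Prod.mk.injEq] at h'
      exact Prod.ext (hρ h'.1) h'.2
    simp [hi, h, this]

theorem Indep.update (h : Indep ρ χ) (b : Basis) (q : Qubit) (v : Bool) :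
    χ (Function.update b (mvq ρ q) v) = χ b := by
  refine h _ _ fun q' hq' => ?_
  rw [Function.update_of_ne]
  rintro rfl
  exact hq' ⟨_, rfl⟩

theorem mvq_inj (hρ : Function.Injective ρ) {q t : Qubit} : mvq ρ q = mvq ρ t ↔ q = t := by
  constructor
  · intro h
    rw [Prod.mk.injEq] at h
    exact Prod.ext (hρ h.1) h.2
  · rintro rfl; rfl

/-- A gate on an embedded qubit changes only the coordinates read by the first factor; the second
factor does not see these coordinates and can be pulled out of the sum. -/
theorem IsProd.gate (hρ : Function.Injective ρ) (hχ : Indep ρ χ) (h : IsProd ρ ψ' ψ χ)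
    (g : Gate1) (q : Qubit) : IsProd ρ (applyGate1 g (mvq ρ q) ψ') (applyGate1 g q ψ) χ := by
  intro b
  rw [applyGate1_apply, applyGate1_apply, Finset.sum_mul]
  refine Finset.sum_congr rfl fun v _ => ?_
  rw [h, hi_update hρ, hχ.update, mul_assoc]
  rfl

theorem IsProd.cnot (hρ : Function.Injective ρ) (hχ : Indep ρ χ) (h : IsProd ρ ψ' ψ χ)
    (q t : Qubit) : IsProd ρ (applyCNOT (mvq ρ q) (mvq ρ t) ψ') (applyCNOT q t ψ) χ := by
  intro b
  rw [applyCNOT_eq, applyCNOT_eq, mapDomain_involutive_apply (cnotMap_involutive _ _),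
    mapDomain_involutive_apply (cnotMap_involutive _ _), h]
  unfold cnotMap
  by_cases hq : q = t
  · rw [if_pos hq, if_pos (congrArg _ hq)]
  · rw [if_neg hq, if_neg (mt (mvq_inj hρ).1 hq), hi_update hρ, hχ.update]
    rfl

theorem IsProd.toffoli (hρ : Function.Injective ρ) (hχ : Indep ρ χ) (h : IsProd ρ ψ' ψ χ)
    (q q' t : Qubit) : IsProd ρ (applyToffoli (mvq ρ q) (mvq ρ q') (mvq ρ t) ψ')
      (applyToffoli q q' t ψ) χ := by
  intro b
  rw [applyToffoli_eq, applyToffoli_eq, mapDomain_involutive_apply (toffoliMap_involutive _ _ _),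
    mapDomain_involutive_apply (toffoliMap_involutive _ _ _), h]
  unfold toffoliMap
  have hiff : (mvq ρ q = mvq ρ t ∨ mvq ρ q' = mvq ρ t) ↔ (q = t ∨ q' = t) := by
    rw [mvq_inj hρ, mvq_inj hρ]
  by_cases hq : q = t ∨ q' = t
  · rw [if_pos hq, if_pos (hiff.2 hq)]
  · rw [if_neg hq, if_neg (mt hiff.1 hq), hi_update hρ, hχ.update]
    rfl

theorem IsProd.project (h : IsProd ρ ψ' ψ χ) (q : Qubit) (v : Bool) :
    IsProd ρ (project (mvq ρ q) v ψ') (project q v ψ) χ := by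
  intro b
  rw [project_apply, project_apply, h]
  have : b (mvq ρ q) = hi ρ b q := rfl
  rw [this]
  split_ifs <;> simp

theorem IsProd.projReg (h : IsProd ρ ψ' ψ χ) (r d : ℕ) (u : Bits d) :
    IsProd ρ (projReg (ρ r) d u ψ') (projReg r d u ψ) χ := by
  intro b
  rw [projReg_apply, projReg_apply, h]
  have : readReg (ρ r) d b = readReg r d (hi ρ b) := rfl
  rw [this]
  split_ifs <;> simp

open Classical in
/-- Splitting a basis state into the registers `ρ r` and the others. -/
def splitBasis (hρ : Function.Injective ρ) :
    Basis ≃ Basis × ({q : Qubit // q.1 ∉ Set.range ρ} → Bool) where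
  toFun b := (hi ρ b, fun q => b q)
  invFun x := fun q => if h : q.1 ∈ Set.range ρ then x.1 (h.choose, q.2) else x.2 ⟨q, h⟩
  left_inv b := by
    funext q
    dsimp only
    split_ifs with h
    · simp only [hi]
      rw [h.choose_spec]
    · rfl
  right_inv x := by
    refine Prod.ext ?_ ?_
    · funext q
      have h : ρ q.1 ∈ Set.range ρ := ⟨_, rfl⟩
      simp only [hi, dif_pos h]
      rw [hρ h.choose_spec]
    · funext q
      simp only [dif_neg q.2]

/-- The squared norm of the second factor of a product. -/
def sqNorm (hρ : Function.Injective ρ) (χ : Basis → ℂ) : ℝ≥0∞ :=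
  ∑' c, ‖χ ((splitBasis hρ).symm (fun _ => false, c))‖ₑ ^ 2

/-- The sum over basis states factorises along `splitBasis`. The second factor may be evaluated with
zeros in the embedded registers because it is independent of them. -/
theorem IsProd.nE (hρ : Function.Injective ρ) (hχ : Indep ρ χ) (h : IsProd ρ ψ' ψ χ) :
    nE ψ' = nE ψ * sqNorm hρ χ := by
  unfold QUnf.nE sqNorm
  rw [← (splitBasis hρ).symm.tsum_eq fun b => ‖ψ' b‖ₑ ^ 2, ENNReal.tsum_prod',
    ← ENNReal.tsum_mul_right]
  refine tsum_congr fun b => ?_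
  rw [← ENNReal.tsum_mul_left]
  refine tsum_congr fun c => ?_
  rw [h, enorm_mul, mul_pow]
  congr 3
  · have := congrArg Prod.fst ((splitBasis hρ).apply_symm_apply (b, c))
    exact congrArg ψ this
  · refine hχ _ _ fun q hq => ?_
    have e1 := congrFun (congrArg Prod.snd ((splitBasis hρ).apply_symm_apply (b, c))) ⟨q, hq⟩
    have e2 := congrFun (congrArg Prod.snd
      ((splitBasis hρ).apply_symm_apply ((fun _ => false), c))) ⟨q, hq⟩
    exact e1.trans e2.symm

end Prod

/-! ## Embedding a program into a larger one -/

/-- Run `p` as often as the smaller one of the values of `x` and `cap`. -/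
def capLoop (t x cap : ℕ) (p : Cmd) : Cmd :=
  .seq (.sub t x cap) (.seq (.sub t x t) (.loop t p))

/-- How a program is embedded: renaming of variables and registers, a scratch variable, the
variable that bounds all loops, and a program that replaces the queries. -/
structure Emb where
  σ : ℕ → ℕ
  ρ : ℕ → ℕ
  tmp : ℕ
  cap : ℕ
  gadget : Cmd

def Emb.ref (e : Emb) (q : QRef) : QRef := ⟨e.ρ q.reg, e.σ q.idx⟩

def Emb.compile (e : Emb) : Cmd → Cmd
  | .skip => .skip
  | .seq p q => .seq (e.compile p) (e.compile q)
  | .const x k => .const (e.σ x) k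
  | .add x y z => .add (e.σ x) (e.σ y) (e.σ z)
  | .sub x y z => .sub (e.σ x) (e.σ y) (e.σ z)
  | .cond x p q => .cond (e.σ x) (e.compile p) (e.compile q)
  | .loop x p => capLoop e.tmp (e.σ x) e.cap (e.compile p)
  | .gate g q => .gate g (e.ref q)
  | .cnot q t => .cnot (e.ref q) (e.ref t)
  | .toffoli q q' t => .toffoli (e.ref q) (e.ref q') (e.ref t)
  | .measure q x => .measure (e.ref q) (e.σ x)
  | .query => e.gadget

/-- `S m w m'`: the memory `m` of the original program is represented by the variables `w` and the
memory `m'` of the embedding program. -/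
structure Emb.Sim (e : Emb) {M : Type} (E : Mem M ℝ≥0∞) {a d : ℕ} (O : Oracle a d) (β : ℕ)
    (κ : ℝ≥0∞) (proj : Qubit → Bool → M → M) (S : M → Vars → QState × List QState → Prop) :
    Prop where
  inj : Function.Injective e.σ
  tmp : e.tmp ∉ Set.range e.σ
  tick : ∀ m, E.tick m = m
  frame : ∀ m w w' m', S m w m' → (∀ y, y ∉ Set.range e.σ → y ≠ e.tmp → w' y = w y) → S m w' m'
  cap_eq : ∀ m w m', S m w m' → w e.cap = β
  gate : ∀ m w m' g q, S m w m' → S (E.gate g q m) w (applyGate1 g (mvq e.ρ q) m'.1, m'.2)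
  cnot : ∀ m w m' q t, S m w m' →
    S (E.cnot q t m) w (applyCNOT (mvq e.ρ q) (mvq e.ρ t) m'.1, m'.2)
  toffoli : ∀ m w m' q q' t, S m w m' →
    S (E.toffoli q q' t m) w (applyToffoli (mvq e.ρ q) (mvq e.ρ q') (mvq e.ρ t) m'.1, m'.2)
  meas : ∀ q k m, E.meas q k m = k true (proj q true m) + k false (proj q false m)
  proj : ∀ m w m' q o, S m w m' → S (proj q o m) w (project (mvq e.ρ q) o m'.1, m'.2)
  query : ∀ (v : Vars) (f : M → ℝ≥0∞) (f' : Vars → QState × List QState → ℝ≥0∞) m w m',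
    (∀ x, w (e.σ x) = v x) → S m w m' →
    (∀ n w n', (∀ x, w (e.σ x) = v x) → S n w n' → κ * f n ≤ f' w n') →
    κ * E.query f m ≤ wp (pureMem O) id e.gadget f' w m'

/-- The invariant `S` survives every operation by assumption, so the induction only has to treat
variables and loops. One direction suffices, since a simulating adversary may win more often than
required; `κ` is the squared norm of the part of the memory that the embedded program does not see.
-/
theorem Emb.Sim.le {e : Emb} {M : Type} {E : Mem M ℝ≥0∞} {a d : ℕ} {O : Oracle a d} {β : ℕ}
    {κ : ℝ≥0∞} {proj : Qubit → Bool → M → M} {S : M → Vars → QState × List QState → Prop}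
    (h : e.Sim E O β κ proj S) (p : Cmd) :
    ∀ (f : Vars → M → ℝ≥0∞) (f' : Vars → QState × List QState → ℝ≥0∞),
    (∀ v m w m', (∀ x, w (e.σ x) = v x) → S m w m' → κ * f v m ≤ f' w m') →
    ∀ v m w m', (∀ x, w (e.σ x) = v x) → S m w m' →
      κ * wp E (fun k => min k β) p f v m ≤ wp (pureMem O) id (e.compile p) f' w m' := by
  have hupd : ∀ (v w : Vars) (x k : ℕ), (∀ x, w (e.σ x) = v x) →
      ∀ y, Function.update w (e.σ x) k (e.σ y) = Function.update v x k y := by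
    intro v w x k hw y
    by_cases hy : y = x
    · subst hy; simp
    · rw [Function.update_of_ne hy, Function.update_of_ne fun h' => hy (h.inj h'), hw]
  have hfr : ∀ m w m' x k, S m w m' → S m (Function.update w (e.σ x) k) m' := by
    intro m w m' x k hS
    refine h.frame _ _ _ _ hS fun y hy _ => ?_
    rw [Function.update_of_ne]
    rintro rfl
    exact hy ⟨_, rfl⟩
  induction p with
  | skip =>
    intro f f' hf v m w m' hw hS
    simp only [wp, Emb.compile, h.tick]
    exact hf _ _ _ _ hw hS
  | seq p q ihp ihq => intro f f' hf; exact ihp _ _ (ihq _ _ hf)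
  | const x k =>
    intro f f' hf v m w m' hw hS
    simp only [wp, Emb.compile, h.tick]
    exact hf _ _ _ _ (hupd _ _ _ _ hw) (hfr _ _ _ _ _ hS)
  | add x y z =>
    intro f f' hf v m w m' hw hS
    simp only [wp, Emb.compile, h.tick, hw]
    exact hf _ _ _ _ (hupd _ _ _ _ hw) (hfr _ _ _ _ _ hS)
  | sub x y z =>
    intro f f' hf v m w m' hw hS
    simp only [wp, Emb.compile, h.tick, hw]
    exact hf _ _ _ _ (hupd _ _ _ _ hw) (hfr _ _ _ _ _ hS)
  | cond x p q ihp ihq =>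
    intro f f' hf v m w m' hw hS
    simp only [wp, Emb.compile, h.tick, hw]
    split_ifs
    · exact ihp _ _ hf _ _ _ _ hw hS
    · exact ihq _ _ hf _ _ _ _ hw hS
  | loop x p ih =>
    intro f f' hf v m w m' hw hS
    simp only [Emb.compile, capLoop]
    simp only [wp, h.tick, id]
    have hcap : w e.cap = β := h.cap_eq _ _ _ hS
    have hn : e.σ x ≠ e.tmp := fun h' => h.tmp ⟨x, h'⟩
    -- Two truncated subtractions compute the minimum, so the compiled loop realises the capped
    -- count.
    have hk : v x - (v x - β) = min (v x) β := by omega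
    simp only [Function.update_self, Function.update_of_ne hn, hw, hcap, Function.update_idem, hk]
    have hw' : ∀ y, Function.update w e.tmp (min (v x) β) (e.σ y) = v y := by
      intro y
      rw [Function.update_of_ne fun h' => h.tmp ⟨y, h'⟩, hw]
    have hS' : S m (Function.update w e.tmp (min (v x) β)) m' :=
      h.frame _ _ _ _ hS fun y _ hy => Function.update_of_ne hy _ _
    have key : ∀ k : ℕ, ∀ v m w m', (∀ x, w (e.σ x) = v x) → S m w m' →
        κ * (((fun g v m => wp E (fun k => min k β) p g v m)^[k] f) v m)
        ≤ (((fun g v m => wp (pureMem O) id (e.compile p) g v ((pureMem O).tick m))^[k] f')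
            w m') := by
      intro k
      induction k with
      | zero => exact hf
      | succ k ihk =>
        intro v m w m' hw hS
        rw [Function.iterate_succ_apply', Function.iterate_succ_apply']
        exact ih _ _ ihk _ _ _ _ hw hS
    exact key _ _ _ _ _ hw' hS'
  | gate g q =>
    intro f f' hf v m w m' hw hS
    simp only [wp, Emb.compile, h.tick, Emb.ref, hw]
    exact hf _ _ _ _ hw (h.gate _ _ _ _ _ hS)
  | cnot q t =>
    intro f f' hf v m w m' hw hS
    simp only [wp, Emb.compile, h.tick, Emb.ref, hw]
    exact hf _ _ _ _ hw (h.cnot _ _ _ _ _ hS)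
  | toffoli q q' t =>
    intro f f' hf v m w m' hw hS
    simp only [wp, Emb.compile, h.tick, Emb.ref, hw]
    exact hf _ _ _ _ hw (h.toffoli _ _ _ _ _ _ hS)
  | measure q x =>
    intro f f' hf v m w m' hw hS
    simp only [wp, Emb.compile, h.tick, Emb.ref, hw, h.meas, mul_add]
    exact add_le_add (hf _ _ _ _ (hupd _ _ _ _ hw) (hfr _ _ _ _ _ (h.proj _ _ _ _ _ hS)))
      (hf _ _ _ _ (hupd _ _ _ _ hw) (hfr _ _ _ _ _ (h.proj _ _ _ _ _ hS)))
  | query =>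
    intro f f' hf v m w m' hw hS
    simp only [wp, Emb.compile, h.tick]
    exact h.query v _ _ _ _ _ hw hS fun n w n' hw' hS' => hf _ _ _ _ hw' hS'

/-! ## Deterministic programs -/

/-- The action of gates on a memory. -/
structure Gates (M : Type) where
  gate : Gate1 → Qubit → M → M
  cnot : Qubit → Qubit → M → M
  toffoli : Qubit → Qubit → Qubit → M → M

def qGates : Gates QState := ⟨applyGate1, applyCNOT, applyToffoli⟩

/-- Gates acting on basis states; only the gate `X` among the one-qubit gates does so. -/
def bGates : Gates Basis := ⟨fun _ q => notMap q, cnotMap, toffoliMap⟩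

namespace Cmd

/-- Neither measurements nor queries occur. -/
def Det : Cmd → Prop
  | .measure _ _ | .query => False
  | .seq p q | .cond _ p q => p.Det ∧ q.Det
  | .loop _ p => p.Det
  | _ => True

/-- Only gates that permute the basis states occur. -/
def Rev : Cmd → Prop
  | .measure _ _ | .query => False
  | .gate g _ => g = .X
  | .seq p q | .cond _ p q => p.Rev ∧ q.Rev
  | .loop _ p => p.Rev
  | _ => True

/-- The values of the variables after a run of a deterministic program. -/
def vev : Cmd → Vars → Vars
  | .seq p q, v => q.vev (p.vev v)
  | .const x k, v => Function.update v x k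
  | .add x y z, v => Function.update v x (v y + v z)
  | .sub x y z, v => Function.update v x (v y - v z)
  | .cond x p q, v => if v x ≠ 0 then p.vev v else q.vev v
  | .loop x p, v => p.vev^[v x] v
  | _, v => v

/-- The memory after a run of a deterministic program. -/
def ev {M : Type} (G : Gates M) : Cmd → Vars → M → M
  | .seq p q, v, m => q.ev G (p.vev v) (p.ev G v m)
  | .cond x p q, v, m => if v x ≠ 0 then p.ev G v m else q.ev G v m
  | .loop x p, v, m => ((fun s : Vars × M => (p.vev s.1, p.ev G s.1 s.2))^[v x] (v, m)).2
  | .gate g q, v, m => G.gate g (q.reg, v q.idx) m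
  | .cnot q t, v, m => G.cnot (q.reg, v q.idx) (t.reg, v t.idx) m
  | .toffoli q q' t, v, m => G.toffoli (q.reg, v q.idx) (q'.reg, v q'.idx) (t.reg, v t.idx) m
  | _, _, m => m

theorem Rev.det {p : Cmd} (h : p.Rev) : p.Det := by
  induction p with
  | seq p q ihp ihq => exact ⟨ihp h.1, ihq h.2⟩
  | cond x p q ihp ihq => exact ⟨ihp h.1, ihq h.2⟩
  | loop x p ih => exact ih h
  | measure => exact h
  | query => exact h
  | _ => trivial

theorem IsClassical.rev {p : Cmd} (h : p.IsClassical) : p.Rev := by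
  induction p with
  | seq p q ihp ihq => exact ⟨ihp h.1, ihq h.2⟩
  | cond x p q ihp ihq => exact ⟨ihp h.1, ihq h.2⟩
  | loop x p ih => exact ih h
  | gate => exact h.elim
  | cnot => trivial
  | toffoli => trivial
  | measure => exact h
  | query => exact h
  | _ => trivial

theorem loop_fst {M : Type} (G : Gates M) (p : Cmd) (k : ℕ) (v : Vars) (m : M) :
    ((fun s : Vars × M => (p.vev s.1, p.ev G s.1 s.2))^[k] (v, m)).1 = p.vev^[k] v := by
  induction k with
  | zero => rfl
  | succ k ih => rw [Function.iterate_succ_apply', Function.iterate_succ_apply', ih]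

theorem wp_det {a d : ℕ} (O : Oracle a d) {p : Cmd} (hp : p.Det) :
    ∀ (f : Vars → QState × List QState → ℝ≥0∞) (v : Vars) (ψ : QState) (l : List QState),
    wp (pureMem O) id p f v (ψ, l) = f (p.vev v) (p.ev qGates v ψ, l) := by
  induction p with
  | seq p q ihp ihq =>
    intro f v ψ l
    rw [wp, ihp hp.1, ihq hp.2]
    rfl
  | cond x p q ihp ihq =>
    intro f v ψ l
    simp only [wp, vev, ev]
    split_ifs
    · exact ihp hp.1 f v ψ l
    · exact ihq hp.2 f v ψ l
  | loop x p ih =>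
    intro f v ψ l
    simp only [wp, vev, ev, id]
    rw [← loop_fst qGates]
    generalize v x = k
    change ((fun g v m => wp (pureMem O) id p g v ((pureMem O).tick m))^[k] f) v (ψ, l) = _
    induction k generalizing v ψ with
    | zero => rfl
    | succ k ihk =>
      rw [Function.iterate_succ_apply', Function.iterate_succ_apply]
      refine (ih hp _ v ψ l).trans ?_
      exact ihk _ _
  | measure => exact hp.elim
  | query => exact hp.elim
  | _ => intro f v ψ l; rfl

/-- A program made of gates that permute basis states acts on superpositions by linear extension, so
circuits can be verified on single basis states. -/
theorem ev_qGates {p : Cmd} (hp : p.Rev) : ∀ (v : Vars) (ψ : QState),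
    p.ev qGates v ψ = ψ.mapDomain (p.ev bGates v) := by
  induction p with
  | seq p q ihp ihq =>
    intro v ψ
    rw [ev, ihp hp.1, ihq hp.2, ← Finsupp.mapDomain_comp]
    rfl
  | cond x p q ihp ihq =>
    intro v ψ
    simp only [ev]
    split_ifs
    · exact ihp hp.1 v ψ
    · exact ihq hp.2 v ψ
  | loop x p ih =>
    intro v ψ
    simp only [ev]
    generalize v x = k
    induction k generalizing v ψ with
    | zero => exact Finsupp.mapDomain_id.symm
    | succ k ihk =>
      simp only [Function.iterate_succ_apply]
      rw [ihk, ih hp, ← Finsupp.mapDomain_comp]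
      rfl
  | gate g q =>
    intro v ψ
    simp only [Rev] at hp
    subst hp
    exact applyX_eq _ _
  | cnot q t => intro v ψ; exact applyCNOT_eq _ _ _
  | toffoli q q' t => intro v ψ; exact applyToffoli_eq _ _ _ _
  | measure => exact hp.elim
  | query => exact hp.elim
  | _ => intro v ψ; exact Finsupp.mapDomain_id.symm

theorem wp_rev {a d : ℕ} (O : Oracle a d) {p : Cmd} (hp : p.Rev)
    (f : Vars → QState × List QState → ℝ≥0∞) (v : Vars) (ψ : QState) (l : List QState) :
    wp (pureMem O) id p f v (ψ, l) = f (p.vev v) (ψ.mapDomain (p.ev bGates v), l) := by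
  rw [wp_det O hp.det, ev_qGates hp]

theorem ev_classical {M : Type} (G : Gates M) {p : Cmd} (hp : p.IsClassical) :
    ∀ (v : Vars) (m : M), p.ev G v m = m := by
  induction p with
  | seq p q ihp ihq => intro v m; rw [ev, ihp hp.1, ihq hp.2]
  | cond x p q ihp ihq =>
    intro v m
    simp only [ev]
    split_ifs
    · exact ihp hp.1 v m
    · exact ihq hp.2 v m
  | loop x p ih =>
    intro v m
    simp only [ev]
    generalize v x = k
    induction k generalizing v m with
    | zero => rfl
    | succ k ihk => rw [Function.iterate_succ_apply, ihk, ih hp]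
  | gate => exact hp.elim
  | cnot => exact hp.elim
  | toffoli => exact hp.elim
  | _ => intro v m; rfl

/-- Only variables in `S` are assigned. -/
def Writes (S : Set ℕ) : Cmd → Prop
  | .const x _ | .add x _ _ | .sub x _ _ | .measure _ x => x ∈ S
  | .seq p q | .cond _ p q => p.Writes S ∧ q.Writes S
  | .loop _ p => p.Writes S
  | _ => True

theorem Writes.mono {S T : Set ℕ} (hST : S ⊆ T) {p : Cmd} (h : p.Writes S) : p.Writes T := by
  induction p with
  | seq p q ihp ihq => exact ⟨ihp h.1, ihq h.2⟩
  | cond x p q ihp ihq => exact ⟨ihp h.1, ihq h.2⟩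
  | loop x p ih => exact ih h
  | const => exact hST h
  | add => exact hST h
  | sub => exact hST h
  | measure => exact hST h
  | _ => trivial

theorem Writes.vev_eq {S : Set ℕ} {p : Cmd} (h : p.Writes S) {y : ℕ} (hy : y ∉ S) :
    ∀ v : Vars, p.vev v y = v y := by
  have hne : ∀ {x : ℕ}, x ∈ S → y ≠ x := fun hx h' => hy (h' ▸ hx)
  induction p with
  | seq p q ihp ihq => intro v; rw [vev, ihq h.2, ihp h.1]
  | cond x p q ihp ihq =>
    intro v
    simp only [vev]
    split_ifs
    · exact ihp h.1 v
    · exact ihq h.2 v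
  | loop x p ih =>
    intro v
    simp only [vev]
    generalize v x = k
    induction k generalizing v with
    | zero => rfl
    | succ k ihk => rw [Function.iterate_succ_apply, ihk, ih h]
  | const x k => intro v; exact Function.update_of_ne (hne h) _ _
  | add x y z => intro v; exact Function.update_of_ne (hne h) _ _
  | sub x y z => intro v; exact Function.update_of_ne (hne h) _ _
  | _ => intro v; rfl

end Cmd

/-! ## Counting loops -/

/-- The variable that holds the number one. -/
abbrev vOne : ℕ := 3

/-- A variable that is never assigned. -/
abbrev vZero : ℕ := 4

def forUp (i N : ℕ) (p : Cmd) : Cmd :=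
  .seq (.const i 0) (.loop N (.seq p (.add i i vOne)))

def forDown (i N : ℕ) (p : Cmd) : Cmd :=
  .seq (.add i N vZero) (.loop N (.seq (.sub i i vOne) p))

/-- `Φ (k - 1) ∘ ⋯ ∘ Φ 0` -/
def up {M : Type} (Φ : ℕ → M → M) : ℕ → M → M
  | 0, m => m
  | k + 1, m => Φ k (up Φ k m)

/-- `Φ 0 ∘ ⋯ ∘ Φ (k - 1)` -/
def down {M : Type} (Φ : ℕ → M → M) : ℕ → M → M
  | 0, m => m
  | k + 1, m => down Φ k (Φ k m)

/-- Uncomputation: a sequence of involutions is undone by the same sequence in reverse order, which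
is what a downward loop performs. -/
theorem down_up {M : Type} {Φ : ℕ → M → M} (h : ∀ k, Function.Involutive (Φ k)) (k : ℕ) (m : M) :
    down Φ k (up Φ k m) = m := by
  induction k with
  | zero => rfl
  | succ k ih => rw [down, up, h k, ih]

theorem forUp_writes {S : Set ℕ} {i N : ℕ} {p : Cmd} (hi : i ∈ S) (hp : p.Writes S) :
    (forUp i N p).Writes S := ⟨hi, hp, hi⟩

theorem forDown_writes {S : Set ℕ} {i N : ℕ} {p : Cmd} (hi : i ∈ S) (hp : p.Writes S) :
    (forDown i N p).Writes S := ⟨hi, hi, hp⟩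

/-- The body may use the scratch variables in `S` freely; its action in iteration j may depend only
on the counter and on variables that neither the body nor the loop assigns. -/
theorem ev_forUp {M : Type} (G : Gates M) {S : Set ℕ} {i N : ℕ} {p : Cmd} (hp : p.Writes S)
    (hi : i ∉ S) (h1 : vOne ∉ S) (hi1 : i ≠ vOne) (hN : N ≠ i) {v : Vars} (hv : v vOne = 1)
    (Φ : ℕ → M → M)
    (hΦ : ∀ j < v N, ∀ w : Vars, (∀ y, y ∉ S → y ≠ i → w y = v y) → w i = j →
      ∀ m, p.ev G w m = Φ j m) (m : M) :
    (forUp i N p).ev G v m = up Φ (v N) m := by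
  simp only [forUp, Cmd.ev, Cmd.vev, Function.update_of_ne hN]
  have key : ∀ k ≤ v N,
      (∀ y, y ∉ S → y ≠ i → ((fun s : Vars × M => (Function.update (p.vev s.1) i
        (p.vev s.1 i + p.vev s.1 vOne), p.ev G s.1 s.2))^[k]
          (Function.update v i 0, m)).1 y = v y) ∧
      ((fun s : Vars × M => (Function.update (p.vev s.1) i
        (p.vev s.1 i + p.vev s.1 vOne), p.ev G s.1 s.2))^[k]
          (Function.update v i 0, m)).1 i = k ∧
      ((fun s : Vars × M => (Function.update (p.vev s.1) i
        (p.vev s.1 i + p.vev s.1 vOne), p.ev G s.1 s.2))^[k]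
          (Function.update v i 0, m)).2 = up Φ k m := by
    intro k
    induction k with
    | zero =>
      intro _
      refine ⟨fun y _ hy => ?_, ?_, rfl⟩
      · simp [hy]
      · simp
    | succ k ih =>
      intro hk
      obtain ⟨a1, a2, a3⟩ := ih (by omega)
      rw [Function.iterate_succ_apply']
      refine ⟨fun y hy hyi => ?_, ?_, ?_⟩
      · simp only [Function.update_of_ne hyi]
        rw [hp.vev_eq hy, a1 y hy hyi]
      · simp only [Function.update_self]
        rw [hp.vev_eq hi, hp.vev_eq h1, a2, a1 _ h1 (Ne.symm hi1), hv]
      · simp only [a3, up]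
        exact hΦ k (by omega) _ a1 a2 _
  exact (key _ le_rfl).2.2

theorem ev_forDown {M : Type} (G : Gates M) {S : Set ℕ} {i N : ℕ} {p : Cmd} (hp : p.Writes S)
    (hi : i ∉ S) (h1 : vOne ∉ S) (hi1 : i ≠ vOne) (hN : N ≠ i) {v : Vars}
    (hv : v vOne = 1) (hz : v vZero = 0)
    (Φ : ℕ → M → M)
    (hΦ : ∀ j < v N, ∀ w : Vars, (∀ y, y ∉ S → y ≠ i → w y = v y) → w i = j →
      ∀ m, p.ev G w m = Φ j m) (m : M) :
    (forDown i N p).ev G v m = down Φ (v N) m := by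
  simp only [forDown, Cmd.ev, Cmd.vev, Function.update_of_ne hN, hz, add_zero]
  have key : ∀ k ≤ v N, ∀ (w : Vars) (m : M), (∀ y, y ∉ S → y ≠ i → w y = v y) → w i = k →
      ((fun s : Vars × M => (p.vev (Function.update s.1 i (s.1 i - s.1 vOne)),
        p.ev G (Function.update s.1 i (s.1 i - s.1 vOne)) s.2))^[k] (w, m)).2 = down Φ k m := by
    intro k
    induction k with
    | zero => intro _ w m _ _; rfl
    | succ k ih =>
      intro hk w m a1 a2
      rw [Function.iterate_succ_apply]
      have a3 : w i - w vOne = k := by rw [a2, a1 _ h1 (Ne.symm hi1), hv]; rfl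
      simp only [a3]
      rw [hΦ k (by omega) (Function.update w i k)
        (fun y hy hyi => by rw [Function.update_of_ne hyi, a1 y hy hyi]) (by simp), down]
      refine ih (by omega) _ _ (fun y hy hyi => ?_) ?_
      · rw [hp.vev_eq hy, Function.update_of_ne hyi, a1 y hy hyi]
      · rw [hp.vev_eq hi, Function.update_self]
  exact key _ le_rfl _ _ (fun y _ hy => by simp [hy]) (by simp)

/-- Measuring a register qubit by qubit. -/
theorem wp_forUp_measure {a d : ℕ} (O : Oracle a d) {r i N u : ℕ} (hu : u ≠ i) (hu1 : u ≠ vOne)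
    (hi1 : i ≠ vOne) (hN : N ≠ i) {v : Vars} (hv : v vOne = 1) {D : ℕ} (hD : v N = D)
    (f : Vars → QState × List QState → ℝ≥0∞) (ψ : QState) (l : List QState) (c : Bits D → ℝ≥0∞)
    (hf : ∀ x w, (∀ y, y ≠ i → y ≠ u → w y = v y) → c x ≤ f w (projReg r D x ψ, l)) :
    ∑ x, c x ≤ wp (pureMem O) id (forUp i N (.measure ⟨r, i⟩ u)) f v (ψ, l) := by
  subst hD
  simp only [forUp, wp, Function.update_of_ne hN, id]
  have key : ∀ (k : ℕ) (f : Vars → QState × List QState → ℝ≥0∞) (c : Bits k → ℝ≥0∞),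
      (∀ x w, (∀ y, y ≠ i → y ≠ u → w y = v y) → w i = k → c x ≤ f w (projReg r k x ψ, l)) →
      ∑ x, c x ≤ ((fun (g : Vars → QState × List QState → ℝ≥0∞) v m =>
        (pureMem O).meas (r, v i) (fun o m => g
          (Function.update (Function.update v u (if o then 1 else 0)) i
            (Function.update v u (if o then 1 else 0) i
              + Function.update v u (if o then 1 else 0) vOne)) ((pureMem O).tick m))
          ((pureMem O).tick ((pureMem O).tick m)))^[k] f) (Function.update v i 0) (ψ, l) := by
    intro k
    induction k with
    | zero =>
      intro f c hf
      have := hf default (Function.update v i 0) (fun y hy _ => by simp [hy]) (by simp)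
      have e : projReg r 0 default ψ = ψ := by
        ext b
        rw [projReg_apply, if_pos (Subsingleton.elim _ _)]
      rw [e] at this
      rw [Fintype.sum_unique]
      exact (le_of_eq (congrArg c (Subsingleton.elim _ _))).trans this
    | succ k ih =>
      intro f c hf
      rw [Function.iterate_succ_apply, sum_bits_succ]
      refine ih _ _ fun x w hw hwi => ?_
      simp only [pureMem, hwi, project_projReg]
      have hw1 : w vOne = 1 := by rw [hw _ (Ne.symm hi1) (Ne.symm hu1), hv]
      refine add_le_add (hf _ _ (fun y hy hyu => ?_) ?_) (hf _ _ (fun y hy hyu => ?_) ?_)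
      · simp [hy, hyu, hw y hy hyu]
      · simp [Ne.symm hu, Ne.symm hu1, hw1, hwi]
      · simp [hy, hyu, hw y hy hyu]
      · simp [Ne.symm hu, Ne.symm hu1, hw1, hwi]
  exact key _ f c fun x w hw _ => hf x w hw

/-! ## Polynomial bounds -/

/-- The base n + 2 is at least 2 for every n, so constants and sums are absorbed by the exponent
without exceptions for small n. -/
def PolyBdd (f : ℕ → ℕ) : Prop := ∃ c : ℕ, ∀ n, f n ≤ (n + 2) ^ c

namespace PolyBdd

variable {f g : ℕ → ℕ}

theorem mono (h : ∀ n, f n ≤ g n) (hg : PolyBdd g) : PolyBdd f := by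
  obtain ⟨c, hc⟩ := hg
  exact ⟨c, fun n => (h n).trans (hc n)⟩

theorem const (k : ℕ) : PolyBdd fun _ => k :=
  ⟨k, fun n => (Nat.lt_two_pow_self).le.trans (Nat.pow_le_pow_left (by omega) k)⟩

theorem id : PolyBdd fun n => n := ⟨1, fun n => by simp⟩

theorem add (hf : PolyBdd f) (hg : PolyBdd g) : PolyBdd fun n => f n + g n := by
  obtain ⟨c, hc⟩ := hf
  obtain ⟨d, hd⟩ := hg
  refine ⟨max c d + 1, fun n => ?_⟩
  have h1 : (n + 2) ^ c ≤ (n + 2) ^ max c d := Nat.pow_le_pow_right (by omega) (le_max_left _ _)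
  have h2 : (n + 2) ^ d ≤ (n + 2) ^ max c d := Nat.pow_le_pow_right (by omega) (le_max_right _ _)
  have := hc n
  have := hd n
  rw [pow_succ]
  nlinarith

theorem mul (hf : PolyBdd f) (hg : PolyBdd g) : PolyBdd fun n => f n * g n := by
  obtain ⟨c, hc⟩ := hf
  obtain ⟨d, hd⟩ := hg
  exact ⟨c + d, fun n => by rw [pow_add]; exact Nat.mul_le_mul (hc n) (hd n)⟩

theorem pow (hf : PolyBdd f) (k : ℕ) : PolyBdd fun n => f n ^ k := by
  induction k with
  | zero => simpa using const 1
  | succ k ih => simpa only [pow_succ] using ih.mul hf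

theorem eval (B : Polynomial ℕ) (hf : PolyBdd f) : PolyBdd fun n => B.eval (f n) := by
  induction B using Polynomial.induction_on' with
  | add p q hp hq => simpa only [Polynomial.eval_add] using hp.add hq
  | monomial k a => simpa only [Polynomial.eval_monomial] using (const a).mul (hf.pow k)

theorem of_poly (h : ∃ B : Polynomial ℕ, ∀ n, f n ≤ B.eval n) : PolyBdd f := by
  obtain ⟨B, hB⟩ := h
  exact mono hB (eval B id)

theorem to_poly (h : PolyBdd f) : ∃ B : Polynomial ℕ, ∀ n, f n ≤ B.eval n := by
  obtain ⟨c, hc⟩ := h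
  exact ⟨(Polynomial.X + 2) ^ c, fun n => by simpa using hc n⟩

end PolyBdd

/-! ## Running time -/

/-- A bound for the running time, as a function of a bound for the number of loop iterations. -/
def Cmd.cost (V : ℕ) : Cmd → ℕ
  | .seq p q => p.cost V + q.cost V
  | .cond _ p q => 1 + p.cost V + q.cost V
  | .loop _ p => 1 + V * (1 + p.cost V)
  | _ => 1

theorem polyBdd_cost (p : Cmd) {f : ℕ → ℕ} (hf : PolyBdd f) : PolyBdd fun n => p.cost (f n) := by
  induction p with
  | seq p q ihp ihq => exact ihp.add ihq
  | cond x p q ihp ihq => exact ((PolyBdd.const 1).add ihp).add ihq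
  | loop x p ih => exact (PolyBdd.const 1).add (hf.mul ((PolyBdd.const 1).add ih))
  | _ => exact PolyBdd.const 1

/-- All loops are bounded by variables in `S`, which are never assigned. -/
inductive Capped (S : Set ℕ) : Cmd → Prop
  | skip : Capped S .skip
  | const {x k} : x ∉ S → Capped S (.const x k)
  | add {x y z} : x ∉ S → Capped S (.add x y z)
  | sub {x y z} : x ∉ S → Capped S (.sub x y z)
  | gate {g q} : Capped S (.gate g q)
  | cnot {q t} : Capped S (.cnot q t)
  | toffoli {q q' t} : Capped S (.toffoli q q' t)
  | measure {q x} : x ∉ S → Capped S (.measure q x)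
  | query : Capped S .query
  | seq {p q} : Capped S p → Capped S q → Capped S (.seq p q)
  | cond {x p q} : Capped S p → Capped S q → Capped S (.cond x p q)
  | loop {x p} : x ∈ S → Capped S p → Capped S (.loop x p)
  | capLoop {t x cap p} : cap ∈ S → t ∉ S → Capped S p → Capped S (QUnf.capLoop t x cap p)

theorem iterate_capped {S : Set ℕ} {f : State → PMF State} {V N : ℕ}
    (hf : ∀ s : State, (∀ x ∈ S, s.vars x ≤ V) → ∀ s' ∈ (f s).support,
      s'.steps ≤ s.steps + N ∧ ∀ x ∈ S, s'.vars x = s.vars x) (k : ℕ) :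
    ∀ s : State, (∀ x ∈ S, s.vars x ≤ V) → ∀ s' ∈ (iterate f k s).support,
      s'.steps ≤ s.steps + k * N ∧ ∀ x ∈ S, s'.vars x = s.vars x := by
  induction k with
  | zero =>
    intro s hs s' h
    rw [iterate, PMF.mem_support_pure_iff] at h
    subst h; simp
  | succ k ih =>
    intro s hs s' h
    rw [iterate, PMF.mem_support_bind_iff] at h
    obtain ⟨s₁, h1, h2⟩ := h
    obtain ⟨a1, a2⟩ := hf s hs s₁ h1
    obtain ⟨b1, b2⟩ := ih s₁ (fun x hx => by rw [a2 x hx]; exact hs x hx) s' h2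
    refine ⟨?_, fun x hx => by rw [b2 x hx, a2 x hx]⟩
    rw [Nat.succ_mul]
    omega

/-- The bounding variables keep their initial values throughout, so a single number `V` limits every
loop at every depth, independently of the oracle and of measurement outcomes. -/
theorem capped_run {a d : ℕ} (O : Oracle a d) {S : Set ℕ} {p : Cmd} (hp : Capped S p) (V : ℕ) :
    ∀ s : State, (∀ x ∈ S, s.vars x ≤ V) → ∀ s' ∈ (p.run O s).support,
      s'.steps ≤ s.steps + p.cost V ∧ ∀ x ∈ S, s'.vars x = s.vars x := by
  have upd : ∀ {x k : ℕ} {v : Vars}, x ∉ S → ∀ y ∈ S, Function.update v x k y = v y := by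
    intro x k v hx y hy
    exact Function.update_of_ne (fun h => hx (by rw [← h]; exact hy)) _ _
  have hloop : ∀ {p : Cmd} (x : ℕ), (∀ s : State, (∀ x ∈ S, s.vars x ≤ V) →
      ∀ s' ∈ (p.run O s).support, s'.steps ≤ s.steps + p.cost V ∧
        ∀ x ∈ S, s'.vars x = s.vars x) →
      ∀ s : State, s.vars x ≤ V → (∀ x ∈ S, s.vars x ≤ V) →
        ∀ s' ∈ ((Cmd.loop x p).run O s).support,
        s'.steps ≤ s.steps + (Cmd.loop x p).cost V ∧ ∀ x ∈ S, s'.vars x = s.vars x := by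
    intro p x ih s hx hs s' h
    rw [Cmd.run] at h
    obtain ⟨a1, a2⟩ := iterate_capped (S := S) (f := fun s' => p.run O s'.tick) (V := V)
      (N := 1 + p.cost V) (fun s hs s' h => by
        have := ih s.tick hs s' h
        simp only [State.tick] at this
        exact ⟨by omega, this.2⟩) _ s.tick hs s' h
    refine ⟨?_, a2⟩
    have := Nat.mul_le_mul_right (1 + p.cost V) hx
    simp only [State.tick, Cmd.cost] at *
    omega
  induction hp with
  | seq hp hq ihp ihq =>
    intro s hs s' h
    rw [Cmd.run, PMF.mem_support_bind_iff] at h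
    obtain ⟨s₁, h1, h2⟩ := h
    obtain ⟨a1, a2⟩ := ihp s hs s₁ h1
    obtain ⟨b1, b2⟩ := ihq s₁ (fun x hx => by rw [a2 x hx]; exact hs x hx) s' h2
    refine ⟨?_, fun x hx => by rw [b2 x hx, a2 x hx]⟩
    rw [Cmd.cost]
    omega
  | cond hp hq ihp ihq =>
    intro s hs s' h
    rw [Cmd.run] at h
    split_ifs at h
    · have := ihp s.tick hs s' h
      simp only [State.tick, Cmd.cost] at *
      exact ⟨by omega, this.2⟩
    · have := ihq s.tick hs s' h
      simp only [State.tick, Cmd.cost] at *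
      exact ⟨by omega, this.2⟩
  | loop hx hp ih => exact fun s hs => hloop _ ih s (hs _ hx) hs
  | @capLoop t x cap p hc ht hp ih =>
    intro s hs s' h
    simp only [QUnf.capLoop] at h ⊢
    rw [Cmd.run, Cmd.run, PMF.pure_bind, Cmd.run, Cmd.run, PMF.pure_bind] at h
    have := hloop t ih _ (by
      -- If the loop variable is itself the scratch variable, the second subtraction leaves zero and
      -- the loop is empty; otherwise the scratch variable holds a minimum with `cap`.
      by_cases hxt : x = t
      · subst hxt; simp [State.setVar, State.tick]
      · simp only [State.setVar, State.tick, Function.update_self, Function.update_of_ne hxt]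
        have := hs _ hc
        omega) (by
      intro y hy
      simp only [State.setVar, State.tick, upd ht y hy]
      exact hs y hy) s' h
    simp only [State.setVar, State.tick, Cmd.cost] at *
    refine ⟨by omega, fun y hy => ?_⟩
    rw [this.2 y hy, upd ht y hy, upd ht y hy]
  | measure hx =>
    intro s hs s' h
    rw [Cmd.run, PMF.mem_support_map_iff] at h
    obtain ⟨o, -, rfl⟩ := h
    exact ⟨le_rfl, upd hx⟩
  | query =>
    intro s hs s' h
    rw [Cmd.run, PMF.mem_support_map_iff] at h
    obtain ⟨o, -, rfl⟩ := h
    exact ⟨le_rfl, fun _ _ => rfl⟩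
  | const hx =>
    intro s hs s' h
    rw [Cmd.run, PMF.mem_support_pure_iff] at h
    subst h
    exact ⟨le_rfl, upd hx⟩
  | add hx =>
    intro s hs s' h
    rw [Cmd.run, PMF.mem_support_pure_iff] at h
    subst h
    exact ⟨le_rfl, upd hx⟩
  | sub hx =>
    intro s hs s' h
    rw [Cmd.run, PMF.mem_support_pure_iff] at h
    subst h
    exact ⟨le_rfl, upd hx⟩
  | _ =>
    intro s hs s' h
    rw [Cmd.run, PMF.mem_support_pure_iff] at h
    subst h
    exact ⟨le_rfl, fun _ _ => rfl⟩

theorem det_run {a d : ℕ} (O : Oracle a d) {p : Cmd} (hp : p.Det) :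
    ∀ s : State, ∀ s' ∈ (p.run O s).support, s'.vars = p.vev s.vars := by
  induction p with
  | seq p q ihp ihq =>
    intro s s' h
    rw [Cmd.run, PMF.mem_support_bind_iff] at h
    obtain ⟨s₁, h1, h2⟩ := h
    rw [ihq hp.2 _ _ h2, ihp hp.1 _ _ h1]
    rfl
  | cond x p q ihp ihq =>
    intro s s' h
    rw [Cmd.run] at h
    simp only [Cmd.vev]
    split_ifs at h ⊢
    · exact ihp hp.1 s.tick s' h
    · exact ihq hp.2 s.tick s' h
  | loop x p ih =>
    intro s s' h
    rw [Cmd.run] at h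
    simp only [Cmd.vev]
    have key : ∀ k : ℕ, ∀ s, s' ∈ (iterate (fun s' => p.run O s'.tick) k s).support →
        s'.vars = p.vev^[k] s.vars := by
      intro k
      induction k with
      | zero =>
        intro s h
        rw [iterate, PMF.mem_support_pure_iff] at h
        subst h; rfl
      | succ k ihk =>
        intro s h
        rw [iterate, PMF.mem_support_bind_iff] at h
        obtain ⟨s₁, h1, h2⟩ := h
        rw [ihk _ h2, ih hp s.tick s₁ h1]
        rfl
    exact key _ s.tick h
  | measure => exact hp.elim
  | query => exact hp.elim
  | _ =>
    intro s s' h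
    rw [Cmd.run, PMF.mem_support_pure_iff] at h
    subst h
    rfl

/-- From the values `v` of the variables, `p` takes at most `N` steps. -/
def TimeB (p : Cmd) (v : Vars) (N : ℕ) : Prop :=
  ∀ (a d : ℕ) (O : Oracle a d) (s : State), s.vars = v → ∀ s' ∈ (p.run O s).support,
    s'.steps ≤ s.steps + N

theorem TimeB.seq {p q : Cmd} {v : Vars} {N₁ N₂ : ℕ} (hd : p.Det) (hp : TimeB p v N₁)
    (hq : TimeB q (p.vev v) N₂) : TimeB (.seq p q) v (N₁ + N₂) := by
  intro a d O s hs s' h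
  rw [Cmd.run, PMF.mem_support_bind_iff] at h
  obtain ⟨s₁, h1, h2⟩ := h
  have e1 := hp a d O s hs s₁ h1
  have e2 := hq a d O s₁ (by rw [det_run O hd s s₁ h1, hs]) s' h2
  omega

theorem Capped.timeB {S : Set ℕ} {p : Cmd} (hp : Capped S p) {v : Vars} {V : ℕ}
    (hv : ∀ x ∈ S, v x ≤ V) : TimeB p v (p.cost V) := by
  intro a d O s hs s' h
  exact (capped_run O hp V s (by rw [hs]; exact hv) s' h).1

theorem Emb.capped_compile (e : Emb) {S : Set ℕ} (hσ : ∀ x, e.σ x ∉ S) (hcap : e.cap ∈ S)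
    (htmp : e.tmp ∉ S) (hG : Capped S e.gadget) (p : Cmd) : Capped S (e.compile p) := by
  induction p with
  | skip => exact .skip
  | seq p q ihp ihq => exact .seq ihp ihq
  | const x k => exact .const (hσ x)
  | add x y z => exact .add (hσ x)
  | sub x y z => exact .sub (hσ x)
  | cond x p q ihp ihq => exact .cond ihp ihq
  | loop x p ih => exact .capLoop hcap htmp ih
  | gate g q => exact .gate
  | cnot q t => exact .cnot
  | toffoli q q' t => exact .toffoli
  | measure q x => exact .measure (hσ x)
  | query => exact hG

theorem capped_forUp {S : Set ℕ} {i N : ℕ} {p : Cmd} (hi : i ∉ S) (hN : N ∈ S)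
    (hp : Capped S p) : Capped S (forUp i N p) :=
  .seq (.const hi) (.loop hN (.seq hp (.add hi)))

theorem classical_writes_compile (e : Emb) {p : Cmd} (hp : p.IsClassical) :
    (e.compile p).Writes (Set.range e.σ ∪ {e.tmp}) ∧ (e.compile p).IsClassical := by
  induction p with
  | seq p q ihp ihq =>
    exact ⟨⟨(ihp hp.1).1, (ihq hp.2).1⟩, (ihp hp.1).2, (ihq hp.2).2⟩
  | cond x p q ihp ihq =>
    exact ⟨⟨(ihp hp.1).1, (ihq hp.2).1⟩, (ihp hp.1).2, (ihq hp.2).2⟩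
  | loop x p ih =>
    exact ⟨⟨Or.inr rfl, Or.inr rfl, (ih hp).1⟩, trivial, trivial, (ih hp).2⟩
  | skip => exact ⟨trivial, trivial⟩
  | const x k => exact ⟨Or.inl ⟨x, rfl⟩, trivial⟩
  | add x y z => exact ⟨Or.inl ⟨x, rfl⟩, trivial⟩
  | sub x y z => exact ⟨Or.inl ⟨x, rfl⟩, trivial⟩
  | _ => exact hp.elim

/-! ## Powers of two as parameters -/

abbrev vT : ℕ := 5
abbrev vN : ℕ := 6
abbrev vP : ℕ := 7
abbrev vL : ℕ := 8

/-- The exponent of the least power of two that is at least `n + 2`. -/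
def lg (n : ℕ) : ℕ := Nat.clog 2 (n + 2)

theorem le_two_pow_lg (n : ℕ) : n + 2 ≤ 2 ^ lg n := Nat.le_pow_clog (by norm_num) _

/-- Together with the lower bound, 2 ^ lg n lies within a factor two of n + 2. Its powers dominate
every polynomial while remaining polynomially bounded, and their reciprocals are exact binary
fractions. -/
theorem two_pow_lg_le (n : ℕ) : 2 ^ lg n ≤ 2 * (n + 2) := by
  have h : 2 ^ (lg n).pred < n + 2 := Nat.pow_pred_clog_lt_self (by norm_num) (by omega)
  have hpos : 0 < lg n := Nat.clog_pos (by norm_num) (by omega)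
  obtain ⟨k, hk⟩ := Nat.exists_eq_succ_of_ne_zero hpos.ne'
  rw [hk] at h ⊢
  rw [pow_succ]
  simp only [Nat.pred_succ] at h
  omega

theorem polyBdd_two_pow_lg : PolyBdd fun n => 2 ^ lg n :=
  PolyBdd.mono two_pow_lg_le ((PolyBdd.const 2).mul (PolyBdd.id.add (PolyBdd.const 2)))

theorem polyBdd_lg : PolyBdd lg :=
  PolyBdd.mono (fun _ => (Nat.lt_two_pow_self).le) polyBdd_two_pow_lg

/-- Every polynomially bounded function is below a power of `2 ^ lg n`. -/
theorem PolyBdd.le_two_pow {f : ℕ → ℕ} (hf : PolyBdd f) : ∃ c, ∀ n, f n ≤ (2 ^ lg n) ^ c := by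
  obtain ⟨c, hc⟩ := hf
  exact ⟨c, fun n => (hc n).trans (Nat.pow_le_pow_left (le_two_pow_lg n) c)⟩

def sizeInit : Cmd :=
  .seq (.const vOne 1) (.seq (.const vP 1) (.seq (.const vL 0) (.seq (.const vT 2)
    (.add vN 0 vT))))

def sizeBody : Cmd :=
  .seq (.sub vT vN vP) (.cond vT (.seq (.add vP vP vP) (.add vL vL vOne)) .skip)

/-- Computes `lg n` and `2 ^ lg n`. -/
def sizeProg : Cmd := .seq sizeInit (.loop vN sizeBody)

theorem sizeProg_writes : sizeProg.Writes {vOne, vT, vN, vP, vL} := by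
  simp [sizeProg, sizeInit, sizeBody, Cmd.Writes]

theorem sizeProg_classical : sizeProg.IsClassical := by
  simp [sizeProg, sizeInit, sizeBody, Cmd.IsClassical]

/-- Each pass doubles the candidate power until it reaches n + 2; from then on the truncated
difference is zero and the body idles. Hence n + 2 passes are enough. -/
theorem sizeProg_vev (v : Vars) : sizeProg.vev v vOne = 1 ∧
    sizeProg.vev v vP = 2 ^ lg (v 0) ∧ sizeProg.vev v vL = lg (v 0) := by
  simp only [sizeProg, Cmd.vev]
  have hN : sizeInit.vev v vN = v 0 + 2 := by simp [sizeInit, Cmd.vev]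
  have key : ∀ k, (sizeBody.vev^[k] (sizeInit.vev v)) vOne = 1 ∧
      (sizeBody.vev^[k] (sizeInit.vev v)) vN = v 0 + 2 ∧
      (sizeBody.vev^[k] (sizeInit.vev v)) vP = 2 ^ min k (lg (v 0)) ∧
      (sizeBody.vev^[k] (sizeInit.vev v)) vL = min k (lg (v 0)) := by
    intro k
    induction k with
    | zero => simp [sizeInit, Cmd.vev]
    | succ k ih =>
      rw [Function.iterate_succ_apply']
      obtain ⟨h1, h2, h3, h4⟩ := ih
      set w := sizeBody.vev^[k] (sizeInit.vev v)
      by_cases hk : k < lg (v 0)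
      · have hlt : 2 ^ k < v 0 + 2 := (Nat.lt_clog_iff_pow_lt (by norm_num)).1 hk
        have e : min k (lg (v 0)) = k := by omega
        have e' : min (k + 1) (lg (v 0)) = k + 1 := by omega
        rw [e] at h3 h4
        have hne : ¬ (v 0 + 2 - 2 ^ k = 0) := by omega
        simp [sizeBody, Cmd.vev, h1, h2, h3, h4, hne, e', pow_succ]
        omega
      · have e : min k (lg (v 0)) = lg (v 0) := by omega
        have e' : min (k + 1) (lg (v 0)) = lg (v 0) := by omega
        rw [e] at h3 h4
        have hle := le_two_pow_lg (v 0)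
        have hz : v 0 + 2 - 2 ^ lg (v 0) = 0 := by omega
        simp [sizeBody, Cmd.vev, h1, h2, h3, h4, hz, e']
  rw [hN]
  have h := key (v 0 + 2)
  have hle : lg (v 0) ≤ v 0 + 2 := by
    have h1 := two_pow_lg_le (v 0)
    by_contra hlt
    have h2 : 2 ^ (v 0 + 3) ≤ 2 ^ lg (v 0) := Nat.pow_le_pow_right (by norm_num) (by omega)
    have h3 : v 0 + 2 < 2 ^ (v 0 + 2) := Nat.lt_two_pow_self
    have h4 : 2 ^ (v 0 + 3) = 2 * 2 ^ (v 0 + 2) := by ring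
    omega
  rw [min_eq_right hle] at h
  exact ⟨h.1, h.2.2⟩

theorem sizeProg_time (v : Vars) : TimeB sizeProg v (5 + (1 + (v 0 + 2) * 6)) := by
  refine TimeB.seq ?_ ?_ ?_
  · simp [sizeInit, Cmd.Det]
  · have : Capped ∅ sizeInit := by
      unfold sizeInit
      repeat' constructor
      all_goals simp
    exact this.timeB (V := 0) (by simp)
  · have : Capped {vN} (.loop vN sizeBody) := by
      unfold sizeBody
      repeat' constructor
      all_goals simp
    have h := this.timeB (v := sizeInit.vev v) (V := v 0 + 2) (by simp [sizeInit, Cmd.vev])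
    intro a d O s hs s' hs'
    have := h a d O s hs s' hs'
    simp only [Cmd.cost, sizeBody] at this
    omega

/-- `x := (value of vP) ^ c` -/
def powProg (x : ℕ) : ℕ → Cmd
  | 0 => .const x 1
  | c + 1 => .seq (powProg x c)
      (.seq (.const vT 0) (.seq (.loop x (.add vT vT vP)) (.add x vT vZero)))

theorem powProg_writes (x c : ℕ) : (powProg x c).Writes {vT, x} := by
  induction c with
  | zero => simp [powProg, Cmd.Writes]
  | succ c ih => simp [powProg, Cmd.Writes, ih]

theorem powProg_classical (x c : ℕ) : (powProg x c).IsClassical := by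
  induction c with
  | zero => simp [powProg, Cmd.IsClassical]
  | succ c ih => simp [powProg, Cmd.IsClassical, ih]

theorem vev_add_iterate {t y : ℕ} (hty : t ≠ y) (k : ℕ) (v : Vars) :
    (Cmd.add t t y).vev^[k] v = Function.update v t (v t + k * v y) := by
  induction k with
  | zero => simp
  | succ k ih =>
    rw [Function.iterate_succ_apply', ih]
    simp only [Cmd.vev, Function.update_self, Function.update_of_ne (Ne.symm hty),
      Function.update_idem]
    congr 1
    ring

theorem powProg_vev (x c : ℕ) (hx : 8 < x) (v : Vars) (hz : v vZero = 0) :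
    (powProg x c).vev v x = v vP ^ c := by
  have hT : x ≠ vT := by simp only [vT]; omega
  have hP : x ≠ vP := by simp only [vP]; omega
  induction c with
  | zero => simp [powProg, Cmd.vev]
  | succ c ih =>
    have e : (powProg x (c + 1)).vev v = (Cmd.add x vT vZero).vev ((Cmd.add vT vT vP).vev^[
        (Cmd.const vT 0).vev ((powProg x c).vev v) x]
        ((Cmd.const vT 0).vev ((powProg x c).vev v))) := rfl
    have hP' : (powProg x c).vev v vP = v vP :=
      (powProg_writes x c).vev_eq (by simp [Ne.symm hP]) v
    have hZ' : (powProg x c).vev v vZero = v vZero :=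
      (powProg_writes x c).vev_eq
        (by simp only [Set.mem_insert_iff, Set.mem_singleton_iff, vT, vZero]; omega) v
    rw [e, vev_add_iterate (by decide)]
    simp only [Cmd.vev, Function.update_self, Function.update_of_ne hT, ih]
    simp [hP', hZ', hz, pow_succ]

def powCost (P : ℕ) : ℕ → ℕ
  | 0 => 1
  | c + 1 => powCost P c + (1 + ((1 + P ^ c * 2) + 1))

theorem polyBdd_powCost {f : ℕ → ℕ} (hf : PolyBdd f) (c : ℕ) : PolyBdd fun n => powCost (f n) c := by
  induction c with
  | zero => exact PolyBdd.const 1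
  | succ c ih =>
    exact ih.add ((PolyBdd.const 1).add
      (((PolyBdd.const 1).add ((hf.pow c).mul (PolyBdd.const 2))).add (PolyBdd.const 1)))

theorem powProg_time (x c : ℕ) (hx : 8 < x) (v : Vars) (hz : v vZero = 0) :
    TimeB (powProg x c) v (powCost (v vP) c) := by
  have hT : x ≠ vT := by simp only [vT]; omega
  induction c with
  | zero =>
    have : Capped ∅ (powProg x 0) := .const (by simp)
    have h := this.timeB (v := v) (V := 0) (by simp)
    exact h
  | succ c ih =>
    have h1 : TimeB (.loop x (.add vT vT vP)) ((Cmd.const vT 0).vev ((powProg x c).vev v))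
        (1 + v vP ^ c * 2) := by
      have : Capped {x} (.loop x (.add vT vT vP)) :=
        .loop rfl (.add (by simpa using Ne.symm hT))
      refine this.timeB ?_
      intro y hy
      rw [Set.mem_singleton_iff] at hy
      subst hy
      simp only [Cmd.vev, Function.update_of_ne hT]
      rw [powProg_vev _ _ hx v hz]
    have h2 : ∀ {x y z : ℕ} {w : Vars}, TimeB (.add x y z) w 1 := by
      intro x y z w
      have : Capped ∅ (.add x y z) := .add (by simp)
      exact this.timeB (V := 0) (by simp)
    have h3 : ∀ {x y : ℕ} {w : Vars}, TimeB (.const x y) w 1 := by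
      intro x y w
      have : Capped ∅ (.const x y) := .const (by simp)
      exact this.timeB (V := 0) (by simp)
    exact TimeB.seq (powProg_classical x c).rev.det ih
      (TimeB.seq (by trivial) h3 (TimeB.seq (by trivial) h1 h2))

/-! ## The real squared norm -/

def nS (ψ : QState) : ℝ := (nE ψ).toReal

theorem ofReal_nS (ψ : QState) : ENNReal.ofReal (nS ψ) = nE ψ := ENNReal.ofReal_toReal (nE_ne_top ψ)

theorem nS_nonneg (ψ : QState) : 0 ≤ nS ψ := ENNReal.toReal_nonneg

theorem nS_eq_sum (ψ : QState) (S : Finset Basis) (h : ψ.support ⊆ S) :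
    nS ψ = ∑ b ∈ S, ‖ψ b‖ ^ 2 := by
  unfold nS nE
  rw [tsum_eq_sum (s := S)]
  · rw [ENNReal.toReal_sum (by intro b _; finiteness)]
    refine Finset.sum_congr rfl fun b _ => ?_
    simp
  · intro b hb
    have : ψ b = 0 := by
      by_contra hne
      exact hb (h (Finsupp.mem_support_iff.2 hne))
    simp [this]

@[simp] theorem nS_zero : nS 0 = 0 := by simp [nS, nE]

theorem nS_zeroKet : nS QState.zeroKet = 1 := by simp [nS, nE_zeroKet]

/-- The gap between the two sides is (‖ψ b‖ − s‖φ b‖)² / s at each basis state. The weight s stays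
free so that it can grow with the number of queries: factors 1 + 1/(q+1) telescope to a polynomial,
whereas a fixed s would double the error at each query. -/
theorem nS_add_le (ψ φ : QState) {s : ℝ} (hs : 0 < s) :
    nS (ψ + φ) ≤ (1 + 1 / s) * nS ψ + (1 + s) * nS φ := by
  classical
  set S := ψ.support ∪ φ.support
  rw [nS_eq_sum ψ S Finset.subset_union_left, nS_eq_sum φ S Finset.subset_union_right,
    nS_eq_sum (ψ + φ) S Finsupp.support_add, Finset.mul_sum, Finset.mul_sum,
    ← Finset.sum_add_distrib]
  refine Finset.sum_le_sum fun b _ => ?_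
  rw [Finsupp.add_apply]
  have h1 : ‖ψ b + φ b‖ ^ 2 ≤ (‖ψ b‖ + ‖φ b‖) ^ 2 := by
    gcongr
    exact norm_add_le _ _
  refine h1.trans ?_
  have h2 : 0 ≤ (‖ψ b‖ - s * ‖φ b‖) ^ 2 / s := by positivity
  have h3 : (1 + 1 / s) * ‖ψ b‖ ^ 2 + (1 + s) * ‖φ b‖ ^ 2 - (‖ψ b‖ + ‖φ b‖) ^ 2
      = (‖ψ b‖ - s * ‖φ b‖) ^ 2 / s := by
    field_simp
    ring
  linarith

theorem nS_neg (ψ : QState) : nS (-ψ) = nS ψ := by simp [nS, nE]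

theorem nS_sub_le (ψ φ : QState) : nS (ψ - φ) ≤ 2 * nS ψ + 2 * nS φ := by
  have := nS_add_le ψ (-φ) one_pos
  rw [nS_neg, ← sub_eq_add_neg] at this
  linarith

/-- Linear maps that preserve the norm. -/
structure IsoLin (T : QState → QState) : Prop where
  sub : ∀ ψ φ, T (ψ - φ) = T ψ - T φ
  nS : ∀ ψ, nS (T ψ) = nS ψ

theorem IsoLin.mapDomain {f : Basis → Basis} (hf : Function.Involutive f) :
    IsoLin fun ψ => ψ.mapDomain f where
  sub ψ φ := by
    ext b
    simp [mapDomain_involutive_apply hf]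
  nS ψ := by simp only [QUnf.nS, nE_mapDomain hf]

theorem IsoLin.gate (g : Gate1) (q : Qubit) : IsoLin (applyGate1 g q) where
  sub ψ φ := by
    ext b
    simp only [Finsupp.sub_apply, applyGate1_apply, mul_sub, Finset.sum_sub_distrib]
  nS ψ := by simp only [QUnf.nS, nE_gate]

theorem IsoLin.cnot (q t : Qubit) : IsoLin (applyCNOT q t) := by
  have := IsoLin.mapDomain (cnotMap_involutive q t)
  simpa only [← applyCNOT_eq] using this

theorem IsoLin.toffoli (q q' t : Qubit) : IsoLin (applyToffoli q q' t) := by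
  have := IsoLin.mapDomain (toffoliMap_involutive q q' t)
  simpa only [← applyToffoli_eq] using this

theorem IsoLin.oracle {a d : ℕ} (g : Bits a → Bits d) : IsoLin (standardOracle g) :=
  IsoLin.mapDomain (oracleMap_involutive g)

theorem project_sub (q : Qubit) (o : Bool) (ψ φ : QState) :
    project q o (ψ - φ) = project q o ψ - project q o φ := by
  ext b
  simp only [Finsupp.sub_apply, project_apply]
  split_ifs <;> simp

theorem projReg_sub (r d : ℕ) (x : Bits d) (ψ φ : QState) :
    projReg r d x (ψ - φ) = projReg r d x ψ - projReg r d x φ := by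
  ext b
  simp only [Finsupp.sub_apply, projReg_apply]
  split_ifs <;> simp

theorem nS_project_add (q : Qubit) (ψ : QState) :
    nS (project q true ψ) + nS (project q false ψ) = nS ψ := by
  unfold nS
  rw [← ENNReal.toReal_add (nE_ne_top _) (nE_ne_top _), nE_project_add]

theorem sum_nS_projReg (r d : ℕ) (ψ : QState) : ∑ u, nS (projReg r d u ψ) = nS ψ := by
  unfold nS
  rw [← ENNReal.toReal_sum fun _ _ => nE_ne_top _, sum_nE_projReg]

/-- The part of `ψ` in which the message register shows an element of `B`. -/
def projSet {a : ℕ} (B : Finset (Bits a)) (ψ : QState) : QState :=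
  ψ.filter fun b => readReg regX a b ∈ B

theorem projSet_apply {a : ℕ} (B : Finset (Bits a)) (ψ : QState) (b : Basis) :
    projSet B ψ b = if readReg regX a b ∈ B then ψ b else 0 := by
  unfold projSet
  rw [Finsupp.filter_apply]

/-- Two oracles that differ only on `B` act differently only on the part of the state in `B`. -/
theorem nS_oracle_sub_le {a d : ℕ} (B : Finset (Bits a)) (h h' : Bits a → Bits d)
    (hB : ∀ x, x ∉ B → h x = h' x) (φ : QState) :
    nS (standardOracle h φ - standardOracle h' φ) ≤ 4 * nS (projSet B φ) := by
  -- Outside `B` both oracles move basis states in the same way and the contributions cancel. What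
  -- remains is a difference of two vectors with the norm of the projection onto `B`, which gives
  -- the constant 4.
  have e : standardOracle h φ - standardOracle h' φ
      = standardOracle h (projSet B φ) - standardOracle h' (projSet B φ) := by
    ext b
    simp only [Finsupp.sub_apply, standardOracle_eq,
      mapDomain_involutive_apply (oracleMap_involutive _), projSet_apply, readReg_oracleMap]
    split_ifs with hb
    · rfl
    · have : oracleMap h b = oracleMap h' b := by
        funext q
        rw [oracleMap_apply, oracleMap_apply, hB _ hb]
      rw [this, sub_self, sub_self]
  rw [e]
  have := nS_sub_le (standardOracle h (projSet B φ)) (standardOracle h' (projSet B φ))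
  rw [(IsoLin.oracle h).nS, (IsoLin.oracle h').nS] at this
  linarith

theorem projSet_singleton {a : ℕ} (m : Bits a) (φ : QState) :
    projSet {m} φ = projReg regX a m φ := by
  ext b
  simp only [projSet_apply, projReg_apply, Finset.mem_singleton]

/-! ## Families of runs that share all outcomes -/

/-- A family of states under the same measurement outcomes and the same oracle randomness; the
`i`-th member of the family is exposed to the oracle modified by `h i`. -/
def famMem {ι : Type} {a d d' : ℕ} (O : Oracle a d) (h : ι → (Bits a → Bits d) → Bits a → Bits d')
    (R : Type) [AddCommGroup R] [Module ℝ R] : Mem ((ι → QState) × List (ι → QState)) R where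
  tick m := m
  gate g q m := (fun i => applyGate1 g q (m.1 i), m.2)
  cnot q t m := (fun i => applyCNOT q t (m.1 i), m.2)
  toffoli q q' t m := (fun i => applyToffoli q q' t (m.1 i), m.2)
  meas q k m := k true (fun i => project q true (m.1 i), m.2)
    + k false (fun i => project q false (m.1 i), m.2)
  query f m := ∑ g, (O g).toReal • f (fun i => standardOracle (h i g) (m.1 i), m.2 ++ [m.1])

/-- Functions between finite sets form a finite type, so oracle averages are finite real sums. Real
values are needed because the arguments below use differences and signed weights. -/
theorem expect_eq_ofReal {α : Type} [Fintype α] (p : PMF α) {f : α → ℝ≥0∞} {f' : α → ℝ}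
    (hf : ∀ x, f x = ENNReal.ofReal (f' x) ∧ 0 ≤ f' x) :
    expect p f = ENNReal.ofReal (∑ x, (p x).toReal * f' x) := by
  unfold expect
  rw [tsum_fintype, ENNReal.ofReal_sum_of_nonneg]
  · refine Finset.sum_congr rfl fun x _ => ?_
    rw [(hf x).1, ENNReal.ofReal_mul ENNReal.toReal_nonneg, ENNReal.ofReal_toReal (p.apply_ne_top x)]
  · exact fun x _ => mul_nonneg ENNReal.toReal_nonneg (hf x).2

section Fam

variable {ι : Type} {a d d' : ℕ} {O : Oracle a d}
  {h : ι → (Bits a → Bits d) → Bits a → Bits d'}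

/-- No operation mixes the members of a family, so each member evolves as if it ran alone with its
own oracle. Separate experiments thereby become coordinates of a single run, in which their states
can be subtracted. -/
theorem wp_pureMem_eq_fam (i : ι) (cnt : ℕ → ℕ) (p : Cmd)
    (f : Vars → QState × List QState → ℝ≥0∞)
    (f' : Vars → (ι → QState) × List (ι → QState) → ℝ)
    (hf : ∀ v φ l, f v (φ i, l.map (· i)) = ENNReal.ofReal (f' v (φ, l)) ∧ 0 ≤ f' v (φ, l))
    (v : Vars) (φ : ι → QState) (l : List (ι → QState)) :
    wp (pureMem (O.map (h i))) cnt p f v (φ i, l.map (· i))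
      = ENNReal.ofReal (wp (famMem O h ℝ) cnt p f' v (φ, l)) ∧
    0 ≤ wp (famMem O h ℝ) cnt p f' v (φ, l) := by
  have H : MemRel (pureMem (O.map (h i))) (famMem O h ℝ)
      (fun m m' => m = (m'.1 i, m'.2.map (· i)))
      (fun _ _ x y => x = ENNReal.ofReal y ∧ 0 ≤ y) := by
    constructor
    · rintro _ m rfl
      exact ⟨rfl, fun _ _ h => h⟩
    · rintro g q _ m rfl
      exact ⟨rfl, fun _ _ h => h⟩
    · rintro q t _ m rfl
      exact ⟨rfl, fun _ _ h => h⟩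
    · rintro q q' t _ m rfl
      exact ⟨rfl, fun _ _ h => h⟩
    · rintro q _ m k k' rfl hk
      obtain ⟨a1, a2⟩ := hk true (project q true (m.1 i), m.2.map (· i))
        (fun i => project q true (m.1 i), m.2) rfl
      obtain ⟨b1, b2⟩ := hk false (project q false (m.1 i), m.2.map (· i))
        (fun i => project q false (m.1 i), m.2) rfl
      simp only [pureMem, famMem]
      exact ⟨by rw [a1, b1, ENNReal.ofReal_add a2 b2], add_nonneg a2 b2⟩
    · rintro _ m k k' rfl hk
      simp only [pureMem, famMem, expect_map, smul_eq_mul]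
      have hk' : ∀ g, k (standardOracle (h i g) (m.1 i), m.2.map (· i) ++ [m.1 i])
          = ENNReal.ofReal (k' (fun i => standardOracle (h i g) (m.1 i), m.2 ++ [m.1]))
          ∧ 0 ≤ k' (fun i => standardOracle (h i g) (m.1 i), m.2 ++ [m.1]) := by
        intro g
        exact hk _ (fun i => standardOracle (h i g) (m.1 i), m.2 ++ [m.1]) (by simp)
      exact ⟨expect_eq_ofReal O hk',
        Finset.sum_nonneg fun g _ => mul_nonneg ENNReal.toReal_nonneg (hk' g).2⟩
  exact wp_rel H cnt p f f' (by rintro v _ ⟨φ, l⟩ rfl; exact hf v φ l) v _ (φ, l) rfl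

/-- The semantics of a run uses only sums and scalar multiples of payoffs, so it commutes with every
linear map of payoffs. -/
theorem wp_fam_linear {R R' : Type} [AddCommGroup R] [Module ℝ R] [AddCommGroup R'] [Module ℝ R']
    (L : R →ₗ[ℝ] R') (cnt : ℕ → ℕ) (p : Cmd)
    (f : Vars → (ι → QState) × List (ι → QState) → R) (v : Vars) (m) :
    L (wp (famMem O h R) cnt p f v m) = wp (famMem O h R') cnt p (fun v m => L (f v m)) v m := by
  have H : MemRel (famMem O h R) (famMem O h R') (fun m m' => m = m') (fun _ _ x y => L x = y) := by
    constructor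
    · rintro m _ rfl
      exact ⟨rfl, fun _ _ h => h⟩
    · rintro g q m _ rfl
      exact ⟨rfl, fun _ _ h => h⟩
    · rintro q t m _ rfl
      exact ⟨rfl, fun _ _ h => h⟩
    · rintro q q' t m _ rfl
      exact ⟨rfl, fun _ _ h => h⟩
    · rintro q m _ k k' rfl hk
      simp only [famMem, map_add, hk _ _ _ rfl]
    · rintro m _ k k' rfl hk
      simp only [famMem, map_sum, map_smul, hk _ _ rfl]
  exact wp_rel H cnt p f _ (by rintro v m _ rfl; rfl) v m m rfl

theorem wp_fam_mono (cnt : ℕ → ℕ) (p : Cmd)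
    {f f' : Vars → (ι → QState) × List (ι → QState) → ℝ} (hf : ∀ v m, f v m ≤ f' v m)
    (v : Vars) (m) : wp (famMem O h ℝ) cnt p f v m ≤ wp (famMem O h ℝ) cnt p f' v m := by
  have H : MemRel (famMem O h ℝ) (famMem O h ℝ) (fun m m' => m = m') (fun _ _ x y => x ≤ y) := by
    constructor
    · rintro m _ rfl
      exact ⟨rfl, fun _ _ h => h⟩
    · rintro g q m _ rfl
      exact ⟨rfl, fun _ _ h => h⟩
    · rintro q t m _ rfl
      exact ⟨rfl, fun _ _ h => h⟩
    · rintro q q' t m _ rfl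
      exact ⟨rfl, fun _ _ h => h⟩
    · rintro q m _ k k' rfl hk
      exact add_le_add (hk _ _ _ rfl) (hk _ _ _ rfl)
    · rintro m _ k k' rfl hk
      simp only [famMem, smul_eq_mul]
      exact Finset.sum_le_sum fun g _ => mul_le_mul_of_nonneg_left (hk _ _ rfl)
        ENNReal.toReal_nonneg
  exact wp_rel H cnt p f f' (by rintro v m _ rfl; exact hf v m) v m m rfl

theorem sum_toReal_eq_one {α : Type} [Fintype α] (p : PMF α) : ∑ x, (p x).toReal = 1 := by
  rw [← ENNReal.toReal_sum fun x _ => p.apply_ne_top x, ← tsum_fintype (L := SummationFilter.unconditional _), p.tsum_coe]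
  simp

/-- A potential that no operation increases bounds the value of a program. -/
theorem wp_fam_le {F : (ι → QState) × List (ι → QState) → ℝ}
    (hiso : ∀ T φ l, IsoLin T → F (fun i => T (φ i), l) = F (φ, l))
    (hproj : ∀ q φ l, F (fun i => project q true (φ i), l) + F (fun i => project q false (φ i), l)
      ≤ F (φ, l))
    (hquery : ∀ g φ l, F (fun i => standardOracle (h i g) (φ i), l ++ [φ]) ≤ F (φ, l))
    (cnt : ℕ → ℕ) (p : Cmd) {f : Vars → (ι → QState) × List (ι → QState) → ℝ}
    (hf : ∀ v m, f v m ≤ F m) (v : Vars) (m) : wp (famMem O h ℝ) cnt p f v m ≤ F m := by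
  have H : MemRel (famMem O h ℝ) (famMem O h ℝ) (fun m m' => m = m')
      (fun m _ x _ => x ≤ F m) := by
    constructor
    · rintro m _ rfl
      exact ⟨rfl, fun _ _ h => h⟩
    · rintro g q m _ rfl
      exact ⟨rfl, fun _ _ h => h.trans (hiso _ m.1 m.2 (IsoLin.gate g q)).le⟩
    · rintro q t m _ rfl
      exact ⟨rfl, fun _ _ h => h.trans (hiso _ m.1 m.2 (IsoLin.cnot q t)).le⟩
    · rintro q q' t m _ rfl
      exact ⟨rfl, fun _ _ h => h.trans (hiso _ m.1 m.2 (IsoLin.toffoli q q' t)).le⟩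
    · rintro q m _ k k' rfl hk
      exact (add_le_add (hk _ _ _ rfl) (hk _ _ _ rfl)).trans (hproj q m.1 m.2)
    · rintro m _ k k' rfl hk
      simp only [famMem, smul_eq_mul]
      calc _ ≤ ∑ g, (O g).toReal * F m := Finset.sum_le_sum fun g _ =>
            mul_le_mul_of_nonneg_left ((hk _ _ rfl).trans (hquery g m.1 m.2))
              ENNReal.toReal_nonneg
        _ = F m := by rw [← Finset.sum_mul, sum_toReal_eq_one, one_mul]
  exact wp_rel H cnt p f f (by rintro v m _ rfl; exact hf v m) v m m rfl

end Fam

/-! ## The random blinding set -/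

def bern {α : Type} [Fintype α] [DecidableEq α] (ε : ℝ) (B : Finset α) : ℝ :=
  ∏ x, if x ∈ B then ε else 1 - ε

section Bern

variable {α : Type} [Fintype α] [DecidableEq α] {ε : ℝ}

theorem bern_nonneg (h0 : 0 ≤ ε) (h1 : ε ≤ 1) (B : Finset α) : 0 ≤ bern ε B :=
  Finset.prod_nonneg fun x _ => by split_ifs <;> linarith

/-- Expand the product over x of ε + (1 − ε), with 1 − ε replaced by 0 on `S`: exactly the terms of
sets `B` containing `S` survive, and the product itself is a power of ε. -/
theorem sum_bern_mul_prod (ε : ℝ) (S : Finset α) :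
    ∑ B : Finset α, bern ε B * (if S ⊆ B then 1 else 0) = ε ^ S.card := by
  have key := Finset.prod_add (fun _ : α => ε) (fun x => if x ∈ S then 0 else 1 - ε) Finset.univ
  have e1 : ∏ x : α, (ε + if x ∈ S then 0 else 1 - ε) = ε ^ S.card := by
    have : ∀ x, (ε + if x ∈ S then 0 else 1 - ε) = if x ∈ S then ε else 1 := by
      intro x; split_ifs <;> ring
    simp only [this]
    rw [Finset.prod_ite]
    simp
  rw [← e1, key, Finset.powerset_univ]
  refine Finset.sum_congr rfl fun B _ => ?_
  unfold bern
  split_ifs with hS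
  · rw [mul_one, Finset.prod_ite]
    congr 1
    · refine Finset.prod_congr ?_ fun _ _ => rfl
      ext x; simp
    · have : Finset.univ.filter (fun x => x ∉ B) = Finset.univ \ B := by ext x; simp
      rw [this]
      refine Finset.prod_congr rfl fun x hx => ?_
      rw [if_neg]
      intro hxS
      simp only [Finset.mem_sdiff] at hx
      exact hx.2 (hS hxS)
  · rw [mul_zero]
    obtain ⟨x, hx, hxB⟩ := Finset.not_subset.1 hS
    symm
    apply mul_eq_zero_of_right
    refine Finset.prod_eq_zero (i := x) (by simp [hxB]) (by simp [hx])

theorem sum_bern (ε : ℝ) : ∑ B : Finset α, bern ε B = 1 := by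
  have := sum_bern_mul_prod ε (∅ : Finset α)
  simpa using this

theorem sum_bern_mem (ε : ℝ) (x : α) :
    ∑ B : Finset α, bern ε B * (if x ∈ B then 1 else 0) = ε := by
  have := sum_bern_mul_prod ε ({x} : Finset α)
  simpa using this

theorem bern_insert {B : Finset α} {x : α} (hx : x ∉ B) :
    bern ε (insert x B) = ε * (bern ε B + bern ε (insert x B)) := by
  have h1 : bern ε (insert x B) = ε * ∏ y ∈ Finset.univ.erase x, if y ∈ B then ε else 1 - ε := by
    unfold bern
    rw [← Finset.mul_prod_erase _ _ (Finset.mem_univ x)]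
    rw [if_pos (Finset.mem_insert_self _ _)]
    congr 1
    refine Finset.prod_congr rfl fun y hy => ?_
    simp [Finset.mem_insert, Finset.ne_of_mem_erase hy]
  have h2 : bern ε B = (1 - ε) * ∏ y ∈ Finset.univ.erase x, if y ∈ B then ε else 1 - ε := by
    unfold bern
    rw [← Finset.mul_prod_erase _ _ (Finset.mem_univ x), if_neg hx]
  rw [h1, h2]
  ring

theorem sum_finset_split {M : Type} [AddCommMonoid M] (x : α) (f : Finset α → M) :
    ∑ B : Finset α, f B = ∑ B : Finset α, if x ∉ B then f B + f (insert x B) else 0 := by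
  rw [← Finset.sum_filter, Finset.sum_add_distrib,
    ← Finset.sum_filter_add_sum_filter_not Finset.univ (fun B => x ∉ B) f]
  congr 1
  refine (Finset.sum_nbij' (fun B => insert x B) (fun B => B.erase x) ?_ ?_ ?_ ?_ ?_).symm
  · intro B _; simp
  · intro B _; simp
  · intro B hB
    simp only [Finset.mem_filter, Finset.mem_univ, true_and] at hB
    exact Finset.erase_insert hB
  · intro B hB
    simp only [Finset.mem_filter, Finset.mem_univ, true_and, not_not] at hB
    exact Finset.insert_erase hB
  · intro B _; rfl

/-- Conditioned on x ∈ B, the other elements are still independent, so B may be resampled as B ∪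
{x}. This is where the probability ε that a forgery is blinded is paid for. -/
theorem sum_bern_mem_mul (x : α) (f : Finset α → ℝ) :
    ∑ B : Finset α, bern ε B * (if x ∈ B then f B else 0)
      = ε * ∑ B : Finset α, bern ε B * f (insert x B) := by
  rw [sum_finset_split x (fun B => bern ε B * (if x ∈ B then f B else 0)),
    sum_finset_split x (fun B => bern ε B * f (insert x B)), Finset.mul_sum]
  refine Finset.sum_congr rfl fun B _ => ?_
  by_cases hx : x ∈ B
  · simp [hx]
  · simp only [hx, not_false_eq_true, if_true, if_false, Finset.mem_insert_self,
      Finset.insert_idem, mul_zero, zero_add]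
    linear_combination f (insert x B) * bern_insert (ε := ε) hx

end Bern

theorem blindingSet_apply (a : ℕ) (ε : unitInterval) (B : Finset (Bits a)) :
    blindingSet a ε B = ENNReal.ofReal (bern (ε : ℝ) B) := by
  unfold blindingSet bern
  rw [PMF.ofFintype_apply]
  have hp : ∀ x : Bits a, (if x ∈ B then Real.toNNReal (ε : ℝ) else Real.toNNReal (1 - (ε : ℝ)))
      = Real.toNNReal (if x ∈ B then (ε : ℝ) else 1 - ε) := by
    intro x; split_ifs <;> rfl
  simp only [hp]
  rw [← Real.toNNReal_prod_of_nonneg]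
  · rfl
  · intro x _
    have := ε.2.1
    have := ε.2.2
    split_ifs
    · assumption
    · linarith

/-- Each basis state shows a single message, and that message is blinded with probability ε whatever
the state is. -/
theorem sum_bern_nS_projSet {a : ℕ} (ε : ℝ) (φ : QState) :
    ∑ B : Finset (Bits a), bern ε B * nS (projSet B φ) = ε * nS φ := by
  have h : ∀ B : Finset (Bits a), nS (projSet B φ)
      = ∑ b ∈ φ.support, (if readReg regX a b ∈ B then 1 else 0) * ‖φ b‖ ^ 2 := by
    intro B
    rw [nS_eq_sum (projSet B φ) φ.support (by
      intro b hb
      rw [Finsupp.mem_support_iff, projSet_apply] at hb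
      rw [Finsupp.mem_support_iff]
      intro h0
      simp [h0] at hb)]
    refine Finset.sum_congr rfl fun b _ => ?_
    rw [projSet_apply]
    split_ifs <;> simp
  simp only [h, Finset.mul_sum]
  rw [Finset.sum_comm, nS_eq_sum φ φ.support subset_rfl, Finset.mul_sum]
  refine Finset.sum_congr rfl fun b _ => ?_
  calc _ = (∑ B : Finset (Bits a), bern ε B * (if readReg regX a b ∈ B then 1 else 0))
        * ‖φ b‖ ^ 2 := by
        rw [Finset.sum_mul]
        exact Finset.sum_congr rfl fun B _ => by ring
    _ = _ := by rw [sum_bern_mem]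

/-! ## Runs with the honest oracle and runs with blinded oracles -/

/-- The function that is zero on `B` and equals `g` elsewhere. -/
def blind0 {a d : ℕ} (B : Finset (Bits a)) (g : Bits a → Bits d) (x : Bits a) : Bits d :=
  if x ∈ B then fun _ => false else g x

theorem blind0_empty {a d : ℕ} : blind0 (∅ : Finset (Bits a)) = (id : (Bits a → Bits d) → _) := by
  funext g x
  simp [blind0]

theorem nS_add_three_le (ψ φ χ : QState) : nS (ψ + φ + χ) ≤ 3 * (nS ψ + nS φ + nS χ) := by
  have h1 := nS_add_le (ψ + φ) χ (s := 2) (by norm_num)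
  have h2 := nS_add_le ψ φ (s := 1) (by norm_num)
  norm_num at h1 h2
  linarith

section Linear

variable {ι : Type} {a d d' : ℕ} {O : Oracle a d}
  {h : ι → (Bits a → Bits d) → Bits a → Bits d'}

/-- A run with vector-valued payoff, indexed by `κ`, is read once through its coordinates and once
through the weighted sum of them. Averages over blinding sets may thus be moved inside a run. -/
theorem wp_fam_sum {κ : Type} [Fintype κ] (c : κ → ℝ) (cnt : ℕ → ℕ) (p : Cmd)
    (f : κ → Vars → (ι → QState) × List (ι → QState) → ℝ) (v : Vars) (m) :
    wp (famMem O h ℝ) cnt p (fun v m => ∑ k, c k * f k v m) v m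
      = ∑ k, c k * wp (famMem O h ℝ) cnt p (f k) v m := by
  have h1 := wp_fam_linear (O := O) (h := h) (∑ k, c k • LinearMap.proj (R := ℝ) (φ := fun _ : κ => ℝ) k) cnt p
    (fun v m k => f k v m) v m
  have h2 : ∀ k, wp (famMem O h (κ → ℝ)) cnt p (fun v m k => f k v m) v m k
      = wp (famMem O h ℝ) cnt p (f k) v m := fun k =>
    wp_fam_linear (O := O) (h := h) (LinearMap.proj (R := ℝ) (φ := fun _ : κ => ℝ) k) cnt p
      (fun v m k => f k v m) v m
  simpa [h2] using h1.symm

theorem wp_fam_add_mul (c₁ c₂ : ℝ) (cnt : ℕ → ℕ) (p : Cmd)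
    (f g : Vars → (ι → QState) × List (ι → QState) → ℝ) (v : Vars) (m) :
    wp (famMem O h ℝ) cnt p (fun v m => c₁ * f v m + c₂ * g v m) v m
      = c₁ * wp (famMem O h ℝ) cnt p f v m + c₂ * wp (famMem O h ℝ) cnt p g v m := by
  have := wp_fam_sum (O := O) (h := h) (fun k : Bool => if k then c₁ else c₂) cnt p
    (fun k => if k then f else g) v m
  simpa using this

end Linear

/-! ### A potential for the distance between the honest run and the blinded runs -/

section Potential

variable {a d : ℕ} (O : Oracle a d) (ε : ℝ) (T : ℕ)

/-- No query has touched `m` in the honest run. -/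
def alive (m : Bits a) (l : List (Finset (Bits a) → QState)) : Prop :=
  ∀ φ ∈ l, projReg regX a m (φ ∅) = 0

/-- The first-order error: the mean squared distance of the blinded states from the honest state. -/
def diffD (φ : Finset (Bits a) → QState) : ℝ := ∑ B, bern ε B * nS (φ B - φ ∅)

-- The second-order error, caused by blinding one further message. It is summed over all messages
-- not yet touched by the honest run, because the message to be forged is not known in advance.
open Classical in
def diffE (φ : Finset (Bits a) → QState) (l : List (Finset (Bits a) → QState)) : ℝ :=
  ∑ B, bern ε B * ∑ m, if alive m l then nS (φ (insert m B) - φ B) else 0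

/-- The potential of the comparison of the honest run with the blinded runs. -/
def pot (m : (Finset (Bits a) → QState) × List (Finset (Bits a) → QState)) : ℝ :=
  (if m.2.length ≤ T then diffD ε m.1 / ((m.2.length : ℝ) + 1) ^ 2
    + diffE ε m.1 m.2 / (4 * ((m.2.length : ℝ) + 1) ^ 4) else 0)
  + 4 * ε * ((T - m.2.length : ℕ) : ℝ) * nS (m.1 ∅)

variable {ε}

theorem diffD_nonneg (h0 : 0 ≤ ε) (h1 : ε ≤ 1) (φ : Finset (Bits a) → QState) : 0 ≤ diffD ε φ :=
  Finset.sum_nonneg fun B _ => mul_nonneg (bern_nonneg h0 h1 B) (nS_nonneg _)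

theorem diffE_nonneg (h0 : 0 ≤ ε) (h1 : ε ≤ 1) (φ : Finset (Bits a) → QState) (l) :
    0 ≤ diffE ε φ l :=
  Finset.sum_nonneg fun B _ => mul_nonneg (bern_nonneg h0 h1 B)
    (Finset.sum_nonneg fun m _ => by split_ifs <;> simp [nS_nonneg])

theorem pot_nonneg (h0 : 0 ≤ ε) (h1 : ε ≤ 1) (m) : 0 ≤ pot (a := a) ε T m := by
  unfold pot
  have := diffD_nonneg h0 h1 m.1
  have := diffE_nonneg h0 h1 m.1 m.2
  have := nS_nonneg (m.1 ∅)
  split_ifs <;> positivity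

theorem pot_init (ψ : QState) : pot (a := a) ε T (fun _ => ψ, []) = 4 * ε * T * nS ψ := by
  simp [pot, diffD, diffE]

theorem pot_iso (S : QState → QState) (hS : IsoLin S) (φ : Finset (Bits a) → QState) (l) :
    pot ε T (fun i => S (φ i), l) = pot ε T (φ, l) := by
  simp only [pot, diffD, diffE, ← hS.sub, hS.nS]

/-- Every ingredient of the potential is a squared norm of a linear expression in the states, hence
is additive over a complete set of orthogonal projections. This covers single-qubit measurements as
well as the measurement of the challenge message. -/
theorem pot_sum {κ : Type} [Fintype κ] (P : κ → QState → QState)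
    (hsub : ∀ k ψ φ, P k (ψ - φ) = P k ψ - P k φ) (hnS : ∀ ψ, ∑ k, nS (P k ψ) = nS ψ)
    (φ : Finset (Bits a) → QState) (l) :
    ∑ k, pot ε T (fun i => P k (φ i), l) = pot ε T (φ, l) := by
  have hD : ∑ k, diffD ε (fun i => P k (φ i)) = diffD ε φ := by
    unfold diffD
    rw [Finset.sum_comm]
    refine Finset.sum_congr rfl fun B _ => ?_
    rw [← Finset.mul_sum, ← hnS (φ B - φ ∅)]
    simp only [hsub]
  have hE : ∑ k, diffE ε (fun i => P k (φ i)) l = diffE ε φ l := by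
    unfold diffE
    rw [Finset.sum_comm]
    refine Finset.sum_congr rfl fun B _ => ?_
    rw [← Finset.mul_sum, Finset.sum_comm]
    congr 1
    refine Finset.sum_congr rfl fun m _ => ?_
    split_ifs
    · rw [← hnS (φ (insert m B) - φ B)]
      simp only [hsub]
    · simp
  simp only [pot]
  rw [Finset.sum_add_distrib, ← Finset.mul_sum, hnS]
  congr 1
  split_ifs
  · rw [Finset.sum_add_distrib, ← Finset.sum_div, ← Finset.sum_div, hD, hE]
  · simp

/-- Apply the blinded oracle to the old difference, which preserves its norm, and add the difference
of the two oracles on the honest state. The latter is carried by the weight of that state on `B`, on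
average the fraction ε. -/
theorem diffD_query (h0 : 0 ≤ ε) (h1 : ε ≤ 1) (g : Bits a → Bits d)
    (φ : Finset (Bits a) → QState) {s : ℝ} (hs : 0 < s) :
    diffD ε (fun B => standardOracle (blind0 B g) (φ B))
      ≤ (1 + 1 / s) * diffD ε φ + (1 + s) * (4 * (ε * nS (φ ∅))) := by
  rw [← sum_bern_nS_projSet (a := a)]
  unfold diffD
  rw [Finset.mul_sum, Finset.mul_sum, Finset.mul_sum, ← Finset.sum_add_distrib]
  refine Finset.sum_le_sum fun B _ => ?_
  have e : standardOracle (blind0 B g) (φ B) - standardOracle (blind0 ∅ g) (φ ∅)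
      = standardOracle (blind0 B g) (φ B - φ ∅)
        + (standardOracle (blind0 B g) (φ ∅) - standardOracle (blind0 ∅ g) (φ ∅)) := by
    rw [(IsoLin.oracle _).sub]
    abel
  have h2 := nS_add_le (standardOracle (blind0 B g) (φ B - φ ∅))
    (standardOracle (blind0 B g) (φ ∅) - standardOracle (blind0 ∅ g) (φ ∅)) hs
  rw [← e, (IsoLin.oracle _).nS] at h2
  have h3 := nS_oracle_sub_le B (blind0 B g) (blind0 ∅ g)
    (fun x hx => by simp [blind0, hx]) (φ ∅)
  have h4 := mul_le_mul_of_nonneg_left h3 (by positivity : (0 : ℝ) ≤ 1 + s)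
  have h5 := mul_le_mul_of_nonneg_left (h2.trans (add_le_add le_rfl h4)) (bern_nonneg h0 h1 B)
  exact h5.trans (le_of_eq (by ring))

/-- The two oracles differ only at m, so the new error is the weight of φ B on m. For m still alive
the honest state has no such weight, and this is the weight of φ B − φ ∅ on m. Summed over all m
these weights give the whole squared norm of φ B − φ ∅, so no factor 2^a arises. -/
theorem diffE_query (h0 : 0 ≤ ε) (h1 : ε ≤ 1) (g : Bits a → Bits d)
    (φ : Finset (Bits a) → QState) (l) {s : ℝ} (hs : 0 < s) :
    diffE ε (fun B => standardOracle (blind0 B g) (φ B)) (l ++ [φ])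
      ≤ (1 + 1 / s) * diffE ε φ l + (1 + s) * (4 * diffD ε φ) := by
  classical
  unfold diffD diffE
  rw [Finset.mul_sum, Finset.mul_sum, Finset.mul_sum, ← Finset.sum_add_distrib]
  refine Finset.sum_le_sum fun B _ => ?_
  have key : ∀ m : Bits a, (if alive m (l ++ [φ]) then
      nS (standardOracle (blind0 (insert m B) g) (φ (insert m B))
        - standardOracle (blind0 B g) (φ B)) else 0)
      ≤ (1 + 1 / s) * (if alive m l then nS (φ (insert m B) - φ B) else 0)
        + (1 + s) * (4 * nS (projReg regX a m (φ B - φ ∅))) := by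
    intro m
    by_cases hm : alive m (l ++ [φ])
    · have hl : alive m l := fun ψ hψ => hm ψ (List.mem_append_left _ hψ)
      have hφ : projReg regX a m (φ ∅) = 0 := hm φ (by simp)
      rw [if_pos hm, if_pos hl, projReg_sub, hφ, sub_zero]
      have e : standardOracle (blind0 (insert m B) g) (φ (insert m B))
            - standardOracle (blind0 B g) (φ B)
          = standardOracle (blind0 (insert m B) g) (φ (insert m B) - φ B)
            + (standardOracle (blind0 (insert m B) g) (φ B)
              - standardOracle (blind0 B g) (φ B)) := by
        rw [(IsoLin.oracle _).sub]
        abel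
      have h2 := nS_add_le (standardOracle (blind0 (insert m B) g) (φ (insert m B) - φ B))
        (standardOracle (blind0 (insert m B) g) (φ B) - standardOracle (blind0 B g) (φ B)) hs
      rw [← e, (IsoLin.oracle _).nS] at h2
      have h3 := nS_oracle_sub_le {m} (blind0 (insert m B) g) (blind0 B g)
        (fun x hx => by simp only [Finset.mem_singleton] at hx; simp [blind0, hx]) (φ B)
      rw [projSet_singleton] at h3
      have h4 := mul_le_mul_of_nonneg_left h3 (by positivity : (0 : ℝ) ≤ 1 + s)
      linarith
    · rw [if_neg hm]
      have := nS_nonneg (projReg regX a m (φ B - φ ∅))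
      have := nS_nonneg (φ (insert m B) - φ B)
      split_ifs <;> positivity
  have hsum := Finset.sum_le_sum fun m (_ : m ∈ Finset.univ) => key m
  rw [Finset.sum_add_distrib, ← Finset.mul_sum, ← Finset.mul_sum, ← Finset.mul_sum,
    sum_nS_projReg] at hsum
  have h5 := mul_le_mul_of_nonneg_left hsum (bern_nonneg h0 h1 B)
  exact h5.trans (le_of_eq (by ring))

/-- After q queries the triangle inequalities are used with s = q + 1, so old errors grow by the
factor (q+2)/(q+1), and the weights (q+1)^(-2) and (q+1)^(-4)/4 shrink fast enough to absorb this
and the flow from the first-order to the second-order error. The new first-order error is paid from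
the reserve 4ε times the norm kept for each remaining query. Runs with more than T queries are not
counted. -/
theorem pot_query (h0 : 0 ≤ ε) (h1 : ε ≤ 1) (g : Bits a → Bits d)
    (φ : Finset (Bits a) → QState) (l) :
    pot ε T (fun B => standardOracle (blind0 B g) (φ B), l ++ [φ]) ≤ pot ε T (φ, l) := by
  have hN := nS_nonneg (φ ∅)
  have hD0 := diffD_nonneg h0 h1 φ
  have hE0 := diffE_nonneg h0 h1 φ l
  simp only [pot, List.length_append, List.length_singleton, (IsoLin.oracle _).nS]
  by_cases hq : l.length + 1 ≤ T
  · rw [if_pos hq, if_pos (by omega)]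
    obtain ⟨k, rfl⟩ := Nat.exists_eq_add_of_le hq
    have e1 : l.length + 1 + k - (l.length + 1) = k := by omega
    have e2 : l.length + 1 + k - l.length = k + 1 := by omega
    rw [e1, e2]
    push_cast
    set q : ℝ := (l.length : ℝ)
    have hq0 : 0 ≤ q := Nat.cast_nonneg _
    have hD := diffD_query h0 h1 g φ (s := q + 1) (by positivity)
    have hE := diffE_query h0 h1 g φ l (s := q + 1) (by positivity)
    set D := diffD ε φ
    set E := diffE ε φ l
    set N := nS (φ ∅)
    have hD2 := div_le_div_of_nonneg_right hD (by positivity : 0 ≤ (q + 1 + 1) ^ 2)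
    have hE2 := div_le_div_of_nonneg_right hE (by positivity : 0 ≤ 4 * (q + 1 + 1) ^ 4)
    have c1 : ((1 + 1 / (q + 1)) * D + (1 + (q + 1)) * (4 * (ε * N))) / (q + 1 + 1) ^ 2
        = D * (1 / ((q + 1) * (q + 2))) + 4 * ε * N * (1 / (q + 2)) := by
      field_simp
      ring
    have c2 : ((1 + 1 / (q + 1)) * E + (1 + (q + 1)) * (4 * D)) / (4 * (q + 1 + 1) ^ 4)
        = E * (1 / (4 * ((q + 1) * (q + 2) ^ 3))) + D * (1 / (q + 2) ^ 3) := by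
      field_simp
      ring
    -- The first-order weight drops by 1/((q+1)²(q+2)), which leaves room for the amount 1/(q+2)³
    -- passed on to the second-order error.
    have i1 : 1 / ((q + 1) * (q + 2)) + 1 / (q + 2) ^ 3 ≤ 1 / (q + 1) ^ 2 := by
      rw [div_add_div _ _ (by positivity) (by positivity),
        div_le_div_iff₀ (by positivity) (by positivity)]
      nlinarith [pow_nonneg hq0 2, pow_nonneg hq0 3, pow_nonneg hq0 4]
    have i2 : 1 / (4 * ((q + 1) * (q + 2) ^ 3)) ≤ 1 / (4 * (q + 1) ^ 4) := by
      apply one_div_le_one_div_of_le (by positivity)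
      have : (q + 1) ^ 3 ≤ (q + 2) ^ 3 := by gcongr; linarith
      nlinarith
    have i3 : 1 / (q + 2) ≤ 1 := by
      rw [div_le_one (by positivity)]; linarith
    have j1 := mul_le_mul_of_nonneg_left i1 hD0
    have j2 := mul_le_mul_of_nonneg_left i2 hE0
    have j3 := mul_le_mul_of_nonneg_left i3 (by positivity : 0 ≤ 4 * ε * N)
    rw [c1] at hD2
    rw [c2] at hE2
    have c3 : D / (q + 1) ^ 2 = D * (1 / (q + 1) ^ 2) := by ring
    have c4 : E / (4 * (q + 1) ^ 4) = E * (1 / (4 * (q + 1) ^ 4)) := by ring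
    rw [c3, c4]
    linarith
  · rw [if_neg hq, zero_add]
    have e1 : T - (l.length + 1) = 0 := by omega
    rw [e1]
    simp only [Nat.cast_zero, mul_zero, zero_mul]
    split_ifs <;> positivity

theorem wp_pot_le (h0 : 0 ≤ ε) (h1 : ε ≤ 1) (cnt : ℕ → ℕ) (p : Cmd)
    {f : Vars → (Finset (Bits a) → QState) × List (Finset (Bits a) → QState) → ℝ}
    (hf : ∀ v m, f v m ≤ pot ε T m) (v : Vars) (m) :
    wp (famMem O blind0 ℝ) cnt p f v m ≤ pot ε T m := by
  refine wp_fam_le ?_ ?_ ?_ cnt p hf v m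
  · intro S φ l hS
    exact pot_iso T S hS φ l
  · intro q φ l
    have := pot_sum (ε := ε) T (fun o : Bool => project q o) (fun o => project_sub q o)
      (fun ψ => by simpa using nS_project_add q ψ) φ l
    simp at this
    exact this.le
  · intro g φ l
    exact pot_query T h0 h1 g φ l

end Potential

/-! ### Games with a measurement of the message between two phases -/

section TwoPhase

variable {a d : ℕ}

/-- A run with a measurement of the message register in the middle. -/
def twoPhase {M R : Type} [AddCommMonoid R] (E : Mem M R) (cnt : ℕ → ℕ) (A₁ A₂ : Cmd)
    (proj : Bits a → M → M) (leaf : Bits a → M → R) : Vars → M → R :=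
  wp E cnt A₁ fun v m => ∑ x, wp E cnt A₂ (fun _ => leaf x) v (proj x m)

abbrev pureProj (x : Bits a) (m : QState × List QState) : QState × List QState :=
  (projReg regX a x m.1, m.2)

abbrev famProj {ι : Type} (x : Bits a) (m : (ι → QState) × List (ι → QState)) :
    (ι → QState) × List (ι → QState) :=
  (fun i => projReg regX a x (m.1 i), m.2)

theorem twoPhase_pureMem_eq_fam {ι : Type} {d' : ℕ} {O : Oracle a d}
    {h : ι → (Bits a → Bits d) → Bits a → Bits d'} (i : ι) (cnt : ℕ → ℕ) (A₁ A₂ : Cmd)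
    (f : Bits a → QState × List QState → ℝ≥0∞)
    (f' : Bits a → (ι → QState) × List (ι → QState) → ℝ)
    (hf : ∀ x φ l, f x (φ i, l.map (· i)) = ENNReal.ofReal (f' x (φ, l)) ∧ 0 ≤ f' x (φ, l))
    (v : Vars) (φ : ι → QState) (l : List (ι → QState)) :
    twoPhase (pureMem (O.map (h i))) cnt A₁ A₂ pureProj f v (φ i, l.map (· i))
      = ENNReal.ofReal (twoPhase (famMem O h ℝ) cnt A₁ A₂ famProj f' v (φ, l)) ∧
    0 ≤ twoPhase (famMem O h ℝ) cnt A₁ A₂ famProj f' v (φ, l) := by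
  refine wp_pureMem_eq_fam i cnt A₁ _ _ (fun v φ l => ?_) v φ l
  have h2 := fun x => wp_pureMem_eq_fam (O := O) (h := h) i cnt A₂ (fun _ => f x) (fun _ => f' x)
    (fun _ => hf x) v (fun i => projReg regX a x (φ i)) l
  refine ⟨?_, Finset.sum_nonneg fun x _ => (h2 x).2⟩
  rw [ENNReal.ofReal_sum_of_nonneg fun x _ => (h2 x).2]
  exact Finset.sum_congr rfl fun x _ => (h2 x).1

open Classical in
/-- The value of the honest game is bounded by that of the blinded games. -/
theorem honest_le_blinded (O : Oracle a d) {ε : ℝ} (h0 : 0 < ε) (h1 : ε ≤ 1) (T : ℕ)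
    (cnt : ℕ → ℕ) (A₁ A₂ : Cmd) (acc : Bits a → Bits d → ℝ)
    (hacc : ∀ x t, 0 ≤ acc x t ∧ acc x t ≤ 1) (v : Vars) (ψ : QState) :
    twoPhase (pureMem O) cnt A₁ A₂ pureProj (fun x m =>
        if m.2.length ≤ T ∧ ∀ φ ∈ m.2, projReg regX a x φ = 0 then
          ∑ t, nE (projReg regY d t m.1) * ENNReal.ofReal (acc x t) else 0) v (ψ, [])
      ≤ ENNReal.ofReal (3 / ε) * ∑ B : Finset (Bits a), ENNReal.ofReal (bern ε B) *
          twoPhase (pureMem (O.map (blind0 B))) cnt A₁ A₂ pureProj (fun x m =>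
            if x ∈ B then ∑ t, nE (projReg regY d t m.1) * ENNReal.ofReal (acc x t) else 0)
            v (ψ, [])
        + ENNReal.ofReal (48 * ε * (T + 1) ^ 5 * nS ψ) := by
  have hw : ∀ x (φ : QState), ∑ t, nE (projReg regY d t φ) * ENNReal.ofReal (acc x t)
      = ENNReal.ofReal (∑ t, nS (projReg regY d t φ) * acc x t) ∧
      0 ≤ ∑ t, nS (projReg regY d t φ) * acc x t := by
    intro x φ
    have hn : ∀ t ∈ Finset.univ, 0 ≤ nS (projReg regY d t φ) * acc x t :=
      fun t _ => mul_nonneg (nS_nonneg _) (hacc x t).1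
    refine ⟨?_, Finset.sum_nonneg hn⟩
    rw [ENNReal.ofReal_sum_of_nonneg hn]
    refine Finset.sum_congr rfl fun t _ => ?_
    rw [ENNReal.ofReal_mul (nS_nonneg _), ofReal_nS]
  set w : Bits a → QState → ℝ := fun x φ => ∑ t, nS (projReg regY d t φ) * acc x t with hwdef
  set fP : Bits a → (Finset (Bits a) → QState) × List (Finset (Bits a) → QState) → ℝ :=
    fun x m => if m.2.length ≤ T ∧ alive x m.2 then w x (m.1 ∅) else 0 with hfP
  set fW : Finset (Bits a) → Bits a →
      (Finset (Bits a) → QState) × List (Finset (Bits a) → QState) → ℝ :=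
    fun B x m => if x ∈ B then w x (m.1 B) else 0 with hfW
  have eP := twoPhase_pureMem_eq_fam (O := O) (h := blind0) ∅ cnt A₁ A₂ (fun x m =>
        if m.2.length ≤ T ∧ ∀ φ ∈ m.2, projReg regX a x φ = 0 then
          ∑ t, nE (projReg regY d t m.1) * ENNReal.ofReal (acc x t) else 0) fP (by
    intro x φ l
    have : (∀ φ' ∈ l.map (· ∅), projReg regX a x φ' = 0) ↔ alive x l := by
      simp [alive]
    simp only [hfP, List.length_map, this, (hw x _).1]
    split_ifs
    · exact ⟨rfl, (hw x _).2⟩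
    · simp) v (fun _ => ψ) []
  have eW := fun B => twoPhase_pureMem_eq_fam (O := O) (h := blind0) B cnt A₁ A₂ (fun x m =>
            if x ∈ B then ∑ t, nE (projReg regY d t m.1) * ENNReal.ofReal (acc x t) else 0)
    (fW B) (by
      intro x φ l
      simp only [hfW, (hw x _).1]
      split_ifs
      · exact ⟨rfl, (hw x _).2⟩
      · simp) v (fun _ => ψ) []
  rw [blind0_empty, PMF.map_id] at eP
  simp only [List.map_nil] at eP eW
  rw [eP.1]
  have hb := fun B : Finset (Bits a) => bern_nonneg h0.le h1 B
  have e2 : ∑ B : Finset (Bits a), ENNReal.ofReal (bern ε B) *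
          twoPhase (pureMem (O.map (blind0 B))) cnt A₁ A₂ pureProj (fun x m =>
            if x ∈ B then ∑ t, nE (projReg regY d t m.1) * ENNReal.ofReal (acc x t) else 0)
            v (ψ, [])
      = ENNReal.ofReal (∑ B, bern ε B *
          twoPhase (famMem O blind0 ℝ) cnt A₁ A₂ famProj (fW B) v (fun _ => ψ, [])) := by
    rw [ENNReal.ofReal_sum_of_nonneg fun B _ => mul_nonneg (hb B) (eW B).2]
    refine Finset.sum_congr rfl fun B _ => ?_
    rw [ENNReal.ofReal_mul (hb B), (eW B).1]
  rw [e2, ← ENNReal.ofReal_mul (by positivity), ← ENNReal.ofReal_add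
    (mul_nonneg (by positivity) (Finset.sum_nonneg fun B _ => mul_nonneg (hb B) (eW B).2))
    (by have := nS_nonneg ψ; positivity)]
  refine ENNReal.ofReal_le_ofReal ?_
  -- This converts the potential back into three times the errors: 12 = 3 · 4 undoes the weight of
  -- `diffE`, and the fourth power bounds (q+1)⁴ for q ≤ T.
  set K : ℝ := 12 * ((T : ℝ) + 1) ^ 4
  have leaf : ∀ x m, fP x m ≤ 3 / ε * (∑ B, bern ε B * fW B x m) + K * pot ε T m := by
    intro x m
    -- The blinded payoff is rewritten for the sets B ∪ {x}, at the price of the factor ε that the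
    -- coefficient 3/ε makes good.
    have hsw : ∑ B, bern ε B * fW B x m = ε * ∑ B, bern ε B * w x (m.1 (insert x B)) :=
      sum_bern_mem_mul x fun B => w x (m.1 B)
    have hWn : 0 ≤ ∑ B, bern ε B * fW B x m := Finset.sum_nonneg fun B _ => by
      refine mul_nonneg (hb B) ?_
      simp only [hfW]
      split_ifs
      · exact (hw x _).2
      · exact le_rfl
    have hpn := pot_nonneg (a := a) T h0.le h1 m
    simp only [hfP]
    split_ifs with hc
    -- The honest state is written as φ_{B∪{x}} − (φ_{B∪{x}} − φ_B) − (φ_B − φ_∅), and the squared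
    -- norm of a sum of three vectors is at most three times the sum of their squared norms.
    · have hstep : w x (m.1 ∅) ≤ 3 * (∑ B, bern ε B * w x (m.1 (insert x B)))
          + 3 * (diffE ε m.1 m.2 + diffD ε m.1) := by
        have h1' : w x (m.1 ∅) = ∑ B : Finset (Bits a), bern ε B * w x (m.1 ∅) := by
          rw [← Finset.sum_mul, sum_bern, one_mul]
        rw [h1']
        unfold diffE diffD
        rw [← Finset.sum_add_distrib, Finset.mul_sum, Finset.mul_sum, ← Finset.sum_add_distrib]
        refine Finset.sum_le_sum fun B _ => ?_
        have hpt : w x (m.1 ∅) ≤ 3 * w x (m.1 (insert x B))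
            + 3 * (nS (m.1 (insert x B) - m.1 B) + nS (m.1 B - m.1 ∅)) := by
          have ht : ∀ t, nS (projReg regY d t (m.1 ∅)) * acc x t
              ≤ 3 * (nS (projReg regY d t (m.1 (insert x B))) * acc x t)
              + 3 * (nS (projReg regY d t (m.1 (insert x B) - m.1 B))
                + nS (projReg regY d t (m.1 B - m.1 ∅))) := by
            intro t
            have := nS_add_three_le (projReg regY d t (m.1 (insert x B)))
              (-(projReg regY d t (m.1 (insert x B) - m.1 B)))
              (-(projReg regY d t (m.1 B - m.1 ∅)))
            rw [nS_neg, nS_neg] at this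
            have e : projReg regY d t (m.1 (insert x B))
                + -(projReg regY d t (m.1 (insert x B) - m.1 B))
                + -(projReg regY d t (m.1 B - m.1 ∅)) = projReg regY d t (m.1 ∅) := by
              simp only [projReg_sub]; abel
            rw [e] at this
            have ha := hacc x t
            have hA := nS_nonneg (projReg regY d t (m.1 (insert x B) - m.1 B))
            have hB := nS_nonneg (projReg regY d t (m.1 B - m.1 ∅))
            have h3 := mul_le_mul_of_nonneg_right this ha.1
            have h4 := mul_le_of_le_one_right (add_nonneg hA hB) ha.2
            nlinarith
          have := Finset.sum_le_sum fun t (_ : t ∈ Finset.univ) => ht t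
          simp only [Finset.sum_add_distrib, ← Finset.mul_sum, sum_nS_projReg] at this
          exact this
        -- Only the term of the forged message is needed; it is admitted to the sum because x is
        -- alive in this branch.
        have hsingle : nS (m.1 (insert x B) - m.1 B)
            ≤ ∑ y, if alive y m.2 then nS (m.1 (insert y B) - m.1 B) else 0 := by
          refine le_trans (le_of_eq (if_pos hc.2).symm)
            (Finset.single_le_sum (f := fun y => if alive y m.2 then
              nS (m.1 (insert y B) - m.1 B) else 0) (fun y _ => ?_) (Finset.mem_univ x))
          split_ifs
          · exact nS_nonneg _
          · exact le_rfl
        have := mul_le_mul_of_nonneg_left (hpt.trans (by gcongr :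
          _ ≤ 3 * w x (m.1 (insert x B)) + 3 * ((∑ y, if alive y m.2 then
            nS (m.1 (insert y B) - m.1 B) else 0) + nS (m.1 B - m.1 ∅)))) (hb B)
        exact this.trans (le_of_eq (by ring))
      have hpot : 3 * (diffE ε m.1 m.2 + diffD ε m.1) ≤ K * pot ε T m := by
        have hE := diffE_nonneg h0.le h1 m.1 m.2
        have hD := diffD_nonneg h0.le h1 m.1
        have hN := nS_nonneg (m.1 ∅)
        simp only [pot, if_pos hc.1]
        set q : ℝ := (m.2.length : ℝ)
        have hq : q ≤ T := Nat.cast_le.2 hc.1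
        have hq0 : 0 ≤ q := Nat.cast_nonneg _
        have hK : 12 * (q + 1) ^ 4 ≤ K := by
          simp only [K]; gcongr
        have hK2 : 12 * (q + 1) ^ 2 ≤ 12 * (q + 1) ^ 4 := by
          have : (q + 1) ^ 2 ≤ (q + 1) ^ 4 := pow_le_pow_right₀ (by linarith) (by norm_num)
          linarith
        have a1 : 3 * diffE ε m.1 m.2 ≤ K * (diffE ε m.1 m.2 / (4 * (q + 1) ^ 4)) := by
          rw [mul_div_assoc', le_div_iff₀ (by positivity)]
          nlinarith
        have a2 : 3 * diffD ε m.1 ≤ K * (diffD ε m.1 / (q + 1) ^ 2) := by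
          rw [mul_div_assoc', le_div_iff₀ (by positivity)]
          nlinarith [mul_nonneg hD (by positivity : 0 ≤ (q + 1) ^ 2)]
        have a3 : 0 ≤ K * (4 * ε * ((T - m.2.length : ℕ) : ℝ) * nS (m.1 ∅)) := by positivity
        rw [mul_add, mul_add]
        linarith
      rw [hsw]
      have : 3 / ε * (ε * ∑ B, bern ε B * w x (m.1 (insert x B)))
          = 3 * ∑ B, bern ε B * w x (m.1 (insert x B)) := by
        field_simp
      rw [this]
      linarith
    · positivity
  -- both phases
  have lin2 : ∀ x v m, wp (famMem O blind0 ℝ) cnt A₂ (fun _ => fP x) v m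
      ≤ 3 / ε * (∑ B, bern ε B * wp (famMem O blind0 ℝ) cnt A₂ (fun _ => fW B x) v m)
        + K * pot ε T m := by
    intro x v m
    refine (wp_fam_mono cnt A₂ (fun v m => leaf x m) v m).trans ?_
    rw [wp_fam_add_mul (O := O) (h := blind0) (3 / ε) K cnt A₂
      (fun _ m => ∑ B, bern ε B * fW B x m) (fun _ m => pot ε T m),
      wp_fam_sum (O := O) (h := blind0) (bern ε) cnt A₂ (fun B _ m => fW B x m)]
    have := wp_pot_le O T h0.le h1 cnt A₂ (fun _ m => le_refl (pot ε T m)) v m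
    have := mul_le_mul_of_nonneg_left this (by positivity : 0 ≤ K)
    linarith
  unfold twoPhase
  -- The leaf bound carries one potential for each outcome x; since the potential is additive over
  -- the measured message, their sum is the potential before the measurement and not 2^a copies of
  -- it.
  have lin1 : ∀ v m, ∑ x, wp (famMem O blind0 ℝ) cnt A₂ (fun _ => fP x) v (famProj x m)
      ≤ 3 / ε * (∑ B, bern ε B *
          ∑ x, wp (famMem O blind0 ℝ) cnt A₂ (fun _ => fW B x) v (famProj x m))
        + K * pot ε T m := by
    intro v m
    refine (Finset.sum_le_sum fun x _ => lin2 x v (famProj x m)).trans (le_of_eq ?_)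
    rw [Finset.sum_add_distrib, ← Finset.mul_sum, ← Finset.mul_sum,
      pot_sum T (fun x : Bits a => projReg regX a x) (fun x => projReg_sub regX a x)
        (sum_nS_projReg regX a) m.1 m.2, Finset.sum_comm]
    simp only [Finset.mul_sum]
  refine (wp_fam_mono cnt A₁ lin1 v _).trans ?_
  rw [wp_fam_add_mul (O := O) (h := blind0) (3 / ε) K cnt A₁
      (fun v m => ∑ B, bern ε B *
        ∑ x, wp (famMem O blind0 ℝ) cnt A₂ (fun _ => fW B x) v (famProj x m))
      (fun _ m => pot ε T m),
      wp_fam_sum (O := O) (h := blind0) (bern ε) cnt A₁ (fun B v m =>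
        ∑ x, wp (famMem O blind0 ℝ) cnt A₂ (fun _ => fW B x) v (famProj x m))]
  have hp := wp_pot_le O T h0.le h1 cnt A₁ (fun _ m => le_refl (pot ε T m)) v (fun _ => ψ, [])
  rw [pot_init] at hp
  have hp2 := mul_le_mul_of_nonneg_left hp (by positivity : 0 ≤ K)
  have hfin : K * (4 * ε * T * nS ψ) ≤ 48 * ε * (T + 1) ^ 5 * nS ψ := by
    have hT : (T : ℝ) ≤ T + 1 := by linarith
    have hn := nS_nonneg ψ
    calc K * (4 * ε * T * nS ψ) = 48 * ε * ((T + 1) ^ 4 * T) * nS ψ := by simp only [K]; ring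
      _ ≤ 48 * ε * ((T + 1) ^ 4 * (T + 1)) * nS ψ := by gcongr
      _ = _ := by ring
  linarith

end TwoPhase

/-! ## Swapping and copying registers -/

def swap3 (p q : QRef) : Cmd := .seq (.cnot p q) (.seq (.cnot q p) (.cnot p q))

def swapMap (p q : Qubit) (b : Basis) : Basis := fun x => b (Equiv.swap p q x)

theorem swapMap_involutive (p q : Qubit) : Function.Involutive (swapMap p q) := by
  intro b
  funext x
  simp [swapMap]

theorem swap3_rev (p q : QRef) : (swap3 p q).Rev := by simp [swap3, Cmd.Rev]

theorem ev_swap3 (p q : QRef) (v : Vars) (h : (p.reg, v p.idx) ≠ (q.reg, v q.idx)) (b : Basis) :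
    (swap3 p q).ev bGates v b = swapMap (p.reg, v p.idx) (q.reg, v q.idx) b := by
  simp only [swap3, Cmd.ev, Cmd.vev, bGates]
  generalize (p.reg, v p.idx) = P at *
  generalize (q.reg, v q.idx) = Q at *
  funext x
  simp only [cnotMap, if_neg h, if_neg (Ne.symm h), swapMap]
  by_cases hP : x = P
  · subst hP
    simp only [h, Ne.symm h, Function.update_self, Function.update_of_ne, ne_eq,
      not_false_eq_true, Equiv.swap_apply_left]
    cases b x <;> cases b Q <;> rfl
  · by_cases hQ : x = Q
    · subst hQ
      simp [h, Ne.symm h]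
    · simp [hP, hQ, Equiv.swap_apply_of_ne_of_ne]

/-- Add register `r` to register `s`. -/
def copyReg (r s D : ℕ) (b : Basis) : Basis :=
  fun q => if q.1 = s ∧ q.2 < D then xor (b q) (b (r, q.2)) else b q

theorem copyReg_involutive {r s : ℕ} (h : r ≠ s) (D : ℕ) :
    Function.Involutive (copyReg r s D) := by
  intro b
  funext q
  simp only [copyReg, h, false_and, if_false]
  split_ifs <;> simp

theorem up_cnot {r s : ℕ} (h : r ≠ s) (D : ℕ) (b : Basis) :
    up (fun j => cnotMap (r, j) (s, j)) D b = copyReg r s D b := by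
  induction D with
  | zero => funext q; simp [up, copyReg]
  | succ D ih =>
    rw [up, ih]
    funext q
    have hne : ((r, D) : Qubit) ≠ (s, D) := by simp [h]
    simp only [cnotMap, if_neg hne, copyReg, h, false_and, if_false]
    by_cases hq : q = (s, D)
    · subst hq; simp
    · rw [Function.update_of_ne hq]
      have : (q.1 = s ∧ q.2 < D + 1) ↔ (q.1 = s ∧ q.2 < D) := by
        refine and_congr_right fun hs => ?_
        have : q.2 ≠ D := fun h' => hq (Prod.ext hs h')
        omega
      simp only [this]
      rfl

def swapReg (r s D : ℕ) (b : Basis) : Basis :=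
  fun q => if q.2 < D then b (Equiv.swap r s q.1, q.2) else b q

theorem swapReg_involutive (r s D : ℕ) : Function.Involutive (swapReg r s D) := by
  intro b
  funext q
  simp only [swapReg]
  split_ifs <;> simp

theorem up_swap {r s : ℕ} (h : r ≠ s) (D : ℕ) (b : Basis) :
    up (fun j => swapMap (r, j) (s, j)) D b = swapReg r s D b := by
  induction D with
  | zero => funext q; simp [up, swapReg]
  | succ D ih =>
    rw [up, ih]
    funext ⟨x, y⟩
    simp only [swapMap, swapReg]
    by_cases hy : y = D
    · subst hy
      by_cases hr : x = r
      · subst hr; simp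
      · by_cases hs : x = s
        · subst hs; simp
        · rw [Equiv.swap_apply_of_ne_of_ne (by simp [hr]) (by simp [hs]),
            Equiv.swap_apply_of_ne_of_ne hr hs]
          simp
    · rw [Equiv.swap_apply_of_ne_of_ne (by simp [hy]) (by simp [hy])]
      have : y < D + 1 ↔ y < D := by omega
      simp only [this]

def copyProg (i N r s : ℕ) : Cmd := forUp i N (.cnot ⟨r, i⟩ ⟨s, i⟩)

def swapProg (i N r s : ℕ) : Cmd := forUp i N (swap3 ⟨r, i⟩ ⟨s, i⟩)

theorem copyProg_rev (i N r s : ℕ) : (copyProg i N r s).Rev := by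
  simp [copyProg, forUp, Cmd.Rev]

theorem swapProg_rev (i N r s : ℕ) : (swapProg i N r s).Rev := by
  simp [swapProg, forUp, Cmd.Rev, swap3]

theorem copyProg_writes (i N r s : ℕ) : (copyProg i N r s).Writes {i} := by
  simp [copyProg, forUp, Cmd.Writes]

theorem swapProg_writes (i N r s : ℕ) : (swapProg i N r s).Writes {i} := by
  simp [swapProg, forUp, Cmd.Writes, swap3]

theorem ev_copyProg {i N r s : ℕ} (h : r ≠ s) (hi1 : i ≠ vOne) (hN : N ≠ i) {v : Vars}
    (hv : v vOne = 1) : (copyProg i N r s).ev bGates v = copyReg r s (v N) := by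
  funext b
  rw [copyProg, ev_forUp bGates (S := ∅) (by simp [Cmd.Writes]) (by simp) (by simp) hi1 hN hv
    (fun j => cnotMap (r, j) (s, j)), up_cnot h]
  intro j _ w _ hw m
  simp [Cmd.ev, bGates, hw]

theorem ev_swapProg {i N r s : ℕ} (h : r ≠ s) (hi1 : i ≠ vOne) (hN : N ≠ i) {v : Vars}
    (hv : v vOne = 1) : (swapProg i N r s).ev bGates v = swapReg r s (v N) := by
  funext b
  rw [swapProg, ev_forUp bGates (S := ∅) (by simp [swap3, Cmd.Writes]) (by simp) (by simp) hi1 hN hv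
    (fun j => swapMap (r, j) (s, j)), up_swap h]
  intro j _ w _ hw m
  rw [ev_swap3 _ _ _ (by simp [h])]
  simp [hw]

/-! ## The blind forger made from an existential forger -/

namespace Forger

/-- The registers 0 and 1 on which the oracle acts keep their places, while workspace is moved up so
that the registers 2 to 21 are free for the simulation. -/
def ρ (r : ℕ) : ℕ := if r < 2 then r else r + 20

theorem ρ_injective : Function.Injective ρ := by
  intro r s h
  simp only [ρ] at h
  split_ifs at h <;> omega

theorem notMem_ρ {r : ℕ} (h2 : 2 ≤ r) (h : r < 22) : r ∉ Set.range ρ := by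
  rintro ⟨s, hs⟩
  simp only [ρ] at hs
  split_ifs at hs <;> omega

/-- A query in which the qubit that receives the flag of `⊥` is replaced by a fixed one. -/
def gadget : Cmd :=
  .seq (swap3 ⟨1, 2⟩ ⟨2, vZero⟩) (.seq .query (swap3 ⟨1, 2⟩ ⟨2, vZero⟩))

def emb : Emb := ⟨fun x => x + 40, ρ, 10, 9, gadget⟩

def setup (c : ℕ) : Cmd :=
  .seq sizeProg (.seq (powProg 9 c) (.seq (.add 40 0 vZero) (.seq (.add 41 1 vZero)
    (.seq (.add 42 2 vZero) (.gate .H ⟨2, vZero⟩)))))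

/-- The second phase may overwrite the message register, so the measured message is kept in register
3 and swapped back only for the final measurement. -/
def store : Cmd := .seq (forUp 11 1 (.measure ⟨0, 11⟩ 12)) (copyProg 11 1 0 3)

def restore : Cmd := swapProg 11 1 0 3

def forger (c : ℕ) (A₁ A₂ : Cmd) : Cmd :=
  .seq (setup c) (.seq (emb.compile A₁) (.seq store (.seq (emb.compile A₂) restore)))

/-- The content of the qubits outside of the registers of the embedded program; `m` is stored. -/
def aux {a : ℕ} (m : Option (Bits a)) (q : Qubit) : Bool :=
  match m with
  | none => false
  | some m => if h : q.1 = 3 ∧ q.2 < a then m ⟨q.2, h.2⟩ else false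

-- The value of the qubit (2, 0) does not enter: it is in the state |+⟩, with amplitude 1/√2 for
-- both values, and so absorbs whatever bit the oracle adds to it.
open Classical in
def χ {a : ℕ} (m : Option (Bits a)) (b : Basis) : ℂ :=
  if ∀ q : Qubit, q.1 ∉ Set.range ρ → q ≠ (2, 0) → b q = aux m q then 1 / (Real.sqrt 2 : ℂ) else 0

variable {a : ℕ}

theorem χ_congr {m m' : Option (Bits a)} {b b' : Basis}
    (h : ∀ q : Qubit, q.1 ∉ Set.range ρ → q ≠ (2, 0) → (b q = aux m q ↔ b' q = aux m' q)) :
    χ m b = χ m' b' := by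
  unfold χ
  have : (∀ q : Qubit, q.1 ∉ Set.range ρ → q ≠ (2, 0) → b q = aux m q) ↔
      (∀ q : Qubit, q.1 ∉ Set.range ρ → q ≠ (2, 0) → b' q = aux m' q) :=
    forall_congr' fun q => forall_congr' fun h1 => forall_congr' fun h2 => h q h1 h2
  by_cases h0 : ∀ q : Qubit, q.1 ∉ Set.range ρ → q ≠ (2, 0) → b q = aux m q
  · rw [if_pos h0, if_pos (this.1 h0)]
  · rw [if_neg h0, if_neg (mt this.2 h0)]

theorem χ_indep (m : Option (Bits a)) : Indep ρ (χ m) := by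
  intro b b' h
  refine χ_congr fun q hq _ => ?_
  rw [h q hq]

theorem isProd_init : IsProd ρ (applyGate1 .H (2, 0) QState.zeroKet) QState.zeroKet
    (χ (none : Option (Bits a))) := by
  intro b
  rw [applyGate1_apply]
  classical
  have hz : ∀ c, QState.zeroKet c = if (fun _ => false) = c then (1 : ℂ) else 0 := fun c => by
    rw [QState.zeroKet, Finsupp.single_apply]
  simp only [hz, Fintype.sum_bool]
  have h1 : ¬ ((fun _ => false) = Function.update b ((2, 0) : Qubit) true) := by
    intro h
    have := congrFun h (2, 0)
    simp at this
  rw [if_neg h1, mul_zero, zero_add]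
  have h2 : (Gate1.H.entry (b (2, 0)) false) = 1 / (Real.sqrt 2 : ℂ) := by
    simp [Gate1.entry]
  rw [h2]
  unfold χ
  by_cases hh : (fun _ => false) = hi ρ b
  · rw [if_pos hh, one_mul]
    by_cases hl : ∀ q : Qubit, q.1 ∉ Set.range ρ → q ≠ (2, 0) → b q = aux (none : Option (Bits a)) q
    · rw [if_pos hl, if_pos, mul_one]
      funext q
      by_cases hq : q = (2, 0)
      · subst hq; simp
      · rw [Function.update_of_ne hq]
        by_cases hr : q.1 ∈ Set.range ρ
        · obtain ⟨r, hr⟩ := hr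
          have := congrFun hh (r, q.2)
          simp only [hi, hr] at this
          exact this
        · exact (hl q hr hq).symm
    · rw [if_neg hl, if_neg, mul_zero]
      intro h
      apply hl
      intro q _ hq
      have := congrFun h q
      rw [Function.update_of_ne hq] at this
      exact this.symm
  · rw [if_neg hh, zero_mul, if_neg, mul_zero]
    intro h
    apply hh
    funext q
    have := congrFun h (ρ q.1, q.2)
    rw [Function.update_of_ne] at this
    · exact this
    · intro h'
      rw [Prod.mk.injEq] at h'
      exact notMem_ρ (r := 2) le_rfl (by norm_num) ⟨_, h'.1⟩

/-- Flipping the qubits of a stored m is norm-preserving and turns the initial product state into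
one with the desired second factor. Comparing norms of the two products gives the value without
evaluating the sum. -/
theorem sqNorm_some (m : Bits a) : sqNorm ρ_injective (χ (some m)) = 1 := by
  have hinv : Function.Involutive fun (b : Basis) q => xor (b q) (aux (some m) q) := by
    intro b; funext q; simp
  have hP : IsProd ρ ((applyGate1 .H (2, 0) QState.zeroKet).mapDomain
      fun b q => xor (b q) (aux (some m) q)) QState.zeroKet (χ (some m)) := by
    intro b
    rw [mapDomain_involutive_apply hinv, isProd_init (a := a)]
    have e1 : hi ρ (fun q => xor (b q) (aux (some m) q)) = hi ρ b := by
      funext q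
      have : ρ q.1 ≠ 3 := fun h => notMem_ρ (r := 3) (by norm_num) (by norm_num) ⟨_, h⟩
      simp [hi, aux, this]
    rw [e1]
    congr 1
    refine χ_congr fun q _ _ => ?_
    simp only [aux]
    cases b q <;> simp
  have := hP.nE ρ_injective (χ_indep _)
  rw [nE_mapDomain hinv, nE_gate, nE_zeroKet, one_mul] at this
  exact this.symm

/-- The embedded memory. -/
structure Rep (b β : ℕ) (m : Option (Bits a)) (s : QState × List QState) (w : Vars)
    (s' : QState × List QState) : Prop where
  a_eq : w 1 = a
  b_eq : w 2 = b
  one : w vOne = 1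
  zero : w vZero = 0
  cap : w 9 = β
  prod : IsProd ρ s'.1 s.1 (χ m)

theorem encodeBot_none {b : ℕ} (i : Fin b) : encodeBot (none : Option (Bits b)) i.castSucc = false :=
  Fin.snoc_castSucc (α := fun _ => Bool) true (fun _ => false) i

theorem encodeBot_some {b : ℕ} (y : Bits b) (i : Fin b) : encodeBot (some y) i.castSucc = y i :=
  Fin.snoc_castSucc (α := fun _ => Bool) false y i

/-- The oracle seen by the embedded program. -/
theorem isProd_query {b : ℕ} {m : Option (Bits a)} {ψ' ψ : QState} (h : IsProd ρ ψ' ψ (χ m))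
    (B : Finset (Bits a)) (g : Bits a → Bits b) :
    IsProd ρ ((standardOracle (fun x => encodeBot (blind B g x))
      (ψ'.mapDomain (swapMap (1, b) (2, 0)))).mapDomain (swapMap (1, b) (2, 0)))
      (standardOracle (blind0 B g) ψ) (χ m) := by
  intro c
  have hs := swapMap_involutive (1, b) (2, 0)
  rw [mapDomain_involutive_apply hs, standardOracle_eq,
    mapDomain_involutive_apply (oracleMap_involutive _), mapDomain_involutive_apply hs, h,
    standardOracle_eq, mapDomain_involutive_apply (oracleMap_involutive _)]
  have hr : readReg regX a (swapMap (1, b) (2, 0) c) = readReg regX a c := by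
    funext i
    simp only [readReg, swapMap]
    rw [Equiv.swap_apply_of_ne_of_ne (by simp) (by simp)]
  have hr' : readReg regX a (hi ρ c) = readReg regX a c := by
    funext i
    simp [readReg, hi, ρ]
  congr 1
  · congr 1
    funext q
    simp only [hi, swapMap]
    have hq2 : ((ρ q.1, q.2) : Qubit) ≠ (2, 0) := by
      intro h'
      rw [Prod.mk.injEq] at h'
      exact notMem_ρ (r := 2) le_rfl (by norm_num) ⟨_, h'.1⟩
    by_cases hq : q = (1, b)
    -- During the query the qubit (1, b), which is ordinary workspace for the embedded program, is
    -- parked at (2, 0) and is therefore left unchanged.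
    · subst hq
      have e : ((ρ 1, b) : Qubit) = (1, b) := by simp [ρ]
      simp only [e, Equiv.swap_apply_left]
      rw [oracleMap_apply, oracleMap_apply]
      simp [swapMap, hi, e]
    · have hq1 : ((ρ q.1, q.2) : Qubit) ≠ (1, b) := by
        intro h'
        apply hq
        rw [Prod.mk.injEq] at h'
        refine Prod.ext (ρ_injective ?_) h'.2
        rw [h'.1]; rfl
      rw [Equiv.swap_apply_of_ne_of_ne hq1 hq2, oracleMap_apply, oracleMap_apply, hr, hr']
      have hρ1 : ρ q.1 = 1 ↔ q.1 = 1 := by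
        constructor
        · intro h'
          exact ρ_injective (h'.trans rfl)
        · intro h'; rw [h']; rfl
      simp only [swapMap]
      rw [Equiv.swap_apply_of_ne_of_ne hq1 hq2]
      by_cases h1 : q.1 = 1
      · by_cases h2 : q.2 < b
        · rw [dif_pos ⟨hρ1.2 h1, by simpa using by omega⟩, dif_pos ⟨h1, h2⟩]
          have hq' : (hi ρ c q) = c (ρ q.1, q.2) := rfl
          rw [hq']
          congr 1
          have hcast : (⟨q.2, by omega⟩ : Fin (b + 1)) = Fin.castSucc ⟨q.2, h2⟩ := rfl
          unfold blind blind0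
          rw [hcast]
          split_ifs
          · exact encodeBot_none _
          · exact encodeBot_some _ _
        · have h3 : q.2 ≠ b := fun h' => hq (Prod.ext h1 h')
          rw [dif_neg (by simp only [not_and, not_lt]; intro _; omega),
            dif_neg (by simp only [not_and, not_lt]; intro _; omega)]
          rfl
      · rw [dif_neg (by simp only [not_and]; exact fun h' => (h1 (hρ1.1 h')).elim),
          dif_neg (by simp [h1])]
        rfl
  -- The flag is added to the qubit that `χ` ignores, and no other qubit outside the embedded
  -- registers is touched.
  · refine χ_congr fun q hq hq2 => ?_
    have hq1 : q ≠ (1, b) := by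
      rintro rfl
      exact hq ⟨1, rfl⟩
    simp only [swapMap]
    rw [Equiv.swap_apply_of_ne_of_ne hq1 hq2, oracleMap_apply]
    have : q.1 ≠ 1 := fun h' => hq ⟨1, h'.symm ▸ rfl⟩
    rw [dif_neg (by simp [this])]
    simp only [swapMap]
    rw [Equiv.swap_apply_of_ne_of_ne hq1 hq2]

theorem wp_gadget {b d : ℕ} (O : Oracle a d) (f : Vars → QState × List QState → ℝ≥0∞) (w : Vars)
    (hb : w 2 = b) (hz : w vZero = 0) (s : QState × List QState) :
    wp (pureMem O) id gadget f w s = expect O fun g => f w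
      ((standardOracle g (s.1.mapDomain (swapMap (1, b) (2, 0)))).mapDomain
        (swapMap (1, b) (2, 0)), s.2 ++ [s.1.mapDomain (swapMap (1, b) (2, 0))]) := by
  have hsw : ∀ c, (swap3 ⟨1, 2⟩ ⟨2, vZero⟩).ev bGates w c = swapMap (1, b) (2, 0) c := by
    intro c
    rw [ev_swap3 _ _ _ (by simp), hb, hz]
  have hv : (swap3 ⟨1, 2⟩ ⟨2, vZero⟩).vev w = w := rfl
  simp only [gadget]
  rw [wp, Cmd.wp_rev O (swap3_rev _ _), wp, hv, funext hsw]
  simp only [wp, pureMem]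
  congr 1
  funext g
  have := Cmd.wp_rev O (swap3_rev ⟨1, 2⟩ ⟨2, vZero⟩) f w
    (standardOracle g (s.1.mapDomain (swapMap (1, b) (2, 0))))
    (s.2 ++ [s.1.mapDomain (swapMap (1, b) (2, 0))])
  rw [hv, funext hsw] at this
  exact this

theorem rep_sim {b β : ℕ} (O : Oracle a b) (B : Finset (Bits a)) (m : Option (Bits a)) :
    emb.Sim (pureMem (O.map (blind0 B))) (O.map fun g x => encodeBot (blind B g x)) β 1
      (fun q o s => (project q o s.1, s.2)) (Rep b β m) where
  inj := fun x y h => by simpa [emb] using h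
  tmp := by rintro ⟨x, hx⟩; simp [emb] at hx
  tick _ := rfl
  frame := by
    rintro s w w' s' ⟨h1, h2, h3, h4, h5, h6⟩ hw
    have hw' : ∀ y, y < 10 → w' y = w y := by
      intro y hy
      refine hw y ?_ ?_
      · rintro ⟨x, hx⟩
        simp only [emb] at hx
        omega
      · simp only [emb]; omega
    exact ⟨by rw [hw' _ (by norm_num), h1], by rw [hw' _ (by norm_num), h2],
      by rw [hw' _ (by norm_num), h3], by rw [hw' _ (by norm_num), h4],
      by rw [hw' _ (by norm_num), h5], h6⟩
  cap_eq := fun _ _ _ h => h.cap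
  gate := fun _ _ _ g q h => { h with prod := h.prod.gate ρ_injective (χ_indep m) g q }
  cnot := fun _ _ _ q t h => { h with prod := h.prod.cnot ρ_injective (χ_indep m) q t }
  toffoli := fun _ _ _ q q' t h => { h with prod := h.prod.toffoli ρ_injective (χ_indep m) q q' t }
  meas _ _ _ := rfl
  proj := fun _ _ _ q o h => { h with prod := h.prod.project q o }
  query := by
    intro v f f' s w s' hw h hf
    change 1 * _ ≤ wp (pureMem _) id gadget f' w s'
    rw [one_mul, wp_gadget _ f' w h.b_eq h.zero]
    simp only [pureMem, expect_map]
    refine expect_mono _ fun g => ?_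
    have := hf (standardOracle (blind0 B g) s.1, s.2 ++ [s.1]) w
      ((standardOracle (fun x => encodeBot (blind B g x))
      (s'.1.mapDomain (swapMap (1, b) (2, 0)))).mapDomain (swapMap (1, b) (2, 0)),
        s'.2 ++ [s'.1.mapDomain (swapMap (1, b) (2, 0))]) hw
      { h with prod := isProd_query h.prod B g }
    rwa [one_mul] at this

/-- After the projection the message register shows m in every surviving basis state, so copying it
amounts to writing the fixed string m and creates no entanglement. -/
theorem isProd_store {m : Bits a} {ψ' ψ : QState} (h : IsProd ρ ψ' ψ (χ (none : Option (Bits a)))) :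
    IsProd ρ ((projReg regX a m ψ').mapDomain (copyReg 0 3 a)) (projReg regX a m ψ)
      (χ (some m)) := by
  intro b
  rw [mapDomain_involutive_apply (copyReg_involutive (by norm_num) _),
    show (projReg regX a m ψ') (copyReg 0 3 a b) = _ from h.projReg regX a m _]
  have e1 : hi ρ (copyReg 0 3 a b) = hi ρ b := by
    funext q
    have : ρ q.1 ≠ 3 := fun h => notMem_ρ (r := 3) (by norm_num) (by norm_num) ⟨_, h⟩
    simp [hi, copyReg, this]
  rw [e1]
  by_cases hb : readReg regX a (hi ρ b) = m
  · congr 1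
    refine χ_congr fun q hq hq2 => ?_
    simp only [copyReg, aux]
    by_cases h3 : q.1 = 3 ∧ q.2 < a
    · rw [if_pos h3, dif_pos h3]
      have : m ⟨q.2, h3.2⟩ = b (0, q.2) := by
        rw [← hb]; rfl
      rw [this]
      cases b q <;> cases b (0, q.2) <;> simp
    · rw [if_neg h3, dif_neg h3]
  · have : projReg regX a m ψ (hi ρ b) = 0 := by rw [projReg_apply, if_neg hb]
    rw [this, zero_mul, zero_mul]

theorem wp_store {b d β : ℕ} (O : Oracle a d)
    (f : Bits a → Vars → QState × List QState → ℝ≥0∞)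
    (f' : Vars → QState × List QState → ℝ≥0∞) (v : Vars)
    (s : QState × List QState) (w : Vars) (s' : QState × List QState)
    (hw : ∀ x, w (emb.σ x) = v x) (h : Rep b β (none : Option (Bits a)) s w s')
    (hf : ∀ x w' t, (∀ y, w' (emb.σ y) = v y) →
      Rep b β (some x) (projReg regX a x s.1, s.2) w' t → f x v (projReg regX a x s.1, s.2) ≤ f' w' t) :
    ∑ x, f x v (projReg regX a x s.1, s.2) ≤ wp (pureMem O) id store f' w s' := by
  unfold store
  rw [wp]
  refine wp_forUp_measure O (by norm_num) (by norm_num) (by norm_num) (by norm_num) h.one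
    h.a_eq _ s'.1 s'.2 _ fun x w' hw' => ?_
  have hw1 : ∀ y, y < 11 → w' y = w y := fun y hy => hw' y (by omega) (by omega)
  rw [Cmd.wp_rev O (copyProg_rev _ _ _ _), ev_copyProg (by norm_num) (by norm_num) (by norm_num)
    (by rw [hw1 _ (by norm_num), h.one])]
  have hv : ∀ y, y ≠ 11 → (copyProg 11 1 0 3).vev w' y = w' y :=
    fun y hy => (copyProg_writes 11 1 0 3).vev_eq (by simpa using hy) w'
  refine hf x _ _ (fun y => ?_) ⟨?_, ?_, ?_, ?_, ?_, ?_⟩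
  · have h1 : emb.σ y ≠ 11 := by simp only [emb]; omega
    have h2 : emb.σ y ≠ 12 := by simp only [emb]; omega
    rw [hv _ h1, hw' _ h1 h2, hw]
  · rw [hv _ (by norm_num), hw1 _ (by norm_num), h.a_eq]
  · rw [hv _ (by norm_num), hw1 _ (by norm_num), h.b_eq]
  · rw [hv _ (by norm_num), hw1 _ (by norm_num), h.one]
  · rw [hv _ (by norm_num), hw1 _ (by norm_num), h.zero]
  · rw [hv _ (by norm_num), hw1 _ (by norm_num), h.cap]
  · rw [hw1 1 (by norm_num), h.a_eq]
    exact isProd_store h.prod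

/-- Register 3 shows m in every basis state of the support, so after the swap the projection onto m
removes nothing; the tag register is not affected by the swap. -/
theorem nE_restore {b : ℕ} {m : Bits a} {ψ' ψ : QState} (h : IsProd ρ ψ' ψ (χ (some m)))
    (t : Bits b) :
    nE (projReg regY b t (projReg regX a m (ψ'.mapDomain (swapReg 0 3 a))))
      = nE (projReg regY b t ψ) := by
  have hinv := swapReg_involutive 0 3 a
  have e : projReg regY b t (projReg regX a m (ψ'.mapDomain (swapReg 0 3 a)))
      = (projReg regY b t ψ').mapDomain (swapReg 0 3 a) := by
    ext c
    rw [projReg_apply, projReg_apply, mapDomain_involutive_apply hinv,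
      mapDomain_involutive_apply hinv, projReg_apply]
    have h1 : readReg regY b (swapReg 0 3 a c) = readReg regY b c := by
      funext i
      simp only [readReg, swapReg]
      split_ifs
      · rw [Equiv.swap_apply_of_ne_of_ne (by norm_num) (by norm_num)]
      · rfl
    rw [h1]
    by_cases ht : readReg regY b c = t
    · rw [if_pos ht, if_pos ht]
      split_ifs with hm
      · rfl
      · symm
        rw [h]
        apply mul_eq_zero_of_right
        unfold χ
        rw [if_neg]
        intro hall
        apply hm
        funext i
        have := hall (3, i) (notMem_ρ (by norm_num) (by norm_num)) (by simp)
        simpa [swapReg, aux, readReg] using this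
    · rw [if_neg ht, if_neg ht]
  rw [e, nE_mapDomain hinv]
  have := h.projReg regY b t
  rw [show ρ regY = regY from rfl] at this
  rw [this.nE ρ_injective (χ_indep _), sqNorm_some, mul_one]

theorem setup_det (c : ℕ) : (setup c).Det :=
  ⟨sizeProg_classical.rev.det, (powProg_classical 9 c).rev.det, trivial, trivial, trivial, trivial⟩

theorem setup_vev (c : ℕ) (v : Vars) (hz : v vZero = 0) :
    (setup c).vev v vOne = 1 ∧ (setup c).vev v vZero = 0 ∧
    (setup c).vev v 1 = v 1 ∧ (setup c).vev v 2 = v 2 ∧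
    (setup c).vev v 9 = (2 ^ lg (v 0)) ^ c ∧
    (setup c).vev v 40 = v 0 ∧ (setup c).vev v 41 = v 1 ∧ (setup c).vev v 42 = v 2 ∧
    ∀ y, 43 ≤ y → (setup c).vev v y = v y := by
  obtain ⟨h1, h2, h3⟩ := sizeProg_vev v
  have hs : ∀ y, y ∉ ({vOne, vT, vN, vP, vL} : Set ℕ) → sizeProg.vev v y = v y := fun y hy =>
    sizeProg_writes.vev_eq hy v
  set w := sizeProg.vev v with hw
  have hp : ∀ y, y ∉ ({vT, 9} : Set ℕ) → (powProg 9 c).vev w y = w y := fun y hy =>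
    (powProg_writes 9 c).vev_eq hy w
  have hz' : w vZero = 0 := by rw [hs _ (by simp), hz]
  have h9 := powProg_vev 9 c (by norm_num) w hz'
  set u := (powProg 9 c).vev w with hu
  have e : (setup c).vev v = (Cmd.add 42 2 vZero).vev ((Cmd.add 41 1 vZero).vev
    ((Cmd.add 40 0 vZero).vev u)) := rfl
  have hu0 : ∀ y, y ∉ ({vT, 9} : Set ℕ) → y ∉ ({vOne, vT, vN, vP, vL} : Set ℕ) → u y = v y :=
    fun y h h' => by rw [hp y h, hs y h']
  rw [e]
  simp only [Cmd.vev]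
  have u0 : u 0 = v 0 := hu0 0 (by simp) (by simp)
  have u1 : u 1 = v 1 := hu0 1 (by simp) (by simp)
  have u2 : u 2 = v 2 := hu0 2 (by simp) (by simp)
  have u4 : u vZero = 0 := by rw [hu0 vZero (by simp) (by simp), hz]
  have u3 : u vOne = 1 := by rw [hp vOne (by simp), h1]
  refine ⟨?_, ?_, ?_, ?_, ?_, ?_, ?_, ?_, fun y hy => ?_⟩
  · simpa using u3
  · simpa using u4
  · simpa using u1
  · simpa using u2
  · simpa [h2] using h9
  · simp [u0, u4]
  · simp [u1, u4]
  · simp [u2, u4]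
  · rw [Function.update_of_ne (by omega), Function.update_of_ne (by omega),
      Function.update_of_ne (by omega)]
    refine hu0 y ?_ ?_ <;> simp [vOne, vT, vN, vP, vL] <;> omega

theorem setup_ev (c : ℕ) (v : Vars) (hz : v vZero = 0) (ψ : QState) :
    (setup c).ev qGates v ψ = applyGate1 .H (2, 0) ψ := by
  have hz' : ((Cmd.add 42 2 vZero).vev ((Cmd.add 41 1 vZero).vev
    ((Cmd.add 40 0 vZero).vev ((powProg 9 c).vev (sizeProg.vev v))))) vZero = 0 := by
    have e : (setup c).vev v = (Cmd.add 42 2 vZero).vev ((Cmd.add 41 1 vZero).vev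
      ((Cmd.add 40 0 vZero).vev ((powProg 9 c).vev (sizeProg.vev v)))) := rfl
    rw [← e]
    exact (setup_vev c v hz).2.1
  simp only [setup, Cmd.ev]
  rw [Cmd.ev_classical _ sizeProg_classical, Cmd.ev_classical _ (powProg_classical 9 c), hz']
  rfl

/-- The value of the blind forger's game is at least that of the embedded run. -/
theorem forger_value {b β c : ℕ} (O : Oracle a b) (B : Finset (Bits a)) (A₁ A₂ : Cmd) (n : ℕ)
    (hβ : (2 ^ lg n) ^ c = β) (acc : Bits a → Bits b → ℝ≥0∞) :
    twoPhase (pureMem (O.map (blind0 B))) (fun k => min k β) A₁ A₂ pureProj (fun x m =>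
        ∑ t, nE (projReg regY b t m.1) * acc x t) (inputVars [n, a, b]) (QState.zeroKet, [])
      ≤ wp (pureMem (O.map fun g x => encodeBot (blind B g x))) id (forger c A₁ A₂)
        (fun _ m => ∑ x, ∑ t, nE (projReg regY b t (projReg regX a x m.1)) * acc x t)
        (inputVars [n, a, b]) (QState.zeroKet, []) := by
  unfold forger twoPhase
  have hz : inputVars [n, a, b] vZero = 0 := rfl
  obtain ⟨h1, h2, h3, h4, h5, h6, h7, h8, h9⟩ := setup_vev c (inputVars [n, a, b]) hz
  rw [wp, Cmd.wp_det _ (setup_det c), setup_ev c _ hz, wp]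
  have key := (rep_sim (β := β) O B (none : Option (Bits a))).le A₁
    (fun v m => ∑ x, wp (pureMem (O.map (blind0 B))) (fun k => min k β) A₂
      (fun _ m => ∑ t, nE (projReg regY b t m.1) * acc x t) v (pureProj x m))
    (wp (pureMem (O.map fun g x => encodeBot (blind B g x))) id
      (.seq store (.seq (emb.compile A₂) restore))
      fun _ m => ∑ x, ∑ t, nE (projReg regY b t (projReg regX a x m.1)) * acc x t)
    (by
      intro v m w m' hw hR
      rw [one_mul, wp]
      refine wp_store _ (fun x v m => wp (pureMem (O.map (blind0 B))) (fun k => min k β) A₂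
        (fun _ m => ∑ t, nE (projReg regY b t m.1) * acc x t) v m) _ v m w m' hw hR ?_
      intro x w' t hw' hR'
      rw [wp]
      have key2 := (rep_sim (β := β) O B (some x)).le A₂
        (fun _ m => ∑ t, nE (projReg regY b t m.1) * acc x t)
        (wp (pureMem (O.map fun g x => encodeBot (blind B g x))) id restore
          fun _ m => ∑ x, ∑ t, nE (projReg regY b t (projReg regX a x m.1)) * acc x t)
        (by
          intro v m w m' hw hR
          rw [one_mul]
          unfold restore
          rw [Cmd.wp_rev _ (swapProg_rev _ _ _ _), ev_swapProg (by norm_num) (by norm_num)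
            (by norm_num) hR.one, hR.a_eq]
          -- The final measurement of the message returns the stored message, so its term alone
          -- carries the value.
          refine le_trans (le_of_eq ?_) (Finset.single_le_sum (f := fun y => ∑ t,
            nE (projReg regY b t (projReg regX a y (m'.1.mapDomain (swapReg 0 3 a)))) * acc y t)
            (fun _ _ => zero_le) (Finset.mem_univ x))
          exact Finset.sum_congr rfl fun t _ => by rw [nE_restore hR.prod])
        v (projReg regX a x m.1, m.2) w' t hw' hR'
      rwa [one_mul] at key2)
    (inputVars [n, a, b]) (QState.zeroKet, []) ((setup c).vev (inputVars [n, a, b]))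
    (applyGate1 .H (2, 0) QState.zeroKet, [])
    (by
      intro x
      simp only [emb]
      rcases x with _ | _ | _ | x
      · exact h6
      · exact h7
      · exact h8
      · rw [h9 _ (by omega)]
        simp [inputVars])
    ⟨h3, h4, h1, h2, h5.trans hβ, isProd_init⟩
  rwa [one_mul] at key

/-! ### Running time -/

theorem rest_capped (A₁ A₂ : Cmd) : Capped {1, 9}
    (.seq (emb.compile A₁) (.seq store (.seq (emb.compile A₂) restore))) := by
  have hc : ∀ A, Capped {1, 9} (emb.compile A) := by
    intro A
    refine emb.capped_compile (fun x => ?_) (by simp [emb]) (by simp [emb]) ?_ A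
    · simp [emb]
    · simp only [emb, gadget, swap3]
      repeat' constructor
  refine .seq (hc _) (.seq ?_ (.seq (hc _) ?_))
  · refine .seq (capped_forUp (by simp) (by simp) (.measure (by simp)))
      (capped_forUp (by simp) (by simp) .cnot)
  · refine capped_forUp (by simp) (by simp) ?_
    simp only [swap3]
    repeat' constructor

def time (c : ℕ) (A₁ A₂ : Cmd) (n V : ℕ) : ℕ :=
  5 + (1 + (n + 2) * 6) + (powCost (2 ^ lg n) c + (1 + (1 + (1 + 1)))) +
    (Cmd.seq (emb.compile A₁) (.seq store (.seq (emb.compile A₂) restore))).cost V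

theorem timeB_forger (c : ℕ) (A₁ A₂ : Cmd) (n : ℕ) (v : Vars) (hn : v 0 = n) (hz : v vZero = 0)
    {V : ℕ} (h1 : v 1 ≤ V) (h9 : (2 ^ lg n) ^ c ≤ V) :
    TimeB (forger c A₁ A₂) v (time c A₁ A₂ n V) := by
  obtain ⟨s1, s2, s3⟩ := sizeProg_vev v
  have single : ∀ {p : Cmd} {w : Vars}, Capped ∅ p → TimeB p w (p.cost 0) := fun h =>
    h.timeB (by simp)
  refine TimeB.seq (setup_det c) ?_ ?_
  · refine TimeB.seq sizeProg_classical.rev.det (hn ▸ sizeProg_time v) ?_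
    refine TimeB.seq (powProg_classical 9 c).rev.det ?_ ?_
    · have := powProg_time 9 c (by norm_num) (sizeProg.vev v)
        (by rw [sizeProg_writes.vev_eq (by simp)]; exact hz)
      rwa [s2, hn] at this
    · exact single (by repeat' constructor
                       all_goals simp)
  · refine (rest_capped A₁ A₂).timeB ?_
    obtain ⟨_, _, e3, _, e5, _⟩ := setup_vev c v hz
    intro x hx
    rcases hx with rfl | rfl
    · rw [e3]; exact h1
    · rw [e5, hn]; exact h9

theorem polyBdd_time (c : ℕ) (A₁ A₂ : Cmd) {V : ℕ → ℕ} (hV : PolyBdd V) :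
    PolyBdd fun n => time c A₁ A₂ n (V n) := by
  unfold time
  exact (((PolyBdd.const 5).add ((PolyBdd.const 1).add
    ((PolyBdd.id.add (PolyBdd.const 2)).mul (PolyBdd.const 6)))).add
    ((polyBdd_powCost polyBdd_two_pow_lg c).add (PolyBdd.const 4))).add (polyBdd_cost _ hV)

end Forger

/-! ## Negligible functions -/

theorem pow_add_two_le {n : ℕ} (hn : 2 ≤ n) (c : ℕ) : ((n : ℝ) + 2) ^ c ≤ (n : ℝ) ^ (2 * c) := by
  rw [pow_mul]
  have : (2 : ℝ) ≤ n := by exact_mod_cast hn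
  exact pow_le_pow_left₀ (by positivity) (by nlinarith) c

/-- Beating every inverse power of n is the same as staying bounded after multiplication by any
polynomially bounded factor. In this form polynomial losses in a reduction are moved into the
factor. -/
theorem negligible_iff {f : ℕ → ℝ} : Negligible f ↔
    ∀ g : ℕ → ℕ, PolyBdd g → ∀ᶠ n in Filter.atTop, (g n : ℝ) * f n ≤ 1 := by
  constructor
  · rintro hf g ⟨c, hc⟩
    filter_upwards [hf (2 * c), Filter.eventually_ge_atTop 2] with n h1 h2
    have h3 : (g n : ℝ) ≤ (n : ℝ) ^ (2 * c) := by
      refine le_trans ?_ (pow_add_two_le h2 c)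
      exact_mod_cast hc n
    have hn : (0 : ℝ) < n := by exact_mod_cast (by omega : 0 < n)
    calc (g n : ℝ) * f n ≤ (g n : ℝ) * (1 / (n : ℝ) ^ (2 * c)) := by gcongr
      _ ≤ (n : ℝ) ^ (2 * c) * (1 / (n : ℝ) ^ (2 * c)) := by gcongr
      _ = 1 := by field_simp
  · intro h c
    filter_upwards [h (fun n => n ^ c) (PolyBdd.id.pow c), Filter.eventually_gt_atTop 0]
      with n h1 h2
    have hn : (0 : ℝ) < n := by exact_mod_cast h2
    rw [le_div_iff₀ (by positivity), mul_comm]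
    exact_mod_cast h1

/-! ## The probability of blinding -/

def mulConst (x y : ℕ) : ℕ → Cmd
  | 0 => .const x 0
  | e + 1 => .seq (mulConst x y e) (.add x x y)

theorem mulConst_classical (x y e : ℕ) : (mulConst x y e).IsClassical := by
  induction e with
  | zero => trivial
  | succ e ih => exact ⟨ih, trivial⟩

theorem mulConst_writes (x y e : ℕ) : (mulConst x y e).Writes {x} := by
  induction e with
  | zero => rfl
  | succ e ih => exact ⟨ih, rfl⟩

theorem mulConst_vev {x y : ℕ} (h : y ≠ x) (e : ℕ) (v : Vars) :
    (mulConst x y e).vev v x = e * v y := by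
  induction e with
  | zero => simp [mulConst, Cmd.vev]
  | succ e ih =>
    simp only [mulConst, Cmd.vev, Function.update_self, ih]
    rw [(mulConst_writes x y e).vev_eq (by simpa using h)]
    ring

theorem mulConst_time (x y e : ℕ) (v : Vars) : TimeB (mulConst x y e) v (e + 1) := by
  induction e with
  | zero => exact (Capped.const (S := ∅) (by simp)).timeB (V := 0) (by simp)
  | succ e ih =>
    refine TimeB.seq (mulConst_classical x y e).rev.det ih ?_
    exact (Capped.add (S := ∅) (by simp)).timeB (V := 0) (by simp)

/-- `1 / P ^ e`, where `P` is the power of two above `n`. -/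
def epsPow (e n : ℕ) : unitInterval :=
  ⟨1 / ((2 : ℝ) ^ lg n) ^ e, by positivity, by
    rw [div_le_one (by positivity)]
    exact one_le_pow₀ (one_le_pow₀ (by norm_num))⟩

def epsTail : Cmd :=
  .seq (.sub 11 10 1) (.cond 11 (.const 0 0)
    (.seq (.sub 12 1 10) (.seq (.const 0 1) (.loop 12 (.add 0 0 0)))))

def epsProg (e : ℕ) : Cmd := .seq sizeProg (.seq (mulConst 10 vL e) epsTail)

theorem Cmd.vev_cond_pos {x : ℕ} {p q : Cmd} {v : Vars} (h : v x ≠ 0) :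
    (Cmd.cond x p q).vev v = p.vev v := by rw [Cmd.vev, if_pos h]

theorem Cmd.vev_cond_neg {x : ℕ} {p q : Cmd} {v : Vars} (h : v x = 0) :
    (Cmd.cond x p q).vev v = q.vev v := by rw [Cmd.vev, if_neg (not_not.2 h)]

theorem vev_double_iterate (k : ℕ) (v : Vars) :
    ((Cmd.add 0 0 0).vev^[k] v) 0 = v 0 * 2 ^ k := by
  induction k with
  | zero => simp
  | succ k ih =>
    have h : ∀ w : Vars, (Cmd.add 0 0 0).vev w 0 = w 0 + w 0 := fun w => by simp [Cmd.vev]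
    rw [Function.iterate_succ_apply', h, ih]
    ring

/-- The probability is 2^(−e lg n). With k ≥ e lg n bits of precision the numerator is an exact
power of two; with fewer bits the probability is below 2^(−k) and zero is a sufficient
approximation. -/
theorem epsProg_vev (e n k : ℕ) :
    (epsProg e).vev (inputVars [n, k]) 0 = if k < e * lg n then 0 else 2 ^ (k - e * lg n) := by
  obtain ⟨_, _, h3⟩ := sizeProg_vev (inputVars [n, k])
  set w := sizeProg.vev (inputVars [n, k]) with hw
  have hw1 : w 1 = k := sizeProg_writes.vev_eq (by simp) _
  set u := (mulConst 10 vL e).vev w with hu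
  have hu10 : u 10 = e * lg n := by rw [hu, mulConst_vev (by norm_num), h3]; rfl
  have hu1 : u 1 = k := by rw [hu, (mulConst_writes 10 vL e).vev_eq (by simp), hw1]
  have e1 : (epsProg e).vev (inputVars [n, k]) = epsTail.vev u := rfl
  rw [e1]
  set t := (Cmd.sub 11 10 1).vev u with ht
  have t11 : t 11 = e * lg n - k := by simp [ht, Cmd.vev, hu10, hu1]
  have t10 : t 10 = e * lg n := by simp [ht, Cmd.vev, hu10]
  have t1 : t 1 = k := by simp [ht, Cmd.vev, hu1]
  by_cases h : k < e * lg n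
  · rw [if_pos h, show epsTail.vev u = (Cmd.cond 11 _ _).vev t from rfl,
      Cmd.vev_cond_pos (by omega)]
    simp [Cmd.vev]
  · rw [if_neg h, show epsTail.vev u = (Cmd.cond 11 _ _).vev t from rfl,
      Cmd.vev_cond_neg (by omega)]
    have e2 := vev_double_iterate (k - e * lg n)
      (Function.update (Function.update t 12 (t 1 - t 10)) 0 1)
    simp only [Function.update_self, one_mul] at e2
    refine Eq.trans ?_ e2
    simp [Cmd.vev, t1, t10]

theorem epsProg_time (e n k : ℕ) : TimeB (epsProg e) (inputVars [n, k])
    (5 + (1 + (n + 2) * 6) + ((e + 1) + (1 + (1 + 1 + (1 + (1 + (1 + k * 2))))))) := by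
  refine TimeB.seq sizeProg_classical.rev.det (sizeProg_time _) ?_
  refine TimeB.seq (mulConst_classical _ _ _).rev.det (mulConst_time _ _ _ _) ?_
  set u := (mulConst 10 vL e).vev (sizeProg.vev (inputVars [n, k])) with hu
  have hu1 : u 1 = k := by
    rw [hu, (mulConst_writes 10 vL e).vev_eq (by simp), sizeProg_writes.vev_eq (by simp)]
    rfl
  refine TimeB.seq trivial ((Capped.sub (S := ∅) (by simp)).timeB (V := 0) (by simp)) ?_
  have htail : TimeB (.seq (.sub 12 1 10) (.seq (.const 0 1) (.loop 12 (.add 0 0 0))))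
      ((Cmd.sub 11 10 1).vev u) (1 + (1 + (1 + k * 2))) := by
    refine TimeB.seq trivial ((Capped.sub (S := ∅) (by simp)).timeB (V := 0) (by simp)) ?_
    refine TimeB.seq trivial ((Capped.const (S := ∅) (by simp)).timeB (V := 0) (by simp)) ?_
    refine (Capped.loop (S := {12}) (by simp) (.add (by simp))).timeB (V := k) ?_
    intro x hx
    rw [Set.mem_singleton_iff] at hx
    subst hx
    simp [Cmd.vev, hu1]
  intro a d O s hs s' h'
  rw [Cmd.run] at h'
  split_ifs at h'
  · have := (Capped.const (S := ∅) (x := 0) (k := 0) (by simp)).timeB (v := s.vars) (V := 0)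
      (by simp) a d O s.tick rfl s' h'
    simp only [Cmd.cost, State.tick] at this
    omega
  · have := htail a d O s.tick (by rw [← hs]; rfl) s' h'
    simp only [State.tick] at this
    omega

theorem efficientlyComputable_epsPow (e : ℕ) :
    EfficientlyComputable fun n => (epsPow e n : ℝ) := by
  refine ⟨epsProg e, ?_, 7 * (Polynomial.X + 2) + Polynomial.C (e + 16) + 2 * Polynomial.X, ?_⟩
  · exact ⟨sizeProg_classical, mulConst_classical _ _ _, by
      simp [epsTail, Cmd.IsClassical]⟩
  intro n k s hs
  have hdet : (epsProg e).Det := ⟨sizeProg_classical.rev.det, (mulConst_classical _ _ _).rev.det,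
    by simp [epsTail, Cmd.Det]⟩
  refine ⟨?_, ?_⟩
  · have := epsProg_time e n k _ _ _ (State.init [n, k]) rfl s hs
    simp only [State.init] at this
    simp
    omega
  · rw [det_run _ hdet _ _ hs]
    have : (epsProg e).vev (State.init [n, k]).vars 0
        = if k < e * lg n then 0 else 2 ^ (k - e * lg n) := epsProg_vev e n k
    rw [this]
    simp only [epsPow, ← pow_mul, mul_comm (lg n) e]
    split_ifs with h
    · rw [Nat.cast_zero, zero_div, sub_zero, abs_of_nonneg (by positivity)]
      exact one_div_le_one_div_of_le (by positivity)
        (pow_le_pow_right₀ (by norm_num) h.le)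
    · push Not at h
      have e1 : (2 : ℝ) ^ k = 2 ^ (e * lg n) * 2 ^ (k - e * lg n) := by
        rw [← pow_add]; congr 1; omega
      have e2 : (1 : ℝ) / 2 ^ (e * lg n) - ((2 ^ (k - e * lg n) : ℕ) : ℝ) / 2 ^ k = 0 := by
        rw [e1]
        push_cast
        field_simp
        simp
      rw [e2, abs_zero]
      positivity

/-! ## Blind unforgeability implies generalised existential unforgeability -/

theorem map_and_apply (p : PMF Bool) (c : Bool) :
    (p.map fun acc => acc && c) true = if c then p true else 0 := by
  rw [PMF.map_apply, tsum_bool]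
  cases c <;> simp

theorem ofReal_toReal_apply {α : Type} (p : PMF α) (x : α) :
    ENNReal.ofReal (p x).toReal = p x := ENNReal.ofReal_toReal (p.apply_ne_top x)

namespace MACScheme

variable (F : MACScheme)

theorem blindForge_apply (A : Cmd) (ε : ℕ → unitInterval) (n : ℕ) :
    F.blindForge A ε n true = expect (F.keyGen n) fun k =>
      ∑ B : Finset (Bits (F.msgLen n)), ENNReal.ofReal (bern (ε n : ℝ) B) *
        expect (F.blindRun A n (F.blindedOracle n k B)) fun o =>
          if o.1 ∈ B then F.ver n k o.1 o.2.1 true else 0 := by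
  unfold blindForge
  rw [bind_apply_eq_expect]
  congr 1
  funext k
  rw [bind_apply_eq_expect]
  unfold expect
  rw [tsum_fintype]
  refine Finset.sum_congr rfl fun B _ => ?_
  rw [blindingSet_apply]
  congr 1
  refine (bind_apply_eq_expect _ _ _).trans ?_
  unfold expect
  simp only [map_and_apply, decide_eq_true_eq]

open Classical in
theorem qExGame_apply (A₁ A₂ : Cmd) (n : ℕ) :
    F.qExGame 1 A₁ A₂ n true = expect (F.keyGen n) fun k =>
      expect (F.qExRun A₁ A₂ n (F.evalOracle n k)) fun o =>
        if ∀ ψ ∈ o.2.2.queries, projReg regX (F.msgLen n) o.1 ψ = 0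
          then F.ver n k o.1 o.2.1 true else 0 := by
  unfold qExGame
  rw [bind_apply_eq_expect]
  congr 1
  funext k
  rw [bind_apply_eq_expect]
  congr 1
  funext o
  rw [map_and_apply]
  simp only [decide_eq_true_eq, distinguishable_one_iff]

theorem blindedOracle_eq (n : ℕ) (k : F.Key n) (B : Finset (Bits (F.msgLen n))) :
    F.blindedOracle n k B = (F.evalOracle n k).map fun g x => encodeBot (blind B g x) := by
  unfold blindedOracle evalOracle
  rw [PMF.map_comp]
  rfl

/-- For each key, the honest game is expressed by unnormalised branches, compared with the blinded
games by `honest_le_blinded`, and these are dominated by the compiled forger through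
`Forger.forger_value`. -/
theorem qExGame_le_forger {A₁ A₂ : Cmd} {n T c T' : ℕ}
    (hT : ∀ O, ∀ o ∈ (F.qExRun A₁ A₂ n O).support, o.2.2.steps ≤ T)
    (hc : T ≤ (2 ^ lg n) ^ c)
    (hT' : ∀ O, ∀ o ∈ (F.blindRun (Forger.forger c A₁ A₂) n O).support, o.2.2.steps ≤ T')
    (ε : ℕ → unitInterval) (hε : 0 < (ε n : ℝ)) :
    F.qExGame 1 A₁ A₂ n true ≤ ENNReal.ofReal (3 / (ε n : ℝ)) *
        F.blindForge (Forger.forger c A₁ A₂) ε n true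
      + ENNReal.ofReal (48 * (ε n : ℝ) * (T + 1) ^ 5) := by
  classical
  rw [qExGame_apply, blindForge_apply, ← expect_const_mul,
    ← expect_const (F.keyGen n) (ENNReal.ofReal (48 * (ε n : ℝ) * (T + 1) ^ 5)), ← expect_add]
  refine expect_mono _ fun k => ?_
  set O := F.evalOracle n k
  set β := (2 ^ lg n) ^ c with hβ
  have hcnt : ∀ j ≤ β, min j β = j := fun j hj => min_eq_left hj
  have e1 : expect (F.qExRun A₁ A₂ n O) (fun o =>
        if ∀ ψ ∈ o.2.2.queries, projReg regX (F.msgLen n) o.1 ψ = 0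
          then F.ver n k o.1 o.2.1 true else 0)
      = twoPhase (pureMem O) (fun j => min j β) A₁ A₂ pureProj (fun x m =>
        if m.2.length ≤ T ∧ ∀ φ ∈ m.2, projReg regX (F.msgLen n) x φ = 0 then
          ∑ t, nE (projReg regY (F.tagLen n) t m.1)
            * ENNReal.ofReal (F.ver n k x t true).toReal else 0)
        (inputVars (F.publicInput n)) (QState.zeroKet, []) := by
    have := F.expect_qExRun A₁ A₂ n O hcnt (fun o ho => (hT O o ho).trans hc)
      -- The bound on the number of queries may be added to the winning condition for free, since
      -- queries are steps and the run takes at most T of them.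
      (fun x t l => if l.length ≤ T ∧ ∀ ψ ∈ l, projReg regX (F.msgLen n) x ψ = 0
          then F.ver n k x t true else 0)
    rw [twoPhase]
    refine Eq.trans (expect_congr fun o ho => ?_) (this.trans ?_)
    · have hl : o.2.2.queries.length ≤ T :=
        (F.queries_length_le_of_mem_qExRun ho).trans (hT O o ho)
      simp only [hl, true_and]
    · congr 1
      funext v m
      refine Finset.sum_congr rfl fun x _ => ?_
      congr 1
      funext v m
      split_ifs
      · simp only [ofReal_toReal_apply]
      · simp
  rw [e1]
  refine (honest_le_blinded O hε (ε n).2.2 T (fun j => min j β) A₁ A₂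
    (fun x t => (F.ver n k x t true).toReal) (fun x t => ⟨ENNReal.toReal_nonneg,
      ENNReal.toReal_mono ENNReal.one_ne_top (PMF.coe_le_one _ _)⟩)
    (inputVars (F.publicInput n)) QState.zeroKet).trans ?_
  rw [nS_zeroKet, mul_one]
  gcongr with B _
  have e2 := F.expect_blindRun (Forger.forger c A₁ A₂) n (F.blindedOracle n k B)
    (cnt := id) (fun _ _ => rfl) (hT' _)
    (fun x t _ => if x ∈ B then F.ver n k x t true else 0)
  rw [e2, blindedOracle_eq]
  have := Forger.forger_value (β := β) O B A₁ A₂ n hβ.symm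
    (fun x t => if x ∈ B then F.ver n k x t true else 0)
  refine le_trans (le_of_eq ?_) this
  congr 1
  funext x m
  split_ifs
  · simp only [ofReal_toReal_apply]
  · simp

theorem blindPolyTime_of_bound {A : Cmd} {f : ℕ → ℕ} (hf : PolyBdd f)
    (h : ∀ n, TimeB A (inputVars (F.publicInput n)) (f n)) : F.BlindPolyTime A := by
  obtain ⟨B, hB⟩ := hf.to_poly
  refine ⟨B, fun n O o ho => ?_⟩
  simp only [blindRun, PMF.mem_support_bind_iff, PMF.mem_support_map_iff] at ho
  obtain ⟨s, h1, om, h2, ot, h3, rfl⟩ := ho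
  have := h n _ _ O (State.init (F.publicInput n)) rfl s h1
  simp only [State.init, zero_add] at this
  exact this.trans (hB n)

/-- The blinding probability is fixed only after the polynomial `g` to be beaten: it makes the
additive error small compared with 1/g, and for this inverse polynomial the loss 3/ε is still
absorbed by a negligible forging probability. -/
theorem qgeu_of_bu (h : F.BU) : F.QGEU 1 := by
  intro A₁ A₂ ⟨Bt, hBt⟩
  set T : ℕ → ℕ := fun n => Bt.eval n
  have hTp : PolyBdd T := PolyBdd.of_poly ⟨Bt, fun _ => le_rfl⟩
  obtain ⟨c, hc⟩ := hTp.le_two_pow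
  have hap : PolyBdd F.msgLen := PolyBdd.of_poly F.msgLen_le
  have hV : PolyBdd fun n => F.msgLen n + (2 ^ lg n) ^ c := hap.add (polyBdd_two_pow_lg.pow c)
  have htb : ∀ n, TimeB (Forger.forger c A₁ A₂) (inputVars (F.publicInput n))
      (Forger.time c A₁ A₂ n (F.msgLen n + (2 ^ lg n) ^ c)) := by
    intro n
    refine Forger.timeB_forger c A₁ A₂ n _ rfl rfl ?_ (Nat.le_add_left _ _)
    exact Nat.le_add_right _ _
  have hpt := F.blindPolyTime_of_bound (Forger.polyBdd_time c A₁ A₂ hV) htb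
  rw [negligible_iff]
  intro g hg
  -- 96 = 2 · 48: this choice of ε keeps g times the additive error at most 1/2.
  have hlarge : PolyBdd fun n => 96 * (T n + 1) ^ 5 * g n :=
    (((PolyBdd.const 96).mul ((hTp.add (PolyBdd.const 1)).pow 5))).mul hg
  obtain ⟨e, he⟩ := hlarge.le_two_pow
  -- 6 = 2 · 3: with this factor, g times 3/ε times the forging probability is at most 1/2 as well.
  have hneg := negligible_iff.1 (h (Forger.forger c A₁ A₂) (epsPow e) hpt
    (efficientlyComputable_epsPow e)) (fun n => 6 * g n * (2 ^ lg n) ^ e)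
    (((PolyBdd.const 6).mul hg).mul (polyBdd_two_pow_lg.pow e))
  filter_upwards [hneg] with n hn
  obtain ⟨Bf, hBf⟩ := hpt
  have hP : (0 : ℝ) < (2 ^ lg n) ^ e := by positivity
  have hε : 0 < (epsPow e n : ℝ) := by simp only [epsPow]; positivity
  have key := F.qExGame_le_forger (hBt n) (hc n) (hBf n) (epsPow e) hε
  set W := F.blindForge (Forger.forger c A₁ A₂) (epsPow e) n true
  have hW : W ≠ ⊤ := PMF.apply_ne_top _ _
  have key2 := ENNReal.toReal_mono (by finiteness) key
  rw [ENNReal.toReal_add (by finiteness) (by finiteness), ENNReal.toReal_mul,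
    ENNReal.toReal_ofReal (by positivity), ENNReal.toReal_ofReal (by positivity)] at key2
  have hg0 : (0 : ℝ) ≤ g n := Nat.cast_nonneg _
  have hε' : (epsPow e n : ℝ) = 1 / (2 ^ lg n) ^ e := rfl
  have he' : (96 : ℝ) * (T n + 1) ^ 5 * g n ≤ (2 ^ lg n) ^ e := by exact_mod_cast he n
  have b1 : (g n : ℝ) * (48 * (epsPow e n : ℝ) * (T n + 1) ^ 5) ≤ 1 / 2 := by
    rw [hε']
    have : (g n : ℝ) * (48 * (1 / (2 ^ lg n) ^ e) * (T n + 1) ^ 5)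
      = (96 * (T n + 1) ^ 5 * g n) / (2 ^ lg n) ^ e * (1 / 2) := by ring
    rw [this]
    have := div_le_one_of_le₀ he' hP.le
    linarith
  have b2 : (g n : ℝ) * (3 / (epsPow e n : ℝ) * W.toReal) ≤ 1 / 2 := by
    rw [hε']
    push_cast at hn
    have : (g n : ℝ) * (3 / (1 / (2 ^ lg n) ^ e) * W.toReal)
      = 6 * g n * (2 ^ lg n) ^ e * W.toReal * (1 / 2) := by field_simp; ring
    rw [this]
    linarith
  calc (g n : ℝ) * _ ≤ (g n : ℝ) * (3 / (epsPow e n : ℝ) * W.toReal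
        + 48 * (epsPow e n : ℝ) * (T n + 1) ^ 5) := by gcongr
    _ ≤ 1 := by rw [mul_add]; linarith

end MACScheme

/-! ## A family of hash functions -/

def xorSum (f : ℕ → Bool) : ℕ → Bool
  | 0 => false
  | k + 1 => xor (xorSum f k) (f k)

theorem xorSum_congr {f g : ℕ → Bool} {k : ℕ} (h : ∀ t < k, f t = g t) : xorSum f k = xorSum g k := by
  induction k with
  | zero => rfl
  | succ k ih => rw [xorSum, xorSum, ih fun t ht => h t (by omega), h k (by omega)]

def toZ (b : Bool) : ZMod 2 := if b then 1 else 0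

theorem toZ_xor (b c : Bool) : toZ (xor b c) = toZ b + toZ c := by
  cases b <;> cases c <;> decide

theorem toZ_and (b c : Bool) : toZ (b && c) = toZ b * toZ c := by
  cases b <;> cases c <;> decide

theorem toZ_xorSum (f : ℕ → Bool) (k : ℕ) : toZ (xorSum f k) = ∑ t : Fin k, toZ (f t) := by
  induction k with
  | zero => rfl
  | succ k ih => rw [xorSum, toZ_xor, ih, Fin.sum_univ_castSucc]; rfl

/-- A bit string as a function on all numbers. -/
def ext {n : ℕ} (u : Bits n) (k : ℕ) : Bool := if h : k < n then u ⟨k, h⟩ else false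

theorem ext_val {n : ℕ} (u : Bits n) (k : Fin n) : ext u k = u k := by simp [ext]

/-- The value at `x` of the affine form number `p` given by `L`. -/
def affine (a : ℕ) (L : ℕ → Bool) (p : ℕ) (x : ℕ → Bool) : Bool :=
  xor (xorSum (fun t => L (t + (a + 1) * p) && x t) a) (L (a + (a + 1) * p))

/-- Whether the first `l` forms of block `j` are all true. -/
def bucket (a d : ℕ) (L x : ℕ → Bool) : ℕ → ℕ → Bool
  | 0, _ => true
  | l + 1, j => bucket a d L x l j && affine a L (j + d * l) x

def word (a d l : ℕ) (L T x : ℕ → Bool) (i : ℕ) : Bool :=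
  xorSum (fun j => T (j + d * i) && bucket a d L x l j) d

/-- Used with v the negation of a word bit: the majority is decided by the top bits of threshold and
word if they differ, and by the lower positions otherwise. It needs only XOR and AND, hence CNOT and
Toffoli gates. -/
def maj (z v c : Bool) : Bool := xor (z && v) (xor (z && c) (v && c))

/-- Comparison of `w` with the threshold `z`, least significant bits first. -/
def less (z w : ℕ → Bool) : ℕ → Bool
  | 0 => false
  | i + 1 => maj (z i) (!w i) (less z w i)

theorem less_congr {z w w' : ℕ → Bool} {s : ℕ} (h : ∀ i < s, w i = w' i) : less z w s = less z w' s := by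
  induction s with
  | zero => rfl
  | succ s ih => rw [less, less, ih fun t ht => h t (by omega), h s (by omega)]

/-- The hashed set. -/
def hashSet (a d l s : ℕ) (z L T : ℕ → Bool) : Finset (Bits a) :=
  Finset.univ.filter fun x => less z (word a d l L T (ext x)) s = true

/-- The number with bits `z 0, …, z (s - 1)`. -/
def bitVal (z : ℕ → Bool) : ℕ → ℕ
  | 0 => 0
  | i + 1 => (if z i then 2 ^ i else 0) + bitVal z i

/-- If the top threshold bit is set, all words with top bit 0 are below and those with top bit 1 are
decided by the lower bits; if it is not set, only words with top bit 0 can be below. -/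
theorem sum_less (z : ℕ → Bool) (s : ℕ) :
    ∑ w : Bits s, (if less z (ext w) s then (1 : ℝ) else 0) = bitVal z s := by
  induction s with
  | zero => simp [less, bitVal]
  | succ s ih =>
    rw [sum_bits_succ]
    have hs : ∀ (u : Bits s) (v : Bool), less z (ext (Fin.snoc (α := fun _ => Bool) u v : Bits (s + 1))) (s + 1)
        = maj (z s) (!v) (less z (ext u) s) := by
      intro u v
      rw [less]
      congr 1
      · have := ext_val (Fin.snoc (α := fun _ => Bool) u v : Bits (s + 1)) (Fin.last s)
        rw [Fin.snoc_last] at this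
        exact congrArg (fun b => !b) this
      · refine less_congr fun i hi => ?_
        have := ext_val (Fin.snoc (α := fun _ => Bool) u v : Bits (s + 1)) (Fin.castSucc ⟨i, hi⟩)
        rw [Fin.snoc_castSucc] at this
        rw [← ext_val u ⟨i, hi⟩] at this
        exact this
    simp only [hs, bitVal]
    cases z s
    · have : ∀ u : Bits s, ((if maj false (!true) (less z (ext u) s) then (1 : ℝ) else 0)
          + if maj false (!false) (less z (ext u) s) then (1 : ℝ) else 0)
          = if less z (ext u) s then (1 : ℝ) else 0 := by
        intro u
        cases less z (ext u) s <;> simp [maj]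
      simp only [this, ih]
      simp
    · have : ∀ u : Bits s, ((if maj true (!true) (less z (ext u) s) then (1 : ℝ) else 0)
          + if maj true (!false) (less z (ext u) s) then (1 : ℝ) else 0)
          = 1 + if less z (ext u) s then (1 : ℝ) else 0 := by
        intro u
        cases less z (ext u) s <;> simp [maj]
      simp only [this, Finset.sum_add_distrib, ih]
      simp

/-! ### Affine forms -/

section Affine

variable {a : ℕ}

def flip {n : ℕ} (i : Fin n) (u : Bits n) : Bits n := Function.update u i (!u i)

theorem flip_involutive {n : ℕ} (i : Fin n) : Function.Involutive (flip i) := by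
  intro u
  simp [flip]

theorem sum_flip {n : ℕ} (i : Fin n) (f : Bits n → ℝ) : ∑ u, f (flip i u) = ∑ u, f u :=
  Equiv.sum_comp (flip_involutive i).toPerm f

theorem ext_flip {n : ℕ} (i : Fin n) (u : Bits n) (k : ℕ) :
    ext (flip i u) k = if k = i then !ext u k else ext u k := by
  simp only [ext, flip]
  split_ifs with h1 h2 h2
  · subst h2; simp
  · rw [Function.update_of_ne]
    exact fun h => h2 (congrArg Fin.val h)
  · exact absurd (h2 ▸ i.2) h1
  · rfl

theorem xorSum_flip (U U' X : ℕ → Bool) (i k : ℕ) (hU : ∀ t, U' t = if t = i then !U t else U t) :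
    xorSum (fun t => U' t && X t) k = xor (xorSum (fun t => U t && X t) k) (decide (i < k) && X i) := by
  induction k with
  | zero => simp [xorSum]
  | succ k ih =>
    rw [xorSum, ih, hU k, xorSum]
    by_cases h : k = i
    · subst h
      simp only [lt_irrefl, if_true, Nat.lt_succ_self, decide_false, decide_true]
      cases xorSum (fun t => U t && X t) k <;> cases U k <;> cases X k <;> rfl
    · have : decide (i < k + 1) = decide (i < k) := by
        rw [decide_eq_decide]; omega
      rw [if_neg h, this]
      cases xorSum (fun t => U t && X t) k <;> cases U k <;> cases X k <;>
        cases (decide (i < k) && X i) <;> rfl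

def affR (x : Bits a) (u : Bits (a + 1)) : ℝ := if affine a (ext u) 0 (ext x) then 1 else 0

theorem affine_flip (x : Bits a) (i : Fin (a + 1)) (u : Bits (a + 1)) :
    affine a (ext (flip i u)) 0 (ext x)
      = xor (affine a (ext u) 0 (ext x)) (if (i : ℕ) < a then ext x i else true) := by
  simp only [affine, mul_zero, add_zero]
  rw [xorSum_flip (ext u) (ext (flip i u)) (ext x) i a (ext_flip i u), ext_flip]
  by_cases h : (i : ℕ) < a
  · have h' : a ≠ i := by omega
    simp only [h, h', if_true, if_false, decide_true]
    cases xorSum (fun t => ext u t && ext x t) a <;> cases ext u a <;> cases ext x i <;> rfl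
  · have h' : a = i := by omega
    simp only [h, if_pos h', if_false, decide_false]
    cases xorSum (fun t => ext u t && ext x t) a <;> cases ext u a <;> cases ext x i <;> rfl

theorem affR_flip (x : Bits a) (i : Fin (a + 1)) (u : Bits (a + 1)) :
    affR x (flip i u) = if (if (i : ℕ) < a then ext x i else true) then 1 - affR x u else affR x u := by
  simp only [affR, affine_flip]
  generalize (if (i : ℕ) < a then ext x i else true) = c
  cases c <;> cases affine a (ext u) 0 (ext x) <;> simp

/-- Flipping the constant term complements the form at every x, so exactly half of the forms are
true. -/
theorem sum_affR (x : Bits a) : ∑ u, affR x u = 2 ^ a := by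
  have h := sum_flip (Fin.last a) (affR x)
  simp only [affR_flip, Fin.val_last, lt_irrefl, if_false, if_true, Finset.sum_sub_distrib] at h
  simp [pow_succ] at h
  linarith

/-- Where x and y differ, flipping that coefficient complements the form at one of the points and
leaves the other alone. So the values at two points are independent fair bits. -/
theorem sum_affR_mul {x y : Bits a} (h : x ≠ y) : ∑ u, affR x u * affR y u = 2 ^ a / 2 := by
  have key : ∀ x y : Bits a, (∃ t, x t = true ∧ y t = false) →
      ∑ u, affR x u * affR y u = 2 ^ a / 2 := by
    rintro x y ⟨t, hx, hy⟩
    have h := sum_flip t.castSucc (fun u => affR x u * affR y u)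
    have ex : ext x (t.castSucc : Fin (a + 1)) = true := (ext_val x t).trans hx
    have ey : ext y (t.castSucc : Fin (a + 1)) = false := (ext_val y t).trans hy
    have hlt : ((t.castSucc : Fin (a + 1)) : ℕ) < a := t.2
    simp only [affR_flip, hlt, if_true, ex, ey, sub_mul, one_mul, Finset.sum_sub_distrib,
      sum_affR, if_false, Bool.false_eq_true] at h
    linarith
  obtain ⟨t, ht⟩ := Function.ne_iff.1 h
  cases hx : x t
  · have hy : y t = true := by
      cases hy : y t
      · exact absurd (hx.trans hy.symm) ht
      · rfl
    have := key y x ⟨t, hy, hx⟩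
    simpa only [mul_comm] using this
  · refine key x y ⟨t, hx, ?_⟩
    cases hy : y t
    · rfl
    · exact absurd (hx.trans hy.symm) ht

end Affine

/-! ### Blocks of affine forms -/

section Blocks

variable {a l d : ℕ}

/-- Whether `x` lies in the bucket of a block. -/
def inBucket (b : Fin l → Bits (a + 1)) (x : Bits a) : Bool :=
  decide (∀ i, affine a (ext (b i)) 0 (ext x) = true)

def bucketR (b : Fin l → Bits (a + 1)) (x : Bits a) : ℝ := if inBucket b x then 1 else 0

theorem bucketR_eq (b : Fin l → Bits (a + 1)) (x : Bits a) : bucketR b x = ∏ i, affR x (b i) := by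
  simp only [bucketR, inBucket, affR, decide_eq_true_eq, Finset.prod_boole]
  simp

theorem sum_bucketR (x : Bits a) : ∑ b : Fin l → Bits (a + 1), bucketR b x = (2 ^ a) ^ l := by
  simp only [bucketR_eq]
  rw [← Fintype.prod_sum fun (_ : Fin l) u => affR x u]
  simp [sum_affR]

theorem sum_bucketR_mul {x y : Bits a} (h : x ≠ y) :
    ∑ b : Fin l → Bits (a + 1), bucketR b x * bucketR b y = (2 ^ a / 2) ^ l := by
  simp only [bucketR_eq, ← Finset.prod_mul_distrib]
  rw [← Fintype.prod_sum fun (_ : Fin l) u => affR x u * affR y u]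
  simp [sum_affR_mul h, div_pow]

/-- The bucket of the block contains an even number of elements of `S`. -/
def IsEven (b : Fin l → Bits (a + 1)) (S : Finset (Bits a)) : Prop :=
  ∑ x ∈ S, toZ (inBucket b x) = 0

instance (b : Fin l → Bits (a + 1)) (S : Finset (Bits a)) : Decidable (IsEven b S) := by
  unfold IsEven; infer_instance

/-- Isolation: fix x in S. The bucket meets S in x alone with probability at least 2^(-l) − |S|
4^(-l) by pairwise independence, and this is at least 2^(-l-1) because |S| ≤ 2^(l-1). A set met in
exactly one point is met in an odd number. -/
theorem sum_isEven_le {S : Finset (Bits a)} (hS : S.Nonempty) (hc : 2 * S.card ≤ 2 ^ l) :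
    ∑ b : Fin l → Bits (a + 1), (if IsEven b S then (1 : ℝ) else 0)
      ≤ (2 ^ (a + 1)) ^ l * (1 - 1 / 2 ^ (l + 1)) := by
  classical
  obtain ⟨x, hx⟩ := hS
  have hb : ∀ b : Fin l → Bits (a + 1), (if IsEven b S then (1 : ℝ) else 0)
      ≤ 1 - (bucketR b x - ∑ y ∈ S.erase x, bucketR b x * bucketR b y) := by
    intro b
    have hnn : ∀ y, 0 ≤ bucketR b y := fun y => by
      simp only [bucketR]; split_ifs <;> norm_num
    by_cases h1 : inBucket b x = true
    · have e1 : bucketR b x = 1 := by simp [bucketR, h1]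
      simp only [e1, one_mul]
      by_cases h2 : ∃ y ∈ S.erase x, inBucket b y = true
      · obtain ⟨y, hy, hy1⟩ := h2
        have : bucketR b y ≤ ∑ y ∈ S.erase x, bucketR b y :=
          Finset.single_le_sum (fun y _ => hnn y) hy
        have e2 : bucketR b y = 1 := by simp [bucketR, hy1]
        split_ifs <;> linarith
      · push Not at h2
        have : ¬ IsEven b S := by
          unfold IsEven
          rw [← Finset.add_sum_erase _ _ hx, Finset.sum_eq_zero, add_zero]
          · simp [h1, toZ]
          · intro y hy
            simp [toZ, h2 y hy]
        rw [if_neg this, Finset.sum_eq_zero]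
        · norm_num
        · intro y hy
          simp [bucketR, h2 y hy]
    · have e1 : bucketR b x = 0 := by simp [bucketR, h1]
      simp only [e1, zero_mul, Finset.sum_const_zero, sub_zero]
      split_ifs <;> norm_num
  refine (Finset.sum_le_sum fun b _ => hb b).trans ?_
  rw [Finset.sum_sub_distrib, Finset.sum_sub_distrib, sum_bucketR, Finset.sum_comm,
    Finset.sum_congr rfl fun y hy => sum_bucketR_mul (Finset.ne_of_mem_erase hy).symm]
  have hcard : ((S.erase x).card : ℝ) ≤ 2 ^ l / 2 := by
    have : 2 * (S.erase x).card ≤ 2 ^ l := (Nat.mul_le_mul_left 2 (Finset.card_erase_le)).trans hc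
    have h2 : (2 : ℝ) * (S.erase x).card ≤ 2 ^ l := by exact_mod_cast this
    linarith
  simp only [Finset.sum_const, Finset.card_univ, Fintype.card_pi, Fintype.card_bool,
    Finset.prod_const, nsmul_eq_mul, mul_one, Fintype.card_fin]
  push_cast
  have h3 : ((S.erase x).card : ℝ) * (2 ^ a / 2) ^ l ≤ 2 ^ l / 2 * (2 ^ a / 2) ^ l := by gcongr
  have e1 : (2 : ℝ) ^ l / 2 * (2 ^ a / 2) ^ l = (2 ^ a) ^ l / 2 := by
    rw [div_pow]; field_simp
  have e2 : ((2 : ℝ) ^ (a + 1)) ^ l * (1 - 1 / 2 ^ (l + 1)) = (2 ^ (a + 1)) ^ l - (2 ^ a) ^ l / 2 := by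
    rw [pow_succ, mul_pow, pow_succ]; field_simp
  rw [e1] at h3
  rw [e2]
  linarith

/-- Every small non-empty set meets some bucket in an odd number of elements. -/
def Good (k : ℕ) (L : Fin d → Fin l → Bits (a + 1)) : Prop :=
  ∀ S : Finset (Bits a), S.Nonempty → S.card ≤ k → ∃ j, ¬ IsEven (L j) S

theorem card_small_le (k : ℕ) :
    ((Finset.univ.filter fun S : Finset (Bits a) => S.Nonempty ∧ S.card ≤ k).card : ℝ)
      ≤ (k + 1) * (2 ^ a) ^ k := by
  classical
  have hsub : (Finset.univ.filter fun S : Finset (Bits a) => S.Nonempty ∧ S.card ≤ k)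
      ⊆ (Finset.range (k + 1)).biUnion fun i => Finset.powersetCard i Finset.univ := by
    intro S hS
    simp only [Finset.mem_filter, Finset.mem_univ, true_and] at hS
    simp only [Finset.mem_biUnion, Finset.mem_range, Finset.mem_powersetCard]
    exact ⟨S.card, by omega, Finset.subset_univ _, rfl⟩
  have h1 := (Finset.card_le_card hsub).trans Finset.card_biUnion_le
  have h2 : ∑ i ∈ Finset.range (k + 1), (Finset.powersetCard i (Finset.univ : Finset (Bits a))).card
      ≤ ∑ _i ∈ Finset.range (k + 1), (2 ^ a) ^ k := by
    refine Finset.sum_le_sum fun i hi => ?_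
    rw [Finset.card_powersetCard, Finset.card_univ, Fintype.card_pi]
    simp only [Fintype.card_bool, Finset.prod_const, Finset.card_univ, Fintype.card_fin]
    refine (Nat.choose_le_pow _ _).trans (Nat.pow_le_pow_right (by positivity) ?_)
    have := Finset.mem_range.1 hi
    omega
  have := h1.trans h2
  simp only [Finset.sum_const, Finset.card_range, smul_eq_mul] at this
  exact_mod_cast this

-- A union bound over the small sets. For a fixed set the d blocks are independent, so the chance
-- that all of them miss its parity is a d-th power.
open Classical in
theorem sum_not_good_le {k : ℕ} (hk : 2 * k ≤ 2 ^ l) :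
    ∑ L : Fin d → Fin l → Bits (a + 1), (if Good k L then (0 : ℝ) else 1)
      ≤ (k + 1) * (2 ^ a) ^ k * ((2 ^ (a + 1)) ^ l) ^ d * (1 - 1 / 2 ^ (l + 1)) ^ d := by
  set F := Finset.univ.filter fun S : Finset (Bits a) => S.Nonempty ∧ S.card ≤ k with hF
  have h1 : ∀ L : Fin d → Fin l → Bits (a + 1), (if Good k L then (0 : ℝ) else 1)
      ≤ ∑ S ∈ F, ∏ j, if IsEven (L j) S then (1 : ℝ) else 0 := by
    intro L
    have hnn : ∀ S ∈ F, (0 : ℝ) ≤ ∏ j, if IsEven (L j) S then (1 : ℝ) else 0 := fun S _ =>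
      Finset.prod_nonneg fun j _ => by split_ifs <;> norm_num
    split_ifs with hg
    · exact Finset.sum_nonneg hnn
    · unfold Good at hg
      push Not at hg
      obtain ⟨S, h1, h2, h3⟩ := hg
      refine le_trans (le_of_eq ?_) (Finset.single_le_sum hnn
        (by simp [hF, h1, h2] : S ∈ F))
      simp [h3]
  refine (Finset.sum_le_sum fun L _ => h1 L).trans ?_
  rw [Finset.sum_comm]
  have h2 : ∀ S ∈ F, ∑ L : Fin d → Fin l → Bits (a + 1),
      ∏ j, (if IsEven (L j) S then (1 : ℝ) else 0)
      ≤ ((2 ^ (a + 1)) ^ l * (1 - 1 / 2 ^ (l + 1))) ^ d := by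
    intro S hS
    simp only [hF, Finset.mem_filter, Finset.mem_univ, true_and] at hS
    rw [← Fintype.prod_sum fun (_ : Fin d) b => if IsEven b S then (1 : ℝ) else 0]
    rw [Finset.prod_const, Finset.card_univ, Fintype.card_fin]
    refine pow_le_pow_left₀ (Finset.sum_nonneg fun b _ => by split_ifs <;> norm_num) ?_ _
    exact sum_isEven_le hS.1 (by omega)
  refine (Finset.sum_le_sum h2).trans ?_
  rw [Finset.sum_const, nsmul_eq_mul, mul_pow]
  have h3 := card_small_le (a := a) k
  have h4 : (0 : ℝ) ≤ 1 - 1 / 2 ^ (l + 1) := by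
    rw [sub_nonneg, div_le_one (by positivity)]
    exact one_le_pow₀ (by norm_num)
  calc _ ≤ ((k : ℝ) + 1) * (2 ^ a) ^ k * (((2 ^ (a + 1)) ^ l) ^ d * (1 - 1 / 2 ^ (l + 1)) ^ d) := by
        gcongr
    _ = _ := by ring

end Blocks

/-! ### Words from good blocks -/

section Words

/-- Independent rows make the map from seed matrices to tuples of words surjective. Being additive,
it has fibres of equal size, so a uniform seed gives uniform independent words at the points of S.
-/
theorem sum_linear_image {S : Type} [Fintype S] [DecidableEq S] {s d : ℕ} (A : S → Fin d → ZMod 2)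
    (hA : LinearIndependent (ZMod 2) A) (G : (Fin s → ZMod 2) → ℝ) :
    ∑ T : Fin s → Fin d → ZMod 2, ∏ x, G (fun i => ∑ j, T i j * A x j)
      = ((2 : ℝ) ^ d) ^ s * ((∑ w, G w) / 2 ^ s) ^ Fintype.card S := by
  set f : (Fin s → Fin d → ZMod 2) →+ (Fin s → S → ZMod 2) := AddMonoidHom.mk'
    (fun T i x => ∑ j, T i j * A x j) (by
      intro T T'
      funext i x
      simp [add_mul, Finset.sum_add_distrib]) with hf
  have hsurj : Function.Surjective f := by
    have hr : LinearMap.range (Matrix.mulVecLin (Matrix.of A)) = ⊤ := by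
      apply Submodule.eq_top_of_finrank_eq
      have := LinearIndependent.rank_matrix (M := Matrix.of A) hA
      rw [Matrix.rank] at this
      rw [this, Module.finrank_fintype_fun_eq_card]
    intro y
    have : ∀ i, ∃ t, Matrix.mulVecLin (Matrix.of A) t = y i := fun i => by
      have : y i ∈ LinearMap.range (Matrix.mulVecLin (Matrix.of A)) := by rw [hr]; trivial
      exact this
    choose T hT using this
    refine ⟨T, ?_⟩
    funext i x
    have := congrFun (hT i) x
    rw [← this]
    simp [hf, Matrix.mulVec, dotProduct, mul_comm]
  set c : ℕ := (Finset.univ.filter fun T => f T = 0).card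
  have hfib : ∀ y, (Finset.univ.filter fun T => f T = y).card = c := fun y =>
    AddMonoidHom.card_fiber_eq_of_mem_range f (hsurj y) (hsurj 0)
  have hsum : ∀ H : (Fin s → S → ZMod 2) → ℝ, ∑ T, H (f T) = c * ∑ y, H y := by
    intro H
    rw [← Finset.sum_fiberwise Finset.univ f, Finset.mul_sum]
    refine Finset.sum_congr rfl fun y _ => ?_
    rw [Finset.sum_congr rfl fun T hT => by rw [(Finset.mem_filter.1 hT).2], Finset.sum_const,
      hfib, nsmul_eq_mul]
  -- Counting with the constant function determines the common size of the fibres.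
  have hc : ((2 : ℝ) ^ d) ^ s = c * ((2 : ℝ) ^ Fintype.card S) ^ s := by
    have := hsum fun _ => 1
    simpa [ZMod.card] using this
  have e1 := hsum fun y => ∏ x, G (fun i => y i x)
  refine Eq.trans e1 ?_
  have e2 : ∑ y : Fin s → S → ZMod 2, ∏ x, G (fun i => y i x) = (∑ w, G w) ^ Fintype.card S := by
    rw [← Equiv.sum_comp (Equiv.piComm fun (_ : S) (_ : Fin s) => ZMod 2)]
    have := Fintype.prod_sum fun (_ : S) w => G w
    rw [Finset.prod_const, Finset.card_univ] at this
    exact this.symm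
  rw [e2, hc, div_pow]
  have : ((2 : ℝ) ^ Fintype.card S) ^ s = (2 ^ s) ^ Fintype.card S := by
    rw [← pow_mul, ← pow_mul, mul_comm]
  rw [this]
  field_simp

def boolEquiv : Bool ≃ ZMod 2 where
  toFun := toZ
  invFun x := decide (x = 1)
  left_inv := by decide
  right_inv := by decide

theorem decide_toZ (b : Bool) : decide (toZ b = 1) = b := by cases b <;> decide

/-- Over 𝔽₂ a linear relation between bucket vectors is a set of messages met evenly by every
bucket. Goodness excludes this for nonempty sets of at most k messages, so the words of any k
messages are independent and uniform. -/
theorem sum_prod_word {a l d s k : ℕ} {L : Fin d → Fin l → Bits (a + 1)} (hL : Good k L)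
    (G : (Fin s → Bool) → ℝ) (w : (Fin s → Fin d → Bool) → Bits a → Fin s → Bool)
    (hw : ∀ T x i, toZ (w T x i) = ∑ j, toZ (T i j) * toZ (inBucket (L j) x))
    {S : Finset (Bits a)} (hS : S.card ≤ k) :
    ∑ T, ∏ x ∈ S, G (w T x) = ((2 : ℝ) ^ d) ^ s * ((∑ v, G v) / 2 ^ s) ^ S.card := by
  classical
  set A : S → Fin d → ZMod 2 := fun x j => toZ (inBucket (L j) x)
  have hA : LinearIndependent (ZMod 2) A := by
    rw [Fintype.linearIndependent_iff]
    intro g hg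
    by_contra hne
    push Not at hne
    obtain ⟨x₀, hx₀⟩ := hne
    set S' : Finset (Bits a) := (Finset.univ.filter fun x : S => g x ≠ 0).image (↑)
    have hS' : S'.card ≤ k := by
      refine (Finset.card_le_card (?_ : S' ⊆ S)).trans hS
      intro x hx
      obtain ⟨y, _, rfl⟩ := Finset.mem_image.1 hx
      exact y.2
    obtain ⟨j, hj⟩ := hL S' ⟨x₀, Finset.mem_image.2 ⟨x₀, by simp [hx₀], rfl⟩⟩ hS'
    apply hj
    unfold IsEven
    rw [Finset.sum_image (by intro x _ y _ h; exact Subtype.ext h), Finset.sum_filter]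
    have := congrFun hg j
    simp only [Finset.sum_apply, Pi.smul_apply, smul_eq_mul, Pi.zero_apply] at this
    refine Eq.trans ?_ this
    refine Finset.sum_congr rfl fun x _ => ?_
    have h01 : ∀ c : ZMod 2, c ≠ 0 → c = 1 := by decide
    split_ifs with h
    · rw [h01 _ h, one_mul]
    · push Not at h
      rw [h, zero_mul]
  have e1 := sum_linear_image (s := s) A hA fun v => G fun i => decide (v i = 1)
  have e2 : ∑ v : Fin s → ZMod 2, G (fun i => decide (v i = 1)) = ∑ v, G v :=
    Equiv.sum_comp (Equiv.arrowCongr (Equiv.refl (Fin s)) boolEquiv.symm) G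
  rw [e2, Fintype.card_coe] at e1
  rw [← e1]
  rw [← Equiv.sum_comp (Equiv.arrowCongr (Equiv.refl (Fin s))
    (Equiv.arrowCongr (Equiv.refl (Fin d)) boolEquiv))]
  refine Finset.sum_congr rfl fun T _ => ?_
  rw [← Finset.prod_coe_sort S]
  refine Finset.prod_congr rfl fun x _ => ?_
  congr 1
  funext i
  have : ∑ j, ((Equiv.arrowCongr (Equiv.refl (Fin s))
    (Equiv.arrowCongr (Equiv.refl (Fin d)) boolEquiv)) T) i j * A x j = toZ (w T x i) := by
    rw [hw]
    rfl
  exact ((congrArg (fun c : ZMod 2 => decide (c = 1)) this).trans (decide_toZ _)).symm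

end Words

/-! ## Functions of low degree -/

section Degree

variable {α : Type} [Fintype α] [DecidableEq α]

/-- The indicator of `S ⊆ B`, a monomial of degree `S.card`. -/
def mono (S B : Finset α) : ℂ := if S ⊆ B then 1 else 0

/-- The functions of sets that are polynomials of degree at most `q` in the membership bits. -/
def Deg (α : Type) [Fintype α] [DecidableEq α] (q : ℕ) : Submodule ℂ (Finset α → ℂ) :=
  Submodule.span ℂ (mono '' {S | S.card ≤ q})

theorem deg_mono {q r : ℕ} (h : q ≤ r) : Deg α q ≤ Deg α r :=
  Submodule.span_mono (Set.image_mono fun _ (hS : _ ≤ q) => hS.trans h)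

theorem const_mem_deg (q : ℕ) (c : ℂ) : (fun _ => c) ∈ Deg α q := by
  have : (fun _ => c) = c • mono (∅ : Finset α) := by funext B; simp [mono]
  rw [this]
  exact Submodule.smul_mem _ _ (Submodule.subset_span ⟨∅, by simp, rfl⟩)

theorem mem_deg_one (x : α) : (fun B => if x ∈ B then (1 : ℂ) else 0) ∈ Deg α 1 := by
  have : (fun B => if x ∈ B then (1 : ℂ) else 0) = mono {x} := by funext B; simp [mono]
  rw [this]
  exact Submodule.subset_span ⟨{x}, by simp, rfl⟩

/-- Membership bits are idempotent: the product of the monomials of S and S' is the monomial of S ∪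
S', which has at most |S| + |S'| elements. -/
theorem mul_mem_deg {q r : ℕ} {f g : Finset α → ℂ} (hf : f ∈ Deg α q) (hg : g ∈ Deg α r) :
    (fun B => f B * g B) ∈ Deg α (q + r) := by
  change f * g ∈ _
  have h := Submodule.mul_mem_mul hf hg
  rw [Deg, Deg, Submodule.span_mul_span] at h
  refine Submodule.span_mono ?_ h
  rintro _ ⟨_, ⟨S, hS, rfl⟩, _, ⟨S', hS', rfl⟩, rfl⟩
  refine ⟨S ∪ S', (Finset.card_union_le _ _).trans (add_le_add hS hS'), ?_⟩
  funext B
  simp only [mono, Pi.mul_apply, Finset.union_subset_iff]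
  by_cases h1 : S ⊆ B <;> by_cases h2 : S' ⊆ B <;> simp [h1, h2]

theorem pow_mem_deg {f : Finset α → ℂ} (hf : f ∈ Deg α 1) (r : ℕ) :
    (fun B => f B ^ r) ∈ Deg α r := by
  induction r with
  | zero => simpa using const_mem_deg 0 1
  | succ r ih =>
    have := mul_mem_deg ih hf
    simpa only [pow_succ] using this

theorem star_mem_deg {q : ℕ} {f : Finset α → ℂ} (hf : f ∈ Deg α q) :
    (fun B => star (f B)) ∈ Deg α q := by
  change star f ∈ _
  induction hf using Submodule.span_induction with
  | mem f h =>
    obtain ⟨S, hS, rfl⟩ := h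
    have : star (mono S) = mono S := by
      funext B
      simp only [Pi.star_apply, mono]
      split_ifs <;> simp
    rw [this]
    exact Submodule.subset_span ⟨S, hS, rfl⟩
  | zero => rw [star_zero]; exact Submodule.zero_mem _
  | add f g _ _ hf hg => rw [star_add]; exact Submodule.add_mem _ hf hg
  | smul c f _ hf => rw [star_smul]; exact Submodule.smul_mem _ _ hf

theorem sum_mem_deg {κ : Type} {q : ℕ} {s : Finset κ} {f : κ → Finset α → ℂ}
    (hf : ∀ k ∈ s, f k ∈ Deg α q) : (fun B => ∑ k ∈ s, f k B) ∈ Deg α q := by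
  have : (fun B => ∑ k ∈ s, f k B) = ∑ k ∈ s, f k := by funext B; simp
  rw [this]
  exact Submodule.sum_mem _ hf

theorem const_mul_mem_deg {q : ℕ} {f : Finset α → ℂ} (c : ℂ) (hf : f ∈ Deg α q) :
    (fun B => c * f B) ∈ Deg α q := Submodule.smul_mem _ c hf

/-- A case distinction on one membership bit is g + (f − g) times that bit; this is why a query
raises the degree by only one. -/
theorem ite_mem_deg {q : ℕ} {f g : Finset α → ℂ} (x : α) (hf : f ∈ Deg α q) (hg : g ∈ Deg α q) :
    (fun B => if x ∈ B then f B else g B) ∈ Deg α (q + 1) := by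
  have h := Submodule.add_mem _ (mul_mem_deg (Submodule.sub_mem _ hf hg) (mem_deg_one x))
    (deg_mono (Nat.le_succ q) hg)
  convert h using 1
  funext B
  simp only [Pi.add_apply, Pi.sub_apply]
  split_ifs <;> ring

/-- The fraction of elements that lie in `B`. -/
def dens (B : Finset α) : ℝ := B.card / Fintype.card α

theorem dens_eq (B : Finset α) : dens B = (Fintype.card α : ℝ)⁻¹ * ∑ x, if x ∈ B then 1 else 0 := by
  simp [dens, div_eq_inv_mul]

theorem dens_nonneg (B : Finset α) : 0 ≤ dens B := by unfold dens; positivity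

theorem dens_le_one (B : Finset α) : dens B ≤ 1 :=
  div_le_one_of_le₀ (by exact_mod_cast Finset.card_le_univ B) (Nat.cast_nonneg _)

theorem dens_pow_mem_deg (r : ℕ) : (fun B : Finset α => ((dens B ^ r : ℝ) : ℂ)) ∈ Deg α r := by
  simp only [Complex.ofReal_pow]
  refine pow_mem_deg ?_ r
  have := const_mul_mem_deg ((Fintype.card α : ℝ)⁻¹ : ℂ)
    (sum_mem_deg (s := Finset.univ) fun (x : α) _ => mem_deg_one x)
  convert this using 1
  funext B
  rw [dens_eq]
  push_cast
  congr 1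
  exact Finset.sum_congr rfl fun x _ => by split_ifs <;> simp

/-- Weights that annihilate the monomials annihilate all functions of low degree. -/
theorem sum_mul_eq_zero_of_deg {k : ℕ} {ν : Finset α → ℝ}
    (hν : ∀ S : Finset α, S.card ≤ k → ∑ B, ν B * (if S ⊆ B then 1 else 0) = 0)
    {f : Finset α → ℝ} (hf : (fun B => (f B : ℂ)) ∈ Deg α k) : ∑ B, ν B * f B = 0 := by
  have key : ∀ g ∈ Deg α k, ∑ B, (ν B : ℂ) * g B = 0 := by
    intro g hg
    induction hg using Submodule.span_induction with
    | mem g h =>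
      obtain ⟨S, hS, rfl⟩ := h
      have := congrArg (fun r : ℝ => (r : ℂ)) (hν S hS)
      push_cast at this
      refine Eq.trans (Finset.sum_congr rfl fun B _ => ?_) this
      simp only [mono]
      split_ifs <;> simp
    | zero => simp
    | add f g _ _ hf hg => simp [mul_add, Finset.sum_add_distrib, hf, hg]
    | smul c g _ hg =>
      simp only [Pi.smul_apply, smul_eq_mul, mul_left_comm _ c, ← Finset.mul_sum, hg, mul_zero]
  have := key _ hf
  exact_mod_cast this

/-- A random set misses a given element although many random elements lie in it only with small
probability. -/
theorem sum_bern_dens_pow_le {ε : ℝ} (h0 : 0 ≤ ε) (h1 : ε ≤ 1) (r : ℕ) (x : α) :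
    ∑ B : Finset α, bern ε B * dens B ^ r * (if x ∈ B then 0 else 1) ≤ 1 / (r + 1) := by
  have : Nonempty α := ⟨x⟩
  have hN : (0 : ℝ) < Fintype.card α := by exact_mod_cast Fintype.card_pos
  -- Both the distribution and the density are invariant under permutations of the elements, so x
  -- may be averaged over all elements, which turns its indicator into 1 − dens B.
  have hsymm : ∀ y : α, ∑ B : Finset α, bern ε B * dens B ^ r * (if y ∈ B then 0 else 1)
      = ∑ B : Finset α, bern ε B * dens B ^ r * (if x ∈ B then (0 : ℝ) else 1) := by
    intro y
    rw [← Equiv.sum_comp (Equiv.finsetCongr (Equiv.swap x y))]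
    refine Finset.sum_congr rfl fun B _ => ?_
    have hm : ∀ z, z ∈ (Equiv.finsetCongr (Equiv.swap x y)) B ↔ Equiv.swap x y z ∈ B := by
      intro z
      simp only [Equiv.finsetCongr_apply, Finset.mem_map_equiv, Equiv.symm_swap]
    have e1 : bern ε ((Equiv.finsetCongr (Equiv.swap x y)) B) = bern ε B := by
      unfold bern
      simp only [hm]
      exact Equiv.prod_comp (Equiv.swap x y) fun z => if z ∈ B then ε else 1 - ε
    have e2 : dens ((Equiv.finsetCongr (Equiv.swap x y)) B) = dens B := by
      simp [dens, Equiv.finsetCongr_apply]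
    rw [e1, e2]
    simp only [hm, Equiv.swap_apply_right]
  have hsum : (Fintype.card α : ℝ) *
      ∑ B : Finset α, bern ε B * dens B ^ r * (if x ∈ B then (0 : ℝ) else 1)
      = ∑ B : Finset α, bern ε B * (Fintype.card α * (dens B ^ r * (1 - dens B))) := by
    calc _ = ∑ y : α, ∑ B : Finset α, bern ε B * dens B ^ r * (if y ∈ B then (0 : ℝ) else 1) := by
          simp only [hsymm, Finset.sum_const, Finset.card_univ, nsmul_eq_mul]
      _ = _ := by
          rw [Finset.sum_comm]
          refine Finset.sum_congr rfl fun B _ => ?_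
          rw [← Finset.mul_sum]
          have : ∑ y : α, (if y ∈ B then (0 : ℝ) else 1) = Fintype.card α * (1 - dens B) := by
            have e : ∀ y, (if y ∈ B then (0 : ℝ) else 1) = 1 - if y ∈ B then 1 else 0 := by
              intro y; split_ifs <;> simp
            simp only [e, Finset.sum_sub_distrib]
            rw [dens, mul_sub, mul_div_cancel₀ _ hN.ne']
            simp
          rw [this]
          ring
  -- On [0, 1] one has (r+1) t^r ≤ 1 + t + ⋯ + t^r, and 1 − t times this sum is 1 − t^(r+1).
  have hpt : ∀ t : ℝ, 0 ≤ t → t ≤ 1 → t ^ r * (1 - t) ≤ 1 / (r + 1) := by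
    intro t ht0 ht1
    rw [le_div_iff₀ (by positivity)]
    have h2 : (r + 1 : ℝ) * t ^ r ≤ ∑ i ∈ Finset.range (r + 1), t ^ i := by
      have : ∑ _i ∈ Finset.range (r + 1), t ^ r ≤ ∑ i ∈ Finset.range (r + 1), t ^ i :=
        Finset.sum_le_sum fun i hi => pow_le_pow_of_le_one ht0 ht1
          (by have := Finset.mem_range.1 hi; omega)
      simpa using this
    have h3 := mul_le_mul_of_nonneg_right h2 (sub_nonneg.2 ht1)
    have h4 := geom_sum_mul_neg t (r + 1)
    have h5 := pow_nonneg ht0 (r + 1)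
    nlinarith
  have hle : (Fintype.card α : ℝ) *
      ∑ B : Finset α, bern ε B * dens B ^ r * (if x ∈ B then (0 : ℝ) else 1)
      ≤ Fintype.card α * (1 / (r + 1)) := by
    rw [hsum]
    calc _ ≤ ∑ B : Finset α, bern ε B * (Fintype.card α * (1 / (r + 1))) := by
          refine Finset.sum_le_sum fun B _ => mul_le_mul_of_nonneg_left
            (mul_le_mul_of_nonneg_left (hpt _ (dens_nonneg B) (dens_le_one B)) hN.le)
            (bern_nonneg h0 h1 B)
      _ = _ := by rw [← Finset.sum_mul, sum_bern, one_mul]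
  exact le_of_mul_le_mul_left hle hN

/-! ### Changing the probability -/

/-- The distribution of a random set with individual probabilities. -/
def bernF (e : α → ℝ) (B : Finset α) : ℝ := ∏ x, if x ∈ B then e x else 1 - e x

/-- With all other elements fixed, the value changes by at most one between x ∉ B and x ∈ B, and the
probabilities of these cases move by |e x − e' x|. -/
theorem abs_sum_bernF_sub_le {e e' : α → ℝ} (x : α) (he : ∀ y, y ≠ x → e y = e' y)
    (h0 : ∀ y, 0 ≤ e y ∧ e y ≤ 1) {V : Finset α → ℝ} (hV : ∀ B, 0 ≤ V B ∧ V B ≤ 1) :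
    |∑ B, bernF e B * V B - ∑ B, bernF e' B * V B| ≤ |e x - e' x| := by
  set R : Finset α → ℝ := fun B => ∏ y ∈ Finset.univ.erase x, if y ∈ B then e y else 1 - e y
  have hR : ∀ B, 0 ≤ R B := fun B => Finset.prod_nonneg fun y _ => by
    have := h0 y
    split_ifs <;> linarith
  have hRi : ∀ B, R (insert x B) = R B := fun B => Finset.prod_congr rfl fun y hy => by
    simp [Finset.ne_of_mem_erase hy]
  have h1 : ∀ B, bernF e B = (if x ∈ B then e x else 1 - e x) * R B := fun B =>
    (Finset.mul_prod_erase _ _ (Finset.mem_univ x)).symm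
  have h2 : ∀ B, bernF e' B = (if x ∈ B then e' x else 1 - e' x) * R B := fun B => by
    refine (Finset.mul_prod_erase _ _ (Finset.mem_univ x)).symm.trans ?_
    congr 1
    exact Finset.prod_congr rfl fun y hy => by rw [he y (Finset.ne_of_mem_erase hy)]
  -- The remaining coordinates carry total mass one; to see this, expand the product with
  -- probability zero put at x.
  have hmass : ∑ B, (if x ∉ B then R B else 0) = 1 := by
    have key := Finset.prod_add (fun y : α => if y = x then 0 else e y)
      (fun y => if y = x then 1 else 1 - e y) Finset.univ
    have e1 : ∏ y : α, ((if y = x then 0 else e y) + if y = x then 1 else 1 - e y) = 1 := by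
      refine Finset.prod_eq_one fun y _ => ?_
      split_ifs <;> ring
    rw [e1, Finset.powerset_univ] at key
    rw [key]
    refine Finset.sum_congr rfl fun B _ => ?_
    have e2 : (∏ y ∈ B, if y = x then 0 else e y) * ∏ y ∈ Finset.univ \ B, (if y = x then 1 else 1 - e y)
        = ∏ y, if y ∈ B then (if y = x then 0 else e y) else (if y = x then 1 else 1 - e y) := by
      have f1 : Finset.univ.filter (· ∈ B) = B := by ext; simp
      have f2 : Finset.univ.filter (· ∉ B) = Finset.univ \ B := by ext; simp
      refine Eq.trans ?_ (Finset.prod_ite _ _).symm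
      rw [f1, f2]
    rw [e2, ← Finset.mul_prod_erase _ _ (Finset.mem_univ x)]
    by_cases hx : x ∈ B
    · rw [if_neg (not_not.2 hx), if_pos hx, if_pos rfl, zero_mul]
    · rw [if_pos hx, if_neg hx, if_pos rfl, one_mul]
      refine Finset.prod_congr rfl fun y hy => ?_
      simp [Finset.ne_of_mem_erase hy]
  rw [← Finset.sum_sub_distrib, sum_finset_split x]
  refine (Finset.abs_sum_le_sum_abs _ _).trans ?_
  calc _ ≤ ∑ B, |e x - e' x| * (if x ∉ B then R B else 0) := by
        refine Finset.sum_le_sum fun B _ => ?_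
        by_cases hx : x ∈ B
        · simp [hx]
        · rw [if_pos hx, if_pos hx]
          have hxi : x ∈ insert x B := Finset.mem_insert_self _ _
          rw [h1, h2, h1, h2, if_neg hx, if_neg hx, if_pos hxi, if_pos hxi, hRi]
          have e3 : (1 - e x) * R B * V B - (1 - e' x) * R B * V B
              + (e x * R B * V (insert x B) - e' x * R B * V (insert x B))
              = (e x - e' x) * R B * (V (insert x B) - V B) := by ring
          rw [e3, abs_mul, abs_mul, abs_of_nonneg (hR B)]
          have h3 : |V (insert x B) - V B| ≤ 1 := by
            have := hV B
            have := hV (insert x B)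
            rw [abs_le]; constructor <;> linarith
          exact mul_le_of_le_one_right (mul_nonneg (abs_nonneg _) (hR B)) h3
    _ = _ := by rw [← Finset.mul_sum, hmass, mul_one]

/-- The probabilities are changed one element at a time. The number of elements enters as a factor,
exponentially large for messages, which the exponentially precise threshold compensates. -/
theorem sum_bern_le_add {ε ε' : ℝ} (h : 0 ≤ ε ∧ ε ≤ 1) (h' : 0 ≤ ε' ∧ ε' ≤ 1)
    {V : Finset α → ℝ} (hV : ∀ B, 0 ≤ V B ∧ V B ≤ 1) :
    ∑ B, bern ε B * V B ≤ ∑ B, bern ε' B * V B + Fintype.card α * |ε - ε'| := by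
  have key : ∀ S : Finset α, ∑ B, bernF (fun x => if x ∈ S then ε else ε') B * V B
      ≤ ∑ B, bernF (fun _ => ε') B * V B + S.card * |ε - ε'| := by
    intro S
    induction S using Finset.induction_on with
    | empty => simp
    | insert x S hx ih =>
      have := abs_sum_bernF_sub_le (e := fun y => if y ∈ insert x S then ε else ε')
        (e' := fun y => if y ∈ S then ε else ε') x (fun y hy => by simp [hy])
        (fun y => by split_ifs <;> assumption) hV
      simp only [Finset.mem_insert_self, if_true, if_neg hx] at this
      have h2 := (abs_le.1 this).2
      rw [Finset.card_insert_of_notMem hx]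
      push_cast
      linarith
  have := key Finset.univ
  simpa [bernF, bern] using this

end Degree

/-! ## Runs with blinded oracles depend on the blinding set with low degree -/

section LowDegree

variable {a b : ℕ}

abbrev blindBot (B : Finset (Bits a)) (g : Bits a → Bits b) (x : Bits a) : Bits (b + 1) :=
  encodeBot (blind B g x)

abbrev FamState (a : ℕ) : Type :=
  (Finset (Bits a) → QState) × List (Finset (Bits a) → QState)

/-- All amplitudes have degree at most `q` in the blinding set. -/
def InDeg (q : ℕ) (φ : Finset (Bits a) → QState) : Prop :=
  ∀ c, (fun B => φ B c) ∈ Deg (Bits a) q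

theorem InDeg.mapDomain {q : ℕ} {φ : Finset (Bits a) → QState} (h : InDeg q φ) {f : Basis → Basis}
    (hf : Function.Involutive f) : InDeg q fun B => (φ B).mapDomain f := by
  intro c
  simp only [mapDomain_involutive_apply hf]
  exact h _

theorem InDeg.project {q : ℕ} {φ : Finset (Bits a) → QState} (h : InDeg q φ) (x : Qubit)
    (o : Bool) : InDeg q fun B => project x o (φ B) := by
  intro c
  simp only [project_apply]
  split_ifs
  · exact h c
  · exact Submodule.zero_mem _

theorem InDeg.projReg {q : ℕ} {φ : Finset (Bits a) → QState} (h : InDeg q φ) (r d : ℕ)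
    (u : Bits d) : InDeg q fun B => projReg r d u (φ B) := by
  intro c
  simp only [projReg_apply]
  split_ifs
  · exact h c
  · exact Submodule.zero_mem _

/-- An amplitude after the query is one of two amplitudes before it, the one for answer ⊥ or the one
for the true answer, and the choice is a single membership bit. -/
theorem InDeg.query {q : ℕ} {φ : Finset (Bits a) → QState} (h : InDeg q φ) (g : Bits a → Bits b) :
    InDeg (q + 1) fun B => standardOracle (blindBot B g) (φ B) := by
  intro c
  have h1 := h (oracleMap (fun _ => encodeBot (none : Option (Bits b)) : Bits a → _) c)
  have h2 := h (oracleMap (fun x => encodeBot (some (g x))) c)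
  convert ite_mem_deg (readReg regX a c) h1 h2 using 1
  funext B
  refine (congrArg (fun ψ : QState => ψ c) (standardOracle_eq (blindBot B g) (φ B))).trans ?_
  rw [mapDomain_involutive_apply (oracleMap_involutive _)]
  split_ifs with hc
  · congr 1
    funext q
    rw [oracleMap_apply, oracleMap_apply]
    simp [blindBot, blind, hc]
  · congr 1
    funext q
    rw [oracleMap_apply, oracleMap_apply]
    simp [blindBot, blind, hc]

/-- A squared modulus is an amplitude times its conjugate, so the degree doubles. One finite set of
basis states supports all members, as there are finitely many blinding sets. -/
theorem InDeg.nS {q : ℕ} {φ : Finset (Bits a) → QState} (h : InDeg q φ) :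
    (fun B => ((nS (φ B) : ℝ) : ℂ)) ∈ Deg (Bits a) (q + q) := by
  classical
  set S : Finset Basis := Finset.univ.biUnion fun B => (φ B).support
  have e : (fun B => ((QUnf.nS (φ B) : ℝ) : ℂ)) = fun B => ∑ c ∈ S, φ B c * star (φ B c) := by
    funext B
    rw [nS_eq_sum (φ B) S (Finset.subset_biUnion_of_mem (fun B => (φ B).support) (Finset.mem_univ B))]
    push_cast
    refine Finset.sum_congr rfl fun c _ => ?_
    rw [Complex.star_def, Complex.mul_conj, Complex.normSq_eq_norm_sq]
    push_cast
    rfl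
  rw [e]
  exact sum_mem_deg fun c _ => mul_mem_deg (h c) (star_mem_deg (h c))

/-- By linearity the signed weights move to the end of the run, where each branch is treated
separately; there the degree of the states is bounded by the length of the query log. -/
theorem sum_fam_eq_zero (O : Oracle a b) (cnt : ℕ → ℕ) (p : Cmd) {ν : Finset (Bits a) → ℝ}
    {leaf : Finset (Bits a) → FamState a → ℝ}
    (hleaf : ∀ m : FamState a, InDeg m.2.length m.1 → ∑ B, ν B * leaf B m = 0) (v : Vars)
    (ψ : QState) :
    ∑ B, ν B * wp (famMem O blindBot ℝ) cnt p (fun _ => leaf B) v (fun _ => ψ, []) = 0 := by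
  rw [← wp_fam_sum (O := O) (h := blindBot) ν cnt p (fun B _ => leaf B)]
  have H : MemRel (famMem O blindBot ℝ) (famMem O blindBot ℝ)
      (fun m m' => m = m' ∧ InDeg m.2.length m.1) (fun _ _ x _ => x = 0) := by
    constructor
    · rintro m _ ⟨rfl, hm⟩
      exact ⟨⟨rfl, hm⟩, fun _ _ h => h⟩
    · rintro g q m _ ⟨rfl, hm⟩
      refine ⟨⟨rfl, fun c => ?_⟩, fun _ _ h => h⟩
      simp only [famMem, applyGate1_apply]
      exact sum_mem_deg fun o _ => const_mul_mem_deg _ (hm _)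
    · rintro q t m _ ⟨rfl, hm⟩
      refine ⟨⟨rfl, ?_⟩, fun _ _ h => h⟩
      simpa only [famMem, applyCNOT_eq] using hm.mapDomain (cnotMap_involutive q t)
    · rintro q q' t m _ ⟨rfl, hm⟩
      refine ⟨⟨rfl, ?_⟩, fun _ _ h => h⟩
      simpa only [famMem, applyToffoli_eq] using hm.mapDomain (toffoliMap_involutive q q' t)
    · rintro q m _ k k' ⟨rfl, hm⟩ hk
      simp only [famMem]
      rw [hk true _ _ ⟨rfl, hm.project q true⟩, hk false _ _ ⟨rfl, hm.project q false⟩, add_zero]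
    · rintro m _ k k' ⟨rfl, hm⟩ hk
      simp only [famMem]
      refine Finset.sum_eq_zero fun g _ => ?_
      rw [hk _ _ ⟨rfl, by simpa using hm.query g⟩, smul_zero]
  refine wp_rel H cnt p _ (fun _ _ => 0) ?_ v _ _ ⟨rfl, fun c => const_mem_deg 0 (ψ c)⟩
  rintro v m _ ⟨rfl, hm⟩
  exact hleaf m hm

/-- The expected payoff of a forgery for `B` read off from `ψ`. -/
def pay (acc : Bits a → Bits b → ℝ) (B : Finset (Bits a)) (ψ : QState) : ℝ :=
  ∑ x, ∑ t, (if x ∈ B then 1 else 0) * (acc x t * nS (projReg regY b t (projReg regX a x ψ)))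

variable {acc : Bits a → Bits b → ℝ}

theorem pay_nonneg (hacc : ∀ x t, 0 ≤ acc x t ∧ acc x t ≤ 1) (B : Finset (Bits a)) (ψ : QState) : 0 ≤ pay acc B ψ :=
  Finset.sum_nonneg fun x _ => Finset.sum_nonneg fun t _ => by
    have := mul_nonneg (hacc x t).1 (nS_nonneg (projReg regY b t (projReg regX a x ψ)))
    split_ifs <;> simp [this]

theorem sum_sum_nS (ψ : QState) :
    ∑ x : Bits a, ∑ t : Bits b, nS (projReg regY b t (projReg regX a x ψ)) = nS ψ := by
  simp only [sum_nS_projReg]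

theorem pay_le (hacc : ∀ x t, 0 ≤ acc x t ∧ acc x t ≤ 1) (B : Finset (Bits a)) (ψ : QState) : pay acc B ψ ≤ nS ψ := by
  rw [← sum_sum_nS (a := a) (b := b) ψ]
  refine Finset.sum_le_sum fun x _ => Finset.sum_le_sum fun t _ => ?_
  have h1 := nS_nonneg (projReg regY b t (projReg regX a x ψ))
  have h2 := mul_le_of_le_one_left h1 (hacc x t).2
  split_ifs <;> linarith

theorem pay_le_add (hacc : ∀ x t, 0 ≤ acc x t ∧ acc x t ≤ 1) (B : Finset (Bits a)) (ψ φ : QState) :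
    pay acc B ψ ≤ 2 * pay acc B φ + 2 * nS (ψ - φ) := by
  rw [← sum_sum_nS (a := a) (b := b) (ψ - φ)]
  unfold pay
  simp only [Finset.mul_sum, ← Finset.sum_add_distrib]
  refine Finset.sum_le_sum fun x _ => Finset.sum_le_sum fun t _ => ?_
  have h1 := nS_add_le (projReg regY b t (projReg regX a x φ))
    (projReg regY b t (projReg regX a x (ψ - φ))) one_pos
  have e : projReg regY b t (projReg regX a x φ) + projReg regY b t (projReg regX a x (ψ - φ))
      = projReg regY b t (projReg regX a x ψ) := by
    simp only [projReg_sub]; abel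
  rw [e] at h1
  have h2 := nS_nonneg (projReg regY b t (projReg regX a x (ψ - φ)))
  have h3 := mul_le_mul_of_nonneg_left h1 (hacc x t).1
  have h4 := mul_le_of_le_one_left h2 (hacc x t).2
  split_ifs
  · nlinarith
  · linarith

theorem pay_mem_deg {q : ℕ} {φ : Finset (Bits a) → QState} (h : InDeg q φ) :
    (fun B => ((pay acc B (φ B) : ℝ) : ℂ)) ∈ Deg (Bits a) (q + q + 1) := by
  unfold pay
  simp only [Complex.ofReal_sum, Complex.ofReal_mul, apply_ite Complex.ofReal, Complex.ofReal_one,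
    Complex.ofReal_zero]
  refine sum_mem_deg fun x _ => sum_mem_deg fun t _ => ?_
  have h1 := mul_mem_deg (mem_deg_one x) (const_mul_mem_deg (acc x t : ℂ)
    (((h.projReg regX a x).projReg regY b t).nS))
  rw [add_comm] at h1
  exact h1

end LowDegree

/-! ## Values of runs with blinded oracles -/

section Values

variable {a b : ℕ}

/-- The payoff of the run with the oracle blinded on `C` when a forgery in `B` counts. -/
def leafOn (acc : Bits a → Bits b → ℝ) (T : ℕ) (C B : Finset (Bits a)) (m : FamState a) : ℝ :=
  if m.2.length ≤ T then pay acc B (m.1 C) else 0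

def valOn (O : Oracle a b) (cnt : ℕ → ℕ) (p : Cmd) (acc : Bits a → Bits b → ℝ) (T : ℕ) (v : Vars)
    (C B : Finset (Bits a)) : ℝ :=
  wp (famMem O blindBot ℝ) cnt p (fun _ => leafOn acc T C B) v (fun _ => QState.zeroKet, [])

/-- The value of a run that uses the oracle blinded on `B` if one of `r` random messages lies
outside of `B`, and the oracle blinded everywhere otherwise. -/
def valMix (O : Oracle a b) (cnt : ℕ → ℕ) (p : Cmd) (acc : Bits a → Bits b → ℝ) (T r : ℕ) (v : Vars)
    (B : Finset (Bits a)) : ℝ :=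
  (1 - dens B ^ r) * valOn O cnt p acc T v B B + dens B ^ r * valOn O cnt p acc T v Finset.univ B

variable {O : Oracle a b} {cnt : ℕ → ℕ} {p : Cmd} {acc : Bits a → Bits b → ℝ} {T r : ℕ} {v : Vars}

theorem wp_eq_valOn (hacc : ∀ x t, 0 ≤ acc x t ∧ acc x t ≤ 1) (C B : Finset (Bits a)) :
    wp (pureMem (O.map (blindBot C))) cnt p
      (fun _ m => if m.2.length ≤ T then ENNReal.ofReal (pay acc B m.1) else 0) v
      (QState.zeroKet, []) = ENNReal.ofReal (valOn O cnt p acc T v C B) ∧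
    0 ≤ valOn O cnt p acc T v C B := by
  refine wp_pureMem_eq_fam (O := O) (h := blindBot) C cnt p _ (fun _ => leafOn acc T C B) ?_ v
    (fun _ => QState.zeroKet) []
  intro v φ l
  simp only [leafOn, List.length_map]
  split_ifs
  · exact ⟨rfl, pay_nonneg hacc _ _⟩
  · simp

theorem valOn_nonneg (hacc : ∀ x t, 0 ≤ acc x t ∧ acc x t ≤ 1) (C B : Finset (Bits a)) :
    0 ≤ valOn O cnt p acc T v C B := (wp_eq_valOn hacc C B).2

theorem valOn_le_one (hacc : ∀ x t, 0 ≤ acc x t ∧ acc x t ≤ 1) (C B : Finset (Bits a)) :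
    valOn O cnt p acc T v C B ≤ 1 := by
  have := wp_fam_le (O := O) (h := blindBot) (F := fun m => nS (m.1 C))
    (fun S φ l hS => hS.nS _) (fun q φ l => (nS_project_add q _).le)
    (fun g φ l => ((IsoLin.oracle _).nS _).le) cnt p (f := fun _ => leafOn acc T C B)
    (fun _ m => by
      simp only [leafOn]
      split_ifs
      · exact pay_le hacc _ _
      · exact nS_nonneg _) v (fun _ => QState.zeroKet, [])
  simp only [nS_zeroKet] at this
  exact this

theorem valMix_mem (hacc : ∀ x t, 0 ≤ acc x t ∧ acc x t ≤ 1) (B : Finset (Bits a)) :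
    0 ≤ valMix O cnt p acc T r v B ∧ valMix O cnt p acc T r v B ≤ 1 := by
  have h1 := valOn_nonneg (O := O) (cnt := cnt) (p := p) (T := T) (v := v) hacc B B
  have h2 := valOn_nonneg (O := O) (cnt := cnt) (p := p) (T := T) (v := v) hacc Finset.univ B
  have h3 := valOn_le_one (O := O) (cnt := cnt) (p := p) (T := T) (v := v) hacc B B
  have h4 := valOn_le_one (O := O) (cnt := cnt) (p := p) (T := T) (v := v) hacc Finset.univ B
  have h5 : 0 ≤ dens B ^ r := pow_nonneg (dens_nonneg B) r
  have h6 : dens B ^ r ≤ 1 := pow_le_one₀ (dens_nonneg B) (dens_le_one B)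
  unfold valMix
  constructor
  · have := mul_nonneg (sub_nonneg.2 h6) h1
    have := mul_nonneg h5 h2
    linarith
  · have := mul_le_mul_of_nonneg_left h3 (sub_nonneg.2 h6)
    have := mul_le_mul_of_nonneg_left h4 h5
    linarith

/-- The degree count: 2T for squared amplitudes after at most T queries, 1 for the condition that
the forgery is blinded, and r for the probability that r random messages all lie in B. -/
theorem sum_valMix_eq_zero {k : ℕ} (hk : 2 * T + 1 + r ≤ k) {ν : Finset (Bits a) → ℝ}
    (hν : ∀ S : Finset (Bits a), S.card ≤ k → ∑ B, ν B * (if S ⊆ B then 1 else 0) = 0) :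
    ∑ B, ν B * valMix O cnt p acc T r v B = 0 := by
  have hd : ∀ {q : ℕ} {f : Finset (Bits a) → ℝ}, (fun B => (f B : ℂ)) ∈ Deg (Bits a) q →
      q + r ≤ k → ∑ B, ν B * (dens B ^ r * f B) = 0 := by
    intro q f hf hq
    refine sum_mul_eq_zero_of_deg hν ?_
    have := deg_mono (by omega : r + q ≤ k) (mul_mem_deg (dens_pow_mem_deg r) hf)
    simpa only [Complex.ofReal_mul] using this
  have h1 := sum_fam_eq_zero O cnt p (ν := fun B => ν B * (1 - dens B ^ r))
    (leaf := fun B => leafOn acc T B B) (fun m hm => by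
      simp only [leafOn]
      split_ifs with hl
      · have hp := pay_mem_deg (acc := acc) hm
        have e1 := hd hp (by omega)
        have e2 := sum_mul_eq_zero_of_deg hν (deg_mono (by omega) hp)
        rw [← sub_eq_zero.2 (e2.trans e1.symm), ← Finset.sum_sub_distrib]
        exact Finset.sum_congr rfl fun B _ => by ring
      · simp) v QState.zeroKet
  have h2 := sum_fam_eq_zero O cnt p (ν := fun B => ν B * dens B ^ r)
    (leaf := fun B => leafOn acc T Finset.univ B) (fun m hm => by
      simp only [leafOn]
      split_ifs with hl
      · have hp := pay_mem_deg (acc := acc) (q := 0) (φ := fun _ : Finset (Bits a) => m.1 Finset.univ)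
          fun c => const_mem_deg 0 _
        rw [← hd hp (by omega)]
        exact Finset.sum_congr rfl fun B _ => by ring
      · simp) v QState.zeroKet
  refine Eq.trans ?_ ((congr (congrArg HAdd.hAdd h1) h2).trans (add_zero 0))
  rw [← Finset.sum_add_distrib]
  refine Finset.sum_congr rfl fun B _ => ?_
  simp only [valMix, valOn]
  ring

/-! ### Comparison with the oracle that is blinded everywhere -/

/-- The reference run is now the one in which everything is blinded, since the weights `μ` will
favour sets that contain nearly all messages. -/
def diffU (μ : Finset (Bits a) → ℝ) (φ : Finset (Bits a) → QState) : ℝ :=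
  ∑ B, μ B * nS (φ B - φ Finset.univ)

def potU (μ : Finset (Bits a) → ℝ) (κ : ℝ) (T : ℕ) (m : FamState a) : ℝ :=
  (if m.2.length ≤ T then diffU μ m.1 / ((m.2.length : ℝ) + 1) else 0)
  + 4 * κ * ((T - m.2.length : ℕ) : ℝ) * nS (m.1 Finset.univ)

variable {μ : Finset (Bits a) → ℝ} {κ : ℝ}

theorem diffU_nonneg (hμ : ∀ B, 0 ≤ μ B) (φ : Finset (Bits a) → QState) : 0 ≤ diffU μ φ :=
  Finset.sum_nonneg fun B _ => mul_nonneg (hμ B) (nS_nonneg _)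

theorem sum_mul_nS_projSet_compl_le
    (hκ : ∀ x : Bits a, ∑ B, μ B * (if x ∈ B then 0 else 1) ≤ κ) (φ : QState) :
    ∑ B : Finset (Bits a), μ B * nS (projSet Bᶜ φ) ≤ κ * nS φ := by
  have h : ∀ B : Finset (Bits a), nS (projSet Bᶜ φ)
      = ∑ c ∈ φ.support, (if readReg regX a c ∈ B then 0 else 1) * ‖φ c‖ ^ 2 := by
    intro B
    rw [nS_eq_sum (projSet Bᶜ φ) φ.support (by
      intro c hc
      rw [Finsupp.mem_support_iff, projSet_apply] at hc
      rw [Finsupp.mem_support_iff]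
      intro h0
      simp [h0] at hc)]
    refine Finset.sum_congr rfl fun c _ => ?_
    rw [projSet_apply]
    simp only [Finset.mem_compl]
    by_cases hc : readReg regX a c ∈ B <;> simp [hc]
  simp only [h, Finset.mul_sum]
  rw [Finset.sum_comm, nS_eq_sum φ φ.support subset_rfl, Finset.mul_sum]
  refine Finset.sum_le_sum fun c _ => ?_
  refine le_trans (le_of_eq ?_) (mul_le_mul_of_nonneg_right (hκ (readReg regX a c)) (by positivity))
  rw [Finset.sum_mul]
  exact Finset.sum_congr rfl fun B _ => by ring

theorem diffU_query (hμ : ∀ B, 0 ≤ μ B)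
    (hκ : ∀ x : Bits a, ∑ B, μ B * (if x ∈ B then 0 else 1) ≤ κ) (g : Bits a → Bits b)
    (φ : Finset (Bits a) → QState) {s : ℝ} (hs : 0 < s) :
    diffU μ (fun B => standardOracle (blindBot B g) (φ B))
      ≤ (1 + 1 / s) * diffU μ φ + (1 + s) * (4 * (κ * nS (φ Finset.univ))) := by
  refine le_trans ?_ (add_le_add le_rfl (mul_le_mul_of_nonneg_left (mul_le_mul_of_nonneg_left
    (sum_mul_nS_projSet_compl_le hκ (φ Finset.univ)) (by norm_num : (0 : ℝ) ≤ 4))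
    (by positivity : 0 ≤ 1 + s)))
  unfold diffU
  rw [Finset.mul_sum, Finset.mul_sum, Finset.mul_sum, ← Finset.sum_add_distrib]
  refine Finset.sum_le_sum fun B _ => ?_
  have e : standardOracle (blindBot B g) (φ B)
        - standardOracle (blindBot Finset.univ g) (φ Finset.univ)
      = standardOracle (blindBot B g) (φ B - φ Finset.univ)
        + (standardOracle (blindBot B g) (φ Finset.univ)
          - standardOracle (blindBot Finset.univ g) (φ Finset.univ)) := by
    rw [(IsoLin.oracle _).sub]
    abel
  have h2 := nS_add_le (standardOracle (blindBot B g) (φ B - φ Finset.univ))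
    (standardOracle (blindBot B g) (φ Finset.univ)
      - standardOracle (blindBot Finset.univ g) (φ Finset.univ)) hs
  rw [← e, (IsoLin.oracle _).nS] at h2
  have h3 := nS_oracle_sub_le Bᶜ (blindBot B g) (blindBot Finset.univ g) (fun x hx => by
    simp only [Finset.mem_compl, not_not] at hx
    simp [blindBot, blind, hx]) (φ Finset.univ)
  have h4 := mul_le_mul_of_nonneg_left h3 (by positivity : (0 : ℝ) ≤ 1 + s)
  have h5 := mul_le_mul_of_nonneg_left (h2.trans (add_le_add le_rfl h4)) (hμ B)
  exact h5.trans (le_of_eq (by ring))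

/-- With s = q + 1 the growth (q+2)/(q+1) of the old error cancels exactly against the change of the
weight 1/(q+1), and the new error is exactly the share 4κ reserved for this query. -/
theorem potU_query (hμ : ∀ B, 0 ≤ μ B) (hκ0 : 0 ≤ κ)
    (hκ : ∀ x : Bits a, ∑ B, μ B * (if x ∈ B then 0 else 1) ≤ κ) (g : Bits a → Bits b)
    (φ : Finset (Bits a) → QState) (l) :
    potU μ κ T (fun B => standardOracle (blindBot B g) (φ B), l ++ [φ]) ≤ potU μ κ T (φ, l) := by
  have hN := nS_nonneg (φ Finset.univ)
  have hD0 := diffU_nonneg hμ φ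
  simp only [potU, List.length_append, List.length_singleton, (IsoLin.oracle _).nS]
  by_cases hq : l.length + 1 ≤ T
  · rw [if_pos hq, if_pos (by omega)]
    obtain ⟨k, rfl⟩ := Nat.exists_eq_add_of_le hq
    have e1 : l.length + 1 + k - (l.length + 1) = k := by omega
    have e2 : l.length + 1 + k - l.length = k + 1 := by omega
    rw [e1, e2]
    push_cast
    set q : ℝ := (l.length : ℝ)
    have hq0 : 0 ≤ q := Nat.cast_nonneg _
    have hD := diffU_query hμ hκ g φ (s := q + 1) (by positivity)
    have hD2 := div_le_div_of_nonneg_right hD (by positivity : 0 ≤ q + 1 + 1)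
    have c1 : ((1 + 1 / (q + 1)) * diffU μ φ + (1 + (q + 1)) * (4 * (κ * nS (φ Finset.univ))))
        / (q + 1 + 1) = diffU μ φ / (q + 1) + 4 * κ * nS (φ Finset.univ) := by
      field_simp
      ring
    rw [c1] at hD2
    linarith
  · rw [if_neg hq, zero_add]
    have e1 : T - (l.length + 1) = 0 := by omega
    rw [e1]
    simp only [Nat.cast_zero, mul_zero, zero_mul]
    split_ifs <;> positivity

/-- In each branch the payoff of one state is at most twice that of the other plus twice their
squared distance. Multiplication by T + 1 undoes the weight of the potential, whose initial value is
4κT. -/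
theorem sum_valOn_le (hacc : ∀ x t, 0 ≤ acc x t ∧ acc x t ≤ 1) (hμ : ∀ B, 0 ≤ μ B) (hκ0 : 0 ≤ κ)
    (hκ : ∀ x : Bits a, ∑ B, μ B * (if x ∈ B then 0 else 1) ≤ κ) :
    ∑ B, μ B * valOn O cnt p acc T v B B
      ≤ 2 * ∑ B, μ B * valOn O cnt p acc T v Finset.univ B + 8 * κ * T * (T + 1) := by
  have hleaf : ∀ m : FamState a, ∑ B, μ B * leafOn acc T B B m
      ≤ 2 * ∑ B, μ B * leafOn acc T Finset.univ B m + (2 * (T + 1)) * potU μ κ T m := by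
    intro m
    have hD0 := diffU_nonneg hμ m.1
    have hN := nS_nonneg (m.1 Finset.univ)
    simp only [leafOn, potU]
    split_ifs with hl
    · have h1 : ∑ B, μ B * pay acc B (m.1 B)
          ≤ 2 * ∑ B, μ B * pay acc B (m.1 Finset.univ) + 2 * diffU μ m.1 := by
        unfold diffU
        rw [Finset.mul_sum, Finset.mul_sum, ← Finset.sum_add_distrib]
        refine Finset.sum_le_sum fun B _ => ?_
        have := mul_le_mul_of_nonneg_left (pay_le_add hacc B (m.1 B) (m.1 Finset.univ)) (hμ B)
        linarith
      have hq : (m.2.length : ℝ) ≤ T := Nat.cast_le.2 hl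
      have h2 : diffU μ m.1 ≤ (T + 1) * (diffU μ m.1 / ((m.2.length : ℝ) + 1)) := by
        rw [mul_div_assoc', le_div_iff₀ (by positivity)]
        nlinarith
      have h3 : 0 ≤ (2 * ((T : ℝ) + 1)) * (4 * κ * ((T - m.2.length : ℕ) : ℝ) * nS (m.1 Finset.univ)) := by
        positivity
      rw [mul_add]
      linarith
    · simp only [mul_zero, Finset.sum_const_zero, zero_add]
      positivity
  have h1 := wp_fam_mono (O := O) (h := blindBot) cnt p (fun _ m => hleaf m) v
    (fun _ => QState.zeroKet, [])
  rw [wp_fam_add_mul (O := O) (h := blindBot) 2 (2 * (T + 1)) cnt p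
      (fun _ m => ∑ B, μ B * leafOn acc T Finset.univ B m) (fun _ m => potU μ κ T m),
    wp_fam_sum (O := O) (h := blindBot) μ cnt p (fun B _ m => leafOn acc T Finset.univ B m),
    wp_fam_sum (O := O) (h := blindBot) μ cnt p (fun B _ m => leafOn acc T B B m)] at h1
  have h2 := wp_fam_le (O := O) (h := blindBot) (F := potU μ κ T)
    (fun S φ l hS => by simp only [potU, diffU, ← hS.sub, hS.nS])
    (fun q φ l => by
      have e : diffU μ (fun B => project q true (φ B)) + diffU μ (fun B => project q false (φ B))
          = diffU μ φ := by
        unfold diffU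
        rw [← Finset.sum_add_distrib]
        refine Finset.sum_congr rfl fun B _ => ?_
        rw [← project_sub, ← project_sub, ← mul_add, nS_project_add]
      simp only [potU, ← e, ← nS_project_add q (φ Finset.univ)]
      split_ifs
      · exact le_of_eq (by ring)
      · exact le_of_eq (by ring))
    (fun g φ l => potU_query hμ hκ0 hκ g φ l) cnt p (f := fun _ m => potU μ κ T m)
    (fun _ _ => le_rfl) v (fun _ => QState.zeroKet, [])
  have e0 : potU μ κ T ((fun _ => QState.zeroKet), []) = 4 * κ * T := by
    simp [potU, diffU, nS_zeroKet]
  rw [e0] at h2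
  have h3 := mul_le_mul_of_nonneg_left h2 (by positivity : (0 : ℝ) ≤ 2 * (T + 1))
  unfold valOn
  linarith

/-- The value is split according to whether a spare message is found. Only the second part, with
weights bern times dens^r, changes its oracle, and under these weights each message is unblinded
with mass at most 1/(r+1). -/
theorem sum_bern_valOn_le (hacc : ∀ x t, 0 ≤ acc x t ∧ acc x t ≤ 1) {ε : ℝ} (h0 : 0 ≤ ε)
    (h1 : ε ≤ 1) :
    ∑ B, bern ε B * valOn O cnt p acc T v B B
      ≤ 2 * ∑ B, bern ε B * valMix O cnt p acc T r v B + 8 * (1 / (r + 1)) * T * (T + 1) := by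
  have hb := fun B : Finset (Bits a) => bern_nonneg h0 h1 B
  have hd := fun B : Finset (Bits a) => pow_nonneg (dens_nonneg B) r
  have hd1 := fun B : Finset (Bits a) => pow_le_one₀ (n := r) (dens_nonneg B) (dens_le_one B)
  have key := sum_valOn_le (O := O) (cnt := cnt) (p := p) (T := T) (v := v) hacc
    (μ := fun B => bern ε B * dens B ^ r) (κ := 1 / (r + 1))
    (fun B => mul_nonneg (hb B) (hd B)) (by positivity)
    (fun x => sum_bern_dens_pow_le h0 h1 r x)
  have h2 : ∑ B, bern ε B * valOn O cnt p acc T v B B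
      = ∑ B, bern ε B * ((1 - dens B ^ r) * valOn O cnt p acc T v B B)
        + ∑ B, bern ε B * dens B ^ r * valOn O cnt p acc T v B B := by
    rw [← Finset.sum_add_distrib]
    exact Finset.sum_congr rfl fun B _ => by ring
  have h3 : 2 * ∑ B, bern ε B * valMix O cnt p acc T r v B
      = 2 * ∑ B, bern ε B * ((1 - dens B ^ r) * valOn O cnt p acc T v B B)
        + 2 * ∑ B, bern ε B * dens B ^ r * valOn O cnt p acc T v Finset.univ B := by
    rw [← mul_add, ← Finset.sum_add_distrib]
    congr 1
    exact Finset.sum_congr rfl fun B _ => by rw [valMix]; ring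
  have h4 : 0 ≤ ∑ B, bern ε B * ((1 - dens B ^ r) * valOn O cnt p acc T v B B) :=
    Finset.sum_nonneg fun B _ => mul_nonneg (hb B)
      (mul_nonneg (sub_nonneg.2 (hd1 B)) (valOn_nonneg hacc _ _))
  rw [h2, h3]
  linarith

end Values

/-! ## The blinding set from a hash function -/

section Hash

variable {a l d s : ℕ}

/-- The bits of the first seed. -/
def seedL (L : Fin d → Fin l → Bits (a + 1)) (n : ℕ) : Bool :=
  if h : n % (a + 1) < a + 1 ∧ (n / (a + 1)) % d < d ∧ n / (a + 1) / d < l then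
    L ⟨_, h.2.1⟩ ⟨_, h.2.2⟩ ⟨_, h.1⟩ else false

def seedT (T : Fin s → Fin d → Bool) (n : ℕ) : Bool :=
  if h : n % d < d ∧ n / d < s then T ⟨_, h.2⟩ ⟨_, h.1⟩ else false

theorem seedL_apply (L : Fin d → Fin l → Bits (a + 1)) (j : Fin d) (i : Fin l) {t : ℕ}
    (ht : t < a + 1) : seedL L (t + (a + 1) * (j + d * i)) = L j i ⟨t, ht⟩ := by
  have h1 : (t + (a + 1) * (j + d * i)) % (a + 1) = t := by
    rw [Nat.add_mul_mod_self_left, Nat.mod_eq_of_lt ht]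
  have h2 : (t + (a + 1) * (j + d * i)) / (a + 1) = j + d * i := by
    rw [Nat.add_mul_div_left _ _ (Nat.succ_pos a), Nat.div_eq_of_lt ht, zero_add]
  have hd : 0 < d := j.pos
  have h3 : (j + d * i : ℕ) % d = j := by
    rw [Nat.add_mul_mod_self_left, Nat.mod_eq_of_lt j.2]
  have h4 : (j + d * i : ℕ) / d = i := by
    rw [Nat.add_mul_div_left _ _ hd, Nat.div_eq_of_lt j.2, zero_add]
  simp only [seedL, h1, h2, h3, h4]
  rw [dif_pos ⟨ht, j.2, i.2⟩]

theorem seedT_apply (T : Fin s → Fin d → Bool) (i : Fin s) (j : Fin d) :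
    seedT T (j + d * i) = T i j := by
  have hd : 0 < d := j.pos
  have h3 : (j + d * i : ℕ) % d = j := by
    rw [Nat.add_mul_mod_self_left, Nat.mod_eq_of_lt j.2]
  have h4 : (j + d * i : ℕ) / d = i := by
    rw [Nat.add_mul_div_left _ _ hd, Nat.div_eq_of_lt j.2, zero_add]
  simp only [seedT, h3, h4]
  rw [dif_pos ⟨j.2, i.2⟩]

theorem affine_seedL (L : Fin d → Fin l → Bits (a + 1)) (j : Fin d) (i : Fin l) (x : ℕ → Bool) :
    affine a (seedL L) (j + d * i) x = affine a (ext (L j i)) 0 x := by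
  unfold affine
  congr 1
  · refine xorSum_congr fun t ht => ?_
    rw [seedL_apply L j i (by omega : t < a + 1)]
    simp [ext, (by omega : t < a + 1)]
  · rw [seedL_apply L j i (by omega : a < a + 1)]
    simp [ext]

theorem bucket_seedL (L : Fin d → Fin l → Bits (a + 1)) (j : Fin d) (x : Bits a) {k : ℕ}
    (hk : k ≤ l) : bucket a d (seedL L) (ext x) k j
      = decide (∀ i : Fin l, (i : ℕ) < k → affine a (ext (L j i)) 0 (ext x) = true) := by
  induction k with
  | zero => simp [bucket]
  | succ k ih =>
    rw [bucket, ih (by omega), affine_seedL L j ⟨k, by omega⟩, Bool.eq_iff_iff]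
    simp only [Bool.and_eq_true, decide_eq_true_eq]
    constructor
    · rintro ⟨h1, h2⟩ i hi
      by_cases h : (i : ℕ) < k
      · exact h1 i h
      · have : i = ⟨k, by omega⟩ := Fin.ext (by simp; omega)
        rw [this]; exact h2
    · intro h
      exact ⟨fun i hi => h i (by omega), h _ (Nat.lt_succ_self k)⟩

theorem toZ_word (L : Fin d → Fin l → Bits (a + 1)) (T : Fin s → Fin d → Bool) (x : Bits a)
    (i : Fin s) : toZ (word a d l (seedL L) (seedT T) (ext x) i)
      = ∑ j, toZ (T i j) * toZ (inBucket (L j) x) := by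
  rw [word, toZ_xorSum]
  refine Finset.sum_congr rfl fun j _ => ?_
  rw [toZ_and, seedT_apply, bucket_seedL L j x le_rfl]
  congr 2
  simp [inBucket]

theorem bitVal_lt (z : ℕ → Bool) (s : ℕ) : bitVal z s < 2 ^ s := by
  induction s with
  | zero => simp [bitVal]
  | succ s ih => rw [bitVal, pow_succ]; split_ifs <;> omega

variable (z : ℕ → Bool)

/-- The set given by two seeds. -/
abbrev seedSet (s : ℕ) (L : Fin d → Fin l → Bits (a + 1)) (T : Fin s → Fin d → Bool) :
    Finset (Bits a) := hashSet a d l s z (seedL L) (seedT T)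

/-- For a good first seed the words of any k messages are independent, and each is below the
threshold for exactly the fraction bitVal z / 2^s of words. Up to k elements, the hashed set has the
inclusion probabilities of the Bernoulli set. -/
theorem sum_subset_seedSet {k : ℕ} {L : Fin d → Fin l → Bits (a + 1)} (hL : Good k L)
    {S : Finset (Bits a)} (hS : S.card ≤ k) :
    ∑ T : Fin s → Fin d → Bool, (if S ⊆ seedSet z s L T then (1 : ℝ) else 0)
      = ((2 : ℝ) ^ d) ^ s * ((bitVal z s : ℝ) / 2 ^ s) ^ S.card := by
  have h := sum_prod_word hL (fun w : Bits s => if less z (ext w) s then (1 : ℝ) else 0)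
    (fun T x i => word a d l (seedL L) (seedT T) (ext x) i) (toZ_word L) hS
  rw [sum_less] at h
  rw [← h]
  refine Finset.sum_congr rfl fun T _ => ?_
  rw [Finset.prod_boole]
  have : (S ⊆ seedSet z s L T) ↔ ∀ x ∈ S, less z
      (ext fun i : Fin s => word a d l (seedL L) (seedT T) (ext x) i) s = true := by
    refine forall₂_congr fun x _ => ?_
    simp only [seedSet, hashSet, Finset.mem_filter, Finset.mem_univ, true_and]
    rw [less_congr (w' := ext fun i : Fin s => word a d l (seedL L) (seedT T) (ext x) i)]
    intro i hi
    simp [ext, hi]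
  by_cases hs : S ⊆ seedSet z s L T
  · rw [if_pos hs, if_pos (this.1 hs)]
  · rw [if_neg hs, if_neg (mt this.2 hs)]

open Classical in
/-- Hashing replaces the independent blinding set. -/
theorem sum_bern_le_hash {k : ℕ} (hk : 2 * k ≤ 2 ^ l) {V : Finset (Bits a) → ℝ}
    (hV : ∀ B, 0 ≤ V B ∧ V B ≤ 1)
    (hdeg : ∀ ν : Finset (Bits a) → ℝ, (∀ S : Finset (Bits a), S.card ≤ k →
      ∑ B, ν B * (if S ⊆ B then 1 else 0) = 0) → ∑ B, ν B * V B = 0) :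
    ∑ B, bern ((bitVal z s : ℝ) / 2 ^ s) B * V B
      ≤ 1 / (((2 ^ (a + 1)) ^ l) ^ d * (2 ^ d) ^ s) *
          (∑ L : Fin d → Fin l → Bits (a + 1), ∑ T : Fin s → Fin d → Bool, V (seedSet z s L T))
        + (k + 1) * (2 ^ a) ^ k * (1 - 1 / 2 ^ (l + 1)) ^ d := by
  set ε : ℝ := (bitVal z s : ℝ) / 2 ^ s with hε
  have hε0 : 0 ≤ ε := by positivity
  have hε1 : ε ≤ 1 := div_le_one_of_le₀ (by exact_mod_cast (bitVal_lt z s).le) (by positivity)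
  set E := ∑ B, bern ε B * V B with hE
  have hE1 : E ≤ 1 := by
    rw [hE, ← sum_bern (α := Bits a) ε]
    exact Finset.sum_le_sum fun B _ => mul_le_of_le_one_right (bern_nonneg hε0 hε1 B) (hV B).2
  set M : ℝ := ((2 : ℝ) ^ d) ^ s with hM
  have hM0 : 0 < M := by positivity
  set N : ℝ := (((2 : ℝ) ^ (a + 1)) ^ l) ^ d with hN
  have hN0 : 0 < N := by positivity
  have hgood : ∀ L : Fin d → Fin l → Bits (a + 1), Good k L →
      M * E = ∑ T : Fin s → Fin d → Bool, V (seedSet z s L T) := by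
    intro L hL
    -- The signed weight, Bernoulli minus hashed, annihilates all monomials of degree at most k, so
    -- it annihilates the value `V`.
    have h1 := hdeg (fun B => M * bern ε B
      - ∑ T : Fin s → Fin d → Bool, if seedSet z s L T = B then 1 else 0) (by
        intro S hS
        simp only [sub_mul, Finset.sum_sub_distrib, mul_assoc, ← Finset.mul_sum,
          sum_bern_mul_prod, Finset.sum_mul]
        rw [Finset.sum_comm, ← sum_subset_seedSet z hL hS, sub_eq_zero]
        refine Finset.sum_congr rfl fun T _ => ?_
        rw [Finset.sum_eq_single (seedSet z s L T)]
        · simp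
        · intro B _ hB
          rw [if_neg hB.symm, zero_mul]
        · simp)
    simp only [sub_mul, Finset.sum_sub_distrib, mul_assoc, ← Finset.mul_sum, Finset.sum_mul] at h1
    rw [sub_eq_zero, Finset.sum_comm] at h1
    rw [h1]
    refine Finset.sum_congr rfl fun T _ => ?_
    rw [Finset.sum_eq_single (seedSet z s L T)]
    · simp
    · intro B _ hB
      rw [if_neg hB.symm, zero_mul]
    · simp
  -- A first seed that is not good is charged the full mass, which suffices because the Bernoulli
  -- average is at most one.
  have hpt : ∀ L : Fin d → Fin l → Bits (a + 1),
      M * E ≤ (∑ T : Fin s → Fin d → Bool, V (seedSet z s L T)) + M * if Good k L then 0 else 1 := by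
    intro L
    split_ifs with hL
    · rw [hgood L hL]; simp
    · have : 0 ≤ ∑ T : Fin s → Fin d → Bool, V (seedSet z s L T) :=
        Finset.sum_nonneg fun T _ => (hV _).1
      have := mul_le_mul_of_nonneg_left hE1 hM0.le
      linarith
  have hsum := Finset.sum_le_sum fun L (_ : L ∈ Finset.univ) => hpt L
  rw [Finset.sum_add_distrib, ← Finset.mul_sum, ← Finset.mul_sum] at hsum
  have hcard : ∑ _L : Fin d → Fin l → Bits (a + 1), E = N * E := by
    simp [hN]
  rw [hcard] at hsum
  have hbad := mul_le_mul_of_nonneg_left (sum_not_good_le (a := a) (d := d) hk) hM0.le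
  have h2 := hsum.trans (add_le_add le_rfl hbad)
  have h3 : E ≤ 1 / (N * M) * ((∑ L : Fin d → Fin l → Bits (a + 1), ∑ T : Fin s → Fin d → Bool,
      V (seedSet z s L T)) + M * ((k + 1) * (2 ^ a) ^ k * N * (1 - 1 / 2 ^ (l + 1)) ^ d)) := by
    have := mul_le_mul_of_nonneg_left h2 (by positivity : 0 ≤ 1 / (N * M))
    refine le_trans (le_of_eq ?_) this
    field_simp
  refine h3.trans (le_of_eq ?_)
  rw [mul_add]
  congr 1
  field_simp

end Hash

/-! ## Reversible circuits as sequences of toggles -/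

/-- Flip qubit `q` if `h` is true. -/
def toggle (q : Qubit) (h : Basis → Bool) (b : Basis) : Basis :=
  Function.update b q (xor (b q) (h b))

theorem toggle_involutive {q : Qubit} {h : Basis → Bool}
    (hh : ∀ b b' : Basis, (∀ x, x ≠ q → b x = b' x) → h b = h b') :
    Function.Involutive (toggle q h) := by
  intro b
  have : h (Function.update b q (xor (b q) (h b))) = h b :=
    hh _ _ fun x hx => Function.update_of_ne hx _ _
  simp [toggle, this]

/-- The `j`-th function does not depend on the qubits `(R, j + off), (R, j + 1 + off), …` -/
def IsChain (R off : ℕ) (h : ℕ → Basis → Bool) : Prop :=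
  ∀ j b b', (∀ q : Qubit, ¬ (q.1 = R ∧ j + off ≤ q.2) → b q = b' q) → h j b = h j b'

abbrev toggles (R off : ℕ) (h : ℕ → Basis → Bool) (j : ℕ) : Basis → Basis :=
  toggle (R, j + off) (h j)

section Chain

variable {R off : ℕ} {h : ℕ → Basis → Bool}

theorem up_toggles_succ (N : ℕ) (b : Basis) :
    up (toggles R off h) (N + 1) b = Function.update (up (toggles R off h) N b) (R, N + off)
      (xor (up (toggles R off h) N b (R, N + off)) (h N (up (toggles R off h) N b))) := rfl

theorem up_toggles_agree {A : Set ℕ} (hh : ∀ j b b', (∀ q : Qubit, q.1 ∈ A → b q = b' q) →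
    h j b = h j b') (N : ℕ) {b b' : Basis} (hb : ∀ q : Qubit, q.1 ∈ A → b q = b' q) :
    ∀ q : Qubit, q.1 ∈ A → up (toggles R off h) N b q = up (toggles R off h) N b' q := by
  induction N with
  | zero => exact hb
  | succ N ih =>
    intro q hq
    rw [up_toggles_succ, up_toggles_succ, hh N _ _ ih]
    by_cases e : q = (R, N + off)
    · subst e; simp [ih _ hq]
    · rw [Function.update_of_ne e, Function.update_of_ne e, ih q hq]

theorem IsChain.involutive (hc : IsChain R off h) (j : ℕ) :
    Function.Involutive (toggles R off h j) :=
  toggle_involutive fun b b' hb => hc j b b' fun q hq => hb q fun h' => hq (by subst h'; simp)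

theorem up_toggles_of_ne (N : ℕ) (b : Basis) {q : Qubit}
    (hq : ¬ (q.1 = R ∧ off ≤ q.2 ∧ q.2 < N + off)) : up (toggles R off h) N b q = b q := by
  induction N with
  | zero => rfl
  | succ N ih =>
    rw [up_toggles_succ, Function.update_of_ne, ih]
    · intro h'; exact hq ⟨h'.1, h'.2.1, by omega⟩
    · rintro rfl; exact hq ⟨rfl, by simp, by simp⟩

/-- Each target is toggled once and the controls of step j are never changed afterwards, so the
controls may be read in the final state. The specification of a stage thus becomes a system of
equations in its output. -/
theorem IsChain.up_apply (hc : IsChain R off h) {N j : ℕ} (hj : j < N) (b : Basis) :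
    up (toggles R off h) N b (R, j + off)
      = xor (b (R, j + off)) (h j (up (toggles R off h) N b)) := by
  have agree : ∀ k, j ≤ k → ∀ q : Qubit, ¬ (q.1 = R ∧ j + off ≤ q.2) →
      up (toggles R off h) k b q = up (toggles R off h) j b q := by
    intro k hk
    induction k, hk using Nat.le_induction with
    | base => intro q _; rfl
    | succ k hk ih =>
      intro q hq
      rw [up_toggles_succ, Function.update_of_ne, ih q hq]
      rintro rfl
      exact hq ⟨rfl, by simp; omega⟩
  have hval : ∀ k, j + 1 ≤ k → up (toggles R off h) k b (R, j + off)
      = xor (b (R, j + off)) (h j (up (toggles R off h) j b)) := by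
    intro k hk
    induction k, hk using Nat.le_induction with
    | base =>
      rw [up_toggles_succ, Function.update_self, up_toggles_of_ne j b (by simp)]
    | succ k hk ih =>
      rw [up_toggles_succ, Function.update_of_ne, ih]
      intro h'
      rw [Prod.mk.injEq] at h'
      omega
  rw [hval N hj, hc j _ _ fun q hq => agree N hj.le q hq]

end Chain

/-! ### Stages of a circuit -/

/-- The loop counter of a stage. -/
abbrev vI : ℕ := 20

def scratch : Set ℕ := {21, 22, 23}

/-- `body` with counter value `j` toggles `(R, j + off)` according to `h j`. -/
structure StageSpec (v : Vars) (body : Cmd) (R off : ℕ) (h : ℕ → Basis → Bool) : Prop where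
  writes : body.Writes scratch
  ev : ∀ w : Vars, (∀ y < 20, w y = v y) → ∀ b, body.ev bGates w b = toggles R off h (w vI) b
  chain : IsChain R off h

namespace StageSpec

variable {v : Vars} {body : Cmd} {R off : ℕ} {h : ℕ → Basis → Bool}

theorem ev_up (hs : StageSpec v body R off h) {N : ℕ} (hN : N < 20) (h1 : v vOne = 1)
    {w : Vars} (hw : ∀ y < 20, w y = v y) (b : Basis) :
    (forUp vI N body).ev bGates w b = up (toggles R off h) (v N) b := by
  rw [← hw N hN]
  refine ev_forUp bGates hs.writes (by simp [scratch]) (by simp [scratch]) (by simp)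
    (by simp only [vI]; omega) (by rw [hw _ (by norm_num), h1]) _ ?_ b
  rintro j _ w' hw' rfl m
  refine hs.ev w' (fun y hy => ?_) m
  rw [hw' y (by simp [scratch]; omega) (by simp only [vI]; omega), hw y hy]

theorem ev_down (hs : StageSpec v body R off h) {N : ℕ} (hN : N < 20) (h1 : v vOne = 1)
    (h0 : v vZero = 0) {w : Vars} (hw : ∀ y < 20, w y = v y) (b : Basis) :
    (forDown vI N body).ev bGates w b = down (toggles R off h) (v N) b := by
  rw [← hw N hN]
  refine ev_forDown bGates hs.writes (by simp [scratch]) (by simp [scratch]) (by simp)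
    (by simp only [vI]; omega) (by rw [hw _ (by norm_num), h1]) (by rw [hw _ (by norm_num), h0])
    _ ?_ b
  rintro j _ w' hw' rfl m
  refine hs.ev w' (fun y hy => ?_) m
  rw [hw' y (by simp [scratch]; omega) (by simp only [vI]; omega), hw y hy]

end StageSpec

/-! ### The stages of the hash circuit

Registers: `2`, `3` seeds, `4` extended message, `5` threshold, `6` affine forms, `7` buckets,
`8` words, `9` comparison. -/

/-- `u := t + M * i` -/
def mulIdx (u M i t : ℕ) : Cmd := .seq (.add u t vZero) (.loop M (.add u u i))

theorem mulIdx_vev {u M i t : ℕ} (hM : M ≠ u) (hi : i ≠ u) (v : Vars) (hz : v vZero = 0) :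
    (mulIdx u M i t).vev v = Function.update v u (v t + v M * v i) := by
  have e : (mulIdx u M i t).vev v
      = (Cmd.add u u i).vev^[(Cmd.add u t vZero).vev v M] ((Cmd.add u t vZero).vev v) := rfl
  rw [e, vev_add_iterate (Ne.symm hi)]
  simp [Cmd.vev, hM, hi, hz]

/-- One entry of a matrix–vector product over 𝔽₂. The same body evaluates affine forms at the
message and forms the words from the buckets. -/
def dotBody (M R₁ c R₂ R₃ : ℕ) : Cmd :=
  forUp 21 M (.seq (mulIdx 22 M vI 21) (.seq (.add 23 c 21) (.toffoli ⟨R₁, 22⟩ ⟨R₂, 23⟩ ⟨R₃, vI⟩)))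

def dotFun (M R₁ c R₂ j : ℕ) (b : Basis) : Bool :=
  xorSum (fun t => b (R₁, t + M * j) && b (R₂, c + t)) M

theorem dotFun_congr {M R₁ c R₂ R₃ j : ℕ} (h1 : R₁ ≠ R₃) (h2 : R₂ ≠ R₃) {b b' : Basis}
    (hb : ∀ q : Qubit, q.1 ≠ R₃ → b q = b' q) : dotFun M R₁ c R₂ j b = dotFun M R₁ c R₂ j b' := by
  refine xorSum_congr fun t _ => ?_
  rw [hb _ h1, hb _ h2]

theorem up_dot {M R₁ c R₂ R₃ j : ℕ} (h1 : R₁ ≠ R₃) (h2 : R₂ ≠ R₃) (K : ℕ) (b : Basis) :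
    up (fun t => toffoliMap (R₁, t + M * j) (R₂, c + t) (R₃, j)) K b
      = Function.update b (R₃, j)
          (xor (b (R₃, j)) (xorSum (fun t => b (R₁, t + M * j) && b (R₂, c + t)) K)) := by
  induction K with
  | zero => simp [up, xorSum]
  | succ K ih =>
    have hne : ∀ {R k}, R ≠ R₃ → ((R, k) : Qubit) ≠ (R₃, j) := fun h h' =>
      h (congrArg Prod.fst h')
    rw [up, ih, toffoliMap, if_neg (by simp [h1, h2]), Function.update_idem, Function.update_self,
      Function.update_of_ne (hne h1), Function.update_of_ne (hne h2), xorSum, Bool.xor_assoc]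

theorem dotBody_spec {v : Vars} {M R₁ c R₂ R₃ : ℕ} (hM : M < 20) (hc : c < 20)
    (h1 : R₁ ≠ R₃) (h2 : R₂ ≠ R₃) (hv1 : v vOne = 1) (hv0 : v vZero = 0) :
    StageSpec v (dotBody M R₁ c R₂ R₃) R₃ 0 (dotFun (v M) R₁ (v c) R₂) where
  writes := by simp [dotBody, forUp, mulIdx, Cmd.Writes, scratch]
  ev := by
    intro w hw b
    have e := ev_forUp bGates (S := {22, 23}) (i := 21) (N := M)
      (p := .seq (mulIdx 22 M vI 21) (.seq (.add 23 c 21) (.toffoli ⟨R₁, 22⟩ ⟨R₂, 23⟩ ⟨R₃, vI⟩)))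
      (by simp [mulIdx, Cmd.Writes]) (by simp) (by simp) (by simp) (by omega) (v := w)
      (by rw [hw _ (by norm_num), hv1])
      (fun t => toffoliMap (R₁, t + v M * w vI) (R₂, v c + t) (R₃, w vI)) (by
        rintro t _ w' hw' rfl m
        have hw20 : ∀ y < 20, w' y = v y := fun y hy => by
          rw [hw' y (by simp; omega) (by omega), hw y hy]
        have e1 := mulIdx_vev (u := 22) (M := M) (i := vI) (t := 21) (by omega) (by norm_num) w'
          (by rw [hw20 _ (by norm_num), hv0])
        have e2 : (mulIdx 22 M vI 21).ev bGates w' m = m :=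
          Cmd.ev_classical _ (by simp [mulIdx, Cmd.IsClassical]) _ _
        have e3 : w' vI = w vI := hw' _ (by simp) (by norm_num)
        have hc22 : c ≠ 22 := by omega
        simp only [Cmd.ev, e2, Cmd.vev, e1]
        simp [bGates, e3, hw20 M hM, hw20 c hc, hc22]) b
    refine e.trans ?_
    rw [hw M hM, up_dot h1 h2]
    rfl
  chain := by
    intro j b b' hb
    exact dotFun_congr h1 h2 fun q hq => hb q (by simp [hq])

def copyBody : Cmd := .cnot ⟨0, vI⟩ ⟨4, vI⟩

theorem copyBody_spec (v : Vars) : StageSpec v copyBody 4 0 (fun j b => b (0, j)) where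
  writes := trivial
  ev := by
    intro w _ b
    simp [copyBody, Cmd.ev, bGates, cnotMap, toggle]
  chain := by
    intro j b b' hb
    exact hb _ (by simp)

/-- Register 7 is filled in rows of length d: row k holds the conjunctions of the first k forms of
all blocks, and each new row is the previous one multiplied by the next forms. -/
def bucketBody : Cmd := .seq (.add 22 vI 13) (.toffoli ⟨7, vI⟩ ⟨6, vI⟩ ⟨7, 22⟩)

theorem bucketBody_spec {v : Vars} (hd : 0 < v 13) :
    StageSpec v bucketBody 7 (v 13) (fun j b => b (7, j) && b (6, j)) where
  writes := by simp [bucketBody, Cmd.Writes, scratch]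
  ev := by
    intro w hw b
    have := hd.ne'
    simp [bucketBody, Cmd.ev, Cmd.vev, bGates, toffoliMap, toggle, hw 13 (by norm_num), this]
  chain := by
    intro j b b' hb
    dsimp only
    rw [hb (7, j) (by simp; omega), hb (6, j) (by simp)]

/-- Over 𝔽₂ the majority of z, 1 + w and c expands to z + zw + zc + c + wc, one gate for each
monomial. -/
def lessBody : Cmd :=
  .seq (.add 22 vI vOne) (.seq (.cnot ⟨5, vI⟩ ⟨9, 22⟩) (.seq (.toffoli ⟨5, vI⟩ ⟨8, vI⟩ ⟨9, 22⟩)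
    (.seq (.toffoli ⟨5, vI⟩ ⟨9, vI⟩ ⟨9, 22⟩) (.seq (.cnot ⟨9, vI⟩ ⟨9, 22⟩)
      (.toffoli ⟨8, vI⟩ ⟨9, vI⟩ ⟨9, 22⟩)))))

theorem lessBody_spec {v : Vars} (h1 : v vOne = 1) :
    StageSpec v lessBody 9 1 (fun j b => maj (b (5, j)) (!b (8, j)) (b (9, j))) where
  writes := by simp [lessBody, Cmd.Writes, scratch]
  ev := by
    intro w hw b
    have h3 : w 3 = 1 := (hw 3 (by norm_num)).trans h1
    simp [lessBody, Cmd.ev, Cmd.vev, bGates, toffoliMap, cnotMap, toggle, h3]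
    generalize b (9, w 20 + 1) = x, b (5, w 20) = y, b (8, w 20) = z, b (9, w 20) = t
    congr 1
    revert x y z t
    decide
  chain := by
    intro j b b' hb
    dsimp only
    rw [hb (5, j) (by simp), hb (8, j) (by simp), hb (9, j) (by simp)]

def hashUp : Cmd :=
  .seq (forUp vI 1 copyBody) (.seq (forUp vI 14 (dotBody 12 2 vZero 4 6))
    (.seq (forUp vI 14 bucketBody) (.seq (forUp vI 15 (dotBody 13 3 14 7 8))
      (forUp vI 15 lessBody))))

def hashDown : Cmd :=
  .seq (forDown vI 15 lessBody) (.seq (forDown vI 15 (dotBody 13 3 14 7 8))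
    (.seq (forDown vI 14 bucketBody) (.seq (forDown vI 14 (dotBody 12 2 vZero 4 6))
      (forDown vI 1 copyBody))))

def work : Set ℕ := {20, 21, 22, 23}

def hashRegs : Set ℕ := {0, 2, 3, 4, 5, 6, 7, 8, 9}

theorem hashUp_rev : hashUp.Rev := by
  simp [hashUp, forUp, copyBody, dotBody, mulIdx, bucketBody, lessBody, Cmd.Rev]

theorem hashDown_rev : hashDown.Rev := by
  simp [hashDown, forDown, forUp, copyBody, dotBody, mulIdx, bucketBody, lessBody, Cmd.Rev]

theorem hashUp_writes : hashUp.Writes work := by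
  simp [hashUp, forUp, copyBody, dotBody, mulIdx, bucketBody, lessBody, Cmd.Writes, work]

theorem hashDown_writes : hashDown.Writes work := by
  simp [hashDown, forDown, forUp, copyBody, dotBody, mulIdx, bucketBody, lessBody, Cmd.Writes, work]

/-- The variables that hold the parameters. -/
structure Par (v : Vars) (a b d l s : ℕ) : Prop where
  msg : v 1 = a
  tag : v 2 = b
  one : v vOne = 1
  zero : v vZero = 0
  succ : v 12 = a + 1
  blocks : v 13 = d
  forms : v 14 = d * l
  width : v 15 = s
  pos : 0 < d

theorem Par.of_eq {v w : Vars} {a b d l s : ℕ} (h : Par v a b d l s) (hw : ∀ y < 20, y ≠ 10 → w y = v y) :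
    Par w a b d l s :=
  have e : ∀ y ∈ ({1, 2, 3, 4, 12, 13, 14, 15} : Set ℕ), w y = v y := fun y hy => by
    simp only [Set.mem_insert_iff, Set.mem_singleton_iff] at hy
    exact hw y (by omega) (by omega)
  ⟨(e _ (by simp)).trans h.msg, (e _ (by simp)).trans h.tag, (e _ (by simp)).trans h.one,
    (e _ (by simp)).trans h.zero, (e _ (by simp)).trans h.succ, (e _ (by simp)).trans h.blocks,
    (e _ (by simp)).trans h.forms, (e _ (by simp)).trans h.width, h.pos⟩

section HashMap

variable (a d l s : ℕ)

def stage1 : Basis → Basis := up (toggles 4 0 fun j b => b (0, j)) a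
def stage2 : Basis → Basis := up (toggles 6 0 (dotFun (a + 1) 2 0 4)) (d * l)
def stage3 : Basis → Basis := up (toggles 7 d fun j b => b (7, j) && b (6, j)) (d * l)
def stage4 : Basis → Basis := up (toggles 8 0 (dotFun d 3 (d * l) 7)) s
def stage5 : Basis → Basis := up (toggles 9 1 fun j b => maj (b (5, j)) (!b (8, j)) (b (9, j))) s

/-- The action of the hash circuit on basis states. -/
def hashMap (b : Basis) : Basis :=
  stage5 s (stage4 d l s (stage3 d l (stage2 a d l (stage1 a b))))

def hashMapInv (b : Basis) : Basis :=
  down (toggles 4 0 fun j b => b (0, j)) a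
    (down (toggles 6 0 (dotFun (a + 1) 2 0 4)) (d * l)
      (down (toggles 7 d fun j b => b (7, j) && b (6, j)) (d * l)
        (down (toggles 8 0 (dotFun d 3 (d * l) 7)) s
          (down (toggles 9 1 fun j b => maj (b (5, j)) (!b (8, j)) (b (9, j))) s b))))

variable {a d l s}

theorem hash_specs {v : Vars} {b : ℕ} (h : Par v a b d l s) :
    StageSpec v copyBody 4 0 (fun j b => b (0, j)) ∧
    StageSpec v (dotBody 12 2 vZero 4 6) 6 0 (dotFun (a + 1) 2 0 4) ∧
    StageSpec v bucketBody 7 d (fun j b => b (7, j) && b (6, j)) ∧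
    StageSpec v (dotBody 13 3 14 7 8) 8 0 (dotFun d 3 (d * l) 7) ∧
    StageSpec v lessBody 9 1 (fun j b => maj (b (5, j)) (!b (8, j)) (b (9, j))) := by
  have s2 := dotBody_spec (v := v) (M := 12) (R₁ := 2) (c := vZero) (R₂ := 4) (R₃ := 6)
    (by norm_num) (by norm_num) (by norm_num) (by norm_num) h.one h.zero
  have s3 := bucketBody_spec (v := v) (by rw [h.blocks]; exact h.pos)
  have s4 := dotBody_spec (v := v) (M := 13) (R₁ := 3) (c := 14) (R₂ := 7) (R₃ := 8)
    (by norm_num) (by norm_num) (by norm_num) (by norm_num) h.one h.zero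
  rw [h.succ, h.zero] at s2
  rw [h.blocks] at s3
  rw [h.blocks, h.forms] at s4
  exact ⟨copyBody_spec v, s2, s3, s4, lessBody_spec h.one⟩

theorem forUp_vev_of_lt {N : ℕ} {p : Cmd} (hp : p.Writes scratch) (w : Vars) :
    ∀ y < 20, (forUp vI N p).vev w y = w y := fun y hy =>
  (forUp_writes (S := work) (by simp [work])
    (hp.mono (by intro x hx; simp only [scratch, work] at *; exact Or.inr hx))).vev_eq
    (by simp [work]; omega) w

theorem forDown_vev_of_lt {N : ℕ} {p : Cmd} (hp : p.Writes scratch) (w : Vars) :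
    ∀ y < 20, (forDown vI N p).vev w y = w y := fun y hy =>
  (forDown_writes (S := work) (by simp [work])
    (hp.mono (by intro x hx; simp only [scratch, work] at *; exact Or.inr hx))).vev_eq
    (by simp [work]; omega) w

theorem ev_hashUp {v : Vars} {b : ℕ} (h : Par v a b d l s) (c : Basis) :
    hashUp.ev bGates v c = hashMap a d l s c := by
  obtain ⟨s1, s2, s3, s4, s5⟩ := hash_specs h
  have e0 : ∀ y < 20, v y = v y := fun _ _ => rfl
  have e1 := fun y hy => (forUp_vev_of_lt (N := 1) s1.writes v y hy).trans (e0 y hy)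
  have e2 := fun y hy => (forUp_vev_of_lt (N := 14) s2.writes _ y hy).trans (e1 y hy)
  have e3 := fun y hy => (forUp_vev_of_lt (N := 14) s3.writes _ y hy).trans (e2 y hy)
  have e4 := fun y hy => (forUp_vev_of_lt (N := 15) s4.writes _ y hy).trans (e3 y hy)
  simp only [hashUp, Cmd.ev]
  rw [s1.ev_up (by norm_num) h.one e0, s2.ev_up (by norm_num) h.one e1,
    s3.ev_up (by norm_num) h.one e2, s4.ev_up (by norm_num) h.one e3,
    s5.ev_up (by norm_num) h.one e4, h.msg, h.forms, h.width]
  rfl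

theorem ev_hashDown {v : Vars} {b : ℕ} (h : Par v a b d l s) (c : Basis) :
    hashDown.ev bGates v c = hashMapInv a d l s c := by
  obtain ⟨s1, s2, s3, s4, s5⟩ := hash_specs h
  have e0 : ∀ y < 20, v y = v y := fun _ _ => rfl
  have e1 := fun y hy => (forDown_vev_of_lt (N := 15) s5.writes v y hy).trans (e0 y hy)
  have e2 := fun y hy => (forDown_vev_of_lt (N := 15) s4.writes _ y hy).trans (e1 y hy)
  have e3 := fun y hy => (forDown_vev_of_lt (N := 14) s3.writes _ y hy).trans (e2 y hy)
  have e4 := fun y hy => (forDown_vev_of_lt (N := 14) s2.writes _ y hy).trans (e3 y hy)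
  simp only [hashDown, Cmd.ev]
  rw [s5.ev_down (by norm_num) h.one h.zero e0, s4.ev_down (by norm_num) h.one h.zero e1,
    s3.ev_down (by norm_num) h.one h.zero e2, s2.ev_down (by norm_num) h.one h.zero e3,
    s1.ev_down (by norm_num) h.one h.zero e4, h.msg, h.forms, h.width]
  rfl

theorem hash_chains (hd : 0 < d) : IsChain 4 0 (fun j b => b (0, j)) ∧
    IsChain 6 0 (dotFun (a + 1) 2 0 4) ∧ IsChain 7 d (fun j b => b (7, j) && b (6, j)) ∧
    IsChain 8 0 (dotFun d 3 (d * l) 7) ∧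
    IsChain 9 1 (fun j b => maj (b (5, j)) (!b (8, j)) (b (9, j))) := by
  -- The chain property does not involve variables, so it is read off the specifications for any
  -- assignment that carries the parameters.
  set v : Vars := fun y => if y = 1 then a else if y = 3 then 1 else if y = 12 then a + 1 else
    if y = 13 then d else if y = 14 then d * l else 0
  obtain ⟨s1, s2, s3, s4, s5⟩ := hash_specs (v := v) (a := a) (b := 0) (d := d) (l := l) (s := 0)
    ⟨rfl, rfl, rfl, rfl, rfl, rfl, rfl, rfl, hd⟩
  exact ⟨s1.chain, s2.chain, s3.chain, s4.chain, s5.chain⟩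

theorem hashMapInv_hashMap (hd : 0 < d) (b : Basis) :
    hashMapInv a d l s (hashMap a d l s b) = b := by
  obtain ⟨c1, c2, c3, c4, c5⟩ := hash_chains (a := a) (l := l) hd
  simp only [hashMap, hashMapInv, stage1, stage2, stage3, stage4, stage5]
  rw [down_up c5.involutive, down_up c4.involutive, down_up c3.involutive, down_up c2.involutive,
    down_up c1.involutive]

theorem hashMap_of_ne {q : Qubit} (h4 : q.1 ≠ 4) (h6 : q.1 ≠ 6) (h7 : q.1 ≠ 7) (h8 : q.1 ≠ 8)
    (h9 : q.1 ≠ 9) (b : Basis) : hashMap a d l s b q = b q := by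
  simp only [hashMap, stage1, stage2, stage3, stage4, stage5]
  rw [up_toggles_of_ne _ _ (by simp [h9]), up_toggles_of_ne _ _ (by simp [h8]),
    up_toggles_of_ne _ _ (by simp [h7]), up_toggles_of_ne _ _ (by simp [h6]),
    up_toggles_of_ne _ _ (by simp [h4])]

/-- The initial content of the registers in which the hash circuit works. -/
structure Clean (a d : ℕ) (b : Basis) : Prop where
  reg4 : ∀ i, b (4, i) = decide (i = a)
  reg6 : ∀ i, b (6, i) = false
  reg7 : ∀ i, b (7, i) = decide (i < d)
  reg8 : ∀ i, b (8, i) = false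
  reg9 : ∀ i, b (9, i) = false

/-- The content of a register. -/
def regBits (b : Basis) (r i : ℕ) : Bool := b (r, i)

theorem affine_congr {L : ℕ → Bool} {x x' : ℕ → Bool} (hx : ∀ t < a, x t = x' t) (p : ℕ) :
    affine a L p x = affine a L p x' := by
  unfold affine
  congr 1
  exact xorSum_congr fun t ht => by rw [hx t ht]

/-- The stages are solved in order, each output cell being written once over a known initial value.
The constant 1 after the message in register 4 multiplies the constant term of each affine form, and
the d leading ones in register 7 are the empty conjunctions. -/
theorem hashMap_flag {b : Basis} (hd : 0 < d) (hb : Clean a d b) :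
    hashMap a d l s b (9, s) = less (regBits b 5)
      (word a d l (regBits b 2) (regBits b 3) (regBits b 0)) s := by
  obtain ⟨c1, c2, c3, c4, c5⟩ := hash_chains (a := a) (l := l) hd
  set b1 := stage1 a b with hb1
  set b2 := stage2 a d l b1 with hb2
  set b3 := stage3 d l b2 with hb3
  set b4 := stage4 d l s b3 with hb4
  set b5 := stage5 s b4 with hb5
  have n1 : ∀ q : Qubit, q.1 ≠ 4 → b1 q = b q := fun q hq => up_toggles_of_ne _ _ (by simp [hq])
  have n2 : ∀ q : Qubit, q.1 ≠ 6 → b2 q = b1 q := fun q hq => up_toggles_of_ne _ _ (by simp [hq])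
  have n3 : ∀ q : Qubit, q.1 ≠ 7 → b3 q = b2 q := fun q hq => up_toggles_of_ne _ _ (by simp [hq])
  have n4 : ∀ q : Qubit, q.1 ≠ 8 → b4 q = b3 q := fun q hq => up_toggles_of_ne _ _ (by simp [hq])
  have n5 : ∀ q : Qubit, q.1 ≠ 9 → b5 q = b4 q := fun q hq => up_toggles_of_ne _ _ (by simp [hq])
  have r1 : ∀ t < a, b1 (4, t) = b (0, t) := by
    intro t ht
    have := c1.up_apply (N := a) ht b
    refine this.trans ?_
    rw [hb.reg4, decide_eq_false (by omega), Bool.false_xor]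
    exact n1 (0, t) (by simp)
  have r1' : b1 (4, a) = true := by
    refine (up_toggles_of_ne _ _ (by simp)).trans ?_
    rw [hb.reg4]; simp
  have r2 : ∀ p < d * l, b2 (6, p) = affine a (regBits b 2) p (regBits b 0) := by
    intro p hp
    refine (c2.up_apply hp b1).trans ?_
    rw [n1 _ (by simp), add_zero, hb.reg6, Bool.false_xor]
    have e1 : ∀ q : Qubit, q.1 = 2 → b2 q = b q := fun q hq => by
      rw [n2 q (by simp [hq]), n1 q (by simp [hq])]
    have e2 : ∀ i, b2 (4, i) = b1 (4, i) := fun i => n2 _ (by simp)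
    change dotFun (a + 1) 2 0 4 p b2 = _
    rw [dotFun, xorSum, affine]
    congr 1
    · refine xorSum_congr fun t ht => ?_
      rw [e1 _ rfl, e2, zero_add, r1 t ht]
      rfl
    · rw [e1 _ rfl, e2, zero_add, r1', Bool.and_true]
      rfl
  have r3 : ∀ j < d, ∀ k ≤ l, b3 (7, j + d * k)
      = bucket a d (regBits b 2) (regBits b 0) k j := by
    intro j hj k
    induction k with
    | zero =>
      intro _
      refine (up_toggles_of_ne _ _ (by simp; omega)).trans ?_
      rw [n2 _ (by simp), n1 _ (by simp), hb.reg7]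
      simp [bucket, hj]
    | succ k ih =>
      intro hk
      have hlt : j + d * k < d * l := by
        calc j + d * k < d + d * k := by omega
          _ = d * (k + 1) := by ring
          _ ≤ d * l := Nat.mul_le_mul_left d hk
      have := c3.up_apply hlt b2
      have e : j + d * (k + 1) = j + d * k + d := by ring
      rw [e]
      refine this.trans ?_
      rw [n2 _ (by simp), n1 _ (by simp), hb.reg7, decide_eq_false (by omega), Bool.false_xor]
      change (b3 (7, j + d * k) && b3 (6, j + d * k)) = _
      rw [ih (by omega), n3 _ (by simp), r2 _ hlt, bucket]
  have r4 : ∀ i < s, b4 (8, i) = word a d l (regBits b 2) (regBits b 3) (regBits b 0) i := by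
    intro i hi
    refine (c4.up_apply hi b3).trans ?_
    rw [n3 _ (by simp), n2 _ (by simp), n1 _ (by simp), hb.reg8, Bool.false_xor]
    change dotFun d 3 (d * l) 7 i b4 = _
    rw [dotFun, word]
    refine xorSum_congr fun t ht => ?_
    rw [n4 _ (by simp), n3 _ (by simp), n2 _ (by simp), n1 _ (by simp), n4 (7, _) (by simp),
      add_comm (d * l) t, r3 t ht l le_rfl]
    rfl
  have r5 : ∀ i ≤ s, b5 (9, i) = less (regBits b 5)
      (word a d l (regBits b 2) (regBits b 3) (regBits b 0)) i := by
    intro i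
    induction i with
    | zero =>
      intro _
      refine (up_toggles_of_ne _ _ (by simp)).trans ?_
      rw [n4 _ (by simp), n3 _ (by simp), n2 _ (by simp), n1 _ (by simp), hb.reg9]
      rfl
    | succ i ih =>
      intro hi
      refine (c5.up_apply hi b4).trans ?_
      rw [n4 _ (by simp), n3 _ (by simp), n2 _ (by simp), n1 _ (by simp), hb.reg9, Bool.false_xor]
      change maj (b5 (5, i)) (!b5 (8, i)) (b5 (9, i)) = _
      rw [ih (by omega), n5 _ (by simp), n5 _ (by simp), r4 i hi, n4 _ (by simp), n3 _ (by simp),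
        n2 _ (by simp), n1 _ (by simp), less]
      rfl
  exact r5 s le_rfl

/-- The hash circuit commutes with changes outside of its registers. -/
theorem hashMap_agree {b b' : Basis} (h : ∀ q : Qubit, q.1 ∈ hashRegs → b q = b' q) :
    ∀ q : Qubit, q.1 ∈ hashRegs → hashMap a d l s b q = hashMap a d l s b' q := by
  have hdot : ∀ {M R₁ c R₂ : ℕ}, R₁ ∈ hashRegs → R₂ ∈ hashRegs → ∀ (j : ℕ) (b b' : Basis),
      (∀ q : Qubit, q.1 ∈ hashRegs → b q = b' q) → dotFun M R₁ c R₂ j b = dotFun M R₁ c R₂ j b' :=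
    fun h₁ h₂ j b b' hb => xorSum_congr fun t _ => by rw [hb _ h₁, hb _ h₂]
  have m : ∀ r ∈ hashRegs, ∀ {b b' : Basis}, (∀ q : Qubit, q.1 ∈ hashRegs → b q = b' q) →
      ∀ i, b (r, i) = b' (r, i) := fun r hr _ _ hb i => hb (r, i) hr
  have h1 := up_toggles_agree (R := 4) (off := 0) (h := fun j b => b (0, j))
    (fun j b b' hb => m 0 (by simp [hashRegs]) hb j) a h
  have h2 := up_toggles_agree (R := 6) (off := 0) (hdot (M := a + 1) (R₁ := 2) (c := 0) (R₂ := 4)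
    (by simp [hashRegs]) (by simp [hashRegs])) (d * l) h1
  have h3 := up_toggles_agree (R := 7) (off := d) (h := fun j b => b (7, j) && b (6, j))
    (fun j b b' hb => congrArg₂ _ (m 7 (by simp [hashRegs]) hb j) (m 6 (by simp [hashRegs]) hb j))
    (d * l) h2
  have h4 := up_toggles_agree (R := 8) (off := 0) (hdot (M := d) (R₁ := 3) (c := d * l) (R₂ := 7)
    (by simp [hashRegs]) (by simp [hashRegs])) s h3
  refine up_toggles_agree (fun j b b' hb => ?_) _ h4
  rw [m 5 (by simp [hashRegs]) hb, m 8 (by simp [hashRegs]) hb, m 9 (by simp [hashRegs]) hb]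

end HashMap

/-! ## The existential forger made from a blind forger: simulating the blinded oracle -/

namespace Hasher

open Forger (ρ ρ_injective notMem_ρ)

def cswap3 (f p q : QRef) : Cmd := .seq (.cnot q p) (.seq (.toffoli f p q) (.cnot q p))

theorem ev_cswap3 (f p q : QRef) (v : Vars) (hf : f.reg ≠ p.reg) (hf' : f.reg ≠ q.reg)
    (h : p.reg ≠ q.reg) (b : Basis) : (cswap3 f p q).ev bGates v b =
      if b (f.reg, v f.idx) then swapMap (p.reg, v p.idx) (q.reg, v q.idx) b else b := by
  have h1 : (f.reg, v f.idx) ≠ (p.reg, v p.idx) := fun e => hf (congrArg Prod.fst e)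
  have h2 : (f.reg, v f.idx) ≠ (q.reg, v q.idx) := fun e => hf' (congrArg Prod.fst e)
  have h3 : (p.reg, v p.idx) ≠ (q.reg, v q.idx) := fun e => h (congrArg Prod.fst e)
  simp only [cswap3, Cmd.ev, Cmd.vev, bGates]
  generalize (p.reg, v p.idx) = P at *
  generalize (q.reg, v q.idx) = Q at *
  generalize (f.reg, v f.idx) = F at *
  funext x
  simp only [cnotMap, toffoliMap, if_neg h3.symm, if_neg (not_or.2 ⟨h2, h3⟩)]
  by_cases hP : x = P
  · subst hP
    cases hF : b F <;> cases hx : b x <;> cases hQ : b Q <;>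
      simp [swapMap, h1, h2, h3, h3.symm, hF, hx, hQ]
  · by_cases hQ : x = Q
    · subst hQ
      cases hF : b F <;> cases hx : b x <;> cases hQ : b P <;>
        simp [swapMap, h1, h2, h3, h3.symm, hF, hx, hQ]
    · simp only [Function.update_of_ne hP, Function.update_of_ne hQ]
      split_ifs <;> simp [swapMap, Equiv.swap_apply_of_ne_of_ne hP hQ]

/-- Swap two registers if the flag is set. -/
def cswapProg (N r t : ℕ) : Cmd := forUp vI N (cswap3 ⟨9, 15⟩ ⟨r, vI⟩ ⟨t, vI⟩)

theorem ev_cswapProg {N r t : ℕ} (hr : r ≠ 9) (ht : t ≠ 9) (h : r ≠ t) (hN : N < 20) {v : Vars}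
    (hv : v vOne = 1) (b : Basis) : (cswapProg N r t).ev bGates v b =
      if b (9, v 15) then swapReg r t (v N) b else b := by
  rw [cswapProg, ev_forUp bGates (S := ∅) (by simp [cswap3, Cmd.Writes]) (by simp) (by simp)
    (by norm_num) (by simp only [vI]; omega) hv
    (fun j b => if b (9, v 15) then swapMap (r, j) (t, j) b else b) fun j _ w hw hj m => by
      rw [ev_cswap3 _ _ _ _ hr.symm ht.symm h]; simp [hj, hw 15]]
  by_cases hb : b (9, v 15)
  · rw [if_pos hb, ← up_swap h]
    induction v N with
    | zero => rfl
    | succ D ih =>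
      rw [up, up, ih, if_pos]
      rw [up_swap h, ← hb]
      simp only [swapReg, Equiv.swap_apply_of_ne_of_ne hr.symm ht.symm, ite_self]
  · rw [if_neg hb]
    induction v N with
    | zero => rfl
    | succ D ih => rw [up, ih, if_neg hb]

def cswaps : Cmd := .seq (cswapProg 1 0 10) (cswapProg 2 1 11)

def preQuery : Cmd := .seq hashUp cswaps

def postQuery : Cmd := .seq cswaps (.seq (.cnot ⟨9, 15⟩ ⟨1, 2⟩) hashDown)

/-- A query with answer `⊥` on the hashed set; if the message is in that set then the oracle gets
the message in register `10` instead and register `11`, which is in a uniform superposition. If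
variable `24` is zero then the answer is always `⊥`. -/
def gadget : Cmd :=
  .cond 24 (.seq preQuery (.seq .query postQuery)) (.gate .X ⟨1, 2⟩)

theorem cswaps_rev : cswaps.Rev := by simp [cswaps, cswapProg, cswap3, forUp, Cmd.Rev]

theorem preQuery_rev : preQuery.Rev := ⟨hashUp_rev, cswaps_rev⟩

theorem postQuery_rev : postQuery.Rev := ⟨cswaps_rev, trivial, hashDown_rev⟩

theorem cswaps_writes : cswaps.Writes work := by
  simp [cswaps, cswapProg, cswap3, forUp, Cmd.Writes, work]

theorem preQuery_writes : preQuery.Writes work := ⟨hashUp_writes, cswaps_writes⟩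

theorem postQuery_writes : postQuery.Writes work := ⟨cswaps_writes, trivial, hashDown_writes⟩

theorem vev_of_writes_work {p : Cmd} (hp : p.Writes work) (w : Vars) {y : ℕ}
    (hy : y < 20 ∨ 24 ≤ y) : p.vev w y = w y :=
  hp.vev_eq (by simp only [work, Set.mem_insert_iff, Set.mem_singleton_iff]; omega) w

/-! ### The simulated query as a permutation of basis states -/

section Maps

variable {a b : ℕ} (d l s : ℕ)

/-- The effect of the controlled swaps. -/
def kMap (a b s : ℕ) (c : Basis) : Basis :=
  if c (9, s) then swapReg 1 11 b (swapReg 0 10 a c) else c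

/-- The effect of a simulated query on basis states, depending on the flag. -/
def qMap (f : Bool) (g : Bits a → Bits b) (c : Basis) : Basis := fun q =>
  if f then
    if q = (1, b) then !c q
    else if h : q.1 = 11 ∧ q.2 < b then xor (c q) (g (readReg 10 a c) ⟨q.2, h.2⟩) else c q
  else oracleMap g c q

def simMap (g : Bits a → Bits b) (c : Basis) : Basis := qMap (hashMap a d l s c (9, s)) g c

theorem qMap_of_ne {q : Qubit} (h1 : q.1 ≠ 1) (h11 : q.1 ≠ 11) (f : Bool) (g : Bits a → Bits b)
    (c : Basis) : qMap f g c q = c q := by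
  have : q ≠ (1, b) := fun e => h1 (congrArg Prod.fst e)
  cases f <;> simp [qMap, oracleMap_apply, h1, h11, this]

theorem qMap_involutive (f : Bool) (g : Bits a → Bits b) : Function.Involutive (qMap f g) := by
  intro c
  cases f
  · exact oracleMap_involutive g c
  · have e : readReg 10 a (qMap true g c) = readReg 10 a c :=
      funext fun i => qMap_of_ne (by norm_num) (by norm_num) _ _ _
    funext q
    rw [qMap, e]
    simp only [if_true, qMap]
    split_ifs <;> simp

/-- With the flag down this is an ordinary query. With the flag up, the swaps send registers 10 and
11 to the oracle, and the controlled not writes the flag of ⊥ into the last answer qubit. -/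
theorem kMap_oracleMap (g : Bits a → Bits b) (c : Basis) :
    cnotMap (9, s) (1, b) (kMap a b s (oracleMap g (kMap a b s c))) = qMap (c (9, s)) g c := by
  have hne : ((9, s) : Qubit) ≠ (1, b) := by simp
  rw [cnotMap, if_neg hne]
  cases hc : c (9, s)
  · have e1 : kMap a b s c = c := by rw [kMap, hc]; rfl
    have e2 : oracleMap g c (9, s) = false := by rw [oracleMap_apply]; simp [hc]
    have e3 : kMap a b s (oracleMap g c) = oracleMap g c := by rw [kMap, e2]; rfl
    rw [e1, e3, e2, Bool.xor_false, Function.update_eq_self]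
    rfl
  · set c' := kMap a b s c with hc'
    have k1 : c' = swapReg 1 11 b (swapReg 0 10 a c) := by rw [hc', kMap, hc]; rfl
    have kval : ∀ (e : Basis) (r i : ℕ), swapReg 1 11 b (swapReg 0 10 a e) (r, i) =
        if (r = 1 ∨ r = 11) ∧ i < b then e (12 - r, i)
        else if (r = 0 ∨ r = 10) ∧ i < a then e (10 - r, i) else e (r, i) := by
      intro e r i
      simp only [swapReg]
      by_cases h1 : r = 1
      · subst h1
        rw [Equiv.swap_apply_left, Equiv.swap_apply_of_ne_of_ne (by norm_num) (by norm_num),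
          Equiv.swap_apply_of_ne_of_ne (by norm_num) (by norm_num)]
        simp
      by_cases h11 : r = 11
      · subst h11
        rw [Equiv.swap_apply_right, Equiv.swap_apply_of_ne_of_ne (by norm_num) (by norm_num),
          Equiv.swap_apply_of_ne_of_ne (by norm_num) (by norm_num)]
        simp
      rw [Equiv.swap_apply_of_ne_of_ne h1 h11, ite_self]
      by_cases h0 : r = 0
      · subst h0; simp
      by_cases h10 : r = 10
      · subst h10; simp
      rw [Equiv.swap_apply_of_ne_of_ne h0 h10]
      simp [h0, h1, h10, h11]
    have cv : ∀ r i, c' (r, i) = _ := fun r i => (congrFun k1 (r, i)).trans (kval c r i)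
    have hx : readReg regX a c' = readReg 10 a c := funext fun i => by simp [readReg, cv]
    have e2 : oracleMap g c' (9, s) = true := by rw [oracleMap_apply]; simp [cv, hc]
    have e3 : kMap a b s (oracleMap g c') = swapReg 1 11 b (swapReg 0 10 a (oracleMap g c')) := by
      rw [kMap, e2]; rfl
    rw [e3]
    funext ⟨r, i⟩
    by_cases hq : ((r, i) : Qubit) = (1, b)
    · rw [hq, Function.update_self, kval, kval]
      simp [oracleMap_apply, cv, qMap, hc]
    · rw [Function.update_of_ne hq, kval, qMap, if_pos rfl, if_neg hq]
      by_cases h1 : r = 1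
      · subst h1
        have : i ≠ b := fun e => hq (by rw [e])
        by_cases hi : i < b
        · simp [oracleMap_apply, cv, hi]
        · simp [oracleMap_apply, cv, hi]
      by_cases h11 : r = 11
      · subst h11
        by_cases hi : i < b
        · simp [oracleMap_apply, cv, hi, hx]
        · simp [oracleMap_apply, cv, hi]
      by_cases h0 : r = 0
      · subst h0
        by_cases hi : i < a <;> simp [oracleMap_apply, cv, hi]
      by_cases h10 : r = 10
      · subst h10
        by_cases hi : i < a <;> simp [oracleMap_apply, cv, hi]
      simp [oracleMap_apply, cv, h0, h1, h10, h11]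

variable {d l s}

theorem hashMap_eq_of_agree {c e e' : Basis}
    (h1 : ∀ q : Qubit, q.1 ∈ hashRegs → e q = c q)
    (h2 : ∀ q : Qubit, q.1 ∈ hashRegs → e' q = hashMap a d l s c q)
    (h3 : ∀ q : Qubit, q.1 ∉ hashRegs → e' q = e q) : e' = hashMap a d l s e := by
  funext q
  by_cases hq : q.1 ∈ hashRegs
  · rw [h2 q hq, hashMap_agree h1 q hq]
  · rw [h3 q hq]
    simp only [hashRegs, Set.mem_insert_iff, Set.mem_singleton_iff, not_or] at hq
    rw [hashMap_of_ne] <;> tauto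

/-- A simulated query changes only registers 1 and 11, which the hash circuit neither reads nor
writes, and it depends only on registers that the circuit leaves alone. Hence the circuit can be
undone after the query. -/
theorem qMap_hashMap (f : Bool) (g : Bits a → Bits b) (c : Basis) :
    qMap f g (hashMap a d l s c) = hashMap a d l s (qMap f g c) := by
  have hne : ∀ {q : Qubit}, q.1 ∈ hashRegs → q.1 ≠ 1 ∧ q.1 ≠ 11 := by
    intro q hq
    constructor <;> · intro e; simp [e, hashRegs] at hq
  have hr : ∀ r : ℕ, r = 0 ∨ r = 10 → readReg r a (hashMap a d l s c) = readReg r a c := by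
    rintro r (rfl | rfl) <;> funext i <;>
      exact hashMap_of_ne (by simp) (by simp) (by simp) (by simp) (by simp) c
  refine hashMap_eq_of_agree (c := c) (fun q hq => qMap_of_ne (hne hq).1 (hne hq).2 _ _ _)
    (fun q hq => qMap_of_ne (hne hq).1 (hne hq).2 _ _ _) fun q hq => ?_
  have hc : hashMap a d l s c q = c q := by
    simp only [hashRegs, Set.mem_insert_iff, Set.mem_singleton_iff, not_or] at hq
    rw [hashMap_of_ne] <;> tauto
  simp only [qMap, hc, hr 10 (Or.inr rfl), oracleMap_apply, hr 0 (Or.inl rfl)]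

theorem simMap_involutive (g : Bits a → Bits b) : Function.Involutive (simMap d l s g) := by
  intro c
  have e : hashMap a d l s (simMap d l s g c) (9, s) = hashMap a d l s c (9, s) := by
    rw [simMap, ← qMap_hashMap, qMap_of_ne (by simp) (by simp)]
  conv_lhs => rw [simMap, e, simMap]
  exact qMap_involutive _ _ _

variable {w : Vars}

theorem ev_cswaps (hw : Par w a b d l s) (c : Basis) : cswaps.ev bGates w c = kMap a b s c := by
  have hv : ∀ y < 20, (cswapProg 1 0 10).vev w y = w y := fun y hy =>
    vev_of_writes_work cswaps_writes.1 w (Or.inl hy)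
  rw [cswaps, Cmd.ev, ev_cswapProg (by norm_num) (by norm_num) (by norm_num) (by norm_num) hw.one,
    ev_cswapProg (by norm_num) (by norm_num) (by norm_num) (by norm_num)
      (by rw [hv _ (by norm_num), hw.one]), hv _ (by norm_num), hv _ (by norm_num), hw.width,
    hw.msg, hw.tag, kMap]
  by_cases h : c (9, s)
  · have : swapReg 0 10 a c (9, s) = true := by
      simp only [swapReg]
      rw [Equiv.swap_apply_of_ne_of_ne (by norm_num) (by norm_num), ite_self, h]
    rw [if_pos h, if_pos this, if_pos h]
  · rw [if_neg h, if_neg h, if_neg h]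

theorem par_vev {p : Cmd} (hp : p.Writes work) (hw : Par w a b d l s) : Par (p.vev w) a b d l s :=
  hw.of_eq fun _ hy _ => vev_of_writes_work hp w (Or.inl hy)

theorem ev_preQuery (hw : Par w a b d l s) (c : Basis) :
    preQuery.ev bGates w c = kMap a b s (hashMap a d l s c) := by
  rw [preQuery, Cmd.ev, ev_cswaps (par_vev hashUp_writes hw), ev_hashUp hw]

theorem ev_postQuery (hw : Par w a b d l s) (c : Basis) : postQuery.ev bGates w c
    = hashMapInv a d l s (cnotMap (9, s) (1, b) (kMap a b s c)) := by
  have h' := par_vev cswaps_writes hw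
  rw [postQuery, Cmd.ev, Cmd.ev, ev_cswaps hw, show (Cmd.cnot ⟨9, 15⟩ ⟨1, 2⟩).vev
    (cswaps.vev w) = cswaps.vev w from rfl, ev_hashDown h', Cmd.ev, h'.width, h'.tag]
  rfl

/-- The effect of the gadget. -/
theorem mapDomain_gadget (hw : Par w a b d l s) (w' : Vars) (hw' : Par w' a b d l s)
    (g : Bits a → Bits b) (ψ : QState) :
    (standardOracle g (ψ.mapDomain (preQuery.ev bGates w))).mapDomain (postQuery.ev bGates w')
      = ψ.mapDomain (simMap d l s g) := by
  rw [standardOracle_eq, ← Finsupp.mapDomain_comp, ← Finsupp.mapDomain_comp]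
  congr 1
  funext c
  simp only [Function.comp, ev_preQuery hw, ev_postQuery hw', kMap_oracleMap, qMap_hashMap]
  exact hashMapInv_hashMap hw.pos _

end Maps

end Hasher

/-! ## Uniform superpositions -/

theorem nE_single (b : Basis) (c : ℂ) : nE (Finsupp.single b c) = ‖c‖ₑ ^ 2 := by
  classical
  rw [nE, tsum_eq_single b fun b' h => by simp [Finsupp.single_apply, h.symm]]
  simp

open Classical in
theorem up_H_single (r N : ℕ) (b₀ : Basis) (c : ℂ) : ∀ b : Basis,
    up (fun j => applyGate1 .H (r, j)) N (Finsupp.single b₀ c) b =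
      if ∀ q : Qubit, ¬ (q.1 = r ∧ q.2 < N) → b q = b₀ q then
        (∏ j ∈ Finset.range N, Gate1.H.entry (b (r, j)) (b₀ (r, j))) * c else 0 := by
  induction N with
  | zero =>
    intro b
    simp only [up, Finsupp.single_apply, Nat.not_lt_zero, and_false, not_false_eq_true, true_imp_iff,
      Finset.range_zero, Finset.prod_empty, one_mul]
    exact if_congr ⟨fun h q => by rw [h], fun h => (funext h).symm⟩ rfl rfl
  | succ N ih =>
    intro b
    have hlt : ∀ q : Qubit, (q.1 = r ∧ q.2 < N + 1) ↔ ((q.1 = r ∧ q.2 < N) ∨ q = (r, N)) := by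
      intro q
      rw [Prod.ext_iff]
      constructor <;> intro h <;> simp only at * <;> omega
    rw [up, applyGate1_apply, Finset.sum_eq_single (b₀ (r, N))]
    · rw [ih, Finset.prod_range_succ]
      have e : (∏ j ∈ Finset.range N, Gate1.H.entry (Function.update b (r, N) (b₀ (r, N)) (r, j))
          (b₀ (r, j))) = ∏ j ∈ Finset.range N, Gate1.H.entry (b (r, j)) (b₀ (r, j)) := by
        refine Finset.prod_congr rfl fun j hj => ?_
        rw [Function.update_of_ne]
        simp [(Finset.mem_range.1 hj).ne]
      rw [e, mul_ite, mul_zero]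
      refine if_congr ⟨fun h q hq => ?_, fun h q hq => ?_⟩ (by ring) rfl
      · rw [hlt, not_or] at hq
        rw [← h q hq.1, Function.update_of_ne hq.2]
      · by_cases hq' : q = (r, N)
        · rw [hq', Function.update_self]
        · rw [Function.update_of_ne hq']
          exact h q (by rw [hlt]; tauto)
    · intro v _ hv
      rw [ih, if_neg, mul_zero]
      intro h
      apply hv
      simpa using h (r, N) (by simp)
    · simp

theorem nE_up_H (r N : ℕ) (ψ : QState) : nE (up (fun j => applyGate1 .H (r, j)) N ψ) = nE ψ := by
  induction N with
  | zero => rfl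
  | succ N ih => rw [up, nE_gate, ih]

theorem encodeBot_none_apply {b : ℕ} (i : Fin (b + 1)) :
    encodeBot (none : Option (Bits b)) i = decide ((i : ℕ) = b) := by
  by_cases h : (i : ℕ) < b
  · simp [encodeBot, Fin.snoc, h, h.ne]
  · have : (i : ℕ) = b := by omega
    simp [encodeBot, Fin.snoc, this]

theorem encodeBot_some_apply {b : ℕ} (y : Bits b) (i : Fin (b + 1)) :
    encodeBot (some y) i = if h : (i : ℕ) < b then y ⟨i, h⟩ else false := by
  by_cases h : (i : ℕ) < b
  · simp [encodeBot, Fin.snoc, h]; rfl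
  · simp [encodeBot, Fin.snoc, h]

theorem word_congr {a d l : ℕ} {L T x x' : ℕ → Bool} (hx : ∀ t < a, x t = x' t) (i : ℕ) :
    word a d l L T x i = word a d l L T x' i := by
  have h : ∀ l j, bucket a d L x l j = bucket a d L x' l j := by
    intro l j
    induction l with
    | zero => rfl
    | succ l ih => rw [bucket, bucket, ih, affine_congr hx]
  exact xorSum_congr fun j _ => by rw [h]

namespace Hasher

open Forger (ρ ρ_injective notMem_ρ)

/-! ### Correctness of the simulated blinded oracle -/

section Sim

variable {a b d l s : ℕ}

/-- The set given by the seeds and the threshold in the registers. -/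
def regSet (a d l s : ℕ) (aux : Basis) : Finset (Bits a) :=
  hashSet a d l s (regBits aux 5) (regBits aux 2) (regBits aux 3)

/-- The qubits outside of the embedded program and of the superposition have the values `aux`. -/
def Match (b : ℕ) (aux e : Basis) : Prop :=
  ∀ q : Qubit, q.1 ∉ Set.range ρ → ¬ (q.1 = 11 ∧ q.2 < b) → e q = aux q

-- Register 11 has the same amplitude for all of its values, so adding an oracle answer to it does
-- not change the state; `c` is the amplitude of the basis state of the other auxiliary qubits.
open Classical in
def χ (b : ℕ) (aux : Basis) (c : ℂ) (e : Basis) : ℂ :=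
  if Match b aux e then (1 / (Real.sqrt 2 : ℂ)) ^ b * c else 0

theorem χ_indep (b : ℕ) (aux : Basis) (c : ℂ) : Indep ρ (χ b aux c) := by
  intro e e' h
  have : Match b aux e ↔ Match b aux e' := forall_congr' fun q => forall_congr' fun hq => by
    rw [h q hq]
  classical exact if_congr this rfl rfl

theorem isProd_init {aux : Basis} (c : ℂ) (h11 : ∀ i, aux (11, i) = false)
    (hρ : ∀ r i, aux (ρ r, i) = false) :
    IsProd ρ (up (fun j => applyGate1 .H (11, j)) b (Finsupp.single aux c)) QState.zeroKet
      (χ b aux c) := by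
  classical
  intro e
  have hH : ∀ v, Gate1.H.entry v false = 1 / (Real.sqrt 2 : ℂ) := fun v => by
    cases v <;> simp [Gate1.entry]
  have hρ11 : ∀ r, ρ r ≠ 11 := fun r h => notMem_ρ (r := 11) (by norm_num) (by norm_num) ⟨r, h⟩
  rw [up_H_single, QState.zeroKet, Finsupp.single_apply, χ]
  simp only [h11, hH, Finset.prod_const, Finset.card_range]
  by_cases hz : (fun _ => false) = hi ρ e
  · rw [if_pos hz, one_mul]
    refine if_congr ⟨fun h q _ h' => h q h', fun h q h' => ?_⟩ rfl rfl
    by_cases hq : q.1 ∈ Set.range ρ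
    · obtain ⟨r, hr⟩ := hq
      have := congrFun hz (r, q.2)
      simp only [hi, hr] at this
      rw [← this, show q = (ρ r, q.2) from Prod.ext hr.symm rfl, hρ]
    · exact h q hq h'
  · rw [if_neg hz, zero_mul, if_neg]
    intro h
    apply hz
    funext q
    exact ((h (ρ q.1, q.2) (fun h' => hρ11 _ h'.1)).trans (hρ _ _)).symm

structure AuxOk (a d l s : ℕ) (fnd : Bool) (aux : Basis) : Prop where
  clean : Clean a d aux
  zero11 : ∀ i, aux (11, i) = false
  zeroρ : ∀ r i, aux (ρ r, i) = false
  fresh : fnd = true → readReg 10 a aux ∉ regSet a d l s aux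

variable {fnd : Bool} {aux : Basis} {c : ℂ}

theorem sqNorm_χ (h : AuxOk a d l s fnd aux) (c : ℂ) :
    sqNorm ρ_injective (χ b aux c) = ‖c‖ₑ ^ 2 := by
  have := (isProd_init (b := b) c h.zero11 h.zeroρ).nE ρ_injective (χ_indep _ _ _)
  rw [nE_up_H, nE_zeroKet, one_mul, nE_single] at this
  exact this.symm

theorem Match.eq {e : Basis} (h : Match b aux e) {r : ℕ} (h2 : 2 ≤ r) (h11 : r < 11) (i : ℕ) :
    e (r, i) = aux (r, i) :=
  h _ (notMem_ρ h2 (by omega)) (by simp only [not_and]; omega)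

theorem flag_eq (h : AuxOk a d l s fnd aux) (hd : 0 < d) {e : Basis} (he : Match b aux e) :
    hashMap a d l s e (9, s) = decide (readReg 0 a e ∈ regSet a d l s aux) := by
  have hc : Clean a d e :=
    ⟨fun i => (he.eq (by norm_num) (by norm_num) i).trans (h.clean.reg4 i),
      fun i => (he.eq (by norm_num) (by norm_num) i).trans (h.clean.reg6 i),
      fun i => (he.eq (by norm_num) (by norm_num) i).trans (h.clean.reg7 i),
      fun i => (he.eq (by norm_num) (by norm_num) i).trans (h.clean.reg8 i),
      fun i => (he.eq (by norm_num) (by norm_num) i).trans (h.clean.reg9 i)⟩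
  have hr : ∀ r, 2 ≤ r → r < 11 → regBits e r = regBits aux r :=
    fun r h2 h11 => funext fun i => he.eq h2 h11 i
  rw [hashMap_flag hd hc, hr 5 (by norm_num) (by norm_num), hr 2 (by norm_num) (by norm_num),
    hr 3 (by norm_num) (by norm_num), less_congr fun i _ => word_congr (x' := ext (readReg 0 a e))
      (fun t ht => by simp [ext, ht, regBits, readReg]) i]
  simp [regSet, hashSet]

/-- The embedded memory. -/
structure Rep (a b d l s β : ℕ) (fnd : Bool) (aux : Basis) (c : ℂ) (m : QState × List QState)
    (w : Vars) (m' : QState × List QState) : Prop where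
  par : Par w a b d l s
  cap : w 9 = β
  found : w 24 = if fnd then 1 else 0
  prod : IsProd ρ m'.1 m.1 (χ b aux c)
  log : ∀ φ ∈ m'.2, ∀ x ∈ regSet a d l s aux, projReg regX a x φ = 0

/-- For a message in the set only the flag of the visible answer is flipped, which is the encoding
of ⊥. The answer of the true oracle goes to register 11, whose value `Match` does not constrain. -/
theorem simMap_match (h : AuxOk a d l s fnd aux) (hd : 0 < d) (g : Bits a → Bits b) {e : Basis}
    (he : Match b aux e) : Match b aux (simMap d l s g e) ∧
      hi ρ (simMap d l s g e) = oracleMap (blindBot (regSet a d l s aux) g) (hi ρ e) := by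
  have hρ1 : ∀ r, ρ r = 1 ↔ r = 1 := fun r => ⟨fun h => ρ_injective (h.trans rfl), fun h => by rw [h]; rfl⟩
  have hρ11 : ∀ r, ρ r ≠ 11 := fun r h => notMem_ρ (r := 11) (by norm_num) (by norm_num) ⟨r, h⟩
  rw [simMap, flag_eq h hd he]
  constructor
  · intro q hq h11
    have h1 : q.1 ≠ 1 := fun e => hq ⟨1, e.symm⟩
    have h1' : q ≠ (1, b) := fun e => h1 (congrArg Prod.fst e)
    rw [← he q hq h11]
    cases decide (readReg 0 a e ∈ regSet a d l s aux) <;> simp [qMap, oracleMap_apply, h1, h11, h1']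
  · funext ⟨r, i⟩
    have hx : readReg regX a (hi ρ e) = readReg 0 a e := rfl
    rw [oracleMap_apply, hx]
    simp only [hi]
    by_cases hr : r = 1
    · subst hr
      rw [(hρ1 1).2 rfl]
      by_cases hm : readReg 0 a e ∈ regSet a d l s aux
      · simp only [hm, decide_true, qMap, if_true, Prod.mk.injEq, true_and, blindBot, blind,
          encodeBot_none_apply]
        by_cases hi : i = b
        · simp [hi]
        · simp [hi]
      · simp only [hm, decide_false, qMap, blindBot, blind, encodeBot_some_apply, oracleMap_apply]
        by_cases hi : i < b
        · simp [hi, Nat.lt_succ_of_lt hi, encodeBot_some_apply, regX]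
        · simp [hi, encodeBot_some_apply]
    · rw [qMap_of_ne (by simpa [hρ1] using hr) (hρ11 r), dif_neg (by simp [hr])]

theorem isProd_query (h : AuxOk a d l s fnd aux) (hd : 0 < d) {ψ' ψ : QState}
    (hP : IsProd ρ ψ' ψ (χ b aux c)) (g : Bits a → Bits b) :
    IsProd ρ (ψ'.mapDomain (simMap d l s g))
      (standardOracle (blindBot (regSet a d l s aux) g) ψ) (χ b aux c) := by
  intro e
  have hinv := simMap_involutive (a := a) (b := b) (d := d) (l := l) (s := s) g
  rw [mapDomain_involutive_apply hinv, hP, standardOracle_eq,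
    mapDomain_involutive_apply (oracleMap_involutive _)]
  by_cases he : Match b aux e
  · obtain ⟨h1, h2⟩ := simMap_match h hd g he
    rw [h2, χ, χ, if_pos h1, if_pos he]
  · have h1 : ¬ Match b aux (simMap d l s g e) := fun h' =>
      he (hinv e ▸ (simMap_match h hd g h').1)
    rw [χ, χ, if_neg h1, if_neg he, mul_zero, mul_zero]

/-- At the moment of the query the message register shows either its original content, if that lies
outside the set, or the spare message, which lies outside by freshness. No element of the set has
any amplitude, which is what distinguishability of degree one requires. -/
theorem log_query (h : AuxOk a d l s true aux) (hd : 0 < d) {ψ' ψ : QState}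
    (hP : IsProd ρ ψ' ψ (χ b aux c)) {x : Bits a} (hx : x ∈ regSet a d l s aux) :
    projReg regX a x (ψ'.mapDomain fun e => kMap a b s (hashMap a d l s e)) = 0 := by
  classical
  ext e
  rw [projReg_apply, Finsupp.zero_apply]
  split_ifs with hr
  swap; · rfl
  by_contra h0
  obtain ⟨e', he', rfl⟩ := Finset.mem_image.1
    (Finsupp.mapDomain_support (Finsupp.mem_support_iff.2 h0))
  have hm : Match b aux e' := by
    by_contra hm
    rw [Finsupp.mem_support_iff, hP, χ, if_neg hm, mul_zero] at he'
    exact he' rfl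
  have hh : ∀ r : ℕ, r = 0 ∨ r = 10 → ∀ i, hashMap a d l s e' (r, i) = e' (r, i) := by
    rintro r (rfl | rfl) i <;>
      exact hashMap_of_ne (by simp) (by simp) (by simp) (by simp) (by simp) e'
  have hf := flag_eq h hd hm
  rw [kMap, hf] at hr
  by_cases hB : readReg 0 a e' ∈ regSet a d l s aux
  · refine h.fresh rfl ?_
    rw [← hr] at hx
    refine (congrArg (· ∈ regSet a d l s aux) (funext fun i => ?_)).mpr hx
    simp only [hB, decide_true, if_true, readReg, swapReg, i.2,
      Equiv.swap_apply_of_ne_of_ne (by norm_num : (0 : ℕ) ≠ 1) (by norm_num : (0 : ℕ) ≠ 11), ite_self,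
      Equiv.swap_apply_left, hh 10 (Or.inr rfl)]
    exact (hm.eq (by norm_num) (by norm_num) _).symm
  · simp only [hB, decide_false] at hr
    apply hB
    rw [← hr] at hx
    refine (congrArg (· ∈ regSet a d l s aux) (funext fun i => ?_)).mpr hx
    exact (hh 0 (Or.inl rfl) i).symm

/-- If everything is blinded the answer is always ⊥, so the simulation needs no query: it flips the
flag qubit. -/
theorem standardOracle_univ (g : Bits a → Bits b) (ψ : QState) :
    standardOracle (blindBot Finset.univ g) ψ = applyGate1 .X (1, b) ψ := by
  rw [standardOracle_eq, applyX_eq]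
  congr 1
  funext e ⟨r, i⟩
  rw [oracleMap_apply, notMap]
  by_cases hq : ((r, i) : Qubit) = (1, b)
  · rw [hq, Function.update_self, dif_pos (by simp)]
    simp [blindBot, blind, encodeBot_none_apply]
  · rw [Function.update_of_ne hq]
    split_ifs with h
    · have : i ≠ b := fun h' => hq (Prod.ext h.1 h')
      simp [blindBot, blind, encodeBot_none_apply, this]
    · rfl

/-- The blind forger uses the even variables from 60 on and the program for ε the odd ones from 61
on, so that the latter leaves no traces in the variables of the former. -/
def emb : Emb := ⟨fun x => 2 * x + 60, ρ, 10, 9, gadget⟩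

/-- Without a spare message the embedded program sees the oracle blinded everywhere and the log does
not grow. With one it sees the oracle blinded on the hashed set, and each logged state avoids that
set. -/
theorem rep_sim {β : ℕ} (O : Oracle a b) (h : AuxOk a d l s fnd aux) (hd : 0 < d) (c : ℂ) :
    emb.Sim (pureMem (O.map (blindBot (if fnd then regSet a d l s aux else Finset.univ)))) O β
      (‖c‖ₑ ^ 2) (fun q o m => (project q o m.1, m.2)) (Rep a b d l s β fnd aux c) where
  inj := fun x y h => by simpa [emb] using h
  tmp := by rintro ⟨x, hx⟩; simp [emb] at hx
  tick _ := rfl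
  frame := by
    rintro m w w' m' ⟨h1, h2, h3, h4, h5⟩ hw
    have hw' : ∀ y < 60, y ≠ 10 → w' y = w y := by
      intro y hy hy'
      refine hw y ?_ hy'
      rintro ⟨x, hx⟩
      simp only [emb] at hx
      omega
    exact ⟨h1.of_eq fun y hy => hw' y (by omega), (hw' _ (by norm_num) (by norm_num)).trans h2,
      (hw' _ (by norm_num) (by norm_num)).trans h3, h4, h5⟩
  cap_eq := fun _ _ _ h => h.cap
  gate := fun _ _ _ g q h => { h with prod := h.prod.gate ρ_injective (χ_indep _ _ _) g q }
  cnot := fun _ _ _ q t h => { h with prod := h.prod.cnot ρ_injective (χ_indep _ _ _) q t }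
  toffoli := fun _ _ _ q q' t h =>
    { h with prod := h.prod.toffoli ρ_injective (χ_indep _ _ _) q q' t }
  meas _ _ _ := rfl
  proj := fun _ _ _ q o h => { h with prod := h.prod.project q o }
  query := by
    intro v f f' m w m' hw hR hf
    change _ * expect (O.map _) _ ≤ _
    rw [expect_map, ← expect_const_mul]
    cases fnd
    · have e : wp (pureMem O) id emb.gadget f' w m' = f' w (applyGate1 .X (1, b) m'.1, m'.2) := by
        have h24 : w 24 = 0 := hR.found
        refine (if_neg (by rw [h24]; norm_num)).trans ?_
        exact congrArg (fun k => f' w (applyGate1 .X (1, k) m'.1, m'.2)) hR.par.tag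
      rw [e, ← expect_const O (f' w _)]
      refine expect_mono _ fun g => hf _ _ _ hw { hR with prod := ?_ }
      rw [if_neg (by simp), standardOracle_univ]
      exact hR.prod.gate ρ_injective (χ_indep _ _ _) .X (1, b)
    · have hw1 := par_vev preQuery_writes hR.par
      have hw2 := par_vev postQuery_writes hw1
      have hv : ∀ y, y < 20 ∨ 24 ≤ y → postQuery.vev (preQuery.vev w) y = w y := fun y hy => by
        rw [vev_of_writes_work postQuery_writes _ hy,
          vev_of_writes_work preQuery_writes _ hy]
      have e : wp (pureMem O) id emb.gadget f' w m' = expect O fun g =>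
          f' (postQuery.vev (preQuery.vev w)) (m'.1.mapDomain (simMap d l s g),
            m'.2 ++ [m'.1.mapDomain fun e => kMap a b s (hashMap a d l s e)]) := by
        have h24 : w 24 = 1 := hR.found
        have e1 : wp (pureMem O) id emb.gadget f' w m'
            = wp (pureMem O) id (.seq preQuery (.seq .query postQuery)) f' w m' := by
          exact if_pos (by rw [h24]; norm_num)
        rw [e1, wp, Cmd.wp_rev O preQuery_rev, wp, wp]
        refine congrArg (expect O) (funext fun g => ?_)
        refine (Cmd.wp_rev O postQuery_rev _ _ _ _).trans ?_
        simp only [show ∀ m, (pureMem O).tick m = m from fun _ => rfl]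
        rw [mapDomain_gadget hR.par _ hw1, funext (ev_preQuery hR.par)]
      rw [e]
      refine expect_mono _ fun g => hf _ _ _ (fun x => ?_) ⟨hw2, ?_, ?_, ?_, ?_⟩
      · rw [hv _ (by simp only [emb]; omega), hw]
      · rw [hv _ (by norm_num), hR.cap]
      · rw [hv _ (by norm_num), hR.found]
      · exact isProd_query h hd hR.prod g
      · intro φ hφ x hx
        rcases List.mem_append.1 hφ with hφ | hφ
        · exact hR.log φ hφ x hx
        · rw [List.mem_singleton.1 hφ]
          exact log_query h hd hR.prod hx

/-! ### The run of the embedded program -/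

def runProg (A : Cmd) : Cmd := .seq (forUp vI 2 (.gate .H ⟨11, vI⟩)) (emb.compile A)

open Classical in
/-- The probability of acceptance for a message that is orthogonal to all queries. -/
def payoff (acc : Bits a → Bits b → ℝ) (_ : Vars) (m : QState × List QState) : ℝ≥0∞ :=
  ∑ x, ∑ t, nE (projReg regY b t (projReg regX a x m.1)) *
    if ∀ φ ∈ m.2, projReg regX a x φ = 0 then ENNReal.ofReal (acc x t) else 0

/-- From the basis states the value is at least `V` times the squared norm. -/
def KetBound (f : Vars → QState × List QState → ℝ≥0∞) (w : Vars) (b : Basis) (V : ℝ) : Prop :=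
  ∀ c : ℂ, ENNReal.ofReal V * ‖c‖ₑ ^ 2 ≤ f w (Finsupp.single b c, [])

/-- Forgeries in the hashed set avoid all logged queries, so they count in the existential game;
further forgeries may count there too, which only helps. -/
theorem payoff_ge {β T : ℕ} {acc : Bits a → Bits b → ℝ} (hacc : ∀ x t, 0 ≤ acc x t ∧ acc x t ≤ 1)
    (h : AuxOk a d l s fnd aux) {v w : Vars} {m m' : QState × List QState}
    (hR : Rep a b d l s β fnd aux c m w m') :
    ‖c‖ₑ ^ 2 * (if m.2.length ≤ T then ENNReal.ofReal (pay acc (regSet a d l s aux) m.1) else 0)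
      ≤ payoff acc v m' := by
  split_ifs
  swap; · simp
  have hn : ∀ x t, 0 ≤ acc x t * nS (projReg regY b t (projReg regX a x m.1)) := fun x t =>
    mul_nonneg (hacc x t).1 (nS_nonneg _)
  have hn' : ∀ x t, 0 ≤ (if x ∈ regSet a d l s aux then (1 : ℝ) else 0) *
      (acc x t * nS (projReg regY b t (projReg regX a x m.1))) := fun x t =>
    mul_nonneg (by split_ifs <;> norm_num) (hn x t)
  rw [pay, payoff, ENNReal.ofReal_sum_of_nonneg fun x _ => Finset.sum_nonneg fun t _ => hn' x t,
    Finset.mul_sum]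
  refine Finset.sum_le_sum fun x _ => ?_
  rw [ENNReal.ofReal_sum_of_nonneg fun t _ => hn' x t, Finset.mul_sum]
  refine Finset.sum_le_sum fun t _ => ?_
  by_cases hx : x ∈ regSet a d l s aux
  · rw [if_pos hx, one_mul, ENNReal.ofReal_mul (hacc x t).1, ofReal_nS, if_pos fun φ hφ => hR.log φ hφ x hx]
    have := (hR.prod.projReg regX a x).projReg regY b t
    rw [show ρ regX = regX from rfl, show ρ regY = regY from rfl] at this
    rw [this.nE ρ_injective (χ_indep _ _ _), sqNorm_χ h]
    exact le_of_eq (by ring)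
  · rw [if_neg hx]; simp

theorem runProg_bound {β T : ℕ} {acc : Bits a → Bits b → ℝ}
    (hacc : ∀ x t, 0 ≤ acc x t ∧ acc x t ≤ 1) (O : Oracle a b) (A : Cmd)
    (h : AuxOk a d l s fnd aux) {v w : Vars} (hw : Par w a b d l s) (h9 : w 9 = β)
    (h24 : w 24 = if fnd then 1 else 0) (hv : ∀ x, w (2 * x + 60) = v x) :
    KetBound (wp (pureMem O) id (runProg A) (payoff acc)) w aux
      (valOn O (fun k => min k β) A acc T v (if fnd then regSet a d l s aux else Finset.univ)
        (regSet a d l s aux)) := by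
  intro c
  have hwr : (forUp vI 2 (.gate .H ⟨11, vI⟩)).Writes work := by simp [forUp, Cmd.Writes, work]
  have hdet : (forUp vI 2 (.gate .H ⟨11, vI⟩)).Det := by simp [forUp, Cmd.Det]
  rw [runProg, wp, Cmd.wp_det O hdet, ev_forUp qGates (S := ∅) (by simp [Cmd.Writes]) (by simp)
    (by simp) (by norm_num) (by norm_num) hw.one (fun j => applyGate1 .H (11, j))
    (fun j _ w' _ hj m => by simp [Cmd.ev, qGates, hj]), hw.tag, mul_comm,
    ← (wp_eq_valOn (O := O) (T := T) hacc _ _).1]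
  refine (rep_sim O h hw.pos c).le A _ _ (fun v m w m' _ hR => payoff_ge hacc h hR) _ _ _ _
    (fun x => ?_) ⟨par_vev hwr hw, ?_, ?_, isProd_init c h.zero11 h.zeroρ, by simp⟩
  · rw [vev_of_writes_work hwr _ (by simp only [emb]; omega)]
    exact hv x
  · rw [vev_of_writes_work hwr _ (by norm_num), h9]
  · rw [vev_of_writes_work hwr _ (by norm_num), h24]

end Sim

end Hasher

/-! ### Random seeds from measured uniform superpositions -/

theorem writeReg_apply {r d : ℕ} {u : Bits d} {b : Basis} {q : Qubit} :
    writeReg r d u b q = if q.1 = r then if q.2 < d then ext u q.2 else b q else b q := by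
  simp only [writeReg, ext]
  split_ifs <;> first | rfl | (exfalso; tauto)

theorem readReg_writeReg (r d : ℕ) (u : Bits d) (b : Basis) : readReg r d (writeReg r d u b) = u := by
  funext i
  simp [readReg, writeReg]

theorem writeReg_writeReg (r d : ℕ) (u u' : Bits d) (b : Basis) :
    writeReg r d u (writeReg r d u' b) = writeReg r d u b := by
  funext q
  simp only [writeReg_apply]
  split_ifs <;> rfl

theorem enorm_entry_H (v v' : Bool) : ‖Gate1.H.entry v v'‖ₑ ^ 2 = ENNReal.ofReal (1 / 2) := by
  have h : ‖Gate1.H.entry v v'‖ ^ 2 = 1 / 2 := by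
    cases v <;> cases v' <;> simp [Gate1.entry, div_pow]
  rw [← ofReal_norm, ← ENNReal.ofReal_pow (norm_nonneg _), h]

theorem projReg_up_H (r N : ℕ) (b : Basis) (c : ℂ) (x : Bits N) :
    projReg r N x (up (fun j => applyGate1 .H (r, j)) N (Finsupp.single b c)) =
      Finsupp.single (writeReg r N x b)
        ((∏ j ∈ Finset.range N, Gate1.H.entry (writeReg r N x b (r, j)) (b (r, j))) * c) := by
  classical
  ext e
  rw [projReg_apply, up_H_single, Finsupp.single_apply]
  by_cases he : writeReg r N x b = e
  · subst he
    rw [if_pos rfl, if_pos (readReg_writeReg _ _ _ _), if_pos]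
    intro q hq
    rw [writeReg, dif_neg hq]
  · rw [if_neg he]
    split_ifs with h1 h2
    · exfalso
      apply he
      funext q
      by_cases hq : q.1 = r ∧ q.2 < N
      · rw [writeReg, dif_pos hq, ← h1, readReg, show ((r, q.2) : Qubit) = q from Prod.ext hq.1.symm rfl]
      · rw [writeReg, dif_neg hq, h2 q hq]
    · rfl
    · rfl

theorem sum_seedL {a d l : ℕ} (hd : 0 < d) (f : (ℕ → Bool) → ℝ) :
    ∑ x : Bits ((a + 1) * (d * l)), f (ext x)
      = ∑ L : Fin d → Fin l → Bits (a + 1), f (seedL L) := by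
  have he : ∀ L : Fin d → Fin l → Bits (a + 1),
      ext (fun n : Fin ((a + 1) * (d * l)) => seedL L n) = seedL L := by
    intro L
    funext n
    unfold ext
    split_ifs with h
    · rfl
    · rw [seedL, dif_neg]
      rintro ⟨-, -, h3⟩
      rw [Nat.div_div_eq_div_mul, Nat.div_lt_iff_lt_mul (by positivity)] at h3
      exact h (by nlinarith)
  have hb : Function.Bijective fun (L : Fin d → Fin l → Bits (a + 1))
      (n : Fin ((a + 1) * (d * l))) => seedL L n := by
    rw [Fintype.bijective_iff_injective_and_card]
    constructor
    · intro L L' h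
      have h' : seedL L = seedL L' := (he L).symm.trans ((congrArg ext h).trans (he L'))
      funext j i t
      rw [← seedL_apply L j i t.2, h', seedL_apply]
    · simp only [Fintype.card_pi, Finset.prod_const, Finset.card_univ, Fintype.card_fin,
        Fintype.card_bool, ← pow_mul]
      congr 1
      ring
  rw [← hb.sum_comp]
  exact Finset.sum_congr rfl fun L _ => by rw [he]

theorem sum_seedT {d s : ℕ} (hd : 0 < d) (f : (ℕ → Bool) → ℝ) :
    ∑ x : Bits (d * s), f (ext x) = ∑ T : Fin s → Fin d → Bool, f (seedT T) := by
  have he : ∀ T : Fin s → Fin d → Bool, ext (fun n : Fin (d * s) => seedT T n) = seedT T := by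
    intro T
    funext n
    unfold ext
    split_ifs with h
    · rfl
    · rw [seedT, dif_neg]
      rintro ⟨-, h3⟩
      rw [Nat.div_lt_iff_lt_mul hd, mul_comm] at h3
      exact h h3
  have hb : Function.Bijective fun (T : Fin s → Fin d → Bool) (n : Fin (d * s)) => seedT T n := by
    rw [Fintype.bijective_iff_injective_and_card]
    constructor
    · intro T T' h
      have h' : seedT T = seedT T' := (he T).symm.trans ((congrArg ext h).trans (he T'))
      funext i j
      rw [← seedT_apply T i j, h', seedT_apply]
    · simp only [Fintype.card_pi, Finset.prod_const, Finset.card_univ, Fintype.card_fin,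
        Fintype.card_bool, ← pow_mul]
  rw [← hb.sum_comp]
  exact Finset.sum_congr rfl fun T _ => by rw [he]

namespace Hasher

open Forger (ρ ρ_injective notMem_ρ)

/-! ### Bounds for runs that start with a basis state -/

section KetBound

variable {a d : ℕ} {O : Oracle a d} {f : Vars → QState × List QState → ℝ≥0∞} {w : Vars} {b : Basis}
  {V : ℝ}

theorem ketBound_seq {p q : Cmd} (h : KetBound (wp (pureMem O) id p (wp (pureMem O) id q f)) w b V) :
    KetBound (wp (pureMem O) id (.seq p q) f) w b V := h

theorem ketBound_rev {p : Cmd} (hp : p.Rev) (h : KetBound f (p.vev w) (p.ev bGates w b) V) :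
    KetBound (wp (pureMem O) id p f) w b V := by
  intro c
  rw [Cmd.wp_rev O hp, Finsupp.mapDomain_single]
  exact h c

theorem ketBound_measure {q : QRef} {u : ℕ}
    (h : KetBound f (Function.update w u (if b (q.reg, w q.idx) then 1 else 0)) b V) :
    KetBound (wp (pureMem O) id (.measure q u) f) w b V := by
  intro c
  have hp : ∀ v, b (q.reg, w q.idx) = v → project (q.reg, w q.idx) v (Finsupp.single b c)
      = Finsupp.single b c := fun v hv => Finsupp.filter_single_of_pos _ hv
  have := h c
  simp only [wp, pureMem]
  cases hb : b (q.reg, w q.idx) <;> rw [hb] at this <;> rw [hp _ hb]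
  · exact this.trans le_add_self
  · exact this.trans le_self_add

def coinProg (r N : ℕ) : Cmd :=
  .seq (forUp vI N (.gate .H ⟨r, vI⟩)) (forUp vI N (.measure ⟨r, vI⟩ 25))

/-- Each outcome of measuring the transformed register leaves a single basis state with squared
amplitude reduced by 2^(-D). Its phase is irrelevant because the bounds depend only on the modulus
of the amplitude. -/
theorem ketBound_coins {r N D : ℕ} (hN : N < 20) (h1 : w vOne = 1) (hD : w N = D) {F : Bits D → ℝ}
    (hF : ∀ x, 0 ≤ F x) (h : ∀ x w', (∀ y, y ≠ 20 → y ≠ 25 → w' y = w y) →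
      KetBound f w' (writeReg r D x b) (F x)) :
    KetBound (wp (pureMem O) id (coinProg r N) f) w b (1 / 2 ^ D * ∑ x, F x) := by
  intro c
  have hwr : (forUp vI N (.gate .H ⟨r, vI⟩)).Writes {vI} := by simp [forUp, Cmd.Writes]
  have hv : ∀ y, y ≠ 20 → (forUp vI N (.gate .H ⟨r, vI⟩)).vev w y = w y := fun y hy =>
    hwr.vev_eq (by simpa using hy) w
  rw [coinProg, wp, Cmd.wp_det O (by simp [forUp, Cmd.Det]), ev_forUp qGates (S := ∅)
    (by simp [Cmd.Writes]) (by simp) (by simp) (by norm_num) (by simp only [vI]; omega) h1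
    (fun j => applyGate1 .H (r, j)) (fun j _ w' _ hj m => by simp [Cmd.ev, qGates, hj]), hD]
  refine le_trans (le_of_eq ?_) (wp_forUp_measure (D := D) O (by norm_num) (by norm_num) (by norm_num)
    (by simp only [vI]; omega) (by rw [hv _ (by norm_num), h1])
    (by rw [hv _ (by omega), hD]) f _ [] (fun x => ENNReal.ofReal (F x) *
      (ENNReal.ofReal (1 / 2) ^ D * ‖c‖ₑ ^ 2)) fun x w' hw' => ?_)
  · rw [← Finset.sum_mul, ← ENNReal.ofReal_sum_of_nonneg fun x _ => hF x, ← mul_assoc,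
      ← ENNReal.ofReal_pow (by norm_num), ← ENNReal.ofReal_mul (Finset.sum_nonneg fun x _ => hF x),
      mul_comm (1 / 2 ^ D : ℝ), div_pow, one_pow]
  · rw [projReg_up_H]
    refine le_trans (le_of_eq ?_) (h x w' (fun y h20 h25 => by rw [hw' y h20 h25, hv y h20]) _)
    rw [enorm_mul, mul_pow]
    congr 2
    generalize writeReg r D x b = e
    clear hF h hD x F
    induction D with
    | zero => simp
    | succ D ih => rw [Finset.prod_range_succ, enorm_mul, mul_pow, ← ih, enorm_entry_H, pow_succ]

end KetBound

/-! ### The random message outside of the blinding set -/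

/-- Variable 24 records success; once it is 1 the remaining attempts are skipped, so the first
message found outside the set is kept. -/
def pickBody : Cmd :=
  .cond 24 .skip (.seq (coinProg 0 1) (.seq hashUp (.seq (.measure ⟨9, 15⟩ 25)
    (.seq hashDown (.sub 24 vOne 25)))))

def finish (A : Cmd) : Cmd := .seq (.loop 18 pickBody) (.seq (swapProg vI 1 0 10) (runProg A))

def sample (A : Cmd) : Cmd := .seq (coinProg 2 16) (.seq (coinProg 3 17) (finish A))

/-- The variables outside of the working range are unchanged. -/
def Keep (w' w : Vars) : Prop := ∀ y, y < 20 ∨ 60 ≤ y → w' y = w y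

section Pick

variable {a b d l s : ℕ} {O : Oracle a b} {w : Vars} {b₀ : Basis}

theorem Keep.par {w' : Vars} (h : Keep w' w) (hw : Par w a b d l s) : Par w' a b d l s :=
  hw.of_eq fun y hy _ => h y (Or.inl hy)

theorem regSet_congr {e e' : Basis} (h : ∀ r, r = 2 ∨ r = 3 ∨ r = 5 → ∀ i, e (r, i) = e' (r, i)) :
    regSet a d l s e = regSet a d l s e' := by
  have : ∀ r, r = 2 ∨ r = 3 ∨ r = 5 → regBits e r = regBits e' r := fun r hr => funext (h r hr)
  rw [regSet, regSet, this 2 (by simp), this 3 (by simp), this 5 (by simp)]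

theorem matchKet (x : Bits a) : Match b b₀ (writeReg 0 a x b₀) := by
  intro q hq _
  rw [writeReg_apply, if_neg fun h => hq ⟨0, h.symm⟩]

/-- By induction on the attempts left. The hash flag is measured on a basis state, so the test is
deterministic and the circuit is undone exactly; a fresh uniform message lies in the set with
probability dens B, independently of earlier attempts. -/
theorem ketBound_pick (hok : AuxOk a d l s false b₀) (hw : Par w a b d l s)
    {f : Vars → QState × List QState → ℝ≥0∞} {W₀ W₁ : ℝ} (hW₀ : 0 ≤ W₀) (hW₁ : 0 ≤ W₁)
    (h1 : ∀ w' x, Keep w' w → w' 24 = 1 → x ∉ regSet a d l s b₀ →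
      KetBound f w' (writeReg 0 a x b₀) W₁)
    (h0 : ∀ w' x, Keep w' w → w' 24 = 0 → KetBound f w' (writeReg 0 a x b₀) W₀) (k : ℕ) :
    (∀ w' x, Keep w' w → w' 24 = 1 → x ∉ regSet a d l s b₀ →
      KetBound ((wp (pureMem O) id pickBody)^[k] f) w' (writeReg 0 a x b₀) W₁) ∧
    ∀ w' x, Keep w' w → w' 24 = 0 → KetBound ((wp (pureMem O) id pickBody)^[k] f) w'
      (writeReg 0 a x b₀) ((1 - dens (regSet a d l s b₀) ^ k) * W₁
        + dens (regSet a d l s b₀) ^ k * W₀) := by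
  set B := regSet a d l s b₀ with hB
  have hd0 := dens_nonneg B
  have hd1 := dens_le_one B
  induction k with
  | zero => exact ⟨h1, by simpa using h0⟩
  | succ k ih =>
    have hk0 := pow_nonneg hd0 k
    have hk1 := pow_le_one₀ (n := k) hd0 hd1
    set W := (1 - dens B ^ k) * W₁ + dens B ^ k * W₀ with hW
    have hWn : 0 ≤ W := add_nonneg (mul_nonneg (by linarith) hW₁) (mul_nonneg hk0 hW₀)
    simp only [Function.iterate_succ_apply']
    constructor
    · intro w' x hk h24 hx c
      refine (ih.1 w' x hk h24 hx c).trans (le_of_eq ?_)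
      exact (if_pos (by rw [h24]; norm_num)).symm
    · intro w' x hk h24
      have hp := hk.par hw
      have key : KetBound (wp (pureMem O) id (.seq (coinProg 0 1) (.seq hashUp
          (.seq (.measure ⟨9, 15⟩ 25) (.seq hashDown (.sub 24 vOne 25)))))
            ((wp (pureMem O) id pickBody)^[k] f)) w' (writeReg 0 a x b₀)
          (1 / 2 ^ a * ∑ y : Bits a, if y ∈ B then W else W₁) := by
        refine ketBound_seq (ketBound_coins (by norm_num) hp.one hp.msg (fun y => by split_ifs <;> assumption)
          fun y w₁ hw₁ => ?_)
        have hk₁ : Keep w₁ w := fun z hz => by rw [hw₁ z (by omega) (by omega), hk z hz]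
        have hp₁ := hk₁.par hw
        rw [writeReg_writeReg]
        refine ketBound_seq (ketBound_rev hashUp_rev (ketBound_seq (ketBound_measure (ketBound_seq
          (ketBound_rev hashDown_rev ?_)))))
        have hk₂ : Keep (hashUp.vev w₁) w := fun z hz => by
          rw [vev_of_writes_work hashUp_writes _ (by omega), hk₁ z hz]
        have hfl := flag_eq hok hw.pos (matchKet (b := b) y)
        rw [readReg_writeReg] at hfl
        have hk₃ : ∀ v, Keep (Function.update (hashUp.vev w₁) 25 v) w := fun v z hz => by
          rw [Function.update_of_ne (by omega), hk₂ z hz]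
        rw [ev_hashUp hp₁, (hk₂.par hw).width, hfl, ev_hashDown ((hk₃ _).par hw),
          hashMapInv_hashMap hw.pos]
        set w₂ := hashDown.vev (Function.update (hashUp.vev w₁) 25
          (if decide (y ∈ regSet a d l s b₀) then 1 else 0)) with hw₂
        have e : ∀ z, z < 20 ∨ 24 ≤ z → w₂ z = Function.update (hashUp.vev w₁) 25
          (if decide (y ∈ regSet a d l s b₀) then 1 else 0) z := fun z hz =>
          vev_of_writes_work hashDown_writes _ hz
        have e25 : w₂ 25 = if y ∈ B then 1 else 0 := by
          rw [e 25 (by norm_num), Function.update_self]; simp [hB]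
        have e3 : w₂ vOne = 1 := by rw [e _ (by norm_num), hk₃ _ _ (by norm_num), hw.one]
        have hk₄ : Keep (Function.update w₂ 24 (w₂ vOne - w₂ 25)) w := fun z hz => by
          rw [Function.update_of_ne (by omega), e z (by omega), hk₃ _ z hz]
        split_ifs with hy
        · exact ih.2 _ _ hk₄ (by rw [Function.update_self, e3, e25, if_pos hy])
        · exact ih.1 _ _ hk₄ (by rw [Function.update_self, e3, e25, if_neg hy]) hy
      have hsum : 1 / 2 ^ a * ∑ y : Bits a, (if y ∈ B then W else W₁)
          = (1 - dens B ^ (k + 1)) * W₁ + dens B ^ (k + 1) * W₀ := by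
        have hc : (0 : ℝ) < 2 ^ a := by positivity
        have e1 : ∑ y : Bits a, (if y ∈ B then W else W₁) = B.card * W + (2 ^ a - B.card) * W₁ := by
          rw [Finset.sum_ite, Finset.sum_const, Finset.sum_const, Finset.filter_mem_eq_inter,
            Finset.univ_inter, nsmul_eq_mul, nsmul_eq_mul, Finset.filter_not,
            Finset.filter_mem_eq_inter, Finset.univ_inter, Finset.card_sdiff_of_subset
              (Finset.subset_univ _), Nat.cast_sub (Finset.card_le_card (Finset.subset_univ _))]
          simp
        have e2 : dens B = B.card / 2 ^ a := by simp [dens]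
        rw [e1, pow_succ, hW, mul_add, ← mul_assoc, ← mul_assoc, mul_sub]
        rw [show (1 : ℝ) / 2 ^ a * B.card = dens B by rw [e2]; ring, one_div,
          inv_mul_cancel₀ hc.ne']
        ring
      rw [hsum] at key
      intro c
      refine (key c).trans (le_of_eq ?_)
      exact (if_neg (by rw [h24]; norm_num)).symm

theorem regSet_writeReg {r N : ℕ} (hr : r = 0 ∨ r = 10) (x : Bits N) :
    regSet a d l s (writeReg r N x b₀) = regSet a d l s b₀ :=
  regSet_congr fun r' hr' i => by rw [writeReg_apply, if_neg (by simp only; omega)]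

theorem AuxOk.writeReg {r N : ℕ} (hok : AuxOk a d l s false b₀) (hr : r = 2 ∨ r = 3 ∨ r = 10)
    (x : Bits N) (fnd : Bool)
    (hf : fnd = true → readReg 10 a (writeReg r N x b₀) ∉ regSet a d l s (writeReg r N x b₀)) :
    AuxOk a d l s fnd (QUnf.writeReg r N x b₀) := by
  have e : ∀ r' i, r' ≠ r → QUnf.writeReg r N x b₀ (r', i) = b₀ (r', i) := fun r' i h => by
    rw [writeReg_apply, if_neg h]
  have hρ : ∀ r', ρ r' ≠ r := fun r' h => notMem_ρ (r := r) (by omega) (by omega) ⟨r', h⟩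
  refine ⟨⟨fun i => ?_, fun i => ?_, fun i => ?_, fun i => ?_, fun i => ?_⟩, fun i => ?_,
    fun r' i => ?_, hf⟩ <;> rw [e _ _ (by first | exact hρ _ | omega)]
  exacts [hok.clean.reg4 i, hok.clean.reg6 i, hok.clean.reg7 i, hok.clean.reg8 i, hok.clean.reg9 i,
    hok.zero11 i, hok.zeroρ r' i]

theorem swapReg_ket (x : Bits a) (h0 : ∀ i, b₀ (0, i) = false) (h10 : ∀ i, b₀ (10, i) = false) :
    swapReg 0 10 a (writeReg 0 a x b₀) = writeReg 10 a x b₀ := by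
  funext ⟨r, i⟩
  by_cases hi : i < a
  · by_cases hr0 : r = 0
    · subst hr0; simp [swapReg, writeReg_apply, hi, h0, h10]
    · by_cases hr10 : r = 10
      · subst hr10; simp [swapReg, writeReg_apply, hi]
      · simp [swapReg, writeReg_apply, hi, Equiv.swap_apply_of_ne_of_ne hr0 hr10, hr0, hr10]
  · simp [swapReg, writeReg_apply, hi]

variable {β T r : ℕ} {acc : Bits a → Bits b → ℝ} {v : Vars} {A : Cmd}

theorem ketBound_finish (hacc : ∀ x t, 0 ≤ acc x t ∧ acc x t ≤ 1) (hok : AuxOk a d l s false b₀)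
    (h10 : ∀ i, b₀ (10, i) = false) (hw : Par w a b d l s) (h9 : w 9 = β) (h18 : w 18 = r)
    (h24 : w 24 = 0) (hv : ∀ x, w (2 * x + 60) = v x) :
    KetBound (wp (pureMem O) id (finish A) (payoff acc)) w b₀
      (valMix O (fun k => min k β) A acc T r v (regSet a d l s b₀)) := by
  have h0 : ∀ i, b₀ (0, i) = false := hok.zeroρ 0
  have hrest : ∀ (fnd : Bool) w' x, Keep w' w → (w' 24 = if fnd then 1 else 0) →
      (fnd = true → x ∉ regSet a d l s b₀) →
      KetBound (wp (pureMem O) id (.seq (swapProg vI 1 0 10) (runProg A)) (payoff acc)) w'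
        (writeReg 0 a x b₀) (valOn O (fun k => min k β) A acc T v
          (if fnd then regSet a d l s b₀ else Finset.univ) (regSet a d l s b₀)) := by
    intro fnd w' x hk hf hx
    have hp := hk.par hw
    have hv' : ∀ y, y ≠ 20 → (swapProg vI 1 0 10).vev w' y = w' y := fun y hy =>
      (swapProg_writes vI 1 0 10).vev_eq (by simpa using hy) w'
    refine ketBound_seq (ketBound_rev (swapProg_rev _ _ _ _) ?_)
    rw [ev_swapProg (by norm_num) (by norm_num) (by norm_num) hp.one, hp.msg, swapReg_ket x h0 h10]
    have hB := regSet_writeReg (a := a) (d := d) (l := l) (s := s) (b₀ := b₀) (Or.inr rfl) x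
    have := runProg_bound (T := T) hacc O A (hok.writeReg (Or.inr (Or.inr rfl)) x fnd fun h => by
      rw [hB, readReg_writeReg]; exact hx h) (w := (swapProg vI 1 0 10).vev w')
      (hp.of_eq fun y hy _ => hv' y (by omega)) ((hv' 9 (by norm_num)).trans
      ((hk 9 (by norm_num)).trans h9)) ((hv' 24 (by norm_num)).trans hf) fun y => by
        rw [hv' _ (by omega), hk _ (by omega), hv]
    rwa [hB] at this
  have hpick := (ketBound_pick (O := O) hok hw (valOn_nonneg hacc _ _) (valOn_nonneg hacc _ _)
    (fun w' x hk hf hx => hrest true w' x hk hf fun _ => hx)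
    (fun w' x hk hf => hrest false w' x hk hf (by simp)) r).2 w (fun _ => false) (fun _ _ => rfl) h24
  have hz : writeReg 0 a (fun _ => false) b₀ = b₀ := by
    funext ⟨r, i⟩
    rw [writeReg_apply]
    split_ifs with h1 h2
    · simp only at h1; subst h1; rw [h0]; simp [ext]
    · rfl
    · rfl
  rw [hz, ← h18] at hpick
  rw [← h18]
  exact hpick

/-- The bound for the run after the threshold has been computed. -/
theorem ketBound_sample (hacc : ∀ x t, 0 ≤ acc x t ∧ acc x t ≤ 1) (hok : AuxOk a d l s false b₀)
    (h2 : ∀ i, b₀ (2, i) = false) (h3 : ∀ i, b₀ (3, i) = false)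
    (h10 : ∀ i, b₀ (10, i) = false) (hw : Par w a b d l s) (h9 : w 9 = β)
    (h16 : w 16 = (a + 1) * (d * l)) (h17 : w 17 = d * s) (h18 : w 18 = r) (h24 : w 24 = 0)
    (hv : ∀ x, w (2 * x + 60) = v x) :
    KetBound (wp (pureMem O) id (sample A) (payoff acc)) w b₀
      (1 / 2 ^ ((a + 1) * (d * l)) * ∑ L : Fin d → Fin l → Bits (a + 1), 1 / 2 ^ (d * s) *
        ∑ S : Fin s → Fin d → Bool, valMix O (fun k => min k β) A acc T r v
          (seedSet (regBits b₀ 5) s L S)) := by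
  have hnn := fun B => (valMix_mem (O := O) (cnt := fun k => min k β) (p := A) (T := T) (r := r)
    (v := v) hacc B).1
  rw [← sum_seedL hw.pos fun L => 1 / 2 ^ (d * s) * ∑ S : Fin s → Fin d → Bool,
    valMix O (fun k => min k β) A acc T r v (hashSet a d l s (regBits b₀ 5) L (seedT S))]
  have hT := fun L => sum_seedT hw.pos (s := s) fun S => valMix O (fun k => min k β) A acc T r v
    (hashSet a d l s (regBits b₀ 5) L S)
  simp only [← hT]
  refine ketBound_seq (ketBound_coins (by norm_num) hw.one h16 (fun x => mul_nonneg (by positivity)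
    (Finset.sum_nonneg fun _ _ => hnn _)) fun x w₁ hw₁ => ?_)
  have hp₁ : Par w₁ a b d l s := hw.of_eq fun y hy _ => hw₁ y (by omega) (by omega)
  refine ketBound_seq (ketBound_coins (by norm_num) hp₁.one ((hw₁ _ (by norm_num) (by norm_num)).trans h17)
    (fun x => hnn _) fun y w₂ hw₂ => ?_)
  have e : ∀ z, z ≠ 20 → z ≠ 25 → w₂ z = w z := fun z h h' => by rw [hw₂ z h h', hw₁ z h h']
  have hok' := (hok.writeReg (Or.inl rfl) x false (by simp)).writeReg (Or.inr (Or.inl rfl)) y false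
    (by simp)
  have hset : regSet a d l s (writeReg 3 (d * s) y (writeReg 2 ((a + 1) * (d * l)) x b₀))
      = hashSet a d l s (regBits b₀ 5) (ext x) (ext y) := by
    have hz : ∀ {N} (u : Bits N) i, ¬ i < N → ext u i = false := fun u i h => by simp [ext, h]
    rw [regSet]
    congr 1
    · funext i
      by_cases hi : i < (a + 1) * (d * l)
      · simp [regBits, writeReg_apply, hi, ext]
      · simp [regBits, writeReg_apply, hi, h2, hz]
    · funext i
      by_cases hi : i < d * s
      · simp [regBits, writeReg_apply, hi, ext]
      · simp [regBits, writeReg_apply, hi, h3, hz]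
  rw [← hset]
  exact ketBound_finish hacc hok' (fun i => by simp [writeReg_apply, h10])
    (hw.of_eq fun y hy _ => e y (by omega) (by omega)) ((e _ (by norm_num) (by norm_num)).trans h9)
    ((e _ (by norm_num) (by norm_num)).trans h18) ((e _ (by norm_num) (by norm_num)).trans h24)
    fun z => by rw [e _ (by omega) (by omega), hv]

end Pick

end Hasher

namespace Hasher

/-! ### The parameters, the threshold and the marked qubits -/

/-- The embedding of the program that computes the blinding probability. -/
def epsEmb : Emb := ⟨fun x => 2 * x + 61, id, 10, 11, .query⟩

def layout : Cmd :=
  .seq (.add 15 9 vZero) (.seq (mulIdx 14 13 19 vZero) (.seq (mulIdx 16 12 14 vZero)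
    (.seq (mulIdx 17 13 15 vZero) (.seq (.add 61 0 vZero) (.add 63 15 vZero)))))

/-- With `P = 2 ^ lg n` this sets variable `18` to `P ^ c₁`, `9`, `13`, `15` to `P ^ c`, `11` to
`P ^ c₅`, and the lengths of the registers accordingly. -/
def params (c₁ c e c₅ : ℕ) : Cmd :=
  .seq sizeProg (.seq (powProg 18 c₁) (.seq (powProg 9 c) (.seq (powProg 11 c₅)
    (.seq (mulConst 19 vL e) (.seq (.add 12 1 vOne) (.seq (.add 13 9 vZero) layout))))))

/-- Binary long division: the remainder in variable 21 is doubled, the test variable is nonzero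
exactly if the result has reached the divisor, and then the divisor is subtracted and the bit is
set. -/
def thresholdBody : Cmd :=
  .seq (.sub 20 20 vOne) (.seq (.add 21 21 21) (.seq (.add 23 21 vOne) (.seq (.sub 23 23 22)
    (.cond 23 (.seq (.sub 21 21 22) (.gate .X ⟨5, 20⟩)) .skip))))

def thresholdInit : Cmd :=
  .seq (.add 20 15 vZero) (.seq (.add 21 61 vZero) (.seq (.const 22 1)
    (.seq (.loop 15 (.add 22 22 22)) (.seq (.add 23 21 vOne) (.seq (.sub 23 23 22)
      (.sub 21 21 23))))))

/-- Writes the value of variable `61`, truncated to the bits available, into register `5`. -/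
def threshold : Cmd := .seq thresholdInit (.loop 15 thresholdBody)

def marks : Cmd :=
  .seq (.gate .X ⟨4, 1⟩) (.seq (forUp vI 13 (.gate .X ⟨7, vI⟩))
    (.seq (.add 60 0 vZero) (.seq (.add 62 1 vZero) (.add 64 2 vZero))))

def prepare (p : Cmd) : Cmd := .seq (epsEmb.compile p) (.seq threshold marks)

def adversary (c₁ c e c₅ : ℕ) (p A : Cmd) : Cmd :=
  .seq (params c₁ c e c₅) (.seq (prepare p) (sample A))

theorem params_classical (c₁ c e c₅ : ℕ) : (params c₁ c e c₅).IsClassical := by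
  refine ⟨sizeProg_classical, powProg_classical _ _, powProg_classical _ _, powProg_classical _ _,
    mulConst_classical _ _ _, ?_⟩
  simp [layout, mulIdx, Cmd.IsClassical]

theorem params_vev (c₁ c e c₅ n a b : ℕ) {w : Vars}
    (hw : w = (params c₁ c e c₅).vev (inputVars [n, a, b])) :
    Par w a b ((2 ^ lg n) ^ c) (e * lg n) ((2 ^ lg n) ^ c) ∧ w 9 = (2 ^ lg n) ^ c ∧
    w 11 = (2 ^ lg n) ^ c₅ ∧ w 16 = (a + 1) * ((2 ^ lg n) ^ c * (e * lg n)) ∧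
    w 17 = (2 ^ lg n) ^ c * (2 ^ lg n) ^ c ∧ w 18 = (2 ^ lg n) ^ c₁ ∧ w 0 = n ∧ w 61 = n ∧
    w 63 = (2 ^ lg n) ^ c ∧ ∀ y, 20 ≤ y → y ≠ 61 → y ≠ 63 → w y = 0 := by
  set v := inputVars [n, a, b] with hv
  obtain ⟨h1, h2, h3⟩ := sizeProg_vev v
  have hpow : ∀ x k w y, y ≠ 5 → y ≠ x → (powProg x k).vev w y = w y := fun x k w y h h' =>
    (powProg_writes x k).vev_eq (by simp [vT, h, h']) w
  have hz0 : sizeProg.vev v vZero = 0 := sizeProg_writes.vev_eq (by simp) v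
  set w₁ := sizeProg.vev v with hw₁
  have f₁ : ∀ y, y ∉ ({vOne, vT, vN, vP, vL} : Set ℕ) → w₁ y = v y := fun y hy =>
    sizeProg_writes.vev_eq hy v
  have g₁ := powProg_vev 18 c₁ (by norm_num) w₁ hz0
  set w₂ := (powProg 18 c₁).vev w₁ with hw₂
  have f₂ : ∀ y, y ≠ 5 → y ≠ 18 → w₂ y = w₁ y := hpow _ _ _
  have g₂ := powProg_vev 9 c (by norm_num) w₂ (by rw [f₂ _ (by norm_num) (by norm_num), hz0])
  set w₃ := (powProg 9 c).vev w₂ with hw₃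
  have f₃ : ∀ y, y ≠ 5 → y ≠ 9 → w₃ y = w₂ y := hpow _ _ _
  have g₃ := powProg_vev 11 c₅ (by norm_num) w₃
    (by rw [f₃ _ (by norm_num) (by norm_num), f₂ _ (by norm_num) (by norm_num), hz0])
  set w₄ := (powProg 11 c₅).vev w₃ with hw₄
  have f₄ : ∀ y, y ≠ 5 → y ≠ 11 → w₄ y = w₃ y := hpow _ _ _
  have g₄ := mulConst_vev (x := 19) (y := vL) (by norm_num) e w₄
  set u := (mulConst 19 vL e).vev w₄ with hu
  have f₅ : ∀ y, y ≠ 19 → u y = w₄ y := fun y hy =>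
    (mulConst_writes 19 vL e).vev_eq (by simpa using hy) w₄
  have ew : w = layout.vev ((Cmd.add 13 9 vZero).vev ((Cmd.add 12 1 vOne).vev u)) := hw
  rw [f₂ _ (by norm_num) (by norm_num), h2] at g₂
  rw [f₃ _ (by norm_num) (by norm_num), f₂ _ (by norm_num) (by norm_num), h2] at g₃
  rw [f₄ _ (by norm_num) (by norm_num), f₃ _ (by norm_num) (by norm_num),
    f₂ _ (by norm_num) (by norm_num), h3] at g₄
  rw [h2] at g₁
  have hv0 : v 0 = n := rfl
  rw [hv0] at g₁ g₂ g₃ g₄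
  have eu : ∀ y, y ∉ ({3, 5, 6, 7, 8, 9, 11, 18, 19} : Set ℕ) → u y = v y := fun y hy => by
    simp only [Set.mem_insert_iff, Set.mem_singleton_iff, not_or] at hy
    obtain ⟨e1, e2, e3, e4, e5, e6, e7, e8, e9⟩ := hy
    rw [f₅ y e9, f₄ y e2 e7, f₃ y e2 e6, f₂ y e2 e8, f₁]
    simp [vT, vN, vP, vL, e1, e2, e3, e4, e5]
  have u0 : u 0 = n := eu 0 (by simp)
  have u1 : u 1 = a := eu 1 (by simp)
  have u2 : u 2 = b := eu 2 (by simp)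
  have u3 : u 3 = 1 := by
    rw [f₅ 3 (by norm_num), f₄ 3 (by norm_num) (by norm_num), f₃ 3 (by norm_num) (by norm_num),
      f₂ 3 (by norm_num) (by norm_num), h1]
  have u4 : u 4 = 0 := eu 4 (by simp)
  have u9 : u 9 = (2 ^ lg n) ^ c := by
    rw [f₅ 9 (by norm_num), f₄ 9 (by norm_num) (by norm_num), g₂]
  have u11 : u 11 = (2 ^ lg n) ^ c₅ := by rw [f₅ 11 (by norm_num), g₃]
  have u18 : u 18 = (2 ^ lg n) ^ c₁ := by
    rw [f₅ 18 (by norm_num), f₄ 18 (by norm_num) (by norm_num), f₃ 18 (by norm_num) (by norm_num), g₁]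
  simp only [layout, Cmd.vev] at ew
  rw [mulIdx_vev (u := 14) (by norm_num) (by norm_num) _ (by simp [u4]),
    mulIdx_vev (u := 16) (by norm_num) (by norm_num) _ (by simp [u4]),
    mulIdx_vev (u := 17) (by norm_num) (by norm_num) _ (by simp [u4])] at ew
  have hP : 0 < (2 ^ lg n) ^ c := by positivity
  subst ew
  refine ⟨⟨?_, ?_, ?_, ?_, ?_, ?_, ?_, ?_, hP⟩, ?_, ?_, ?_, ?_, ?_, ?_, ?_, ?_, fun y hy h61 h63 => ?_⟩
  all_goals try simp [u0, u1, u2, u3, u4, u9, u11, u18, g₄]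
  have : ∀ k < 20, y ≠ k := fun k hk => by omega
  simp only [Function.update_of_ne h61, Function.update_of_ne h63,
    Function.update_of_ne (this _ (show 17 < 20 by norm_num)),
    Function.update_of_ne (this _ (show 16 < 20 by norm_num)),
    Function.update_of_ne (this _ (show 15 < 20 by norm_num)),
    Function.update_of_ne (this _ (show 14 < 20 by norm_num)),
    Function.update_of_ne (this _ (show 13 < 20 by norm_num)),
    Function.update_of_ne (this _ (show 12 < 20 by norm_num))]
  rw [eu y (by simp only [Set.mem_insert_iff, Set.mem_singleton_iff]; omega)]
  rw [hv, inputVars, List.getD_eq_default _ _ (by simp; omega)]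

/-! ### The embedded computation of the blinding probability -/

theorem epsEmb_sim (O : Oracle 0 0) (β : ℕ) :
    epsEmb.Sim (pureMem O) O β 1 (fun q o m => (project q o m.1, m.2))
      (fun m w m' => m' = m ∧ w 11 = β) where
  inj := fun x y h => by simp only [epsEmb] at h; omega
  tmp := by rintro ⟨x, hx⟩; simp only [epsEmb] at hx; omega
  tick := fun _ => rfl
  frame := fun m w w' m' h hw => ⟨h.1, by
    rw [hw 11 (by rintro ⟨x, hx⟩; simp only [epsEmb] at hx; omega) (by simp [epsEmb]), h.2]⟩
  cap_eq := fun m w m' h => h.2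
  gate := fun m w m' g q h => ⟨by rw [h.1]; rfl, h.2⟩
  cnot := fun m w m' q t h => ⟨by rw [h.1]; rfl, h.2⟩
  toffoli := fun m w m' q q' t h => ⟨by rw [h.1]; rfl, h.2⟩
  meas := fun _ _ _ => rfl
  proj := fun m w m' q o h => ⟨by rw [h.1]; rfl, h.2⟩
  query := fun v f f' m w m' hw h hf => by
    obtain ⟨rfl, h⟩ := h
    simp only [one_mul] at hf ⊢
    exact expect_mono O fun g => hf _ _ _ hw ⟨rfl, h⟩

/-- The time bound concerns the original program, while the compiled one has capped loops. The
simulation transfers the statement that the result has the intended value, which holds with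
probability one. The compiled program is deterministic, so a positive lower bound for this event is
enough. -/
theorem epsEmb_vev {p : Cmd} (hp : p.IsClassical) {n s β : ℕ}
    (hβ : ∀ t ∈ (p.run (PMF.pure id : Oracle 0 0) (State.init [n, s])).support, t.steps ≤ β)
    {w : Vars} (hw : ∀ x, w (2 * x + 61) = inputVars [n, s] x) (h11 : w 11 = β) :
    (epsEmb.compile p).vev w 61 = p.vev (inputVars [n, s]) 0 := by
  classical
  set O : Oracle 0 0 := PMF.pure id
  set z := p.vev (inputVars [n, s]) 0 with hz
  have e1 := expect_run O (cnt := fun k => min k β) (fun k hk => min_eq_left hk) p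
    (State.init [n, s]) (fun v _ => if v 0 = z then 1 else 0) hβ
  have e2 : expect (p.run O (State.init [n, s])) (fun t => if t.vars 0 = z then (1 : ℝ≥0∞) else 0)
      = 1 := by
    refine (expect_congr fun t ht => if_pos ?_).trans (expect_const _ 1)
    rw [det_run O hp.rev.det _ _ ht]; rfl
  have e3 := nE_mul_wp_runMem O (fun k => min k β) p (fun v _ => if v 0 = z then 1 else 0)
    (inputVars [n, s]) QState.zeroKet [] 0
  have e4 := (epsEmb_sim O β).le p (fun v m => nE m.1 * if v 0 = z then 1 else 0)
    (fun w m => nE m.1 * if w 61 = z then 1 else 0) (fun v m w m' hv h => by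
      rw [h.1, one_mul, ← hv 0]; exact le_rfl)
    (inputVars [n, s]) (QState.zeroKet, []) w (QState.zeroKet, []) hw ⟨rfl, h11⟩
  have e5 : wp (runMem O) (fun k => min k β) p (fun v _ => if v 0 = z then 1 else 0)
    (inputVars [n, s]) (QState.zeroKet, [], 0) = 1 := e1.symm.trans e2
  rw [← e3, e5, Cmd.wp_det O (classical_writes_compile epsEmb hp).2.rev.det] at e4
  by_contra hne
  simp [hne, nE_zeroKet] at e4

/-! ### The threshold -/

/-- The invariant of the division: the k bits written are the integer part of 2^k · (remainder) / M,
stated without division. For M = 2^k they are the binary digits of the remainder itself. -/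
theorem threshold_iterate (M : ℕ) : ∀ (k : ℕ) (v : Vars) (c : Basis), v 20 = k → v 22 = M →
    v vOne = 1 → v 21 < M → (∀ i < k, c (5, i) = false) → ∀ c',
    c' = ((fun s : Vars × Basis => (thresholdBody.vev s.1, thresholdBody.ev bGates s.1 s.2))^[k]
      (v, c)).2 →
    (∀ q : Qubit, ¬ (q.1 = 5 ∧ q.2 < k) → c' q = c q) ∧
      bitVal (regBits c' 5) k * M ≤ v 21 * 2 ^ k ∧
      v 21 * 2 ^ k < (bitVal (regBits c' 5) k + 1) * M := by
  intro k
  induction k with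
  | zero =>
    rintro v c - - - h - c' rfl
    exact ⟨fun q _ => rfl, by simp [bitVal], by simpa [bitVal] using h⟩
  | succ k ih =>
    intro v c h20 h22 h1 hR hc c' hc'
    rw [Function.iterate_succ_apply] at hc'
    have hw : thresholdBody.Writes {20, 21, 23} := by simp [thresholdBody, Cmd.Writes]
    have w22 : thresholdBody.vev v 22 = M := by rw [hw.vev_eq (by simp), h22]
    have w1 : thresholdBody.vev v vOne = 1 := by rw [hw.vev_eq (by simp), h1]
    by_cases hb : M ≤ v 21 + v 21
    · have hne : ¬ (v 21 + v 21 + 1 - M = 0) := by omega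
      have w20 : thresholdBody.vev v 20 = k := by
        simp [thresholdBody, Cmd.vev, h20, h22, h1, hne]
      have w21 : thresholdBody.vev v 21 = v 21 + v 21 - M := by
        simp [thresholdBody, Cmd.vev, h20, h22, h1, hne]
      have we : thresholdBody.ev bGates v c = notMap (5, k) c := by
        simp [thresholdBody, Cmd.ev, Cmd.vev, h20, h22, h1, hne, bGates]
      rw [we] at hc'
      obtain ⟨i1, i2, i3⟩ := ih _ (notMap (5, k) c) w20 w22 w1 (by omega) (fun i hi => by
        rw [notMap, Function.update_of_ne (by simp; omega), hc i (by omega)]) c' hc'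
      have hk : regBits c' 5 k = true := by
        rw [regBits, i1 _ (by simp), notMap, Function.update_self, hc k (by omega)]; rfl
      refine ⟨fun q hq => ?_, ?_, ?_⟩
      · rw [i1 q (by omega), notMap, Function.update_of_ne (by rintro rfl; simp at hq)]
      all_goals
        rw [bitVal, hk, if_pos rfl]
        rw [w21] at i2 i3
        zify [hb] at i2 i3 ⊢
        rw [pow_succ]
        nlinarith
    · have hne : v 21 + v 21 + 1 - M = 0 := by omega
      have w20 : thresholdBody.vev v 20 = k := by
        simp [thresholdBody, Cmd.vev, h20, h22, h1, hne]
      have w21 : thresholdBody.vev v 21 = v 21 + v 21 := by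
        simp [thresholdBody, Cmd.vev, h20, h22, h1, hne]
      have we : thresholdBody.ev bGates v c = c := by
        simp [thresholdBody, Cmd.ev, Cmd.vev, h20, h22, h1, hne, bGates]
      rw [we] at hc'
      obtain ⟨i1, i2, i3⟩ := ih _ c w20 w22 w1 (by omega) (fun i hi => hc i (by omega)) c' hc'
      have hk : regBits c' 5 k = false := by
        rw [regBits, i1 _ (by simp), hc k (by omega)]
      refine ⟨fun q hq => i1 q (by omega), ?_, ?_⟩
      all_goals
        rw [bitVal, hk, if_neg (by simp), zero_add]
        rw [w21] at i2 i3
        rw [pow_succ]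
        nlinarith

theorem threshold_ev {w : Vars} {s : ℕ} (h1 : w vOne = 1) (h0 : w vZero = 0) (hs : w 15 = s)
    {c : Basis} (hc : ∀ i < s, c (5, i) = false) :
    (∀ q : Qubit, ¬ (q.1 = 5 ∧ q.2 < s) → threshold.ev bGates w c q = c q) ∧
      bitVal (regBits (threshold.ev bGates w c) 5) s = min (w 61) (2 ^ s - 1) := by
  have hi : thresholdInit.Writes {20, 21, 22, 23} := by simp [thresholdInit, Cmd.Writes]
  have h15 : thresholdInit.vev w 15 = s := by rw [hi.vev_eq (by simp), hs]
  have hev : thresholdInit.ev bGates w c = c :=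
    Cmd.ev_classical _ (by simp [thresholdInit, Cmd.IsClassical]) w c
  have hdbl : ∀ k (v : Vars), (fun x : Vars => Function.update x 22 (x 22 + x 22))^[k] v
      = Function.update v 22 (v 22 * 2 ^ k) := by
    intro k v
    induction k with
    | zero => simp
    | succ k ih =>
      rw [Function.iterate_succ_apply', ih]
      simp only [Function.update_self, Function.update_idem]
      congr 1; ring
  have hpos : 0 < 2 ^ s := by positivity
  have e20 : thresholdInit.vev w 20 = s := by
    simp [thresholdInit, Cmd.vev, hdbl, h0, h1, hs]
  have e22 : thresholdInit.vev w 22 = 2 ^ s := by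
    simp [thresholdInit, Cmd.vev, hdbl, h0, h1, hs]
  -- The bound 2^s − 1 keeps the number within s bits, as the division needs a remainder smaller
  -- than the divisor.
  have e21 : thresholdInit.vev w 21 = min (w 61) (2 ^ s - 1) := by
    simp [thresholdInit, Cmd.vev, hdbl, h0, h1, hs]
    omega
  obtain ⟨t1, t2, t3⟩ := threshold_iterate (2 ^ s) s (thresholdInit.vev w) c e20 e22
    (by rw [hi.vev_eq (by simp), h1]) (by rw [e21]; omega) hc (threshold.ev bGates w c) (by
      rw [threshold, Cmd.ev, hev, Cmd.ev, h15])
  refine ⟨t1, ?_⟩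
  rw [e21] at t2 t3
  have := Nat.le_of_mul_le_mul_right t2 hpos
  have := Nat.lt_of_mul_lt_mul_right t3
  omega

end Hasher

namespace Hasher

open Forger (ρ notMem_ρ)

/-! ### The prepared basis state -/

theorem up_notMap (r N : ℕ) (c : Basis) (q : Qubit) :
    up (fun j => notMap (r, j)) N c q = if q.1 = r ∧ q.2 < N then !c q else c q := by
  induction N with
  | zero => simp [up]
  | succ N ih =>
    rw [up, notMap]
    by_cases hq : q = (r, N)
    · subst hq
      rw [Function.update_self, ih, if_neg (by simp), if_pos (by simp)]
    · rw [Function.update_of_ne hq, ih]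
      refine if_congr ⟨fun h => ⟨h.1, by omega⟩, fun h => ⟨h.1, ?_⟩⟩ rfl rfl
      have : q.2 ≠ N := fun h' => hq (Prod.ext h.1 h')
      omega

theorem threshold_rev : threshold.Rev := by
  simp [threshold, thresholdInit, thresholdBody, Cmd.Rev]

theorem threshold_writes : threshold.Writes work := by
  simp [threshold, thresholdInit, thresholdBody, Cmd.Writes, work]

theorem marks_rev : marks.Rev := by simp [marks, forUp, Cmd.Rev]

theorem marks_writes : marks.Writes {20, 60, 62, 64} := by simp [marks, forUp, Cmd.Writes]

theorem prepare_rev {p : Cmd} (hp : p.IsClassical) : (prepare p).Rev :=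
  ⟨(classical_writes_compile epsEmb hp).2.rev, threshold_rev, marks_rev⟩

theorem prepare_writes {p : Cmd} (hp : p.IsClassical) (w : Vars) {y : ℕ}
    (hy : y ≠ 10 ∧ y ∉ work ∧ (y < 60 ∨ 65 ≤ y ∧ y % 2 = 0)) : (prepare p).vev w y = w y := by
  obtain ⟨h10, hwk, hy⟩ := hy
  simp only [work, Set.mem_insert_iff, Set.mem_singleton_iff, not_or] at hwk
  have e : (prepare p).vev w = marks.vev (threshold.vev ((epsEmb.compile p).vev w)) := rfl
  rw [e, marks_writes.vev_eq (by simp only [Set.mem_insert_iff, Set.mem_singleton_iff]; omega),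
    threshold_writes.vev_eq (by simp [work, hwk]), (classical_writes_compile epsEmb hp).1.vev_eq]
  rintro (⟨x, hx⟩ | hx)
  · simp only [epsEmb] at hx; omega
  · exact h10 hx

/-- Up to the sampling of the seeds the run stays on a single basis state, so preparation is a
computation with bits. The threshold depends on the program for ε only, hence one z works for all
oracles and acceptance functions. -/
theorem adversary_bound {c₁ c e c₅ n a b : ℕ} {p : Cmd} (hp : p.IsClassical)
    (hc₅ : ∀ t ∈ (p.run (PMF.pure id : Oracle 0 0) (State.init [n, (2 ^ lg n) ^ c])).support,
      t.steps ≤ (2 ^ lg n) ^ c₅) :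
    ∃ z : ℕ → Bool, bitVal z ((2 ^ lg n) ^ c)
        = min (p.vev (inputVars [n, (2 ^ lg n) ^ c]) 0) (2 ^ ((2 ^ lg n) ^ c) - 1) ∧
      ∀ (O : Oracle a b) (A : Cmd) (acc : Bits a → Bits b → ℝ) (T : ℕ),
        (∀ x t, 0 ≤ acc x t ∧ acc x t ≤ 1) →
        ENNReal.ofReal (1 / 2 ^ ((a + 1) * ((2 ^ lg n) ^ c * (e * lg n))) *
          ∑ L : Fin ((2 ^ lg n) ^ c) → Fin (e * lg n) → Bits (a + 1),
            1 / 2 ^ ((2 ^ lg n) ^ c * (2 ^ lg n) ^ c) *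
              ∑ S : Fin ((2 ^ lg n) ^ c) → Fin ((2 ^ lg n) ^ c) → Bool,
                valMix O (fun k => min k ((2 ^ lg n) ^ c)) A acc T ((2 ^ lg n) ^ c₁)
                  (inputVars [n, a, b]) (seedSet z ((2 ^ lg n) ^ c) L S))
        ≤ wp (pureMem O) id (adversary c₁ c e c₅ p A) (payoff acc) (inputVars [n, a, b])
            (QState.zeroKet, []) := by
  obtain ⟨w, hw⟩ : ∃ w, w = (params c₁ c e c₅).vev (inputVars [n, a, b]) := ⟨_, rfl⟩
  obtain ⟨hpar, h9, h11, h16, h17, h18, h0, h61, h63, hz⟩ := params_vev c₁ c e c₅ n a b hw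
  generalize hs : (2 ^ lg n) ^ c = s at *
  generalize (2 ^ lg n) ^ c₁ = r at *
  generalize hl : e * lg n = l at *
  have hin : ∀ x, w (2 * x + 61) = inputVars [n, s] x := by
    intro x
    rcases x with _ | _ | x
    · exact h61
    · exact h63
    · rw [hz _ (by omega) (by omega) (by omega)]; simp [inputVars]
  have hcl := classical_writes_compile epsEmb hp
  set w₁ := (epsEmb.compile p).vev w with hw₁
  have f₁ : ∀ y, y ≠ 10 → y < 60 ∨ y % 2 = 0 → w₁ y = w y := fun y h10 hy => hcl.1.vev_eq (by
    rintro (⟨x, hx⟩ | hx)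
    · simp only [epsEmb] at hx; omega
    · exact h10 hx) w
  have g61 : w₁ 61 = p.vev (inputVars [n, s]) 0 := epsEmb_vev hp hc₅ hin h11
  set w₂ := threshold.vev w₁ with hw₂
  have f₂ : ∀ y, y < 20 ∨ 24 ≤ y → w₂ y = w₁ y := fun y hy => vev_of_writes_work threshold_writes _ hy
  obtain ⟨t1, t2⟩ := threshold_ev (w := w₁) (s := s)
    (by rw [f₁ _ (by norm_num) (by norm_num), hpar.one])
    (by rw [f₁ _ (by norm_num) (by norm_num), hpar.zero])
    (by rw [f₁ _ (by norm_num) (by norm_num), hpar.width]) (c := fun _ => false) fun _ _ => rfl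
  set c₂ := threshold.ev bGates w₁ fun _ => false with hc₂
  have hc0 : ∀ q : Qubit, q.1 ≠ 5 → c₂ q = false := fun q hq => t1 q fun h => hq h.1
  have e2 : ∀ y, y < 20 → y ≠ 10 → w₂ y = w y := fun y h h10 => by
    rw [f₂ y (Or.inl h), f₁ y h10 (Or.inl (by omega))]
  have hpar₂ : Par w₂ a b s l s := hpar.of_eq e2
  set b₀ := (prepare p).ev bGates w fun _ => false with hb₀
  have hb : b₀ = marks.ev bGates w₂ c₂ := by
    rw [hb₀, prepare, Cmd.ev, Cmd.ev_classical _ hcl.2]; rfl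
  have hb' : ∀ q : Qubit, b₀ q = if q.1 = 7 ∧ q.2 < s then !(notMap (4, a) c₂ q)
      else notMap (4, a) c₂ q := by
    intro q
    have : b₀ = up (fun j => notMap (7, j)) s (notMap (4, a) c₂) := by
      rw [hb, marks, Cmd.ev, Cmd.ev]
      have : (Cmd.gate Gate1.X ⟨4, 1⟩).ev bGates w₂ c₂ = notMap (4, a) c₂ := by
        simp only [Cmd.ev, bGates, hpar₂.msg]
      rw [this, show (Cmd.gate Gate1.X ⟨4, 1⟩).vev w₂ = w₂ from rfl, ev_forUp bGates (S := ∅)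
        (by simp [Cmd.Writes]) (by simp) (by simp) (by norm_num) (by norm_num) hpar₂.one
        (fun j => notMap (7, j)) (fun j _ w' _ hj m => by simp [Cmd.ev, bGates, hj]), hpar₂.blocks]
      rfl
    rw [this, up_notMap]
  have hb4 : ∀ r i, r ≠ 4 → notMap (4, a) c₂ (r, i) = c₂ (r, i) := fun r i h =>
    Function.update_of_ne (by simp [h]) _ _
  have hbr : ∀ r i, r ≠ 4 → r ≠ 5 → r ≠ 7 → b₀ (r, i) = false := fun r i h4 h5 h7 => by
    rw [hb', if_neg fun h => h7 h.1, hb4 _ _ h4, hc0 _ h5]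
  have hok : AuxOk a s l s false b₀ := by
    refine ⟨⟨fun i => ?_, fun i => hbr _ _ (by norm_num) (by norm_num) (by norm_num), fun i => ?_,
      fun i => hbr _ _ (by norm_num) (by norm_num) (by norm_num),
      fun i => hbr _ _ (by norm_num) (by norm_num) (by norm_num)⟩,
      fun i => hbr _ _ (by norm_num) (by norm_num) (by norm_num), fun r i => ?_, by simp⟩
    · rw [hb', if_neg (by simp), notMap, Function.update_apply, hc0 _ (by simp), hc0 _ (by simp)]
      by_cases h : i = a <;> simp [h]
    · rw [hb', hb4 _ _ (by norm_num), hc0 _ (by simp)]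
      by_cases h : i < s <;> simp [h]
    · have hρ : ∀ k, 2 ≤ k → k < 22 → ρ r ≠ k := fun k h h' hk => notMem_ρ h h' ⟨r, hk⟩
      exact hbr _ _ (hρ _ (by norm_num) (by norm_num)) (hρ _ (by norm_num) (by norm_num))
        (hρ _ (by norm_num) (by norm_num))
  have h5 : regBits b₀ 5 = regBits c₂ 5 := by
    funext i
    rw [regBits, hb', if_neg (by simp), hb4 _ _ (by norm_num)]; rfl
  refine ⟨regBits b₀ 5, by rw [h5, t2, g61], fun O A acc T hacc => ?_⟩
  have hprep : ∀ y, y < 20 → y ≠ 10 → (prepare p).vev w y = w y := fun y h h10 =>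
    prepare_writes hp w ⟨h10, by simp only [work, Set.mem_insert_iff, Set.mem_singleton_iff]; omega,
      Or.inl (by omega)⟩
  have hinp : ∀ x, (prepare p).vev w (2 * x + 60) = inputVars [n, a, b] x := by
    intro x
    set w₃ := (forUp vI 13 (.gate .X ⟨7, vI⟩)).vev w₂
    have f₃ : ∀ y, y < 20 → y ≠ 10 → w₃ y = w y := fun y h h10 => (Cmd.Writes.vev_eq (S := {20})
      (by simp [forUp, Cmd.Writes]) (by simp; omega) w₂).trans (e2 y h h10)
    have e : (prepare p).vev w = (Cmd.add 64 2 vZero).vev ((Cmd.add 62 1 vZero).vev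
      ((Cmd.add 60 0 vZero).vev w₃)) := rfl
    have k0 := (f₃ 0 (by norm_num) (by norm_num)).trans h0
    have k1 := (f₃ 1 (by norm_num) (by norm_num)).trans hpar.msg
    have k2 := (f₃ 2 (by norm_num) (by norm_num)).trans hpar.tag
    have k4 := (f₃ 4 (by norm_num) (by norm_num)).trans hpar.zero
    rcases x with _ | _ | _ | x
    · rw [e]; simp [Cmd.vev, k0, k4, inputVars]
    · rw [e]; simp [Cmd.vev, k1, k4, inputVars]
    · rw [e]; simp [Cmd.vev, k2, k4, inputVars]
    · rw [prepare_writes hp w ⟨by omega, by simp only [work, Set.mem_insert_iff, Set.mem_singleton_iff]; omega, by omega⟩,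
        hz _ (by omega) (by omega) (by omega)]
      simp [inputVars]
  have key : KetBound (wp (pureMem O) id (adversary c₁ c e c₅ p A) (payoff acc)) (inputVars [n, a, b])
      (fun _ => false) _ := ketBound_seq (ketBound_rev (params_classical c₁ c e c₅).rev (ketBound_seq
    (ketBound_rev (prepare_rev hp) (by
      rw [← hw, Cmd.ev_classical _ (params_classical c₁ c e c₅), ← hb₀]
      exact ketBound_sample (O := O) (A := A)
        (T := T) hacc hok (fun i => hbr _ _ (by norm_num) (by norm_num) (by norm_num))
        (fun i => hbr _ _ (by norm_num) (by norm_num) (by norm_num))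
        (fun i => hbr _ _ (by norm_num) (by norm_num) (by norm_num))
        (hpar.of_eq hprep) ((hprep _ (by norm_num) (by norm_num)).trans h9)
        ((hprep _ (by norm_num) (by norm_num)).trans h16)
        ((hprep _ (by norm_num) (by norm_num)).trans h17)
        ((hprep _ (by norm_num) (by norm_num)).trans h18)
        ((prepare_writes hp w ⟨by norm_num, by simp [work], by norm_num⟩).trans
          (hz _ (by norm_num) (by norm_num) (by norm_num))) hinp))))
  have := key 1
  rwa [enorm_one, one_pow, mul_one] at this

/-! ### Running time -/

def loopVars : Set ℕ := {1, 2, 9, 11, 12, 13, 14, 15, 16, 17, 18}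

theorem rest_capped (p A : Cmd) : Capped loopVars (.seq (prepare p) (sample A)) := by
  have key : Capped loopVars gadget ∧ Capped loopVars threshold ∧ Capped loopVars marks ∧
      (∀ r N, N ∈ loopVars → Capped loopVars (coinProg r N)) ∧ Capped loopVars (.loop 18 pickBody) ∧
      Capped loopVars (swapProg vI 1 0 10) ∧
      Capped loopVars (forUp vI 2 (.gate .H ⟨11, vI⟩)) := by
    refine ⟨?_, ?_, ?_, fun r N hN => ?_, ?_, ?_, ?_⟩
    all_goals
      simp only [gadget, preQuery, postQuery, cswaps, cswapProg, cswap3, hashUp, hashDown, forUp,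
        forDown, dotBody, copyBody, bucketBody, lessBody, mulIdx, threshold, thresholdInit,
        thresholdBody, marks, coinProg, pickBody, swapProg, swap3]
      repeat' first
        | apply Capped.seq | apply Capped.cond | apply Capped.loop | apply Capped.const
        | apply Capped.add | apply Capped.sub | apply Capped.measure | exact Capped.skip
        | exact Capped.gate | exact Capped.cnot | exact Capped.toffoli | exact Capped.query
      all_goals first | assumption | simp [loopVars]
  obtain ⟨hG, hth, hmk, hco, hpk, hsw, hin⟩ := key
  have h1 : Capped loopVars (epsEmb.compile p) := by
    refine epsEmb.capped_compile (fun x => ?_) ?_ ?_ .query p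
    · simp only [epsEmb, loopVars, Set.mem_insert_iff, Set.mem_singleton_iff]; omega
    all_goals simp [epsEmb, loopVars]
  have h2 : Capped loopVars (emb.compile A) := by
    refine emb.capped_compile (fun x => ?_) ?_ ?_ ?_ A
    · simp only [emb, loopVars, Set.mem_insert_iff, Set.mem_singleton_iff]; omega
    · simp [emb, loopVars]
    · simp [emb, loopVars]
    · exact hG
  exact .seq (.seq h1 (.seq hth hmk)) (.seq (hco 2 16 (by simp [loopVars])) (.seq
    (hco 3 17 (by simp [loopVars])) (.seq hpk (.seq hsw (.seq hin h2)))))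

def time (c₁ c e c₅ : ℕ) (p A : Cmd) (n V : ℕ) : ℕ :=
  5 + (1 + (n + 2) * 6) + (powCost (2 ^ lg n) c₁ + (powCost (2 ^ lg n) c + (powCost (2 ^ lg n) c₅ +
    (e + 1 + (1 + (1 + layout.cost V)))))) + (Cmd.seq (prepare p) (sample A)).cost V

theorem polyBdd_time (c₁ c e c₅ : ℕ) (p A : Cmd) {V : ℕ → ℕ} (hV : PolyBdd V) :
    PolyBdd fun n => time c₁ c e c₅ p A n (V n) := by
  have h : ∀ c, PolyBdd fun n => powCost (2 ^ lg n) c := polyBdd_powCost polyBdd_two_pow_lg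
  exact (((PolyBdd.const 5).add ((PolyBdd.const 1).add
    ((PolyBdd.id.add (PolyBdd.const 2)).mul (PolyBdd.const 6)))).add ((h c₁).add ((h c).add
      ((h c₅).add ((PolyBdd.const (e + 1)).add ((PolyBdd.const 1).add ((PolyBdd.const 1).add
        (polyBdd_cost _ hV)))))))).add (polyBdd_cost _ hV)

/-- A bound for the number of iterations of each loop. -/
def loopBound (c₁ c e c₅ n a b : ℕ) : ℕ :=
  (a + 1 + b) + (2 ^ lg n) ^ c + (2 ^ lg n) ^ c₅ + (2 ^ lg n) ^ c₁ + (2 ^ lg n) ^ c * (2 ^ lg n) ^ c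
    + ((2 ^ lg n) ^ c * (e * lg n)) + (a + 1) * ((2 ^ lg n) ^ c * (e * lg n))

theorem timeB_adversary (c₁ c e₀ c₅ n a b : ℕ) (p A : Cmd) :
    TimeB (adversary c₁ c e₀ c₅ p A) (inputVars [n, a, b])
      (time c₁ c e₀ c₅ p A n (loopBound c₁ c e₀ c₅ n a b)) := by
  obtain ⟨w, hw⟩ : ∃ w, w = (params c₁ c e₀ c₅).vev (inputVars [n, a, b]) := ⟨_, rfl⟩
  obtain ⟨hpar, h9, h11, h16, h17, h18, h0, h61, h63, hz⟩ := params_vev c₁ c e₀ c₅ n a b hw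
  obtain ⟨hs1, hs2, -⟩ := sizeProg_vev (inputVars [n, a, b])
  have hs4 : sizeProg.vev (inputVars [n, a, b]) vZero = 0 := sizeProg_writes.vev_eq (by simp) _
  have hpow : ∀ (x k : ℕ) (w : Vars), 8 < x → w vZero = 0 → w vP = 2 ^ lg n →
      (powProg x k).vev w vZero = 0 ∧ (powProg x k).vev w vP = 2 ^ lg n ∧
      TimeB (powProg x k) w (powCost (2 ^ lg n) k) := fun x k w hx h4 h7 =>
    ⟨by rw [(powProg_writes x k).vev_eq (by simp only [Set.mem_insert_iff, Set.mem_singleton_iff, vT, vZero]; omega), h4],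
      by rw [(powProg_writes x k).vev_eq (by simp only [Set.mem_insert_iff, Set.mem_singleton_iff, vT, vP]; omega), h7], h7 ▸ powProg_time x k hx w h4⟩
  obtain ⟨a4, a7, at'⟩ := hpow 18 c₁ _ (by norm_num) hs4 hs2
  obtain ⟨b4, b7, bt⟩ := hpow 9 c _ (by norm_num) a4 a7
  obtain ⟨-, -, ct⟩ := hpow 11 c₅ _ (by norm_num) b4 b7
  have hadd : ∀ {x y z : ℕ} {w : Vars}, TimeB (.add x y z) w 1 := fun {x y z w} =>
    (Capped.add (S := ∅) (by simp)).timeB (V := 0) (by simp)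
  have hlay : Capped {12, 13} layout := by
    refine .seq (.add (by simp)) (.seq (.seq (.add (by simp)) (.loop (by simp) (.add (by simp))))
      (.seq (.seq (.add (by simp)) (.loop (by simp) (.add (by simp)))) (.seq (.seq (.add (by simp))
        (.loop (by simp) (.add (by simp)))) (.seq (.add (by simp)) (.add (by simp))))))
  have hlw : layout.Writes {14, 15, 16, 17, 61, 63} := by simp [layout, mulIdx, Cmd.Writes]
  refine TimeB.seq (params_classical c₁ c e₀ c₅).rev.det
    (TimeB.seq sizeProg_classical.rev.det (sizeProg_time _)
    (TimeB.seq (powProg_classical _ _).rev.det at' (TimeB.seq (powProg_classical _ _).rev.det bt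
    (TimeB.seq (powProg_classical _ _).rev.det ct (TimeB.seq (mulConst_classical _ _ _).rev.det
      (mulConst_time _ _ _ _) (TimeB.seq trivial hadd (TimeB.seq trivial hadd
        (hlay.timeB fun x hx => ?_)))))))) ((rest_capped p A).timeB fun x hx => ?_)
  · have e : x ∉ ({14, 15, 16, 17, 61, 63} : Set ℕ) := by rcases hx with rfl | rfl <;> simp
    refine (hlw.vev_eq e _).symm.le.trans ?_
    change (params c₁ c e₀ c₅).vev (inputVars [n, a, b]) x ≤ _
    rw [← hw, loopBound]
    rcases hx with rfl | rfl
    · rw [hpar.succ]; omega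
    · rw [hpar.blocks]; omega
  · rw [← hw, loopBound]
    simp only [loopVars, Set.mem_insert_iff, Set.mem_singleton_iff] at hx
    rcases hx with rfl | rfl | rfl | rfl | rfl | rfl | rfl | rfl | rfl | rfl | rfl
    · rw [hpar.msg]; omega
    · rw [hpar.tag]; omega
    · rw [h9]; omega
    · rw [h11]; omega
    · rw [hpar.succ]; omega
    · rw [hpar.blocks]; omega
    · rw [hpar.forms]; omega
    · rw [hpar.width]; omega
    · rw [h16]; omega
    · rw [h17]; omega
    · rw [h18]; omega

end Hasher

/-! ## Generalised existential unforgeability implies blind unforgeability -/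

/-- Truncation matters only if the approximation is at least 1; since ε ≤ 1, the largest s-bit
fraction 1 − 2^(-s) is then still within 2^(-s) of ε. -/
theorem abs_sub_bitVal_le {ε : ℝ} (h1 : ε ≤ 1) {z y s : ℕ} (hz : |ε - (z : ℝ) / 2 ^ s| ≤ 1 / 2 ^ s)
    (hy : y = min z (2 ^ s - 1)) : |ε - (y : ℝ) / 2 ^ s| ≤ 1 / 2 ^ s := by
  have hp : (0 : ℝ) < 2 ^ s := by positivity
  by_cases h : z ≤ 2 ^ s - 1
  · rwa [hy, min_eq_left h]
  · have h2 : 2 ^ s ≤ z := by omega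
    have h3 : (2 : ℝ) ^ s ≤ z := by exact_mod_cast h2
    have h4 : (y : ℝ) / 2 ^ s = 1 - 1 / 2 ^ s := by
      rw [hy, min_eq_right (by omega), Nat.cast_sub Nat.one_le_two_pow]
      push_cast
      field_simp
    have h5 : 1 ≤ (z : ℝ) / 2 ^ s := (one_le_div hp).2 h3
    rw [abs_le] at hz ⊢
    rw [h4]
    constructor <;> linarith

/-- The error made by the hashed blinding set. -/
def hashError (a T s l r : ℕ) : ℝ :=
  2 * (2 ^ a * (1 / 2 ^ s)) +
    2 * ((2 * T + 1 + r + 1 : ℕ) * (2 ^ a) ^ (2 * T + 1 + r) * (1 - 1 / 2 ^ (l + 1)) ^ s) +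
    8 * (1 / (r + 1)) * T * (T + 1)

theorem hashError_nonneg (a T s l r : ℕ) : 0 ≤ hashError a T s l r := by
  have : (0 : ℝ) ≤ 1 - 1 / 2 ^ (l + 1) := by
    rw [sub_nonneg, div_le_one (by positivity)]
    exact one_le_pow₀ (by norm_num)
  unfold hashError
  positivity

/-- The three errors, after multiplication by g, are bounded by 1/8, 1/8 and 1/4: rounding of ε by
many threshold bits, bad first seeds by many blocks, and a failed search for a spare message by many
attempts. -/
theorem mul_hashError_le {g a T s l r : ℕ} (hr : 32 * T * (T + 1) * g ≤ r)
    (hs : 2 * 2 ^ l * (g + 4 + (2 * T + 1 + r) + a * (2 * T + 1 + r)) + (g + a + 4) ≤ s) :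
    g * hashError a T s l r ≤ 1 / 2 := by
  set k := 2 * T + 1 + r with hk
  clear_value k
  set N := g + 4 + k + a * k with hN
  have two_pow : ∀ m : ℕ, (m : ℝ) ≤ 2 ^ m := fun m => by exact_mod_cast Nat.lt_two_pow_self.le
  have hg := two_pow g
  have e1 : (g : ℝ) * (2 * (2 ^ a * (1 / 2 ^ s))) ≤ 1 / 8 := by
    have h1 : (2 : ℝ) ^ (g + a + 4) ≤ 2 ^ s := pow_le_pow_right₀ (by norm_num) (by omega)
    calc (g : ℝ) * (2 * (2 ^ a * (1 / 2 ^ s)))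
        ≤ 2 ^ g * (2 * (2 ^ a * (1 / 2 ^ (g + a + 4)))) := by gcongr
      _ = 1 / 8 := by rw [pow_add, pow_add]; field_simp; norm_num
  have e2 : (g : ℝ) * (2 * ((k + 1 : ℕ) * (2 ^ a) ^ k * (1 - 1 / 2 ^ (l + 1)) ^ s)) ≤ 1 / 8 := by
    have hx0 : (0 : ℝ) ≤ 1 - 1 / 2 ^ (l + 1) := by
      rw [sub_nonneg, div_le_one (by positivity)]
      exact one_le_pow₀ (by norm_num)
    have hx1 : (1 : ℝ) - 1 / 2 ^ (l + 1) ≤ 1 := by linarith [show (0 : ℝ) ≤ 1 / 2 ^ (l + 1) by positivity]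
    -- Each group of 2^(l+1) blocks contributes a factor of at most 1/e ≤ 1/2, and s provides N such
    -- groups.
    have h1 : (1 - 1 / 2 ^ (l + 1) : ℝ) ^ s ≤ (1 / 2) ^ N := by
      have hs' : 2 ^ (l + 1) * N ≤ s := by rw [pow_succ, mul_comm (2 ^ l)]; omega
      refine (pow_le_pow_of_le_one hx0 hx1 hs').trans ?_
      rw [pow_mul]
      refine pow_le_pow_left₀ (pow_nonneg hx0 _) ?_ N
      have h2 : (1 - 1 / 2 ^ (l + 1) : ℝ) ≤ Real.exp (-(1 / 2 ^ (l + 1))) := by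
        have := Real.add_one_le_exp (-(1 / 2 ^ (l + 1)) : ℝ)
        linarith
      refine (pow_le_pow_left₀ hx0 h2 _).trans ?_
      rw [← Real.exp_nat_mul]
      have h3 : ((2 ^ (l + 1) : ℕ) : ℝ) * -(1 / 2 ^ (l + 1)) = -1 := by push_cast; field_simp
      rw [h3, Real.exp_neg, one_div]
      have := Real.add_one_le_exp (1 : ℝ)
      gcongr
      linarith
    have h4 : ((k + 1 : ℕ) : ℝ) ≤ 2 ^ k := by exact_mod_cast Nat.lt_two_pow_self
    calc (g : ℝ) * (2 * ((k + 1 : ℕ) * (2 ^ a) ^ k * (1 - 1 / 2 ^ (l + 1)) ^ s))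
        ≤ 2 ^ g * (2 * (2 ^ k * (2 ^ a) ^ k * (1 / 2) ^ N)) := by gcongr
      _ = 1 / 8 := by
        rw [hN, ← pow_mul, one_div, inv_pow, pow_add, pow_add, pow_add]
        field_simp; norm_num
  have e3 : (g : ℝ) * (8 * (1 / (r + 1)) * T * (T + 1)) ≤ 1 / 4 := by
    have h : (32 : ℝ) * T * (T + 1) * g ≤ r := by exact_mod_cast hr
    have hr0 : (0 : ℝ) < r + 1 := by positivity
    rw [show (g : ℝ) * (8 * (1 / (r + 1)) * T * (T + 1)) = (8 * T * (T + 1) * g) / (r + 1) by ring,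
      div_le_iff₀ hr0]
    linarith
  unfold hashError
  rw [mul_add, mul_add, ← hk]
  linarith

namespace MACScheme

variable (F : MACScheme)

theorem expect_blindRun_eq_valOn {A : Cmd} {n T β : ℕ}
    (hT : ∀ O, ∀ o ∈ (F.blindRun A n O).support, o.2.2.steps ≤ T) (hβ : T ≤ β) (k : F.Key n)
    (B : Finset (Bits (F.msgLen n))) :
    expect (F.blindRun A n (F.blindedOracle n k B)) (fun o =>
        if o.1 ∈ B then F.ver n k o.1 o.2.1 true else 0)
      = ENNReal.ofReal (valOn (F.evalOracle n k) (fun j => min j β) A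
          (fun x t => (F.ver n k x t true).toReal) T (inputVars (F.publicInput n)) B B) := by
  classical
  rw [← (wp_eq_valOn (fun x t => ⟨ENNReal.toReal_nonneg,
    ENNReal.toReal_mono ENNReal.one_ne_top (PMF.coe_le_one _ _)⟩) B B).1]
  have := F.expect_blindRun A n (F.blindedOracle n k B) (cnt := fun j => min j β)
    (fun _ hj => min_eq_left hj) (fun o ho => (hT _ o ho).trans hβ)
    (fun x t l => if l.length ≤ T ∧ x ∈ B then F.ver n k x t true else 0)
  refine (expect_congr fun o ho => ?_).trans (this.trans ?_)
  · have hl : o.2.2.queries.length ≤ T :=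
      (F.queries_length_le_of_mem_blindRun ho).trans (hT _ o ho)
    simp only [hl, true_and]
  · rw [blindedOracle_eq]
    congr 1
    funext v m
    by_cases hl : m.2.length ≤ T
    · simp only [hl, true_and, if_true]
      rw [pay, ENNReal.ofReal_sum_of_nonneg fun x _ => Finset.sum_nonneg fun t _ =>
        mul_nonneg (by split_ifs <;> norm_num) (mul_nonneg ENNReal.toReal_nonneg (nS_nonneg _))]
      refine Finset.sum_congr rfl fun x _ => ?_
      rw [ENNReal.ofReal_sum_of_nonneg fun t _ =>
        mul_nonneg (by split_ifs <;> norm_num) (mul_nonneg ENNReal.toReal_nonneg (nS_nonneg _))]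
      refine Finset.sum_congr rfl fun t _ => ?_
      split_ifs
      · rw [one_mul, ENNReal.ofReal_mul ENNReal.toReal_nonneg, ofReal_nS, ofReal_toReal_apply, mul_comm]
      · simp
    · simp [hl]

open Classical in
theorem expect_qExRun_skip {A : Cmd} {n T : ℕ}
    (hT : ∀ O, ∀ o ∈ (F.qExRun A .skip n O).support, o.2.2.steps ≤ T) (k : F.Key n) :
    expect (F.qExRun A .skip n (F.evalOracle n k)) (fun o =>
        if ∀ ψ ∈ o.2.2.queries, projReg regX (F.msgLen n) o.1 ψ = 0
          then F.ver n k o.1 o.2.1 true else 0)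
      = wp (pureMem (F.evalOracle n k)) id A
          (Hasher.payoff fun x t => (F.ver n k x t true).toReal)
          (inputVars (F.publicInput n)) (QState.zeroKet, []) := by
  have := F.expect_qExRun A .skip n (F.evalOracle n k) (cnt := id) (fun _ _ => rfl) (hT _)
    (fun x t l => if ∀ ψ ∈ l, projReg regX (F.msgLen n) x ψ = 0
      then F.ver n k x t true else 0)
  refine this.trans ?_
  congr 1
  funext v m
  refine Finset.sum_congr rfl fun x _ => ?_
  refine Finset.sum_congr rfl fun t _ => ?_
  simp only [ofReal_toReal_apply]
  rfl

/-- The chain of replacements: the oracle that may become ⊥ everywhere (a factor two and the error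
of the search), the probability given by the threshold (a rounding error), and the hashed set (the
error of bad seeds). The result is the value simulated by the adversary. -/
theorem blindForge_le {A p : Cmd} {n T c₁ c e c₅ T' : ℕ} {ε : ℕ → unitInterval}
    (hT : ∀ O, ∀ o ∈ (F.blindRun A n O).support, o.2.2.steps ≤ T) (hc : T ≤ (2 ^ lg n) ^ c)
    (hp : p.IsClassical)
    (hz : ∀ t ∈ (p.run (PMF.pure id : Oracle 0 0) (State.init [n, (2 ^ lg n) ^ c])).support,
      t.steps ≤ (2 ^ lg n) ^ c₅ ∧
      |(ε n : ℝ) - (t.vars 0 : ℝ) / 2 ^ ((2 ^ lg n) ^ c)| ≤ 1 / 2 ^ ((2 ^ lg n) ^ c))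
    (he : 2 * (2 * T + 1 + (2 ^ lg n) ^ c₁) ≤ 2 ^ (e * lg n))
    (hT' : ∀ O, ∀ o ∈ (F.qExRun (Hasher.adversary c₁ c e c₅ p A) .skip n O).support,
      o.2.2.steps ≤ T') :
    F.blindForge A ε n true ≤ 2 * F.qExGame 1 (Hasher.adversary c₁ c e c₅ p A) .skip n true
      + ENNReal.ofReal (hashError (F.msgLen n) T ((2 ^ lg n) ^ c) (e * lg n) ((2 ^ lg n) ^ c₁)) := by
  classical
  obtain ⟨z, hzv, hz'⟩ := Hasher.adversary_bound (c₁ := c₁) (e := e) (a := F.msgLen n)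
    (b := F.tagLen n) hp fun t ht => (hz t ht).1
  generalize hs : (2 ^ lg n) ^ c = s at *
  generalize hr : (2 ^ lg n) ^ c₁ = r at *
  generalize hl : e * lg n = l at *
  obtain ⟨t, ht⟩ := (p.run (PMF.pure id : Oracle 0 0) (State.init [n, s])).support_nonempty
  have hε : |(ε n : ℝ) - (bitVal z s : ℝ) / 2 ^ s| ≤ 1 / 2 ^ s := by
    refine abs_sub_bitVal_le (ε n).2.2 (hz t ht).2 ?_
    rw [hzv, det_run _ hp.rev.det _ _ ht]
    rfl
  rw [qExGame_apply, blindForge_apply, ← expect_const_mul,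
    ← expect_const (F.keyGen n) (ENNReal.ofReal (hashError (F.msgLen n) T s l r)), ← expect_add]
  refine expect_mono _ fun k => ?_
  set acc : Bits (F.msgLen n) → Bits (F.tagLen n) → ℝ := fun x t => (F.ver n k x t true).toReal
  have hacc : ∀ x t, 0 ≤ acc x t ∧ acc x t ≤ 1 := fun x t => ⟨ENNReal.toReal_nonneg,
    ENNReal.toReal_mono ENNReal.one_ne_top (PMF.coe_le_one _ _)⟩
  set O := F.evalOracle n k
  have hb := fun B : Finset (Bits (F.msgLen n)) => bern_nonneg (ε n).2.1 (ε n).2.2 B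
  have key := (hz' O A acc T hacc).trans_eq (F.expect_qExRun_skip hT' k).symm
  simp only [F.expect_blindRun_eq_valOn hT hc k]
  simp only [← ENNReal.ofReal_mul (hb _)]
  rw [← ENNReal.ofReal_sum_of_nonneg fun B _ => mul_nonneg (hb B) (wp_eq_valOn hacc B B).2]
  set W := fun B => valMix O (fun j => min j s) A acc T r (inputVars (F.publicInput n)) B
  have hW : ∀ B, 0 ≤ W B ∧ W B ≤ 1 := fun B => valMix_mem hacc B
  have b1 := sum_bern_valOn_le (O := O) (cnt := fun j => min j s) (p := A) (T := T) (r := r)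
    (v := inputVars (F.publicInput n)) hacc (ε n).2.1 (ε n).2.2
  have b2 := sum_bern_le_add (ε := ε n) (ε' := (bitVal z s : ℝ) / 2 ^ s) (ε n).2
    ⟨by positivity, div_le_one_of_le₀ (by exact_mod_cast (bitVal_lt z s).le) (by positivity)⟩ hW
  have b3 := sum_bern_le_hash (d := s) (s := s) z he hW fun ν hν => sum_valMix_eq_zero le_rfl hν
  have hcard : (Fintype.card (Bits (F.msgLen n)) : ℝ) = 2 ^ F.msgLen n := by simp
  rw [hcard] at b2
  have b4 : (2 : ℝ) ^ F.msgLen n * |(ε n : ℝ) - (bitVal z s : ℝ) / 2 ^ s|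
    ≤ 2 ^ F.msgLen n * (1 / 2 ^ s) := by gcongr
  set Sd := 1 / 2 ^ ((F.msgLen n + 1) * (s * l)) *
    ∑ L : Fin s → Fin l → Bits (F.msgLen n + 1), 1 / 2 ^ (s * s) *
      ∑ S : Fin s → Fin s → Bool, W (seedSet z s L S) with hSd
  have hSd' : (1 : ℝ) / (((2 ^ (F.msgLen n + 1)) ^ l) ^ s * (2 ^ s) ^ s) *
      (∑ L : Fin s → Fin l → Bits (F.msgLen n + 1), ∑ S : Fin s → Fin s → Bool,
        W (seedSet z s L S)) = Sd := by
    rw [hSd, ← Finset.mul_sum, ← mul_assoc]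
    congr 1
    rw [← pow_mul, ← pow_mul, ← pow_mul, one_div_mul_one_div, mul_comm l s]
  rw [hSd'] at b3
  have hfin : ∑ B, bern (ε n : ℝ) B * valOn O (fun j => min j s) A acc T
      (inputVars (F.publicInput n)) B B ≤ 2 * Sd + hashError (F.msgLen n) T s l r := by
    unfold hashError
    push_cast at b3 ⊢
    linarith
  have hSd0 : 0 ≤ Sd := mul_nonneg (by positivity) (Finset.sum_nonneg fun L _ =>
    mul_nonneg (by positivity) (Finset.sum_nonneg fun S _ => (hW _).1))
  refine (ENNReal.ofReal_le_ofReal hfin).trans ?_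
  rw [ENNReal.ofReal_add (by positivity) (hashError_nonneg _ _ _ _ _), ENNReal.ofReal_mul (by norm_num),
    ENNReal.ofReal_ofNat]
  gcongr
  exact key

theorem qExPolyTime_of_bound {A : Cmd} {f : ℕ → ℕ} (hf : PolyBdd f)
    (h : ∀ n, TimeB A (inputVars (F.publicInput n)) (f n)) : F.QExPolyTime A .skip := by
  obtain ⟨B, hB⟩ := (hf.add (PolyBdd.const 1)).to_poly
  refine ⟨B, fun n O o ho => ?_⟩
  simp only [qExRun, PMF.mem_support_bind_iff, PMF.mem_support_map_iff, Cmd.run,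
    PMF.mem_support_pure_iff] at ho
  obtain ⟨s, h1, om, h2, s₂, rfl, ot, h3, rfl⟩ := ho
  have := h n _ _ O (State.init (F.publicInput n)) rfl s h1
  simp only [State.init, zero_add] at this
  exact (Nat.add_le_add_right this 1).trans (hB n)

/-- The exponents are chosen one after the other, since each parameter has to dominate a polynomial
in the earlier ones; all of them depend on the polynomial `g` to be beaten. -/
theorem bu_of_qgeu (h : F.QGEU 1) : F.BU := by
  intro A ε ⟨Bt, hBt⟩ ⟨p, hp, Bε, hε⟩
  rw [negligible_iff]
  intro g hg
  set T : ℕ → ℕ := fun n => Bt.eval n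
  have hTp : PolyBdd T := PolyBdd.of_poly ⟨Bt, fun _ => le_rfl⟩
  have hap : PolyBdd F.msgLen := PolyBdd.of_poly F.msgLen_le
  have hbp : PolyBdd F.tagLen := PolyBdd.of_poly F.tagLen_le
  have hPp : ∀ c, PolyBdd fun n => (2 ^ lg n) ^ c := fun c => polyBdd_two_pow_lg.pow c
  have hC := PolyBdd.const
  -- The number of attempts r = P^c₁, where P = 2 ^ lg n.
  obtain ⟨c₁, hc₁⟩ := (((hC 32).mul hTp).mul (hTp.add (hC 1))).mul hg |>.le_two_pow
  have hk : PolyBdd fun n => 2 * T n + 1 + (2 ^ lg n) ^ c₁ :=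
    (((hC 2).mul hTp).add (hC 1)).add (hPp c₁)
  -- The number l = e · lg n of forms in a block: 2^l must be at least twice the degree k for
  -- isolation.
  obtain ⟨e, he⟩ := ((hC 2).mul hk).le_two_pow
  have hle : ∀ n, (2 ^ lg n) ^ e = 2 ^ (e * lg n) := fun n => by rw [← pow_mul, mul_comm]
  -- P^c serves as number of blocks, as number of threshold bits and as cap on the loops of the
  -- blind forger.
  obtain ⟨c, hc⟩ := ((((hC 2).mul (hPp e)).mul (((hg.add (hC 4)).add hk).add (hap.mul hk))).add
    (((hg.add hap).add (hC 4)).add hTp)).le_two_pow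
  -- P^c₅ caps the loops of the program for ε, run with P^c bits of precision.
  obtain ⟨c₅, hc₅⟩ := (PolyBdd.eval Bε (PolyBdd.id.add (hPp c))).le_two_pow
  have hfp : PolyBdd fun n => Hasher.loopBound c₁ c e c₅ n (F.msgLen n) (F.tagLen n) := by
    have hl : PolyBdd fun n => (2 ^ lg n) ^ c * (e * lg n) := (hPp c).mul ((hC e).mul polyBdd_lg)
    exact ((((((hap.add (hC 1)).add hbp).add (hPp c)).add (hPp c₅)).add (hPp c₁)).add
      ((hPp c).mul (hPp c))).add hl |>.add ((hap.add (hC 1)).mul hl)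
  have hpt := F.qExPolyTime_of_bound (Hasher.polyBdd_time c₁ c e c₅ p A hfp) fun n =>
    Hasher.timeB_adversary c₁ c e c₅ n (F.msgLen n) (F.tagLen n) p A
  have hneg := negligible_iff.1 (h _ _ hpt) (fun n => 4 * g n) ((hC 4).mul hg)
  obtain ⟨Bq, hBq⟩ := hpt
  filter_upwards [hneg] with n hn
  have hcn := hc n
  simp only [hle] at hcn
  have hTc : T n ≤ (2 ^ lg n) ^ c := by omega
  have key := F.blindForge_le (ε := ε) (c₁ := c₁) (c := c) (e := e) (c₅ := c₅) (hBt n) hTc hp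
    (fun t ht => ⟨((hε n _ t ht).1).trans (hc₅ n), (hε n _ t ht).2⟩)
    ((he n).trans_eq (hle n)) (hBq n)
  have herr := mul_hashError_le (g := g n) (a := F.msgLen n) (T := T n) (s := (2 ^ lg n) ^ c)
    (l := e * lg n) (r := (2 ^ lg n) ^ c₁) (hc₁ n) (by omega)
  set W := F.qExGame 1 (Hasher.adversary c₁ c e c₅ p A) .skip n true
  have hW : W ≠ ⊤ := PMF.apply_ne_top _ _
  have key2 := ENNReal.toReal_mono (by finiteness) key
  rw [ENNReal.toReal_add (by finiteness) (by finiteness), ENNReal.toReal_mul,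
    ENNReal.toReal_ofReal (hashError_nonneg _ _ _ _ _), ENNReal.toReal_ofNat] at key2
  push_cast at hn
  calc (g n : ℝ) * _ ≤ (g n : ℝ) * (2 * W.toReal + hashError (F.msgLen n) (T n) ((2 ^ lg n) ^ c)
        (e * lg n) ((2 ^ lg n) ^ c₁)) := by gcongr
    _ ≤ 1 := by rw [mul_add]; linarith

end MACScheme

end QUnf

end

theorem mainTheorem4 (F : QUnf.MACScheme) : F.QGEU 1 ↔ F.BU := by
  exact ⟨F.bu_of_qgeu, F.qgeu_of_bu⟩
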